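/- **The RPC3BP near $L_3$ in scaled Poincaré coordinates.** For $0<\mu\le\frac12$ consider the restricted planar circular 3-body problem, i.e. the Hamiltonian system (form $dq_1\wedge dp_1+dq_2\wedge dp_2$, time $t$) $$h(q,p;\mu)=\tfrac12\|p\|^2-(q_1p_2-q_2p_1)-\frac{1-\mu}{\|q-(\mu,0)\|}-\frac{\mu}{\|q-(\mu-1,0)\|}.$$ Let $(r,\theta,R,G)$ be symplectic polar coordinates ($R$ radial momentum, $G$ angular momentum), so that $h=H_0^{\rm pol}+\mu H_1^{\rm pol}$ with $H_0^{\rm pol}=\frac12(R^2+\frac{G^2}{r^2})-\frac1r-G$ and $$\mu H_1^{\rm pol}(r,\theta;\mu)=\frac1r-\frac{1-\mu}{\sqrt{r^2-2\mu r\cos\theta+\mu^2}}-\frac{\mu}{\sqrt{r^2+2(1-\mu)r\cos\theta+(1-\mu)^2}}.$$ Let $(\ell,L,g,G)$ be the rotating Delaunay elements: $-\frac1{2L^2}=\frac12(R^2+\frac{G^2}{r^2})-\frac1r$, $e=\sqrt{1-G^2/L^2}$, $r=L^2(1-e\cos u)$, $\theta=f+g$, $u-e\sin u=\ell$, $\cos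 f=\frac{\cos u-e}{1-e\cos u}$, $\sin f=\frac{\sqrt{1-e^2}\sin u}{1-e\cos u}$, $R=\frac{e\sin u}{L(1-e\cos u)}$. The Poincaré coordinates are $$\lambda=\ell+g,\qquad L,\qquad \eta=\sqrt{L-G}\,e^{ig},\qquad \xi=\sqrt{L-G}\,e^{-ig},$$ where $L>0$, $G=L-\eta\xi>0$, and at $e=0$ one puts $(r,\theta,R,G)=(L^2,\lambda,0,L)$. Write $H_1^{\rm Poi}$ for $H_1^{\rm pol}$ in these coordinates. Put $\delta=\mu^{1/4}$ and $$L=1+\delta^2\Lambda,\qquad \eta=\delta x,\qquad \xi=\delta y,\qquad t=\delta^{-2}\tau .$$ Real points are those with $\lambda,\Lambda\in\mathbb R$, $y=\bar x$. 1. On real points $(\lambda,\Lambda,x,y)$ (with $\lambda$ modulo $2\pi$) are analytic coordinates on the set of states with $q\ne0$, $\frac12\|p\|^2-\frac1{\|q\|}<0$ and $G>0$. In them $dq_1\wedge dp_1+dq_2\wedge dp_2=\delta^2\,(d\lambda\wedge d\Lambda+i\,dx\wedge dy)$. Away from collision with the primaries, the equations of $h$ become, in the time $\tau$, the Hamiltonian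 system for the form $d\lambda\wedge d\Lambda+i\,dx\wedge dy$ (that is $\lambda'=\partial_\Lambda H$, $\Lambda'=-\partial_\lambda H$, $x'=-i\,\partial_yH$, $y'=i\,\partial_xH$) of $$H=\delta^{-4}h+\tfrac32\delta^{-4}=H_{\rm pend}+H_{\rm osc}+H_1,$$ $$H_{\rm pend}=-\tfrac32\Lambda^2+V(\lambda),\qquad H_{\rm osc}=\frac{xy}{\delta^2},\qquad H_1=H_1^{\rm Poi}(\lambda,1+\delta^2\Lambda,\delta x,\delta y;\delta^4)-V(\lambda)+\frac1{\delta^4}F_{\rm pend}(\delta^2\Lambda),$$ where $V(\lambda)=1-\cos\lambda-\frac1{\sqrt{2+2\cos\lambda}}$, which for $\cos\lambda\neq-1$ is $\lim_{\mu\to0}H_1^{\rm Poi}(\lambda,1,0,0;\mu)$, and $F_{\rm pend}(z)=-\frac1{2(1+z)^2}-(1+z)+\frac32+\frac32z^2$. 2. $H$ is real-analytic away from collision: it extends to a holomorphic function of $(\lambda,\Lambda,x,y;\delta)$ on an open neighbourhood in $\mathbb C^5$ of the real points with $0<\delta$, $\delta^4\le\frac12$ that are not collisions. This neighbourhood can be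 taken invariant under $(\lambda,\Lambda,x,y;\delta)\mapsto(\bar\lambda,\bar\Lambda,\bar y,\bar x;\bar\delta)$, and there $\overline{H(\lambda,\Lambda,x,y;\delta)}=H(\bar\lambda,\bar\Lambda,\bar y,\bar x;\bar\delta)$. 3. There are $\delta_0>0$ and $C>0$ such that the following holds for $0<\delta<\delta_0$. Let $L_3$ be the unique equilibrium of $h$ with $q_2=0$, $q_1>\mu$. In the new coordinates it is the real point $$\mathfrak L(\delta)=\bigl(0,\ \delta^2\mathfrak L_\Lambda(\delta),\ \delta^3\mathfrak L_x(\delta),\ \delta^3\mathfrak L_y(\delta)\bigr),\qquad |\mathfrak L_\Lambda|,|\mathfrak L_x|,|\mathfrak L_y|\le C.$$ It is an equilibrium of $H$, and the linear part of the vector field at $\mathfrak L(\delta)$, in the order $(\lambda,\Lambda,x,y)$, differs entrywise by at most $C\delta$ from $$\begin{pmatrix}0&-3&0&0\\-\frac78&0&0&0\\0&0&-\frac{i}{\delta^2}&0\\0&0&0&\frac{i}{\delta^2}\end{pmatrix}.$$ The point $\mathfrak L(\delta)$ is a saddle-center: the eigenvalues are $\pm\rho,\pm i\omega$ for some $\rho,\omega>0$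 (depending on $\delta$). In the real phase space it possesses a one-dimensional stable manifold, a one-dimensional unstable manifold and a two-dimensional center manifold, that is: smooth local invariant curves $W^s$, $W^u$ through $\mathfrak L(\delta)$, tangent to the eigenspaces of $-\rho$ and $\rho$, such that all orbits on $W^s$ (on $W^u$) tend to $\mathfrak L(\delta)$ in forward (backward) time, and every orbit that tends to $\mathfrak L(\delta)$ in forward (backward) time lies in $W^s$ (in $W^u$) for all sufficiently late (early) times; and a locally invariant $C^1$ surface through $\mathfrak L(\delta)$ tangent to the real invariant plane of $\pm i\omega$. -/

import Mathlib

open scoped ComplexConjugate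
open Filter Topology

noncomputable section

namespace RPC3BP

/-! ### The restricted planar circular three body problem -/

/-- Cartesian phase space: a point is `![q₁, q₂, p₁, p₂]`. -/
abbrev Cart : Type := Fin 4 → ℝ

/-- The Hamiltonian in rotating coordinates; the primaries of masses `1 - μ` and `μ` sit at
`(μ, 0)` and `(μ - 1, 0)`. -/
def h (μ : ℝ) (w : Cart) : ℝ :=
  (w 2 ^ 2 + w 3 ^ 2) / 2 - (w 0 * w 3 - w 1 * w 2)
    - (1 - μ) / √((w 0 - μ) ^ 2 + w 1 ^ 2)
    - μ / √((w 0 - (μ - 1)) ^ 2 + w 1 ^ 2)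

/-- Collision of the massless body with one of the primaries. -/
def IsCollision (μ : ℝ) (w : Cart) : Prop :=
  (w 0 = μ ∧ w 1 = 0) ∨ (w 0 = μ - 1 ∧ w 1 = 0)

/-- The symplectic form `dq₁ ∧ dp₁ + dq₂ ∧ dp₂`. -/
def cartForm (v w : Cart) : ℝ :=
  (v 0 * w 2 - v 2 * w 0) + (v 1 * w 3 - v 3 * w 1)

/-- The Hamiltonian vector field `q' = ∂F/∂p`, `p' = -∂F/∂q`. -/
def cartVF (F : Cart → ℝ) (w : Cart) : Cart :=
  ![fderiv ℝ F w (Pi.single 2 1), fderiv ℝ F w (Pi.single 3 1),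
    -fderiv ℝ F w (Pi.single 0 1), -fderiv ℝ F w (Pi.single 1 1)]

/-- `w` is the Lagrange point `L₃`: the equilibrium on the line through the primaries for which the
heavy primary, at `(μ, 0)`, lies between the massless body and the light primary. -/
def IsL3 (μ : ℝ) (w : Cart) : Prop :=
  μ < w 0 ∧ w 1 = 0 ∧ cartVF (h μ) w = 0

/-! ### Polar coordinates -/

/-- Symplectic polar coordinates: radius, argument, radial and angular momentum. -/
structure Polar where
  r : ℝ
  θ : ℝ
  R : ℝ
  G : ℝ

/-- The change from polar to Cartesian coordinates. -/
def phiPol (c : Polar) : Cart :=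
  ![c.r * Real.cos c.θ, c.r * Real.sin c.θ,
    c.R * Real.cos c.θ - c.G / c.r * Real.sin c.θ,
    c.R * Real.sin c.θ + c.G / c.r * Real.cos c.θ]

/-- The perturbation `H₁` in polar coordinates, from
`μ H₁ = 1/r - (1-μ)/√(r² - 2μ r cos θ + μ²) - μ/√(r² + 2(1-μ) r cos θ + (1-μ)²)`. -/
def H1pol (μ r θ : ℝ) : ℝ :=
  (1 / r - (1 - μ) / √(r ^ 2 - 2 * μ * r * Real.cos θ + μ ^ 2)
    - μ / √(r ^ 2 + 2 * (1 - μ) * r * Real.cos θ + (1 - μ) ^ 2)) / μ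

/-! ### Delaunay and Poincaré coordinates -/

/-- The eccentric anomaly: the solution `u` of Kepler's equation `u - e sin u = ℓ`. -/
def eccentricAnomaly (e ℓ : ℝ) : ℝ :=
  Function.invFun (fun u : ℝ => u - e * Real.sin u) ℓ

/-- For `0 ≤ e < 1` Kepler's equation has exactly one solution, and it is `eccentricAnomaly`. -/
theorem eccentricAnomaly_iff {e : ℝ} (h0 : 0 ≤ e) (h1 : e < 1) (ℓ u : ℝ) :
    eccentricAnomaly e ℓ = u ↔ u - e * Real.sin u = ℓ := by
  have hmono : StrictMono (fun u : ℝ => u - e * Real.sin u) := by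
    apply strictMono_of_deriv_pos
    intro x
    have hd : HasDerivAt (fun u : ℝ => u - e * Real.sin u) (1 - e * Real.cos x) x :=
      (hasDerivAt_id x).sub ((Real.hasDerivAt_sin x).const_mul e)
    rw [hd.deriv]
    nlinarith [Real.cos_le_one x, Real.neg_one_le_cos x]
  have hsurj : Function.Surjective (fun u : ℝ => u - e * Real.sin u) := by
    apply Continuous.surjective
    · fun_prop
    · apply tendsto_atTop_mono (f := fun u : ℝ => u + (-1))
      · intro x
        nlinarith [Real.sin_le_one x, Real.neg_one_le_sin x]
      · exact tendsto_atTop_add_const_right _ _ tendsto_id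
    · apply tendsto_atBot_mono (f := fun u : ℝ => u + 1)
      · intro x
        nlinarith [Real.sin_le_one x, Real.neg_one_le_sin x]
      · exact tendsto_atBot_add_const_right _ _ tendsto_id
  constructor
  · rintro rfl
    exact Function.invFun_eq (hsurj ℓ)
  · rintro rfl
    exact Function.leftInverse_invFun hmono.injective u

/-- Poincaré coordinates `(λ, L, η, ξ)`, `ξ = conj η`, to polar coordinates, through the rotating
Delaunay elements `(ℓ, L, g, G)`: `λ = ℓ + g`, `η = √(L - G) e^{ig}`, `ξ = √(L - G) e^{-ig}`.
Here `e` is the eccentricity, `u` the eccentric and `f` the true anomaly; `f` is determined by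
`(1 - e cos u) cos f = cos u - e` and `(1 - e cos u) sin f = √(1 - e²) sin u`. At `η = 0` the orbit
is circular, the value of `g` is irrelevant, and `(r, θ, R, G) = (L², λ, 0, L)` modulo `2π` in
`θ`. -/
def phiPoi (lam L : ℝ) (η ξ : ℂ) : Polar :=
  let G : ℝ := L - (η * ξ).re
  let g : ℝ := Complex.arg η
  let ℓ : ℝ := lam - g
  let e : ℝ := √(1 - G ^ 2 / L ^ 2)
  let u : ℝ := eccentricAnomaly e ℓ
  let f : ℝ := Complex.arg ⟨Real.cos u - e, √(1 - e ^ 2) * Real.sin u⟩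
  { r := L ^ 2 * (1 - e * Real.cos u)
    θ := f + g
    R := e * Real.sin u / (L * (1 - e * Real.cos u))
    G := G }

/-- The perturbation `H₁` in Poincaré coordinates. -/
def H1Poi (μ lam L : ℝ) (η ξ : ℂ) : ℝ :=
  H1pol μ (phiPoi lam L η ξ).r (phiPoi lam L η ξ).θ

/-! ### The scaled coordinates `(λ, Λ, x, y)` -/

/-- A real point, `(λ, Λ, x)` with `λ, Λ` real; it stands for `(λ, Λ, x, y)` with `y = conj x`. -/
abbrev RealPt : Type := ℝ × ℝ × ℂ

/-- The complexified phase space: a point is `![λ, Λ, x, y]`. -/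
abbrev CPt : Type := Fin 4 → ℂ

/-- The real points inside the complexified phase space. -/
def emb (z : RealPt) : CPt := ![(z.1 : ℂ), (z.2.1 : ℂ), z.2.2, conj z.2.2]

/-- The symplectic form `dλ ∧ dΛ + i dx ∧ dy`. -/
def form (v w : CPt) : ℂ :=
  (v 0 * w 1 - v 1 * w 0) + Complex.I * (v 2 * w 3 - v 3 * w 2)

/-- The Hamiltonian vector field of `F` for `form`. -/
def hamVF (F : CPt → ℂ) (z : CPt) : CPt :=
  ![fderiv ℂ F z (Pi.single 1 1), -fderiv ℂ F z (Pi.single 0 1),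
    -Complex.I * fderiv ℂ F z (Pi.single 3 1), Complex.I * fderiv ℂ F z (Pi.single 2 1)]

/-- The defining property of the Hamiltonian vector field: contracting `form` with it
gives `dF`. -/
theorem form_hamVF (F : CPt → ℂ) (z w : CPt) : form (hamVF F z) w = fderiv ℂ F z w := by
  have hw : w = w 0 • (Pi.single 0 1 : CPt) + w 1 • (Pi.single 1 1 : CPt)
      + w 2 • (Pi.single 2 1 : CPt) + w 3 • (Pi.single 3 1 : CPt) := by
    ext i
    fin_cases i <;> simp
  conv_rhs => rw [hw]
  simp only [map_add, map_smul, smul_eq_mul, form, hamVF, Matrix.cons_val]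
  ring_nf
  simp only [Complex.I_sq]
  ring

/-- The real points at which the coordinates are used: `L = 1 + δ² Λ > 0` and
`G = L - |η|² > 0` with `η = δ x`. They describe the states that move, in the Kepler problem, on
elliptic orbits with positive angular momentum. -/
def chartDomain (δ : ℝ) : Set RealPt :=
  {z | 0 < 1 + δ ^ 2 * z.2.1 ∧ δ ^ 2 * ‖z.2.2‖ ^ 2 < 1 + δ ^ 2 * z.2.1}

/-- The states with negative Kepler energy and positive angular momentum. -/
def directElliptic : Set Cart :=
  {w | ¬ (w 0 = 0 ∧ w 1 = 0) ∧ (w 2 ^ 2 + w 3 ^ 2) / 2 - 1 / √(w 0 ^ 2 + w 1 ^ 2) < 0 ∧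
    0 < w 0 * w 3 - w 1 * w 2}

/-- The coordinate change `(λ, Λ, x, y) ↦ (q, p)`: the scaling `L = 1 + δ² Λ`, `η = δ x`, `ξ = δ y`,
followed by Poincaré and by polar coordinates. -/
def coord (δ : ℝ) (z : RealPt) : Cart :=
  phiPol (phiPoi z.1 (1 + δ ^ 2 * z.2.1) (δ * z.2.2) (δ * conj z.2.2))

/-- The domain of the new Hamiltonian: the coordinate domain without the collisions. -/
def regularDomain (δ : ℝ) : Set RealPt :=
  {z | z ∈ chartDomain δ ∧ ¬ IsCollision (δ ^ 4) (coord δ z)}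

/-! ### The new Hamiltonian -/

/-- The potential `V(λ) = 1 - cos λ - 1/√(2 + 2 cos λ)`. -/
def V (lam : ℂ) : ℂ :=
  1 - Complex.cos lam - 1 / (2 + 2 * Complex.cos lam) ^ (1 / 2 : ℂ)

def Hpend (lam Lam : ℂ) : ℂ := -(3 / 2) * Lam ^ 2 + V lam

def Hosc (δ x y : ℂ) : ℂ := x * y / δ ^ 2

def Fpend (z : ℂ) : ℂ :=
  (-(1 / (2 * (1 + z) ^ 2)) - (1 + z)) + 3 / 2 + 3 / 2 * z ^ 2

/-- The perturbation `H₁` at real points. -/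
def H1 (δ : ℝ) (z : RealPt) : ℂ :=
  (H1Poi (δ ^ 4) z.1 (1 + δ ^ 2 * z.2.1) (δ * z.2.2) (δ * conj z.2.2) : ℂ)
    - V z.1 + 1 / (δ : ℂ) ^ 4 * Fpend (δ ^ 2 * z.2.1)

/-- The Hamiltonian `H = H_pend + H_osc + H₁` at real points. -/
def H (δ : ℝ) (z : RealPt) : ℂ :=
  Hpend z.1 z.2.1 + Hosc δ z.2.2 (conj z.2.2) + H1 δ z

/-! ### Real-analyticity -/

/-- The real points `(λ, Λ, x, conj x; δ)` away from collision, where `μ = δ⁴ ∈ (0, 1/2]`. -/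
def regularPoints : Set (CPt × ℂ) :=
  {P | ∃ (δ : ℝ) (z : RealPt), 0 < δ ∧ δ ^ 4 ≤ 1 / 2 ∧ z ∈ regularDomain δ ∧ P = (emb z, (δ : ℂ))}

/-- The conjugation `(λ, Λ, x, y; δ) ↦ (conj λ, conj Λ, conj y, conj x; conj δ)`, whose fixed points
are the real points. -/
def conjPt (P : CPt × ℂ) : CPt × ℂ :=
  (![conj (P.1 0), conj (P.1 1), conj (P.1 3), conj (P.1 2)], conj P.2)

/-- `Hc` is a holomorphic extension of `H` to the neighbourhood `U` of the real points away from
collision, and it has the symmetry that makes it real-analytic. -/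
structure IsRealAnalyticExtension (U : Set (CPt × ℂ)) (Hc : CPt × ℂ → ℂ) : Prop where
  isOpen : IsOpen U
  subset : regularPoints ⊆ U
  conj_mem : ∀ P ∈ U, conjPt P ∈ U
  analytic : AnalyticOnNhd ℂ Hc U
  conj_eq : ∀ P ∈ U, conj (Hc P) = Hc (conjPt P)
  eq_H : ∀ (δ : ℝ) (z : RealPt), 0 < δ → δ ^ 4 ≤ 1 / 2 → z ∈ regularDomain δ →
    Hc (emb z, (δ : ℂ)) = H δ z

/-- The Hamiltonian vector field of `Hc(·; δ)`. -/
def field (Hc : CPt × ℂ → ℂ) (δ : ℝ) : CPt → CPt :=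
  hamVF (fun z => Hc (z, (δ : ℂ)))

/-! ### Linear part and invariant manifolds -/

/-- The matrix of the linear part of a vector field at a point. -/
def linearPart (X : CPt → CPt) (P : CPt) : Matrix (Fin 4) (Fin 4) ℂ :=
  Matrix.of fun i j => fderiv ℂ X P (Pi.single j 1) i

/-- The eigenvalues, with multiplicity, are `ρ, -ρ, iσ, -iσ` with `ρ, σ > 0`. -/
def IsSaddleCenter (M : Matrix (Fin 4) (Fin 4) ℂ) (ρ σ : ℝ) : Prop :=
  0 < ρ ∧ 0 < σ ∧
    M.charpoly = (Polynomial.X ^ 2 - Polynomial.C ((ρ : ℂ) ^ 2)) *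
      (Polynomial.X ^ 2 + Polynomial.C ((σ : ℂ) ^ 2))

/-- `W` is an embedded disc of real dimension `k` and class `C^n` in the real phase space, it passes
through `P` with tangent space `E`, and `X` is tangent to it, so that it is locally invariant. -/
def IsInvariantManifold (X : CPt → CPt) (P : CPt) (E : Set CPt) (k : ℕ) (n : WithTop ℕ∞)
    (W : Set CPt) : Prop :=
  ∃ (γ : EuclideanSpace ℝ (Fin k) → CPt) (r : ℝ), 0 < r ∧
    ContDiffOn ℝ n γ (Metric.ball 0 r) ∧
    IsEmbedding ((Metric.ball (0 : EuclideanSpace ℝ (Fin k)) r).domRestrict γ) ∧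
    W = γ '' Metric.ball 0 r ∧ W ⊆ Set.range emb ∧
    γ 0 = P ∧ Set.range (fderiv ℝ γ 0) = E ∧
    ∀ s ∈ Metric.ball (0 : EuclideanSpace ℝ (Fin k)) r,
      Function.Injective (fderiv ℝ γ s) ∧ X (γ s) ∈ Set.range (fderiv ℝ γ s)

/-- `W` is a one-dimensional local stable manifold of the equilibrium `P` for the eigenvalue `-ρ`:
a smooth invariant curve tangent to the eigenspace, on which all orbits tend to `P` in forward time,
and in which every real orbit that tends to `P` in forward time eventually stays. -/
def IsStableCurve (X : CPt → CPt) (P : CPt) (ρ : ℝ) (W : Set CPt) : Prop :=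
  IsInvariantManifold X P {v | v ∈ Set.range emb ∧ fderiv ℂ X P v = (-ρ : ℂ) • v} 1
    ((⊤ : ℕ∞) : WithTop ℕ∞) W ∧
  (∀ w ∈ W, ∃ z : ℝ → CPt, z 0 = w ∧
    (∀ t, 0 ≤ t → z t ∈ W ∧ HasDerivWithinAt z (X (z t)) (Set.Ici 0) t) ∧
    Tendsto z atTop (𝓝 P)) ∧
  ∀ z : ℝ → CPt,
    (∀ t, 0 ≤ t → z t ∈ Set.range emb ∧ HasDerivWithinAt z (X (z t)) (Set.Ici 0) t) →
    Tendsto z atTop (𝓝 P) → ∃ T, ∀ t, T ≤ t → z t ∈ W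

/-- The unstable manifold is the stable manifold after reversal of time. -/
def IsUnstableCurve (X : CPt → CPt) (P : CPt) (ρ : ℝ) (W : Set CPt) : Prop :=
  IsStableCurve (fun z => -X z) P ρ W

/-- `W` is a two-dimensional local center manifold of the equilibrium `P` for the eigenvalues
`± iσ`: an invariant surface tangent to the real center subspace. -/
def IsCenterSurface (X : CPt → CPt) (P : CPt) (σ : ℝ) (W : Set CPt) : Prop :=
  IsInvariantManifold X P
    {v | v ∈ Set.range emb ∧ fderiv ℂ X P (fderiv ℂ X P v) = (-σ ^ 2 : ℂ) • v} 2 1 W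

/-- The limit linear part at `L₃`, in the order `(λ, Λ, x, y)`. -/
def L3Matrix (δ : ℝ) : Matrix (Fin 4) (Fin 4) ℂ :=
  !![0, -3, 0, 0;
     -7 / 8, 0, 0, 0;
     0, 0, -(Complex.I / (δ : ℂ) ^ 2), 0;
     0, 0, 0, Complex.I / (δ : ℂ) ^ 2]

end RPC3BP

end

open scoped ComplexConjugate
open Filter Topology

noncomputable section

namespace RPC3BP

/-! Coordinates. The singularity of the Delaunay elements at zero eccentricity disappears when the
state is written with the eccentric longitude F = u + g. With w = e^{iF} and s = √(2L - ηξ), the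
position q₁ + i q₂, the momentum p₁ + i p₂, their conjugates, the radius and the term λ - F of
Kepler's equation are rational in (w, s, η, ξ) (`phiPoi_formulas`). The derivative of Kepler's
equation in F is r / L², which does not vanish, so the implicit function theorem gives F as a
holomorphic function near real points (`exists_local_longitude`); this yields both the analyticity
of the chart and its complexification. That the chart is symplectic becomes an algebraic identity
(`wedge_half`, `wedge_sum`). It is inverted with the first integrals of the Kepler problem: energy,
angular momentum and eccentricity vector give L, η and w (`kepler_algebra`, `directElliptic_subset`,
`cartPoi_eq_iff`).

Hamiltonian. The potential V cancels between H_pend and H₁, so H is h / δ⁴ plus a constant.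
Rationalising the difference 1/r - 1/‖q - (μ, 0)‖ removes the division by μ and makes H₁ analytic up
to μ = 0 (`realH1_eq`, `exists_local_H1`). A holomorphic function on a convex set invariant under
conjugation is determined by its real points; hence the local extensions fit together and inherit
the symmetry (`exists_glued_extension`). The factors δ² of the form, δ⁴ of the energy and δ² of the
time match, which gives the equations of motion (`emb_eq_field_iff`, `equations_iff`).

Lagrange point. At L₃ the state is (r, 0, 0, r), where r solves a scalar equation with an increasing
and a decreasing side and lies in (1, 1 + 2μ). It is the perihelion of a Kepler ellipse with L - 1
and η of order μ (`exists_lagrange_point`). In the scaled variables every second derivative of H₁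
carries a factor δ except the one in λ twice, which tends to V''(0) = 7/8; this gives the linear
part up to O(δ). The characteristic polynomial of a Hamiltonian matrix is even, and here it is real
with negative constant term, so the point is a saddle-center (`exists_isSaddleCenter`,
`exists_det_neg`).

Invariant manifolds. In a frame of eigenvectors the field has the form `SaddleCenterForm`, with the
energy as first integral. For the stable curve the stable direction is blown up, z = s (1, W): all
three fibre directions are then expanding, and the invariant graph is the fixed point of a Laplace
integral (`exists_stable_graph`). Conversely, an orbit that tends to the equilibrium has the energy
of the equilibrium. This bounds its center part by the hyperbolic part, and a cone argument bounds
the latter by s (`orbit_le_stable`); such an orbit stays in a bounded part of the blow-up, where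
expansion forces it onto the graph. The unstable curve comes from the Hamiltonian -H. The center
surface is the Lyapunov family: in polar coordinates of the center plane, with the scaled energy E
as parameter, the hyperbolic components solve linear equations along the rotation, and the radius
follows from the conservation of energy (`exists_center_graph`). The graph vanishes at E = 0, which
suffices for C¹ at the origin (`contDiff_polar_remainder`). -/

section

/-! ### Holomorphic maps between Banach spaces. -/

section Holomorphic

variable {E F : Type*} [NormedAddCommGroup E] [NormedSpace ℂ E]
  [NormedAddCommGroup F] [NormedSpace ℂ F]

/-- Cauchy's estimate for the Fréchet derivative. -/
theorem norm_fderiv_le_of_bounded {f : E → F} {x : E} {r M : ℝ} (hr : 0 < r)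
    (hf : DifferentiableOn ℂ f (Metric.ball x r)) (hM : ∀ y ∈ Metric.ball x r, ‖f y‖ ≤ M) :
    ‖fderiv ℂ f x‖ ≤ 2 * M / r := by
  have hM0 : 0 ≤ M := (norm_nonneg _).trans (hM x (Metric.mem_ball_self hr))
  refine ContinuousLinearMap.opNorm_le_bound _ (by positivity) fun v => ?_
  rcases eq_or_ne v 0 with rfl | hv
  · simp
  have hv' : 0 < ‖v‖ := norm_pos_iff.mpr hv
  -- For |ζ| ≤ R the complex line x + ζ v stays within distance r / 2 of x. Half the radius is used
  -- because the one-variable estimate needs a closed disc; this is the origin of the factor 2 in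
  -- the bound.
  set R : ℝ := r / 2 / ‖v‖ with hR
  have hRpos : 0 < R := by positivity
  have hmem : ∀ ζ ∈ Metric.closedBall (0 : ℂ) R, x + ζ • v ∈ Metric.ball x r := by
    intro ζ hζ
    rw [mem_closedBall_zero_iff] at hζ
    rw [mem_ball_iff_norm, add_sub_cancel_left, norm_smul]
    calc ‖ζ‖ * ‖v‖ ≤ R * ‖v‖ := by gcongr
      _ = r / 2 := by rw [hR]; field_simp
      _ < r := by linarith
  have hd : ∀ ζ ∈ Metric.closedBall (0 : ℂ) R, DifferentiableAt ℂ (fun ζ : ℂ => f (x + ζ • v)) ζ := by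
    intro ζ hζ
    have h1 : DifferentiableAt ℂ f (x + ζ • v) :=
      (hf _ (hmem ζ hζ)).differentiableAt (Metric.isOpen_ball.mem_nhds (hmem ζ hζ))
    exact h1.comp ζ (by fun_prop)
  have h0 : (0 : ℂ) ∈ Metric.closedBall (0 : ℂ) R := Metric.mem_closedBall_self hRpos.le
  have key := Complex.norm_deriv_le_of_forall_mem_sphere_norm_le (f := fun ζ : ℂ => f (x + ζ • v))
    (c := 0) (C := M) hRpos
    (DifferentiableOn.diffContOnCl (by
      rw [closure_ball _ hRpos.ne']
      exact fun ζ hζ => (hd ζ hζ).differentiableWithinAt))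
    (fun ζ hζ => hM _ (hmem ζ (Metric.sphere_subset_closedBall hζ)))
  have hder : deriv (fun ζ : ℂ => f (x + ζ • v)) 0 = fderiv ℂ f x v := by
    have h1 : HasFDerivAt f (fderiv ℂ f x) (x + (0 : ℂ) • v) := by
      rw [zero_smul, add_zero]
      exact ((hf x (Metric.mem_ball_self hr)).differentiableAt
        (Metric.ball_mem_nhds x hr)).hasFDerivAt
    have h2 : HasDerivAt (fun ζ : ℂ => x + ζ • v) v 0 := by
      simpa using ((hasDerivAt_id (0 : ℂ)).smul_const v).const_add x
    exact (h1.comp_hasDerivAt 0 h2).deriv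
  rw [hder] at key
  calc ‖fderiv ℂ f x v‖ ≤ M / R := key
    _ = 2 * M / r * ‖v‖ := by rw [hR]; field_simp

/-- A function that is complex differentiable on an open set is continuously differentiable. -/
theorem continuousOn_fderiv_of_differentiableOn {f : E → F} {Ω : Set E} (hΩ : IsOpen Ω)
    (hf : DifferentiableOn ℂ f Ω) : ContinuousOn (fderiv ℂ f) Ω := by
  intro x hx
  refine ContinuousAt.continuousWithinAt ?_
  have hc : ContinuousAt f x := (hf x hx).continuousWithinAt.continuousAt (hΩ.mem_nhds hx)
  obtain ⟨r, hr, hball⟩ : ∃ r > 0, ∀ y ∈ Metric.ball x (4 * r), y ∈ Ω ∧ ‖f y‖ ≤ ‖f x‖ + 1 := by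
    have h1 : ∀ᶠ y in 𝓝 x, y ∈ Ω ∧ ‖f y‖ ≤ ‖f x‖ + 1 := by
      filter_upwards [hΩ.mem_nhds hx, hc.norm.eventually_lt_const (lt_add_one ‖f x‖)] with y h1 h2
      exact ⟨h1, h2.le⟩
    obtain ⟨r, hr, h⟩ := Metric.eventually_nhds_iff_ball.1 h1
    exact ⟨r / 4, by positivity, fun y hy => h y (by rwa [mul_div_cancel₀ _ (by norm_num)] at hy)⟩
  set M := ‖f x‖ + 1
  have hdiff : ∀ y ∈ Metric.ball x (4 * r), DifferentiableAt ℂ f y := fun y hy =>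
    (hf y (hball y hy).1).differentiableAt (hΩ.mem_nhds (hball y hy).1)
  set K := 2 * M / (2 * r)
  have hK : ∀ y ∈ Metric.ball x (2 * r), ‖fderiv ℂ f y‖ ≤ K := by
    intro y hy
    have hsub : Metric.ball y (2 * r) ⊆ Metric.ball x (4 * r) :=
      Metric.ball_subset_ball' (by linarith [Metric.mem_ball.1 hy])
    exact norm_fderiv_le_of_bounded (by positivity)
      (fun z hz => (hdiff z (hsub hz)).differentiableWithinAt) (fun z hz => (hball z (hsub hz)).2)
  have hlip : ∀ y ∈ Metric.ball x (2 * r), ∀ z ∈ Metric.ball x (2 * r), ‖f z - f y‖ ≤ K * ‖z - y‖ :=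
    fun y hy z hz => (convex_ball x (2 * r)).norm_image_sub_le_of_norm_fderiv_le (𝕜 := ℂ)
      (fun u hu => hdiff u (Metric.ball_subset_ball (by linarith) hu)) hK hy hz
  -- Cauchy's estimate is applied to the difference z ↦ f (z + (y - x)) - f z, which is at most K ‖y
  -- - x‖ by the Lipschitz bound; its derivative at x is the difference of the two derivatives.
  have hmain : ∀ y ∈ Metric.ball x r, ‖fderiv ℂ f y - fderiv ℂ f x‖ ≤ 2 * (K * ‖y - x‖) / r := by
    intro y hy
    have hy' : ‖y - x‖ < r := mem_ball_iff_norm.1 hy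
    have e1 : ∀ z ∈ Metric.ball x r, z + (y - x) ∈ Metric.ball x (2 * r) := by
      intro z hz
      rw [mem_ball_iff_norm] at hz ⊢
      calc ‖z + (y - x) - x‖ = ‖(z - x) + (y - x)‖ := by congr 1; abel
        _ ≤ ‖z - x‖ + ‖y - x‖ := norm_add_le _ _
        _ < 2 * r := by linarith
    have e2 : ∀ z ∈ Metric.ball x r, z ∈ Metric.ball x (2 * r) := fun z hz =>
      Metric.ball_subset_ball (by linarith) hz
    have hd : ∀ z ∈ Metric.ball x r, HasFDerivAt (fun z => f (z + (y - x)) - f z)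
        (fderiv ℂ f (z + (y - x)) - fderiv ℂ f z) z := by
      intro z hz
      have h1 := (hdiff _ (Metric.ball_subset_ball (by linarith) (e1 z hz))).hasFDerivAt
      have h2 := (hdiff _ (Metric.ball_subset_ball (by linarith) (e2 z hz))).hasFDerivAt
      exact (h1.comp z ((hasFDerivAt_id z).add_const (y - x))).sub h2
    have := norm_fderiv_le_of_bounded (f := fun z => f (z + (y - x)) - f z) hr
      (fun z hz => (hd z hz).differentiableAt.differentiableWithinAt) (M := K * ‖y - x‖)
      (fun z hz => by
        simpa using hlip z (e2 z hz) _ (e1 z hz))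
    rwa [(hd x (Metric.mem_ball_self hr)).fderiv, add_sub_cancel] at this
  rw [ContinuousAt, tendsto_iff_norm_sub_tendsto_zero]
  refine squeeze_zero' (Eventually.of_forall fun _ => norm_nonneg _)
    (by filter_upwards [Metric.ball_mem_nhds x hr] with y hy using hmain y hy) ?_
  have : Tendsto (fun y => 2 * (K * ‖y - x‖) / r) (𝓝 x) (𝓝 (2 * (K * ‖x - x‖) / r)) := by
    apply Continuous.tendsto
    fun_prop
  simpa using this

theorem contDiffOn_one_of_differentiableOn {f : E → F} {Ω : Set E} (hΩ : IsOpen Ω)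
    (hf : DifferentiableOn ℂ f Ω) : ContDiffOn ℂ 1 f Ω := by
  have : (1 : WithTop ℕ∞) = 0 + 1 := by simp
  rw [this, contDiffOn_succ_iff_fderiv_of_isOpen hΩ]
  exact ⟨hf, by simp, contDiffOn_zero.2 (continuousOn_fderiv_of_differentiableOn hΩ hf)⟩

/-- A uniform limit of holomorphic functions is holomorphic. -/
theorem differentiableOn_of_tendstoUniformlyOn [CompleteSpace F] {f : ℕ → E → F} {g : E → F}
    {Ω : Set E} (hΩ : IsOpen Ω) (hf : ∀ n, DifferentiableOn ℂ (f n) Ω)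
    (hlim : TendstoUniformlyOn f g atTop Ω) : DifferentiableOn ℂ g Ω := by
  intro x hx
  obtain ⟨r, hr, hball⟩ : ∃ r > 0, Metric.ball x (2 * r) ⊆ Ω := by
    obtain ⟨r, hr, h⟩ := Metric.isOpen_iff.1 hΩ x hx
    exact ⟨r / 2, by positivity, by rwa [mul_div_cancel₀ _ (by norm_num)]⟩
  have hsub : Metric.ball x r ⊆ Ω := (Metric.ball_subset_ball (by linarith)).trans hball
  have hdiff : ∀ n, ∀ y ∈ Ω, DifferentiableAt ℂ (f n) y := fun n y hy =>
    (hf n y hy).differentiableAt (hΩ.mem_nhds hy)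
  -- By Cauchy's estimate, uniform closeness of the values on Ω gives uniform closeness of the
  -- derivatives on a smaller ball.
  have hcau : UniformCauchySeqOn (fun n => fderiv ℂ (f n)) atTop (Metric.ball x r) := by
    rw [Metric.uniformCauchySeqOn_iff]
    intro ε hε
    obtain ⟨N, hN⟩ := (Metric.uniformCauchySeqOn_iff.1 hlim.uniformCauchySeqOn) (ε * r / 4)
      (by positivity)
    refine ⟨N, fun m hm n hn y hy => ?_⟩
    have hsub' : Metric.ball y r ⊆ Ω := (Metric.ball_subset_ball'
      (by linarith [Metric.mem_ball.1 hy])).trans hball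
    have := norm_fderiv_le_of_bounded (f := fun z => f m z - f n z) hr
      (fun z hz => ((hdiff m z (hsub' hz)).sub (hdiff n z (hsub' hz))).differentiableWithinAt)
      (M := ε * r / 4) (fun z hz => by
        have := hN m hm n hn z (hsub' hz)
        rw [dist_eq_norm] at this
        exact this.le)
    rw [fderiv_fun_sub (hdiff m y (hsub hy)) (hdiff n y (hsub hy))] at this
    rw [dist_eq_norm]
    refine this.trans_lt ?_
    rw [show 2 * (ε * r / 4) / r = ε / 2 by field_simp; norm_num]
    linarith
  have hpt : ∀ y ∈ Metric.ball x r, ∃ L, Tendsto (fun n => fderiv ℂ (f n) y) atTop (𝓝 L) :=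
    fun y hy => cauchySeq_tendsto_of_complete (hcau.cauchySeq hy)
  choose! g' hg' using hpt
  have hunif := hcau.tendstoUniformlyOn_of_tendsto hg'
  exact (hasFDerivAt_of_tendstoUniformlyOn Metric.isOpen_ball hunif
    (fun n y hy => (hdiff n y (hsub hy)).hasFDerivAt)
    (fun y hy => hlim.tendsto_at (hsub hy)) (Metric.mem_ball_self hr)).differentiableAt
    |>.differentiableWithinAt

/-- The holomorphic maps from `Ω` to the ball of radius `K` that map `S` to `C`. -/
def holClass (Ω : Set E) (K : ℝ) (S : Set E) (C : Set F) : Set (E → F) :=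
  {W | DifferentiableOn ℂ W Ω ∧ (∀ x ∈ Ω, ‖W x‖ ≤ K) ∧ ∀ x ∈ S, W x ∈ C}

/-- The contraction principle for operators on holomorphic maps. -/
theorem exists_holomorphic_fixedPoint [CompleteSpace F] {Ω : Set E} (hΩ : IsOpen Ω) {K : ℝ}
    (hK : 0 ≤ K) {S : Set E} (hS : S ⊆ Ω) {C : Set F} (hC : IsClosed C) (h0 : (0 : F) ∈ C)
    (T : (E → F) → E → F) (hT : ∀ W ∈ holClass Ω K S C, T W ∈ holClass Ω K S C)
    (hlip : ∀ W ∈ holClass Ω K S C, ∀ W' ∈ holClass Ω K S C, ∀ D : ℝ,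
      (∀ x ∈ Ω, ‖W x - W' x‖ ≤ D) → ∀ x ∈ Ω, ‖T W x - T W' x‖ ≤ D / 2) :
    ∃ W ∈ holClass Ω K S C, ∀ x ∈ Ω, T W x = W x := by
  set W : ℕ → E → F := fun n => T^[n] 0 with hW
  have hsucc : ∀ n, W (n + 1) = T (W n) := fun n => Function.iterate_succ_apply' T n 0
  have hmem : ∀ n, W n ∈ holClass Ω K S C := by
    intro n
    induction n with
    | zero => exact ⟨by simp [hW], by simp [hW, hK],
        by simp [hW, h0]⟩
    | succ n ih => rw [hsucc]; exact hT _ ih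
  -- The first two iterates differ by at most 2 K, and each application of `T` halves the distance.
  -- The shape C / 2 / 2 ^ n with C = 4 K is the one of the geometric criterion used below.
  have hdist : ∀ n, ∀ x ∈ Ω, ‖W n x - W (n + 1) x‖ ≤ (4 * K) / 2 / 2 ^ n := by
    intro n
    induction n with
    | zero =>
      intro x hx
      have h1 := (hmem 0).2.1 x hx
      have h2 := (hmem 1).2.1 x hx
      calc ‖W 0 x - W 1 x‖ ≤ ‖W 0 x‖ + ‖W 1 x‖ := norm_sub_le _ _
        _ ≤ _ := by simp; linarith
    | succ n ih =>
      intro x hx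
      have := hlip _ (hmem n) _ (hmem (n + 1)) _ ih x hx
      rw [← hsucc, ← hsucc] at this
      refine this.trans (le_of_eq ?_)
      rw [pow_succ]; field_simp
  have hpt : ∀ x ∈ Ω, ∃ a, Tendsto (fun n => W n x) atTop (𝓝 a) := fun x hx =>
    cauchySeq_tendsto_of_complete
      (cauchySeq_of_le_geometric_two (fun n => by rw [dist_eq_norm]; exact hdist n x hx))
  choose! V hV using hpt
  have hrate : ∀ n, ∀ x ∈ Ω, ‖W n x - V x‖ ≤ 4 * K / 2 ^ n := fun n x hx => by
    rw [← dist_eq_norm]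
    exact dist_le_of_le_geometric_two_of_tendsto
      (fun n => by rw [dist_eq_norm]; exact hdist n x hx) (hV x hx) n
  have hgeo : Tendsto (fun n : ℕ => 4 * K / 2 ^ n) atTop (𝓝 0) := by
    simpa [div_eq_mul_inv] using (tendsto_pow_atTop_nhds_zero_of_lt_one (r := (2 : ℝ)⁻¹)
      (by norm_num) (by norm_num)).const_mul (4 * K)
  have hunif : TendstoUniformlyOn W V atTop Ω := by
    rw [Metric.tendstoUniformlyOn_iff]
    intro ε hε
    filter_upwards [hgeo.eventually_lt_const hε] with n hn x hx
    rw [dist_comm, dist_eq_norm]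
    exact (hrate n x hx).trans_lt hn
  have hVmem : V ∈ holClass Ω K S C := by
    refine ⟨differentiableOn_of_tendstoUniformlyOn hΩ (fun n => (hmem n).1) hunif,
      fun x hx => ?_, fun x hx => ?_⟩
    · exact le_of_tendsto' (hV x hx).norm fun n => (hmem n).2.1 x hx
    · exact hC.mem_of_tendsto (hV x (hS hx)) (Eventually.of_forall fun n => (hmem n).2.2 x hx)
  refine ⟨V, hVmem, fun x hx => ?_⟩
  have h1 : Tendsto (fun n => W (n + 1) x) atTop (𝓝 (T V x)) := by
    rw [tendsto_iff_norm_sub_tendsto_zero]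
    refine squeeze_zero (fun _ => norm_nonneg _) (fun n => ?_) (g := fun n => 4 * K / 2 ^ n / 2) ?_
    · rw [hsucc]
      exact hlip _ (hmem n) _ hVmem _ (hrate n) x hx
    · simpa using hgeo.div_const 2
  exact tendsto_nhds_unique h1 ((tendsto_add_atTop_iff_nat 1).2 (hV x hx))

/-- Hadamard's lemma for analytic maps. -/
theorem exists_analytic_hadamard [CompleteSpace F] {f : E → F} (hf : AnalyticAt ℂ f 0) :
    ∃ g : E → E →L[ℂ] F, AnalyticAt ℂ g 0 ∧ g 0 = fderiv ℂ f 0 ∧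
      ∀ᶠ z in 𝓝 0, f z = f 0 + g z z := by
  obtain ⟨p, r, hp⟩ := hf
  -- The quotient is the sum of the shifted power series, whose n-th coefficient is p (n + 1) with
  -- its last argument left open. The shift does not change the radius of convergence.
  have hrad : 0 < p.shift.radius := by
    rw [FormalMultilinearSeries.radius_shift]
    exact hp.r_pos.trans_le hp.r_le
  have hq := p.shift.hasFPowerSeriesOnBall hrad
  have hev : ∀ᶠ z in 𝓝 (0 : E), f z = f 0 + p.shift.sum z z := by
    filter_upwards [Metric.eball_mem_nhds (0 : E) hp.r_pos] with z hz
    have h1 := hp.hasSum hz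
    rw [zero_add] at h1
    have hz' : z ∈ Metric.eball (0 : E) p.shift.radius := by
      rw [FormalMultilinearSeries.radius_shift]
      exact Metric.eball_subset_eball hp.r_le hz
    have h2 := hq.hasSum hz'
    rw [zero_add] at h2
    have h3 := (ContinuousLinearMap.apply ℂ F z).hasSum h2
    have h4 : HasSum (fun n => p (n + 1) fun _ => z) (p.shift.sum z z) := by
      rw [ContinuousLinearMap.apply_apply] at h3
      convert h3 using 2 with n
      simp only [FormalMultilinearSeries.shift, ContinuousLinearMap.apply_apply]
      rw [ContinuousMultilinearMap.curryRight_apply]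
      congr 1
      ext i
      refine Fin.lastCases ?_ (fun j => ?_) i <;> simp
    have h5 := (hasSum_nat_add_iff' 1).2 h1
    have h6 := h5.unique h4
    simp only [Finset.range_one, Finset.sum_singleton] at h6
    rw [hp.coeff_zero] at h6
    rw [← h6]; abel
  refine ⟨p.shift.sum, hq.analyticAt, ?_, hev⟩
  have h1 : HasFDerivAt (fun z => f 0 + p.shift.sum z z) (p.shift.sum 0) 0 := by
    have := (hq.analyticAt.differentiableAt.hasFDerivAt).clm_apply (hasFDerivAt_id (0 : E))
    refine (this.const_add (f 0)).congr_fderiv ?_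
    ext v
    simp
  exact ((h1.congr_of_eventuallyEq hev).fderiv).symm

end Holomorphic

/-! ### Laplace integrals along a linear flow. -/

section FlowIntegral

open MeasureTheory Set

theorem integrableOn_exp_neg_mul {b : ℂ} (hb : 0 < b.re) {B : ℝ} {g : ℝ → ℂ}
    (hg : ContinuousOn g (Ici 0)) (hB : ∀ τ, 0 ≤ τ → ‖g τ‖ ≤ B) :
    IntegrableOn (fun τ : ℝ => Complex.exp (-b * τ) * g τ) (Ioi 0) := by
  have hcont : ContinuousOn (fun τ : ℝ => Complex.exp (-b * τ) * g τ) (Ioi 0) :=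
    (Continuous.continuousOn (by fun_prop)).mul (hg.mono Ioi_subset_Ici_self)
  refine Integrable.mono' ((exp_neg_integrableOn_Ioi 0 hb).mul_const B)
    (hcont.aestronglyMeasurable measurableSet_Ioi) ?_
  filter_upwards [ae_restrict_mem measurableSet_Ioi] with τ hτ
  rw [norm_mul, Complex.norm_exp]
  have : (-b * (τ : ℂ)).re = -b.re * τ := by simp
  rw [this]
  exact mul_le_mul_of_nonneg_left (hB τ (le_of_lt hτ)) (Real.exp_pos _).le

theorem norm_integral_exp_neg_mul_le {b : ℂ} (hb : 0 < b.re) {B : ℝ} {g : ℝ → ℂ}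
    (hB : ∀ τ, 0 ≤ τ → ‖g τ‖ ≤ B) :
    ‖∫ τ in Ioi (0 : ℝ), Complex.exp (-b * τ) * g τ‖ ≤ B / b.re := by
  have h1 : ∫ τ in Ioi (0 : ℝ), Real.exp (-b.re * τ) * B = B / b.re := by
    rw [integral_mul_const, integral_exp_mul_Ioi (by linarith)]
    simp
    field_simp
  rw [← h1]
  refine norm_integral_le_of_norm_le ((exp_neg_integrableOn_Ioi 0 hb).mul_const B) ?_
  filter_upwards [ae_restrict_mem measurableSet_Ioi] with τ hτ
  rw [norm_mul, Complex.norm_exp]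
  have : (-b * (τ : ℂ)).re = -b.re * τ := by simp
  rw [this]
  exact mul_le_mul_of_nonneg_left (hB τ (le_of_lt hτ)) (Real.exp_pos _).le

/-- The Laplace integral of a shifted function solves `y' = b y - g`. -/
theorem hasDerivWithinAt_integral_shift {b : ℂ} (hb : 0 < b.re) {B : ℝ} {g : ℝ → ℂ}
    (hg : ContinuousOn g (Ici 0)) (hB : ∀ τ, 0 ≤ τ → ‖g τ‖ ≤ B) :
    HasDerivWithinAt (fun t : ℝ => ∫ τ in Ioi (0 : ℝ), Complex.exp (-b * τ) * g (t + τ))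
      (b * (∫ τ in Ioi (0 : ℝ), Complex.exp (-b * τ) * g τ) - g 0) (Ici 0) 0 := by
  set f : ℝ → ℂ := fun τ => Complex.exp (-b * τ) * g τ with hf
  have hfint := integrableOn_exp_neg_mul hb hg hB
  have hfc : ContinuousOn f (Ici 0) :=
    (Continuous.continuousOn (by fun_prop)).mul hg
  -- Substituting τ ↦ t + τ turns the integral into e^{bt} times the tail from t, which is then
  -- differentiated by the product rule. The derivative at 0 is one-sided because `g` is controlled
  -- only on [0, ∞).
  have key : ∀ t : ℝ, 0 ≤ t → ∫ τ in Ioi (0 : ℝ), Complex.exp (-b * τ) * g (t + τ) =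
      Complex.exp (b * t) * ((∫ τ in Ioi (0 : ℝ), f τ) - ∫ τ in (0 : ℝ)..t, f τ) := by
    intro t ht
    have h1 : (∫ τ in Ioi (0 : ℝ), f τ) - ∫ τ in (0 : ℝ)..t, f τ = ∫ τ in Ioi t, f τ := by
      rw [← intervalIntegral.integral_interval_add_Ioi hfint
        (hfint.mono_set (Ioi_subset_Ioi ht))]
      ring
    have h2 : ∫ τ in Ioi t, f τ = ∫ τ in Ioi (0 : ℝ), f (t + τ) := by
      have := (measurePreserving_add_left (volume : Measure ℝ) t).setIntegral_preimage_emb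
        (measurableEmbedding_addLeft t) f (Ioi t)
      rw [← this]
      congr 2
      ext τ; simp
    rw [h1, h2, ← integral_const_mul]
    refine integral_congr_ae (Eventually.of_forall fun τ => ?_)
    simp only [hf]
    rw [← mul_assoc, ← Complex.exp_add]
    congr 2
    push_cast; ring
  have hint : HasDerivWithinAt (fun t : ℝ => ∫ τ in (0 : ℝ)..t, f τ) (f 0) (Ici 0) 0 := by
    refine intervalIntegral.integral_hasDerivWithinAt_right (t := Ioi 0)
      IntervalIntegrable.refl ?_ ?_
    · exact (hfc.mono Ioi_subset_Ici_self).stronglyMeasurableAtFilter_nhdsWithin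
        measurableSet_Ioi 0
    · exact ((hfc 0 self_mem_Ici).mono Ioi_subset_Ici_self)
  have hexp : HasDerivWithinAt (fun t : ℝ => Complex.exp (b * t)) b (Ici 0) 0 := by
    have : HasDerivAt (fun t : ℝ => Complex.exp (b * t)) b 0 := by
      have h1 : HasDerivAt (fun t : ℝ => b * (t : ℂ)) b 0 := by
        simpa using (Complex.ofRealCLM.hasDerivAt (x := (0 : ℝ))).const_mul b
      simpa using h1.cexp
    exact this.hasDerivWithinAt
  have hmain := hexp.mul (hint.const_sub (∫ τ in Ioi (0 : ℝ), f τ))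
  refine (hmain.congr_of_mem (fun t ht => key t ht) self_mem_Ici).congr_deriv ?_
  simp [hf]
  ring

variable {E : Type*} [NormedAddCommGroup E] [NormedSpace ℂ E]

/-- The Laplace integral of `G` along the orbits of the linear flow `M`. -/
def flowIntegral (b : ℂ) (M : ℝ → E →L[ℂ] E) (G : E → ℂ) (x : E) : ℂ :=
  ∫ τ in Ioi (0 : ℝ), Complex.exp (-b * τ) * G (M τ x)

variable {b : ℂ} {M : ℝ → E →L[ℂ] E} {Ω : Set E} {B : ℝ} {G : E → ℂ}

theorem continuousOn_along_flow (hM : Continuous M)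
    (hMΩ : ∀ τ, 0 ≤ τ → ∀ x ∈ Ω, M τ x ∈ Ω) (hG : ContinuousOn G Ω) {x : E} (hx : x ∈ Ω) :
    ContinuousOn (fun τ => G (M τ x)) (Ici 0) :=
  hG.comp (Continuous.continuousOn (by fun_prop)) fun τ hτ => hMΩ τ hτ x hx

theorem norm_flowIntegral_le (hb : 0 < b.re)
    (hMΩ : ∀ τ, 0 ≤ τ → ∀ x ∈ Ω, M τ x ∈ Ω) (hB : ∀ x ∈ Ω, ‖G x‖ ≤ B) {x : E} (hx : x ∈ Ω) :
    ‖flowIntegral b M G x‖ ≤ B / b.re :=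
  norm_integral_exp_neg_mul_le hb fun τ hτ => hB _ (hMΩ τ hτ x hx)

theorem norm_flowIntegral_sub_le (hb : 0 < b.re) (hM : Continuous M)
    (hMΩ : ∀ τ, 0 ≤ τ → ∀ x ∈ Ω, M τ x ∈ Ω) {G' : E → ℂ} {D : ℝ}
    (hG : ContinuousOn G Ω) (hG' : ContinuousOn G' Ω)
    (hB : ∀ x ∈ Ω, ‖G x‖ ≤ B) (hB' : ∀ x ∈ Ω, ‖G' x‖ ≤ B)
    (hD : ∀ x ∈ Ω, ‖G x - G' x‖ ≤ D) {x : E} (hx : x ∈ Ω) :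
    ‖flowIntegral b M G x - flowIntegral b M G' x‖ ≤ D / b.re := by
  have h1 := integrableOn_exp_neg_mul hb (continuousOn_along_flow hM hMΩ hG hx)
    fun τ hτ => hB _ (hMΩ τ hτ x hx)
  have h2 := integrableOn_exp_neg_mul hb (continuousOn_along_flow hM hMΩ hG' hx)
    fun τ hτ => hB' _ (hMΩ τ hτ x hx)
  unfold flowIntegral
  rw [← integral_sub h1 h2]
  simp_rw [← mul_sub]
  exact norm_integral_exp_neg_mul_le hb fun τ hτ => hD _ (hMΩ τ hτ x hx)

/-- Differentiation under the integral sign. The dominating function comes from Cauchy's estimate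
for the composite y ↦ G (M τ y), so no bound on the operator norms ‖M τ‖ is needed. -/
theorem differentiableOn_flowIntegral (hb : 0 < b.re) (hΩ : IsOpen Ω) (hM : Continuous M)
    (hMΩ : ∀ τ, 0 ≤ τ → ∀ x ∈ Ω, M τ x ∈ Ω) (hG : DifferentiableOn ℂ G Ω)
    (hB : ∀ x ∈ Ω, ‖G x‖ ≤ B) : DifferentiableOn ℂ (flowIntegral b M G) Ω := by
  intro x hx
  obtain ⟨r, hr, hball⟩ : ∃ r > 0, Metric.ball x (2 * r) ⊆ Ω := by
    obtain ⟨r, hr, h⟩ := Metric.isOpen_iff.1 hΩ x hx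
    exact ⟨r / 2, by positivity, by rwa [mul_div_cancel₀ _ (by norm_num)]⟩
  have hsub : Metric.ball x r ⊆ Ω := (Metric.ball_subset_ball (by linarith)).trans hball
  have hder : ∀ τ, 0 ≤ τ → ∀ y ∈ Ω, HasFDerivAt (fun y => G (M τ y))
      ((fderiv ℂ G (M τ y)).comp (M τ)) y := fun τ hτ y hy =>
    ((hG _ (hMΩ τ hτ y hy)).differentiableAt (hΩ.mem_nhds (hMΩ τ hτ y hy))).hasFDerivAt.comp y
      (M τ).hasFDerivAt
  have hbd : ∀ τ, 0 ≤ τ → ∀ y ∈ Metric.ball x r,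
      ‖(fderiv ℂ G (M τ y)).comp (M τ)‖ ≤ 2 * B / r := by
    intro τ hτ y hy
    have hs : Metric.ball y r ⊆ Ω := (Metric.ball_subset_ball'
      (by linarith [Metric.mem_ball.1 hy])).trans hball
    have := norm_fderiv_le_of_bounded (f := fun y => G (M τ y)) (x := y) hr
      (fun z hz => (hder τ hτ z (hs hz)).differentiableAt.differentiableWithinAt) (M := B)
      (fun z hz => hB _ (hMΩ τ hτ z (hs hz)))
    rwa [(hder τ hτ y (hsub hy)).fderiv] at this
  have hexp : Continuous fun τ : ℝ => Complex.exp (-b * τ) := by fun_prop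
  have hcontG : ∀ y ∈ Ω, ContinuousOn (fun τ : ℝ => Complex.exp (-b * τ) * G (M τ y)) (Ioi 0) :=
    fun y hy => hexp.continuousOn.mul
      ((continuousOn_along_flow hM hMΩ hG.continuousOn hy).mono Ioi_subset_Ici_self)
  have hcontF : ContinuousOn (fun τ : ℝ => (fderiv ℂ G (M τ x)).comp (M τ)) (Ioi 0) := by
    have h1 : ContinuousOn (fun τ : ℝ => fderiv ℂ G (M τ x)) (Ioi 0) :=
      (continuousOn_fderiv_of_differentiableOn hΩ hG).comp
        (Continuous.continuousOn (by fun_prop)) fun τ hτ => hMΩ τ (le_of_lt hτ) x hx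
    exact h1.clm_comp hM.continuousOn
  have hnorm : ∀ τ : ℝ, ‖Complex.exp (-b * τ)‖ = Real.exp (-b.re * τ) := by
    intro τ; rw [Complex.norm_exp]; simp
  have := hasFDerivAt_integral_of_dominated_of_fderiv_le (𝕜 := ℂ) (μ := volume.restrict (Ioi 0))
    (F := fun y (τ : ℝ) => Complex.exp (-b * τ) * G (M τ y))
    (F' := fun y (τ : ℝ) => Complex.exp (-b * τ) • (fderiv ℂ G (M τ y)).comp (M τ)) (x₀ := x)
    (bound := fun τ : ℝ => Real.exp (-b.re * τ) * (2 * B / r)) (Metric.ball_mem_nhds x hr)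
    (by
      filter_upwards [Metric.ball_mem_nhds x hr] with y hy
      exact (hcontG y (hsub hy)).aestronglyMeasurable measurableSet_Ioi)
    (integrableOn_exp_neg_mul hb (continuousOn_along_flow hM hMΩ hG.continuousOn hx)
      fun τ hτ => hB _ (hMΩ τ hτ x hx))
    ((hexp.continuousOn.smul hcontF).aestronglyMeasurable measurableSet_Ioi)
    (by
      filter_upwards [ae_restrict_mem measurableSet_Ioi] with τ hτ y hy
      rw [norm_smul, hnorm]
      exact mul_le_mul_of_nonneg_left (hbd τ (le_of_lt hτ) y hy) (Real.exp_pos _).le)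
    ((exp_neg_integrableOn_Ioi 0 hb).mul_const _)
    (by
      filter_upwards [ae_restrict_mem measurableSet_Ioi] with τ hτ y hy
      exact (hder τ (le_of_lt hτ) y (hsub hy)).const_mul _)
  exact this.differentiableAt.differentiableWithinAt

/-- The flow integral `W` satisfies `DW · V = b W - G`, with `V` the generator of the flow. -/
theorem fderiv_flowIntegral (hb : 0 < b.re) (hΩ : IsOpen Ω) (hM : Continuous M)
    (hMΩ : ∀ τ, 0 ≤ τ → ∀ x ∈ Ω, M τ x ∈ Ω) (hG : DifferentiableOn ℂ G Ω)
    (hB : ∀ x ∈ Ω, ‖G x‖ ≤ B) (hM0 : M 0 = ContinuousLinearMap.id ℂ E)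
    (hadd : ∀ t τ, M (t + τ) = (M τ).comp (M t)) {A : E →L[ℂ] E} (hA : HasDerivAt M A 0)
    {x : E} (hx : x ∈ Ω) :
    fderiv ℂ (flowIntegral b M G) x (A x) = b * flowIntegral b M G x - G x := by
  have h1 := ((differentiableOn_flowIntegral hb hΩ hM hMΩ hG hB x hx).differentiableAt
    (hΩ.mem_nhds hx)).hasFDerivAt
  have hMx : HasDerivAt (fun t => M t x) (A x) 0 := by
    have := (ContinuousLinearMap.apply ℂ E x).restrictScalars ℝ |>.hasFDerivAt.comp_hasDerivAt
      (0 : ℝ) hA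
    exact this
  have h0 : M 0 x = x := by rw [hM0]; rfl
  have h2 : HasDerivAt (fun t => flowIntegral b M G (M t x))
      (fderiv ℂ (flowIntegral b M G) x (A x)) 0 := by
    have h1' : HasFDerivAt (flowIntegral b M G)
      ((fderiv ℂ (flowIntegral b M G) x).restrictScalars ℝ) (M 0 x) := by
      rw [h0]; exact h1.restrictScalars ℝ
    exact h1'.comp_hasDerivAt 0 hMx
  have h3 := hasDerivWithinAt_integral_shift hb
    (continuousOn_along_flow hM hMΩ hG.continuousOn hx) fun τ hτ => hB _ (hMΩ τ hτ x hx)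
  have h4 : (fun t => flowIntegral b M G (M t x)) =
      fun t => ∫ τ in Ioi (0 : ℝ), Complex.exp (-b * τ) * G (M (t + τ) x) := by
    ext t
    simp only [flowIntegral, hadd]
    rfl
  rw [← h4] at h3
  -- The chain rule gives a two-sided derivative along the orbit, the Laplace integral only a right
  -- derivative at 0; on [0, ∞) the two must coincide.
  have := (uniqueDiffWithinAt_Ici (0 : ℝ)).eq_deriv _ h2.hasDerivWithinAt h3
  rw [this, h0]
  rfl

end FlowIntegral

end

section

/-! ### Bounds that are uniform near a compact set. -/

section Uniform

theorem analyticAt_clm_apply {E F G : Type*} [NormedAddCommGroup E] [NormedSpace ℂ E]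
    [NormedAddCommGroup F] [NormedSpace ℂ F] [NormedAddCommGroup G] [NormedSpace ℂ G]
    [CompleteSpace G] {f : E → F →L[ℂ] G} {g : E → F} {x : E}
    (hf : AnalyticAt ℂ f x) (hg : AnalyticAt ℂ g x) : AnalyticAt ℂ (fun y => f y (g y)) x :=
  AnalyticAt.comp (f := fun y => (f y, g y))
    ((ContinuousLinearMap.id ℂ (F →L[ℂ] G)).analyticAt_bilinear (f x, g x)) (hf.prod hg)

variable {A V F : Type*} [NormedAddCommGroup A] [NormedSpace ℂ A] [ProperSpace A]
  [NormedAddCommGroup V] [NormedSpace ℂ V] [ProperSpace V]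
  [NormedAddCommGroup F] [NormedSpace ℂ F] [CompleteSpace F]

/-- An analytic map near a compact set `Z × closedBall 0 K` is bounded and Lipschitz in the second
variable, uniformly near the set. -/
theorem exists_uniform_bounds {G : A × V → F} {Z : Set A} (hZ : IsCompact Z) {K : ℝ}
    (hG : ∀ x ∈ Z, ∀ w, ‖w‖ ≤ K → AnalyticAt ℂ G (x, w)) :
    ∃ δ > 0, ∃ C ≥ 0, ∀ x, (∃ z ∈ Z, dist x z ≤ δ) → ∀ w, ‖w‖ ≤ K →
      AnalyticAt ℂ G (x, w) ∧ ‖G (x, w)‖ ≤ C ∧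
      ∀ w', ‖w'‖ ≤ K → ‖G (x, w) - G (x, w')‖ ≤ C * ‖w - w'‖ := by
  have hcomp : IsCompact (Z ×ˢ Metric.closedBall (0 : V) K) :=
    hZ.prod (isCompact_closedBall 0 K)
  -- The set of points of analyticity is open, so it contains a closed thickening of the compact
  -- set, and in a proper space this thickening is again compact.
  obtain ⟨δ, hδ, hsub⟩ := hcomp.exists_cthickening_subset_open (isOpen_analyticAt ℂ G)
    (by rintro ⟨x, w⟩ ⟨hx, hw⟩; exact hG x hx w (by simpa using hw))
  have hcT : IsCompact (Metric.cthickening δ (Z ×ˢ Metric.closedBall (0 : V) K)) :=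
    hcomp.cthickening
  obtain ⟨C₁, hC₁⟩ := hcT.exists_bound_of_continuousOn (f := G)
    fun p hp => (hsub hp).continuousAt.continuousWithinAt
  obtain ⟨C₂, hC₂⟩ := hcT.exists_bound_of_continuousOn (f := fderiv ℂ G)
    fun p hp => (hsub hp).fderiv.continuousAt.continuousWithinAt
  have hmem : ∀ x, (∃ z ∈ Z, dist x z ≤ δ) → ∀ w, ‖w‖ ≤ K →
      (x, w) ∈ Metric.cthickening δ (Z ×ˢ Metric.closedBall (0 : V) K) := by
    rintro x ⟨z, hz, hxz⟩ w hw
    refine Metric.mem_cthickening_of_dist_le (x, w) (z, w) _ _ ⟨hz, by simpa using hw⟩ ?_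
    rw [Prod.dist_eq, dist_self]; exact max_le hxz hδ.le
  refine ⟨δ, hδ, max (max C₁ C₂) 0, le_max_right _ _, fun x hx w hw =>
    ⟨hsub (hmem x hx w hw), (hC₁ _ (hmem x hx w hw)).trans
      ((le_max_left _ _).trans (le_max_left _ _)), fun w' hw' => ?_⟩⟩
  have hder : ∀ u ∈ Metric.closedBall (0 : V) K, HasFDerivWithinAt (fun u => G (x, u))
      ((fderiv ℂ G (x, u)).comp (ContinuousLinearMap.inr ℂ A V)) (Metric.closedBall 0 K) u := by
    intro u hu
    have h1 := (hsub (hmem x hx u (by simpa using hu))).differentiableAt.hasFDerivAt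
    exact (h1.comp u (hasFDerivAt_prodMk_right x u)).hasFDerivWithinAt
  have := (convex_closedBall (0 : V) K).norm_image_sub_le_of_norm_hasFDerivWithin_le (𝕜 := ℂ)
    hder (C := max (max C₁ C₂) 0) (fun u hu => by
      refine (ContinuousLinearMap.opNorm_comp_le _ _).trans ?_
      have h1 := hC₂ _ (hmem x hx u (by simpa using hu))
      have h2 : ‖ContinuousLinearMap.inr ℂ A V‖ ≤ 1 := ContinuousLinearMap.norm_inr_le_one ℂ A V
      calc _ ≤ ‖fderiv ℂ G (x, u)‖ * 1 := by gcongr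
        _ ≤ C₂ := by rwa [mul_one]
        _ ≤ _ := (le_max_right _ _).trans (le_max_left _ _))
    (x := w') (y := w) (by simpa using hw') (by simpa using hw)
  simpa using this

end Uniform

/-! ### The normal form of a saddle-center and the blow-up of its stable direction. -/

/-- A holomorphic vector field with a first integral in the normal form of a saddle-center, in
coordinates `(s, u, c, c*)` whose real points are those of the form `emb`. -/
structure SaddleCenterForm (Y : CPt → CPt) (En : CPt → ℂ) (ρ σ : ℝ) (a b : ℂ) : Prop where
  rho_pos : 0 < ρ
  b_ne : b ≠ 0
  analytic : AnalyticAt ℂ Y 0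
  zero : Y 0 = 0
  linear : ∀ v, fderiv ℂ Y 0 v =
    ![-ρ * v 0, ρ * v 1, Complex.I * σ * v 2, -(Complex.I * σ) * v 3]
  real : ∀ᶠ z in 𝓝 0, z ∈ Set.range emb → Y z ∈ Set.range emb
  en_analytic : AnalyticAt ℂ En 0
  en_quad : ∃ Q : CPt → CPt →L[ℂ] CPt →L[ℂ] ℂ, AnalyticAt ℂ Q 0 ∧
    (∀ᶠ z in 𝓝 0, En z = Q z z z) ∧ ∀ v, Q 0 v v = a * (v 0 * v 1) + b * (v 2 * v 3)
  en_invariant : ∀ᶠ z in 𝓝 0, fderiv ℂ En z (Y z) = 0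
  en_real : ∀ᶠ z in 𝓝 0, z ∈ Set.range emb → conj (En z) = En z

theorem mem_range_emb_iff {v : CPt} :
    v ∈ Set.range emb ↔ conj (v 0) = v 0 ∧ conj (v 1) = v 1 ∧ v 3 = conj (v 2) := by
  constructor
  · rintro ⟨z, rfl⟩
    simp [emb]
  · rintro ⟨h0, h1, h3⟩
    refine ⟨((v 0).re, (v 1).re, v 2), ?_⟩
    ext i
    fin_cases i
    · simpa [emb] using Complex.conj_eq_iff_re.1 h0
    · simpa [emb] using Complex.conj_eq_iff_re.1 h1
    · simp [emb]
    · simp [emb, h3]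

theorem add_mem_range_emb {v w : CPt} (hv : v ∈ Set.range emb) (hw : w ∈ Set.range emb) :
    v + w ∈ Set.range emb := by
  rw [mem_range_emb_iff] at *
  simp [hv.1, hv.2.1, hv.2.2, hw.1, hw.2.1, hw.2.2]

theorem real_smul_mem_range_emb {v : CPt} (t : ℝ) (hv : v ∈ Set.range emb) :
    (t : ℂ) • v ∈ Set.range emb := by
  rw [mem_range_emb_iff] at *
  simp [hv.1, hv.2.1, hv.2.2]

/-- The remainder of second order of a holomorphic map. -/
theorem exists_quadratic_remainder {F : Type*} [NormedAddCommGroup F] [NormedSpace ℂ F]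
    [CompleteSpace F] {f : CPt → F} (hf : AnalyticAt ℂ f 0) :
    ∃ B : CPt → CPt →L[ℂ] CPt →L[ℂ] F, AnalyticAt ℂ B 0 ∧
      ∀ᶠ z in 𝓝 0, f z = f 0 + fderiv ℂ f 0 z + B z z z := by
  obtain ⟨g, hg, hg0, hgz⟩ := exists_analytic_hadamard hf
  obtain ⟨B, hB, -, hBz⟩ := exists_analytic_hadamard hg
  refine ⟨B, hB, ?_⟩
  filter_upwards [hgz, hBz] with z h1 h2
  rw [h1, h2, hg0, add_assoc]
  rfl

/-- The point `(1, W)` of the blow-up of the stable direction. -/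
def blow (W : Fin 3 → ℂ) : CPt := ![1, W 0, W 1, W 2]

/-- Inclusion of the last three coordinates. -/
def fib (W : Fin 3 → ℂ) : CPt := ![0, W 0, W 1, W 2]

/-- The rates of the blown-up field. -/
def blowRate (ρ σ : ℝ) : Fin 3 → ℂ := ![2 * ρ, ρ + Complex.I * σ, ρ - Complex.I * σ]

/-- The real points of the fibre. -/
def realFibre : Set (Fin 3 → ℂ) := {W | conj (W 0) = W 0 ∧ W 2 = conj (W 1)}

theorem isClosed_realFibre : IsClosed realFibre := by
  refine IsClosed.inter (isClosed_eq ?_ ?_) (isClosed_eq ?_ ?_)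
  all_goals first
    | exact Complex.continuous_conj.comp (continuous_apply _)
    | exact continuous_apply _

theorem blow_mem_range_emb {W : Fin 3 → ℂ} (hW : W ∈ realFibre) : blow W ∈ Set.range emb := by
  rw [mem_range_emb_iff]
  exact ⟨by simp [blow], by simpa [blow] using hW.1, by simpa [blow] using hW.2⟩

theorem analyticAt_blow (W : Fin 3 → ℂ) : AnalyticAt ℂ blow W := by
  refine AnalyticAt.pi fun i => ?_
  fin_cases i
  · exact analyticAt_const
  · exact (ContinuousLinearMap.proj (R := ℂ) (φ := fun _ : Fin 3 => ℂ) 0).analyticAt W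
  · exact (ContinuousLinearMap.proj (R := ℂ) (φ := fun _ : Fin 3 => ℂ) 1).analyticAt W
  · exact (ContinuousLinearMap.proj (R := ℂ) (φ := fun _ : Fin 3 => ℂ) 2).analyticAt W

theorem blowRate_re {ρ σ : ℝ} (hρ : 0 < ρ) (j : Fin 3) : ρ ≤ (blowRate ρ σ j).re := by
  fin_cases j <;> simp [blowRate] ; linarith

/-- Used to see that the fixed point operators preserve reality: the rates 1 and 2 of `blowRate` are
conjugate to each other, as are the corresponding coordinates of a real fibre point. -/
theorem conj_flowIntegral {E : Type*} [NormedAddCommGroup E] [NormedSpace ℂ E] (b : ℂ)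
    (M : ℝ → E →L[ℂ] E) (G : E → ℂ) (x : E) :
    conj (flowIntegral b M G x) = flowIntegral (conj b) M (fun y => conj (G y)) x := by
  unfold flowIntegral
  rw [← integral_conj]
  congr 1
  ext τ
  simp [← Complex.exp_conj]

theorem flowIntegral_congr {E : Type*} [NormedAddCommGroup E] [NormedSpace ℂ E] {b : ℂ}
    {M : ℝ → E →L[ℂ] E} {G G' : E → ℂ} {x : E} (h : ∀ τ, 0 < τ → G (M τ x) = G' (M τ x)) :
    flowIntegral b M G x = flowIntegral b M G' x := by
  unfold flowIntegral
  refine MeasureTheory.setIntegral_congr_fun measurableSet_Ioi fun τ hτ => ?_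
  simp only [h τ hτ]

/-- Along the stable direction the blown-up system has an invariant holomorphic graph: after the
multiplication by `1 / ψ` the base moves by `s' = -ρ s` and the fibre by `N`. -/
theorem SaddleCenterForm.exists_stable_graph {Y : CPt → CPt} {En : CPt → ℂ} {ρ σ : ℝ} {a b : ℂ}
    (h : SaddleCenterForm Y En ρ σ a b) {K : ℝ} (hK : 0 < K) :
    ∃ (r : ℝ) (W : ℂ → Fin 3 → ℂ) (ψ : ℂ → (Fin 3 → ℂ) → ℂ) (N : ℂ → (Fin 3 → ℂ) → Fin 3 → ℂ),
      0 < r ∧ DifferentiableOn ℂ W (Metric.ball (0 : ℂ) r) ∧ W 0 = 0 ∧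
      (∀ s ∈ Metric.ball (0 : ℂ) r, ‖W s‖ ≤ K) ∧
      (∀ s : ℝ, (s : ℂ) ∈ Metric.ball (0 : ℂ) r → s ≠ 0 → W s ∈ realFibre) ∧
      (∀ s : ℝ, (s : ℂ) ∈ Metric.ball (0 : ℂ) r → s ≠ 0 → ∀ V ∈ realFibre, ‖V‖ ≤ K →
        conj (ψ s V) = ψ s V) ∧
      (∀ s ∈ Metric.ball (0 : ℂ) r, -(ρ * s) • deriv W s = N s (W s)) ∧
      (ContinuousOn (fun s => ψ s (W s)) (Metric.ball (0 : ℂ) r)) ∧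
      ∀ s ∈ Metric.ball (0 : ℂ) r, ∀ V, ‖V‖ ≤ K →
        Y (s • blow V) = ψ s V • (-(ρ * s) • blow V + s • fib (N s V)) ∧
        ‖ψ s V - 1‖ ≤ 1 / 2 ∧
        ∀ V', ‖V'‖ ≤ K → ∀ j,
          ‖N s V j - N s V' j - blowRate ρ σ j * (V j - V' j)‖ ≤ ρ / 4 * ‖V - V'‖ := by
  obtain ⟨B, hB, hYB⟩ := exists_quadratic_remainder h.analytic
  have hρ := h.rho_pos
  have hρc : (ρ : ℂ) ≠ 0 := by exact_mod_cast hρ.ne'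
  -- the nonlinear terms
  set β : ℂ × (Fin 3 → ℂ) → CPt := fun p => B (p.1 • blow p.2) (blow p.2) (blow p.2) with hβ
  -- The stable component of the field at s (1, V) is -ρ s ψ. Division by ψ makes the base motion
  -- exactly s' = -ρ s; the change of time is undone later. The fibre is a quotient by s, so its
  -- rates are the other eigenvalues increased by ρ, and all have real part at least ρ.
  set ψ : ℂ × (Fin 3 → ℂ) → ℂ := fun p => 1 - p.1 * β p 0 / ρ with hψ
  set g : ℂ × (Fin 3 → ℂ) → Fin 3 → ℂ := fun p j =>
    (blowRate ρ σ j * p.2 j * β p 0 / ρ + β p j.succ - p.2 j * β p 0) / ψ p with hg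
  have hβan : ∀ V, AnalyticAt ℂ β (0, V) := by
    intro V
    have h2 : AnalyticAt ℂ (fun p : ℂ × (Fin 3 → ℂ) => blow p.2) (0, V) :=
      AnalyticAt.comp (g := blow) (f := Prod.snd) (analyticAt_blow V) analyticAt_snd
    have h1 : AnalyticAt ℂ (fun p : ℂ × (Fin 3 → ℂ) => B (p.1 • blow p.2)) (0, V) := by
      have : AnalyticAt ℂ B ((0 : ℂ) • blow V) := by simpa using hB
      exact AnalyticAt.comp (g := B) (f := fun p : ℂ × (Fin 3 → ℂ) => p.1 • blow p.2) this
        (analyticAt_fst.smul h2)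
    exact analyticAt_clm_apply (analyticAt_clm_apply h1 h2) h2
  have hβi : ∀ V, ∀ i, AnalyticAt ℂ (fun p => β p i) (0, V) := fun V i =>
    analyticAt_pi_iff.1 (hβan V) i
  have hψan : ∀ V, AnalyticAt ℂ ψ (0, V) := fun V =>
    analyticAt_const.sub ((analyticAt_fst.mul (hβi V 0)).div analyticAt_const hρc)
  have hψ0 : ∀ V, ψ (0, V) = 1 := fun V => by simp [hψ]
  have hgan : ∀ V, AnalyticAt ℂ g (0, V) := by
    intro V
    refine AnalyticAt.pi fun j => ?_
    have hVj : AnalyticAt ℂ (fun p : ℂ × (Fin 3 → ℂ) => p.2 j) (0, V) :=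
      analyticAt_pi_iff.1 analyticAt_snd j
    refine AnalyticAt.div ?_ (hψan V) (by rw [hψ0]; exact one_ne_zero)
    exact ((((analyticAt_const.mul hVj).mul (hβi V 0)).div analyticAt_const hρc).add
      (hβi V j.succ)).sub (hVj.mul (hβi V 0))
  obtain ⟨δ₁, hδ₁, C₁, hC₁, hbd₁⟩ := exists_uniform_bounds (isCompact_singleton (x := (0 : ℂ)))
    (K := K) (G := β) (by rintro _ rfl V -; exact hβan V)
  obtain ⟨δ₂, hδ₂, C₂, hC₂, hbd₂⟩ := exists_uniform_bounds (isCompact_singleton (x := (0 : ℂ)))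
    (K := K) (G := g) (by rintro _ rfl V -; exact hgan V)
  obtain ⟨δ₃, hδ₃, hY⟩ := Metric.eventually_nhds_iff_ball.1 (hYB.and h.real)
  -- the radius
  obtain ⟨r, hr, hr1, hr2, hr3, hr4, hr5, hr6⟩ : ∃ r > 0, r ≤ δ₁ ∧ r ≤ δ₂ ∧ r * (1 + K) ≤ δ₃ ∧
      r * C₁ ≤ ρ / 2 ∧ r * C₂ ≤ ρ * K ∧ r * C₂ ≤ ρ / 4 := by
    have e : ∀ c d : ℝ, 0 < d → ∀ᶠ r in 𝓝[>] (0 : ℝ), r * c ≤ d := by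
      intro c d hd
      have : Tendsto (fun r : ℝ => r * c) (𝓝 0) (𝓝 (0 * c)) := tendsto_id.mul_const c
      rw [zero_mul] at this
      exact nhdsWithin_le_nhds ((this.eventually_lt_const hd).mono fun _ => le_of_lt)
    have h0 : ∀ᶠ r in 𝓝[>] (0 : ℝ), 0 < r := eventually_mem_nhdsWithin
    have := h0.and ((e 1 δ₁ hδ₁).and ((e 1 δ₂ hδ₂).and
      ((e (1 + K) δ₃ hδ₃).and ((e C₁ (ρ / 2) (by positivity)).and
      ((e C₂ (ρ * K) (by positivity)).and (e C₂ (ρ / 4) (by positivity)))))))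
    obtain ⟨r, h0, h1, h2, h3, h4, h5, h6⟩ := Eventually.exists this
    exact ⟨r, h0, by simpa using h1, by simpa using h2, h3, h4, h5, h6⟩
  set Ω : Set ℂ := Metric.ball 0 r with hΩ
  have hsr : ∀ s ∈ Ω, ‖s‖ < r := fun s hs => by simpa [hΩ] using hs
  have hs1 : ∀ s ∈ Ω, ∃ z ∈ ({0} : Set ℂ), dist s z ≤ δ₁ := fun s hs =>
    ⟨0, rfl, by rw [dist_zero_right]; exact (hsr s hs).le.trans hr1⟩
  have hs2 : ∀ s ∈ Ω, ∃ z ∈ ({0} : Set ℂ), dist s z ≤ δ₂ := fun s hs =>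
    ⟨0, rfl, by rw [dist_zero_right]; exact (hsr s hs).le.trans hr2⟩
  have hblow : ∀ V : Fin 3 → ℂ, ‖V‖ ≤ K → ‖blow V‖ ≤ 1 + K := by
    intro V hV
    rw [pi_norm_le_iff_of_nonneg (by positivity)]
    have hVi : ∀ i, ‖V i‖ ≤ K := fun i => (norm_le_pi_norm V i).trans hV
    intro i
    fin_cases i
    · simp [blow, hK.le]
    · simpa [blow] using (hVi 0).trans (by linarith)
    · simpa [blow] using (hVi 1).trans (by linarith)
    · simpa [blow] using (hVi 2).trans (by linarith)
  have hsV : ∀ s ∈ Ω, ∀ V : Fin 3 → ℂ, ‖V‖ ≤ K → s • blow V ∈ Metric.ball (0 : CPt) δ₃ := by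
    intro s hs V hV
    rw [mem_ball_zero_iff, norm_smul]
    calc ‖s‖ * ‖blow V‖ ≤ ‖s‖ * (1 + K) := by gcongr; exact hblow V hV
      _ < r * (1 + K) := by gcongr; exact hsr s hs
      _ ≤ δ₃ := hr3
  have hψ1 : ∀ s ∈ Ω, ∀ V : Fin 3 → ℂ, ‖V‖ ≤ K → ‖ψ (s, V) - 1‖ ≤ 1 / 2 := by
    intro s hs V hV
    have h1 : ‖β (s, V) 0‖ ≤ C₁ := (norm_le_pi_norm _ 0).trans (hbd₁ s (hs1 s hs) V hV).2.1
    simp only [hψ]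
    rw [sub_sub_cancel_left, norm_neg, norm_div, norm_mul, Complex.norm_real,
      Real.norm_of_nonneg hρ.le, div_le_iff₀ hρ]
    calc ‖s‖ * ‖β (s, V) 0‖ ≤ r * C₁ := by gcongr; exact (hsr s hs).le
      _ ≤ 1 / 2 * ρ := by linarith
  have hψne : ∀ s ∈ Ω, ∀ V : Fin 3 → ℂ, ‖V‖ ≤ K → ψ (s, V) ≠ 0 := by
    intro s hs V hV h0
    have := hψ1 s hs V hV
    rw [h0] at this
    norm_num at this
  have hYeq : ∀ s ∈ Ω, ∀ V : Fin 3 → ℂ, ‖V‖ ≤ K → Y (s • blow V) =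
      ψ (s, V) • (-(ρ * s) • blow V + s • fib (fun j => blowRate ρ σ j * V j + s * g (s, V) j)) := by
    intro s hs V hV
    have hne := hψne s hs V hV
    have h1 := (hY _ (hsV s hs V hV)).1
    have hsg : ∀ j, ψ (s, V) * g (s, V) j =
        blowRate ρ σ j * V j * β (s, V) 0 / ρ + β (s, V) j.succ - V j * β (s, V) 0 := by
      intro j
      simp only [hg]
      field_simp
    have hβs : B (s • blow V) (s • blow V) (s • blow V) = (s * s) • β (s, V) := by
      simp only [hβ, map_smul, smul_apply, smul_smul]
    have hψs : ψ (s, V) = 1 - s * β (s, V) 0 / ρ := rfl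
    rw [h1, h.zero, zero_add, h.linear, hβs]
    have e0 := hsg 0
    have e1 := hsg 1
    have e2 := hsg 2
    ext i
    fin_cases i
    · simp [blow, fib, hψs]
      field_simp
      ring
    · simp [blow, fib] at e0 ⊢
      have : ψ (s, V) * (-(ρ * s * V 0) + s * (blowRate ρ σ 0 * V 0 + s * g (s, V) 0)) =
        ψ (s, V) * (-(ρ * s * V 0) + s * (blowRate ρ σ 0 * V 0)) +
          s * s * (ψ (s, V) * g (s, V) 0) := by ring
      rw [this, e0, hψs]
      simp [blowRate]
      field_simp
      ring
    · simp [blow, fib] at e1 ⊢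
      have : ψ (s, V) * (-(ρ * s * V 1) + s * (blowRate ρ σ 1 * V 1 + s * g (s, V) 1)) =
        ψ (s, V) * (-(ρ * s * V 1) + s * (blowRate ρ σ 1 * V 1)) +
          s * s * (ψ (s, V) * g (s, V) 1) := by ring
      rw [this, e1, hψs]
      simp [blowRate]
      field_simp
      ring
    · simp [blow, fib] at e2 ⊢
      have : ψ (s, V) * (-(ρ * s * V 2) + s * (blowRate ρ σ 2 * V 2 + s * g (s, V) 2)) =
        ψ (s, V) * (-(ρ * s * V 2) + s * (blowRate ρ σ 2 * V 2)) +
          s * s * (ψ (s, V) * g (s, V) 2) := by ring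
      rw [this, e2, hψs]
      simp [blowRate]
      field_simp
      ring
  -- Reality of ψ and of g is read off from the reality of the field after division by s. For this
  -- reason the set of real base points below leaves out s = 0.
  have hreal : ∀ s : ℝ, (s : ℂ) ∈ Ω → s ≠ 0 → ∀ V : Fin 3 → ℂ, ‖V‖ ≤ K → V ∈ realFibre →
      conj (ψ (s, V)) = ψ (s, V) ∧ g (s, V) ∈ realFibre := by
    intro s hs hs0 V hV hVr
    have hsc : (s : ℂ) ≠ 0 := by exact_mod_cast hs0
    have h1 : Y ((s : ℂ) • blow V) ∈ Set.range emb := (hY _ (hsV s hs V hV)).2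
      (real_smul_mem_range_emb s (blow_mem_range_emb hVr))
    rw [hYeq s hs V hV, mem_range_emb_iff] at h1
    obtain ⟨h1, h2, h3⟩ := h1
    simp [blow, fib] at h1 h2 h3
    have hψr : conj (ψ (s, V)) = ψ (s, V) := by
      rcases h1 with h1 | h1 | h1
      · exact h1
      · exact absurd h1 hρ.ne'
      · exact absurd h1 hs0
    have hne := hψne s hs V hV
    refine ⟨hψr, ?_, ?_⟩
    · rw [hψr] at h2
      have h2' := mul_left_cancel₀ hne h2
      rw [hVr.1] at h2'
      have h4 := mul_left_cancel₀ hsc (add_left_cancel h2')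
      simp only [blowRate, Matrix.cons_val, map_mul, Complex.conj_ofReal, map_ofNat] at h4
      have h5 : (s : ℂ) * conj (g (s, V) 0) = s * g (s, V) 0 := by linear_combination h4
      exact mul_left_cancel₀ hsc h5
    · rw [hψr] at h3
      have h3' := mul_left_cancel₀ hne h3
      rw [hVr.2] at h3'
      have h4 := mul_left_cancel₀ hsc (add_left_cancel h3')
      simp only [blowRate, Matrix.cons_val, map_add, map_mul, Complex.conj_I, Complex.conj_ofReal] at h4
      have h5 : (s : ℂ) * g (s, V) 2 = s * conj (g (s, V) 1) := by linear_combination h4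
      exact mul_left_cancel₀ hsc h5
  -- the operator
  set M : ℝ → ℂ →L[ℂ] ℂ := fun τ => ((Real.exp (-(ρ * τ)) : ℝ) : ℂ) • ContinuousLinearMap.id ℂ ℂ
    with hM
  have hMapp : ∀ τ s, M τ s = ((Real.exp (-(ρ * τ)) : ℝ) : ℂ) * s := fun τ s => by simp [hM]
  have hMc : Continuous M := by
    simp only [hM]
    fun_prop
  have hMΩ : ∀ τ, 0 ≤ τ → ∀ s ∈ Ω, M τ s ∈ Ω := by
    intro τ hτ s hs
    have h1 := hsr s hs
    rw [hMapp, hΩ, mem_ball_zero_iff, norm_mul, Complex.norm_real, Real.norm_of_nonneg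
      (Real.exp_pos _).le]
    have : Real.exp (-(ρ * τ)) ≤ 1 := Real.exp_le_one_iff.2 (by
      have := mul_nonneg hρ.le hτ; linarith)
    calc Real.exp (-(ρ * τ)) * ‖s‖ ≤ 1 * ‖s‖ := by gcongr
      _ < r := by linarith
  set S : Set ℂ := {s | s ∈ Ω ∧ conj s = s ∧ s ≠ 0} with hS
  set G : (ℂ → Fin 3 → ℂ) → Fin 3 → ℂ → ℂ := fun W j s => s * g (s, W s) j with hG
  -- Invariance of the graph means -ρ s W' = b W + s g (s, W). Since Re b > 0, the bounded solution
  -- is minus the Laplace integral of s g along s ↦ e^{-ρτ} s.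
  set T : (ℂ → Fin 3 → ℂ) → ℂ → Fin 3 → ℂ := fun W s j =>
    -flowIntegral (blowRate ρ σ j) M (G W j) s with hT
  have hbre : ∀ j, 0 < (blowRate ρ σ j).re := fun j => hρ.trans_le (blowRate_re hρ j)
  have hGd : ∀ W ∈ holClass Ω K S realFibre, ∀ j, DifferentiableOn ℂ (G W j) Ω := by
    intro W hW j s hs
    have h1 := (hbd₂ s (hs2 s hs) (W s) (hW.2.1 s hs)).1.differentiableAt
    have hWd := (hW.1 s hs).differentiableAt (Metric.isOpen_ball.mem_nhds hs)
    have h2 : DifferentiableAt ℂ (fun s => g (s, W s)) s :=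
      DifferentiableAt.comp (g := g) (f := fun s => (s, W s)) s h1 (differentiableAt_id.prodMk hWd)
    exact (differentiableAt_id.mul (differentiableAt_pi.1 h2 j)).differentiableWithinAt
  have hGb : ∀ W ∈ holClass Ω K S realFibre, ∀ j, ∀ s ∈ Ω, ‖G W j s‖ ≤ r * C₂ := by
    intro W hW j s hs
    have h1 := (hbd₂ s (hs2 s hs) (W s) (hW.2.1 s hs)).2.1
    simp only [hG, norm_mul]
    have := (norm_le_pi_norm (g (s, W s)) j).trans h1
    gcongr
    exact (hsr s hs).le
  have hGl : ∀ W ∈ holClass Ω K S realFibre, ∀ W' ∈ holClass Ω K S realFibre, ∀ D : ℝ,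
      (∀ x ∈ Ω, ‖W x - W' x‖ ≤ D) → ∀ j, ∀ s ∈ Ω, ‖G W j s - G W' j s‖ ≤ r * C₂ * D := by
    intro W hW W' hW' D hD j s hs
    have h1 := (hbd₂ s (hs2 s hs) (W s) (hW.2.1 s hs)).2.2 (W' s) (hW'.2.1 s hs)
    have h2 := (norm_le_pi_norm (g (s, W s) - g (s, W' s)) j).trans h1
    simp only [hG]
    rw [← mul_sub, norm_mul]
    have h3 := hD s hs
    calc ‖s‖ * ‖g (s, W s) j - g (s, W' s) j‖ ≤ r * (C₂ * D) := by
          refine mul_le_mul (hsr s hs).le (h2.trans ?_) (norm_nonneg _) hr.le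
          gcongr
      _ = r * C₂ * D := by ring
  -- The integrals divide by Re b ≥ ρ. Hence r C₂ ≤ ρ K keeps the ball of radius K invariant, and r
  -- C₂ ≤ ρ / 4 more than suffices for the contraction factor 1 / 2.
  obtain ⟨W, hW, hWfix⟩ := exists_holomorphic_fixedPoint (Ω := Ω) Metric.isOpen_ball hK.le
    (S := S) (fun s hs => hs.1) isClosed_realFibre (by simp [realFibre]) T
    (by
      intro W hW
      refine ⟨?_, ?_, ?_⟩
      · refine differentiableOn_pi.2 fun j => ?_
        exact (differentiableOn_flowIntegral (hbre j) Metric.isOpen_ball hMc hMΩ (hGd W hW j)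
          (hGb W hW j)).neg
      · intro s hs
        rw [pi_norm_le_iff_of_nonneg hK.le]
        intro j
        simp only [hT, norm_neg]
        refine (norm_flowIntegral_le (hbre j) hMΩ (hGb W hW j) hs).trans ?_
        rw [div_le_iff₀ (hbre j)]
        calc r * C₂ ≤ ρ * K := hr5
          _ ≤ K * (blowRate ρ σ j).re := by
            rw [mul_comm]; gcongr; exact blowRate_re hρ j
      · rintro s ⟨hs, hsr', hs0⟩
        have hMr : ∀ τ : ℝ, 0 < τ → g (M τ s, W (M τ s)) ∈ realFibre ∧ conj (M τ s) = M τ s := by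
          intro τ hτ
          obtain ⟨x, rfl⟩ := Complex.conj_eq_iff_real.1 hsr'
          have hx : M τ x = ((Real.exp (-(ρ * τ)) * x : ℝ) : ℂ) := by rw [hMapp]; push_cast; ring
          have hx0 : Real.exp (-(ρ * τ)) * x ≠ 0 :=
            mul_ne_zero (Real.exp_pos _).ne' (by exact_mod_cast hs0)
          have hxΩ := hMΩ τ hτ.le x hs
          have hxS : M τ x ∈ S := ⟨hxΩ, by rw [hx, Complex.conj_ofReal], by
            rw [hx]; exact_mod_cast hx0⟩
          have h1 := hW.2.2 _ hxS
          rw [hx] at hxΩ h1 ⊢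
          exact ⟨(hreal _ hxΩ hx0 _ (hW.2.1 _ hxΩ) h1).2, Complex.conj_ofReal _⟩
        constructor
        · simp only [hT, map_neg, conj_flowIntegral]
          congr 1
          have hb0 : conj (blowRate ρ σ 0) = blowRate ρ σ 0 := by
            simp [blowRate]
            exact Or.inl (map_ofNat _ 2)
          rw [hb0]
          refine flowIntegral_congr fun τ hτ => ?_
          simp only [hG, map_mul]
          rw [(hMr τ hτ).2, (hMr τ hτ).1.1]
        · simp only [hT, map_neg, conj_flowIntegral]
          congr 1
          have hb1 : conj (blowRate ρ σ 1) = blowRate ρ σ 2 := by simp [blowRate]; ring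
          rw [hb1]
          refine flowIntegral_congr fun τ hτ => ?_
          simp only [hG, map_mul]
          rw [(hMr τ hτ).2, (hMr τ hτ).1.2])
    (by
      intro W hW W' hW' D hD s hs
      have hD0 : 0 ≤ D := (norm_nonneg _).trans (hD s hs)
      rw [pi_norm_le_iff_of_nonneg (by positivity)]
      intro j
      simp only [hT, Pi.sub_apply]
      rw [neg_sub_neg, norm_sub_rev]
      refine (norm_flowIntegral_sub_le (hbre j) hMc hMΩ (hGd W hW j).continuousOn
        (hGd W' hW' j).continuousOn (hGb W hW j) (hGb W' hW' j)
        (hGl W hW W' hW' D hD j) hs).trans ?_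
      rw [div_le_iff₀ (hbre j)]
      have := blowRate_re (σ := σ) hρ j
      calc r * C₂ * D ≤ ρ / 4 * D := by gcongr
        _ ≤ D / 2 * ρ := by nlinarith
        _ ≤ _ := by gcongr)
  refine ⟨r, W, fun s V => ψ (s, V), fun s V j => blowRate ρ σ j * V j + s * g (s, V) j, hr, hW.1,
    ?_, hW.2.1, ?_, fun s hs hs0 V hV hVK => (hreal s hs hs0 V hVK hV).1, ?_, ?_, ?_⟩
  · rw [← hWfix 0 (Metric.mem_ball_self hr)]
    ext j
    simp [hT, flowIntegral, hG, hM]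
  · intro s hs hs0
    exact hW.2.2 _ ⟨hs, Complex.conj_ofReal s, by exact_mod_cast hs0⟩
  · intro s hs
    have hWd := (hW.1 s hs).differentiableAt (Metric.isOpen_ball.mem_nhds hs)
    ext j
    have hM' : HasDerivAt M (-(ρ : ℂ) • ContinuousLinearMap.id ℂ ℂ) 0 := by
      have h1 : HasDerivAt (fun τ : ℝ => ((Real.exp (-(ρ * τ)) : ℝ) : ℂ)) (-(ρ : ℂ)) 0 := by
        have h2 : HasDerivAt (fun τ : ℝ => Real.exp (-(ρ * τ))) (-ρ) 0 := by
          have := ((hasDerivAt_id (0 : ℝ)).const_mul ρ).neg.exp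
          simpa using this
        simpa using h2.ofReal_comp
      have h2 := h1.smul_const (ContinuousLinearMap.id ℂ ℂ)
      exact h2
    have h1 := fderiv_flowIntegral (hbre j) Metric.isOpen_ball hMc hMΩ (hGd W hW j) (hGb W hW j)
      (by ext; simp [hM]) (by
        intro t τ
        ext
        simp only [hM]
        simp [mul_add, Real.exp_add]
        ring) hM' hs
    have h2 : HasDerivAt (fun s => W s j) (deriv W s j) s := hasDerivAt_pi.1 hWd.hasDerivAt j
    have h3 : HasDerivAt (fun s => -flowIntegral (blowRate ρ σ j) M (G W j) s) (deriv W s j) s := by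
      refine h2.congr_of_eventuallyEq ?_
      filter_upwards [Metric.isOpen_ball.mem_nhds hs] with s' hs'
      rw [← hWfix s' hs']
    have h4 : fderiv ℂ (flowIntegral (blowRate ρ σ j) M (G W j)) s (-(ρ * s)) =
        ρ * s * deriv W s j := by
      have := h3.fun_neg
      simp only [neg_neg] at this
      rw [this.hasFDerivAt.fderiv]
      simp
    have h5 : -flowIntegral (blowRate ρ σ j) M (G W j) s = W s j := by rw [← hWfix s hs]
    simp only [smul_apply, ContinuousLinearMap.id_apply, smul_eq_mul,
      neg_mul] at h1
    rw [h4] at h1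
    simp only [Pi.smul_apply, smul_eq_mul]
    rw [← h5] 
    simp only [hG] at h1 ⊢
    linear_combination -h1
  · intro s hs
    have h1 := (hbd₁ s (hs1 s hs) (W s) (hW.2.1 s hs)).1.continuousAt
    have hWc := ((hW.1 s hs).differentiableAt (Metric.isOpen_ball.mem_nhds hs)).continuousAt
    have h2 : ContinuousAt (fun s => β (s, W s)) s :=
      ContinuousAt.comp (f := fun s => (s, W s)) h1 (continuousAt_id.prodMk hWc)
    have h3 : ContinuousAt (fun s => 1 - s * β (s, W s) 0 / ρ) s :=
      continuousAt_const.sub ((continuousAt_id.mul (continuousAt_pi.1 h2 0)).div_const _)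
    exact h3.continuousWithinAt
  · intro s hs V hV
    refine ⟨hYeq s hs V hV, hψ1 s hs V hV, fun V' hV' j => ?_⟩
    have h1 := (hbd₂ s (hs2 s hs) V hV).2.2 V' hV'
    have h2 := (norm_le_pi_norm (g (s, V) - g (s, V')) j).trans h1
    have : blowRate ρ σ j * V j + s * g (s, V) j - (blowRate ρ σ j * V' j + s * g (s, V') j) -
        blowRate ρ σ j * (V j - V' j) = s * (g (s, V) j - g (s, V') j) := by ring
    simp only [this, norm_mul]
    calc ‖s‖ * ‖g (s, V) j - g (s, V') j‖ ≤ r * (C₂ * ‖V - V'‖) := by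
          refine mul_le_mul (hsr s hs).le h2 (norm_nonneg _) hr.le
      _ = r * C₂ * ‖V - V'‖ := by ring
      _ ≤ ρ / 4 * ‖V - V'‖ := by gcongr

end

/-! ### Orbits asymptotic to the equilibrium. -/

section

section TimeChange

/-- Solutions of the autonomous scalar equation `τ' = p(τ)` with `p` pinched between positive
constants. -/
theorem exists_time_change {p : ℝ → ℝ} (hp : Continuous p) (h1 : ∀ x, 1 / 2 ≤ p x)
    (h2 : ∀ x, p x ≤ 3 / 2) :
    ∃ τ : ℝ → ℝ, τ 0 = 0 ∧ (∀ t, HasDerivAt τ (p (τ t)) t) ∧ Monotone τ ∧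
      Tendsto τ atTop atTop := by
  have hpos : ∀ x, 0 < p x := fun x => lt_of_lt_of_le (by norm_num) (h1 x)
  have hinv : Continuous fun x => (p x)⁻¹ := hp.inv₀ fun x => (hpos x).ne'
  -- The solution is the inverse function of T x = ∫ dy / p y. As p ≤ 3 / 2, the function T x - 2 x
  -- / 3 is monotone, so T is onto ℝ.
  set T : ℝ → ℝ := fun x => ∫ y in (0 : ℝ)..x, (p y)⁻¹ with hT
  have hder : ∀ x, HasDerivAt T (p x)⁻¹ x := fun x =>
    intervalIntegral.integral_hasDerivAt_right (hinv.intervalIntegrable _ _)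
      (hinv.stronglyMeasurableAtFilter _ _) hinv.continuousAt
  have hmono : StrictMono T := strictMono_of_deriv_pos fun x => by
    rw [(hder x).deriv]; exact inv_pos.2 (hpos x)
  have hcont : Continuous T := continuous_iff_continuousAt.2 fun x => (hder x).continuousAt
  have hgrow : Monotone fun x => T x - 2 / 3 * x := by
    have hd : ∀ x, HasDerivAt (fun x => T x - 2 / 3 * x) ((p x)⁻¹ - 2 / 3 * 1) x := fun x =>
      (hder x).sub ((hasDerivAt_id x).const_mul (2 / 3))
    refine monotone_of_deriv_nonneg (fun x => (hd x).differentiableAt) fun x => ?_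
    · rw [(hd x).deriv]
      have : (3 / 2 : ℝ)⁻¹ ≤ (p x)⁻¹ := inv_anti₀ (hpos x) (h2 x)
      norm_num at this ⊢
      linarith
  have hT0 : T 0 = 0 := by simp [hT]
  have htop : Tendsto T atTop atTop := by
    refine tendsto_atTop_mono' _ ?_ (tendsto_id.const_mul_atTop (show (0 : ℝ) < 2 / 3 by norm_num))
    filter_upwards [eventually_ge_atTop 0] with x hx
    have := hgrow hx
    simp only [hT0] at this
    simp only [id]
    linarith
  have hbot : Tendsto T atBot atBot := by
    refine tendsto_atBot_mono' _ ?_ (tendsto_id.const_mul_atBot (show (0 : ℝ) < 2 / 3 by norm_num))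
    filter_upwards [eventually_le_atBot 0] with x hx
    have := hgrow hx
    simp only [hT0] at this
    simp only [id]
    linarith
  set e := hmono.orderIsoOfSurjective T (hcont.surjective htop hbot) with he
  have heT : ∀ x, e x = T x := fun x => rfl
  have hTe : ∀ t, T (e.symm t) = t := fun t => e.apply_symm_apply t
  refine ⟨e.symm, ?_, fun t => ?_, e.symm.monotone, e.symm.tendsto_atTop⟩
  · rw [OrderIso.symm_apply_eq, heT, hT0]
  · have h := HasDerivAt.of_local_left_inverse (f := T) (g := e.symm) (a := t)
      e.symm.continuous.continuousAt (hder _) (inv_ne_zero (hpos _).ne')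
      (Eventually.of_forall hTe)
    rwa [inv_inv] at h

theorem le_of_hasDerivAt_nonneg {f f' : ℝ → ℝ} {T : ℝ} (hf : ∀ t, T ≤ t → HasDerivAt f (f' t) t)
    (h0 : ∀ t, T ≤ t → 0 ≤ f' t) {x y : ℝ} (hx : T ≤ x) (hxy : x ≤ y) : f x ≤ f y := by
  have : MonotoneOn f (Set.Ici T) := by
    refine monotoneOn_of_deriv_nonneg (convex_Ici T)
      (fun t ht => (hf t ht).continuousAt.continuousWithinAt)
      (fun t ht => (hf t (interior_subset ht)).differentiableAt.differentiableWithinAt)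
      fun t ht => ?_
    rw [(hf t (interior_subset ht)).deriv]
    exact h0 t (interior_subset ht)
  exact this hx (hx.trans hxy) hxy

end TimeChange

variable {Y : CPt → CPt} {En : CPt → ℂ} {ρ σ : ℝ} {a b : ℂ}

theorem norm_sq_le_of_real {z : CPt} (hz : z ∈ Set.range emb) {q : ℝ}
    (h0 : ‖z 0‖ ^ 2 ≤ q) (h1 : ‖z 1‖ ^ 2 ≤ q) (h2 : ‖z 2‖ ^ 2 ≤ q) : ‖z‖ ^ 2 ≤ q := by
  have hq : 0 ≤ q := (sq_nonneg _).trans h0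
  have h3 : ‖z 3‖ = ‖z 2‖ := by rw [(mem_range_emb_iff.1 hz).2.2, RCLike.norm_conj]
  have : ‖z‖ ≤ √q := by
    rw [pi_norm_le_iff_of_nonneg (Real.sqrt_nonneg _)]
    intro i
    refine Real.le_sqrt_of_sq_le ?_
    fin_cases i
    · exact h0
    · exact h1
    · exact h2
    · show ‖z 3‖ ^ 2 ≤ q
      rw [h3]; exact h2
  calc ‖z‖ ^ 2 ≤ √q ^ 2 := by gcongr
    _ = q := Real.sq_sqrt hq

/-- On the zero level of the first integral the norm is controlled by the hyperbolic part. -/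
theorem SaddleCenterForm.norm_sq_le (h : SaddleCenterForm Y En ρ σ a b) :
    ∃ K ≥ 1, ∀ᶠ z in 𝓝 (0 : CPt), z ∈ Set.range emb → En z = 0 →
      ‖z‖ ^ 2 ≤ K * (‖z 0‖ ^ 2 + ‖z 1‖ ^ 2) ∧ ‖z 2‖ ^ 2 ≤ K * (‖z 0‖ ^ 2 + ‖z 1‖ ^ 2) := by
  obtain ⟨Q, hQ, hEn, hQ0⟩ := h.en_quad
  have hb : 0 < ‖b‖ := norm_pos_iff.2 h.b_ne
  refine ⟨‖a‖ / ‖b‖ + 1, by have : 0 ≤ ‖a‖ / ‖b‖ := by positivity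
                            linarith, ?_⟩
  -- At real points z 2 z 3 = |z 2|². The energy level zero then bounds |b| |z 2|² by |a| |z 0 z 1|
  -- plus an error of at most |b| ‖z‖² / 2, and half of the left side absorbs the part of the error
  -- that contains |z 2|².
  have hclose : ∀ᶠ z in 𝓝 (0 : CPt), ‖Q z - Q 0‖ < ‖b‖ / 2 := by
    have := hQ.continuousAt.tendsto
    rw [tendsto_iff_norm_sub_tendsto_zero] at this
    exact this.eventually_lt_const (by positivity)
  filter_upwards [hEn, hclose] with z h1 h2 hz hz0
  have h3 := (mem_range_emb_iff.1 hz).2.2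
  have h4 : ‖Q z z z - Q 0 z z‖ ≤ ‖b‖ / 2 * ‖z‖ ^ 2 := by
    have : Q z z z - Q 0 z z = (Q z - Q 0) z z := rfl
    rw [this]
    calc ‖(Q z - Q 0) z z‖ ≤ ‖Q z - Q 0‖ * ‖z‖ * ‖z‖ := (Q z - Q 0).le_opNorm₂ z z
      _ ≤ ‖b‖ / 2 * ‖z‖ * ‖z‖ := by gcongr
      _ = _ := by ring
  rw [← h1, hz0, hQ0, zero_sub, norm_neg] at h4
  set x := ‖z 0‖
  set y := ‖z 1‖
  set c := ‖z 2‖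
  have hx : 0 ≤ x := norm_nonneg _
  have hy : 0 ≤ y := norm_nonneg _
  have h5 : ‖b‖ * c ^ 2 ≤ ‖a‖ * (x * y) + ‖b‖ / 2 * ‖z‖ ^ 2 := by
    have e1 : ‖b * (z 2 * z 3)‖ = ‖b‖ * c ^ 2 := by
      rw [h3, norm_mul, norm_mul, RCLike.norm_conj]; ring
    have e2 : ‖a * (z 0 * z 1)‖ = ‖a‖ * (x * y) := by rw [norm_mul, norm_mul]
    have := norm_sub_le (a * (z 0 * z 1) + b * (z 2 * z 3)) (a * (z 0 * z 1))
    rw [add_sub_cancel_left, e1, e2] at this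
    linarith
  have h6 : ‖z‖ ^ 2 ≤ x ^ 2 + y ^ 2 + c ^ 2 := by
    apply norm_sq_le_of_real hz <;> nlinarith [sq_nonneg x, sq_nonneg y, sq_nonneg c]
  have h7 : c ^ 2 ≤ (‖a‖ / ‖b‖ + 1) * (x ^ 2 + y ^ 2) := by
    have : (‖a‖ / ‖b‖ + 1) * (x ^ 2 + y ^ 2) = (‖a‖ + ‖b‖) * (x ^ 2 + y ^ 2) / ‖b‖ := by field_simp
    rw [this, le_div_iff₀ hb]
    nlinarith [mul_nonneg (norm_nonneg a) (sq_nonneg (x - y)), norm_nonneg a]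
  refine ⟨?_, h7⟩
  have hK : 1 ≤ ‖a‖ / ‖b‖ + 1 := by have : 0 ≤ ‖a‖ / ‖b‖ := by positivity
                                    linarith
  refine norm_sq_le_of_real hz ?_ ?_ h7
  · nlinarith [sq_nonneg x, sq_nonneg y]
  · nlinarith [sq_nonneg x, sq_nonneg y]

/-- A real orbit that tends to the saddle-center is controlled by its stable coordinate. -/
theorem SaddleCenterForm.orbit_le_stable (h : SaddleCenterForm Y En ρ σ a b) :
    ∃ K > 0, ∀ z : ℝ → CPt, (∀ t, 0 < t → z t ∈ Set.range emb ∧ HasDerivAt z (Y (z t)) t) →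
      Tendsto z atTop (𝓝 0) → ∀ᶠ t in atTop, ∀ i, ‖z t i‖ ≤ K * ‖z t 0‖ := by
  obtain ⟨K, hK, hKz⟩ := h.norm_sq_le
  refine ⟨2 * K, by positivity, fun z hz hlim => ?_⟩
  have hρ := h.rho_pos
  -- With n = ‖z‖ and n² ≤ K (x² + y²) one has (|x| + |y|) n ≤ (K + 2) / 2 · (x² + y²). For this ε
  -- the nonlinear terms in the derivative of y² - x² are at most half of the leading part 2ρ (x² +
  -- y²).
  set ε : ℝ := ρ / (K + 2) with hε
  have hεpos : 0 < ε := by positivity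
  have hlin : ∀ᶠ w in 𝓝 (0 : CPt), ‖Y w - fderiv ℂ Y 0 w‖ ≤ ε * ‖w‖ := by
    have := (h.analytic.differentiableAt.hasFDerivAt.isLittleO).def hεpos
    simpa [h.zero] using this
  obtain ⟨T, hT0, hT⟩ : ∃ T > 0, ∀ t, T ≤ t → (z t ∈ Set.range emb → En (z t) = 0 →
      ‖z t‖ ^ 2 ≤ K * (‖z t 0‖ ^ 2 + ‖z t 1‖ ^ 2) ∧
      ‖z t 2‖ ^ 2 ≤ K * (‖z t 0‖ ^ 2 + ‖z t 1‖ ^ 2)) ∧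
      ‖Y (z t) - fderiv ℂ Y 0 (z t)‖ ≤ ε * ‖z t‖ ∧ AnalyticAt ℂ En (z t) ∧
      fderiv ℂ En (z t) (Y (z t)) = 0 := by
    have := hlim.eventually (hKz.and (hlin.and (h.en_analytic.eventually_analyticAt.and
      h.en_invariant)))
    obtain ⟨T, hT⟩ := eventually_atTop.1 this
    exact ⟨max T 1, by positivity, fun t ht => hT t ((le_max_left _ _).trans ht)⟩
  have hpos : ∀ t, T ≤ t → 0 < t := fun t ht => hT0.trans_le ht
  -- The first integral is constant along the orbit, and its limit is its value 0 at the
  -- equilibrium.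
  have hEn0 : ∀ t, T ≤ t → En (z t) = 0 := by
    have hder : ∀ t, T ≤ t → HasDerivAt (fun t => En (z t)) 0 t := by
      intro t ht
      have h1 := ((hT t ht).2.2.1.differentiableAt.hasFDerivAt.restrictScalars ℝ).comp_hasDerivAt t
        (hz t (hpos t ht)).2
      refine h1.congr_deriv ?_
      exact (hT t ht).2.2.2
    have hconst : ∀ t, T ≤ t → En (z t) = En (z T) := by
      intro t ht
      exact constant_of_has_deriv_right_zero (f := fun t => En (z t)) (a := T) (b := t)
        (fun x hx => (hder x hx.1).continuousAt.continuousWithinAt)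
        (fun x hx => (hder x hx.1).hasDerivWithinAt) t ⟨ht, le_rfl⟩
    have hl : Tendsto (fun t => En (z t)) atTop (𝓝 (En 0)) :=
      h.en_analytic.continuousAt.tendsto.comp hlim
    have hl' : Tendsto (fun t => En (z t)) atTop (𝓝 (En (z T))) := by
      refine tendsto_const_nhds.congr' ?_
      filter_upwards [eventually_ge_atTop T] with t ht using (hconst t ht).symm
    have h00 : En 0 = 0 := by
      obtain ⟨Q, -, hEn, -⟩ := h.en_quad
      rw [hEn.self_of_nhds]; simp
    intro t ht
    rw [hconst t ht, tendsto_nhds_unique hl' hl, h00]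
  have hest : ∀ t, T ≤ t → ‖z t‖ ^ 2 ≤ K * (‖z t 0‖ ^ 2 + ‖z t 1‖ ^ 2) ∧
      ‖z t 2‖ ^ 2 ≤ K * (‖z t 0‖ ^ 2 + ‖z t 1‖ ^ 2) := fun t ht =>
    (hT t ht).1 (hz t (hpos t ht)).1 (hEn0 t ht)
  set x : ℝ → ℝ := fun t => (z t 0).re with hx
  set y : ℝ → ℝ := fun t => (z t 1).re with hy
  have hzx : ∀ t, T ≤ t → z t 0 = x t := fun t ht =>
    (Complex.conj_eq_iff_re.1 (mem_range_emb_iff.1 (hz t (hpos t ht)).1).1).symm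
  have hzy : ∀ t, T ≤ t → z t 1 = y t := fun t ht =>
    (Complex.conj_eq_iff_re.1 (mem_range_emb_iff.1 (hz t (hpos t ht)).1).2.1).symm
  have hdi : ∀ t, T ≤ t → ∀ i, HasDerivAt (fun t => (z t i).re) (Y (z t) i).re t := by
    intro t ht i
    have h1 := hasDerivAt_pi.1 (hz t (hpos t ht)).2 i
    exact (Complex.reCLM.hasFDerivAt.comp_hasDerivAt t h1 :)
  have hD : ∀ t, T ≤ t → HasDerivAt (fun t => y t ^ 2 - x t ^ 2)
      (2 * y t * (Y (z t) 1).re - 2 * x t * (Y (z t) 0).re) t := by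
    intro t ht
    refine (((hdi t ht 1).pow 2).sub ((hdi t ht 0).pow 2)).congr_deriv ?_
    simp [hx, hy]
  have hDpos : ∀ t, T ≤ t → 0 ≤ 2 * y t * (Y (z t) 1).re - 2 * x t * (Y (z t) 0).re := by
    intro t ht
    have hq := (hest t ht).1
    rw [hzx t ht, hzy t ht, Complex.norm_real, Complex.norm_real, Real.norm_eq_abs,
      Real.norm_eq_abs, sq_abs, sq_abs] at hq
    have he := (hT t ht).2.1
    have he0 := (Complex.abs_re_le_norm _).trans ((norm_le_pi_norm _ 0).trans he)
    have he1 := (Complex.abs_re_le_norm _).trans ((norm_le_pi_norm _ 1).trans he)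
    rw [Pi.sub_apply, h.linear] at he0 he1
    simp only [Matrix.cons_val_zero, Matrix.cons_val_one, Complex.sub_re] at he0 he1
    rw [hzx t ht] at he0
    rw [hzy t ht] at he1
    have r0 : (-(ρ : ℂ) * (x t : ℂ)).re = -ρ * x t := by simp
    have r1 : ((ρ : ℂ) * (y t : ℂ)).re = ρ * y t := by simp
    rw [r0] at he0
    rw [r1] at he1
    set e0 := (Y (z t) 0).re - -ρ * x t with hhe0
    set e1 := (Y (z t) 1).re - ρ * y t with hhe1
    have g0 : (Y (z t) 0).re = -ρ * x t + e0 := by rw [hhe0]; ring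
    have g1 : (Y (z t) 1).re = ρ * y t + e1 := by rw [hhe1]; ring
    rw [g0, g1]
    set n := ‖z t‖ with hn
    have hn0 : 0 ≤ n := norm_nonneg _
    have hεK : ε * (K + 2) = ρ := by rw [hε]; field_simp
    have k1 : |y t * e1| ≤ |y t| * (ε * n) := by rw [abs_mul]; gcongr
    have k0 : |x t * e0| ≤ |x t| * (ε * n) := by rw [abs_mul]; gcongr
    have k2 : |y t| * n + |x t| * n ≤ (K + 2) / 2 * (x t ^ 2 + y t ^ 2) := by
      nlinarith [sq_nonneg (|x t| - n / 2), sq_nonneg (|y t| - n / 2), sq_abs (x t), sq_abs (y t),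
        sq_nonneg (|x t| + |y t| - n), sq_nonneg (|x t| - |y t|)]
    have k3 := neg_abs_le (y t * e1)
    have k4 := le_abs_self (x t * e0)
    have k5 : ε * (|y t| * n + |x t| * n) ≤ ρ / 2 * (x t ^ 2 + y t ^ 2) := by
      calc ε * (|y t| * n + |x t| * n) ≤ ε * ((K + 2) / 2 * (x t ^ 2 + y t ^ 2)) := by gcongr
        _ = (ε * (K + 2)) / 2 * (x t ^ 2 + y t ^ 2) := by ring
        _ = _ := by rw [hεK]
    nlinarith [mul_nonneg hρ.le (add_nonneg (sq_nonneg (x t)) (sq_nonneg (y t)))]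
  -- The function y² - x² is nondecreasing and tends to zero, so it is nowhere positive: the orbit
  -- cannot lie in the unstable cone.
  have hDle : ∀ t, T ≤ t → y t ^ 2 ≤ x t ^ 2 := by
    intro t ht
    have hlim0 : ∀ i, Tendsto (fun t => (z t i).re) atTop (𝓝 0) := fun i => by
      have : Continuous fun w : CPt => (w i).re := by fun_prop
      simpa [Function.comp_def] using (this.tendsto 0).comp hlim
    have hl : Tendsto (fun t => y t ^ 2 - x t ^ 2) atTop (𝓝 0) := by
      simpa using ((hlim0 1).pow 2).sub ((hlim0 0).pow 2)
    have := ge_of_tendsto hl (by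
      filter_upwards [eventually_ge_atTop t] with t' ht'
      exact le_of_hasDerivAt_nonneg hD hDpos ht ht')
    linarith
  filter_upwards [eventually_ge_atTop T] with t ht i
  have h1 := (hest t ht).1
  have h2 := hDle t ht
  rw [hzx t ht, hzy t ht, Complex.norm_real, Complex.norm_real, Real.norm_eq_abs,
    Real.norm_eq_abs, sq_abs, sq_abs] at h1
  rw [hzx t ht, Complex.norm_real, Real.norm_eq_abs]
  have h3 : ‖z t‖ ^ 2 ≤ (2 * K * |x t|) ^ 2 := by
    rw [mul_pow, sq_abs]
    nlinarith [sq_nonneg (x t), mul_nonneg (sub_nonneg.2 hK) (sq_nonneg (x t))]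
  exact (norm_le_pi_norm _ i).trans (abs_le_of_sq_le_sq' h3 (by positivity)).2

end

/-! ### The stable curve. -/

section

variable {Y : CPt → CPt} {En : CPt → ℂ} {ρ σ : ℝ} {a b : ℂ}

theorem euclidean_one_norm (x : EuclideanSpace ℝ (Fin 1)) : ‖x‖ = |x 0| := by
  rw [EuclideanSpace.norm_eq]
  simp [Real.sqrt_sq_eq_abs]

theorem hasDerivAt_smul_blow {W : ℂ → Fin 3 → ℂ} {s : ℂ} (hW : DifferentiableAt ℂ W s) :
    HasDerivAt (fun s => s • blow (W s)) (blow (W s) + s • fib (deriv W s)) s := by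
  have hWi : ∀ j, HasDerivAt (fun s => W s j) (deriv W s j) s := fun j =>
    hasDerivAt_pi.1 hW.hasDerivAt j
  have hid := hasDerivAt_id s
  rw [hasDerivAt_pi]
  intro i
  fin_cases i
  · simpa [blow, fib] using hasDerivAt_id' s
  · simpa [blow, fib] using hid.fun_mul (hWi 0)
  · simpa [blow, fib] using hid.fun_mul (hWi 1)
  · simpa [blow, fib] using hid.fun_mul (hWi 2)

/-- Two bounded orbits of the blown-up system over the same base orbit coincide. -/
theorem eq_zero_of_expanding {d d' : ℝ → Fin 3 → ℂ} {ψ : ℝ → ℝ} {T C ρ : ℝ} {bb : Fin 3 → ℂ}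
    (hρ : 0 < ρ) (hb : ∀ j, ρ ≤ (bb j).re)
    (hd : ∀ t, T ≤ t → HasDerivAt d (d' t) t) (hψ : ∀ t, T ≤ t → 1 / 2 ≤ ψ t)
    (hd' : ∀ t, T ≤ t → ∃ e : Fin 3 → ℂ, (∀ j, d' t j = ψ t * (bb j * d t j + e j)) ∧
      ∀ j, ‖e j‖ ≤ ρ / 4 * ‖d t‖)
    (hC : ∀ t, T ≤ t → ‖d t‖ ≤ C) : d T = 0 := by
  set q : ℝ → ℝ := fun t => ∑ j, ‖d t j‖ ^ 2 with hq
  have hdj : ∀ t, T ≤ t → ∀ j, HasDerivAt (fun t => d t j) (d' t j) t := fun t ht j =>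
    hasDerivAt_pi.1 (hd t ht) j
  have hq' : ∀ t, T ≤ t → HasDerivAt q (∑ j, 2 * (conj (d t j) * d' t j).re) t := by
    intro t ht
    refine HasDerivAt.fun_sum fun j _ => ?_
    refine (hdj t ht j).norm_sq.congr_deriv ?_
    simp [Complex.inner, mul_comm]
  -- Each of the three components loses at most ρ / 4 · ‖d‖² ≤ ρ / 4 · q from the expansion ρ, which
  -- leaves ρ q / 4, and ψ ≥ 1 / 2 compensates the factor 2. Hence e^{-ρt/4} q is nondecreasing; for
  -- bounded d it also tends to zero, so q vanishes.
  have hlow : ∀ t, T ≤ t → ρ / 4 * q t ≤ ∑ j, 2 * (conj (d t j) * d' t j).re := by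
    intro t ht
    obtain ⟨e, he, hen⟩ := hd' t ht
    have hn : ‖d t‖ ^ 2 ≤ q t := by
      have hq0 : 0 ≤ q t := Finset.sum_nonneg fun j _ => sq_nonneg _
      have : ‖d t‖ ≤ √(q t) := by
        rw [pi_norm_le_iff_of_nonneg (Real.sqrt_nonneg _)]
        intro j
        exact Real.le_sqrt_of_sq_le (Finset.single_le_sum (f := fun j => ‖d t j‖ ^ 2)
          (fun i _ => sq_nonneg _) (Finset.mem_univ j))
      calc ‖d t‖ ^ 2 ≤ √(q t) ^ 2 := by gcongr
        _ = q t := Real.sq_sqrt hq0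
    have hj : ∀ j, 2 * ψ t * (ρ * ‖d t j‖ ^ 2 - ρ / 4 * ‖d t‖ ^ 2) ≤
        2 * (conj (d t j) * d' t j).re := by
      intro j
      have hψt := hψ t ht
      have e1 : (conj (d t j) * d' t j).re =
          ψ t * ((bb j).re * ‖d t j‖ ^ 2 + (conj (d t j) * e j).re) := by
        rw [he j]
        have : conj (d t j) * (ψ t * (bb j * d t j + e j)) =
            ψ t * (bb j * (d t j * conj (d t j)) + conj (d t j) * e j) := by ring
        rw [this, Complex.mul_conj, Complex.re_ofReal_mul, Complex.add_re, Complex.re_mul_ofReal,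
          Complex.normSq_eq_norm_sq]
      have e2 : -(ρ / 4 * ‖d t‖ ^ 2) ≤ (conj (d t j) * e j).re := by
        have h1 := (abs_le.1 (Complex.abs_re_le_norm (conj (d t j) * e j))).1
        rw [norm_mul, RCLike.norm_conj] at h1
        have h2 : ‖d t j‖ * ‖e j‖ ≤ ‖d t‖ * (ρ / 4 * ‖d t‖) := by
          gcongr
          · exact norm_le_pi_norm _ j
          · exact hen j
        nlinarith
      rw [e1]
      have e3 : ρ * ‖d t j‖ ^ 2 ≤ (bb j).re * ‖d t j‖ ^ 2 := by gcongr; exact hb j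
      have : ψ t * (ρ * ‖d t j‖ ^ 2 - ρ / 4 * ‖d t‖ ^ 2) ≤
          ψ t * ((bb j).re * ‖d t j‖ ^ 2 + (conj (d t j) * e j).re) := by
        gcongr; linarith
      linarith
    have hsum := Finset.sum_le_sum fun j (_ : j ∈ Finset.univ) => hj j
    refine le_trans ?_ hsum
    rw [← Finset.mul_sum, Finset.sum_sub_distrib, ← Finset.mul_sum]
    simp only [Finset.sum_const, Finset.card_univ, Fintype.card_fin, nsmul_eq_mul]
    have hψt := hψ t ht
    have hq0 : 0 ≤ q t := (sq_nonneg _).trans hn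
    have h3 : ρ / 4 * q t ≤ ρ * q t - (3 : ℕ) * (ρ / 4 * ‖d t‖ ^ 2) := by
      push_cast; nlinarith
    have h4 : 0 ≤ ρ / 4 * q t := by positivity
    calc ρ / 4 * q t ≤ 2 * ψ t * (ρ / 4 * q t) := by nlinarith
      _ ≤ 2 * ψ t * (ρ * q t - (3 : ℕ) * (ρ / 4 * ‖d t‖ ^ 2)) := by gcongr
  have hexp : ∀ t, HasDerivAt (fun t => Real.exp (-(ρ / 4) * t))
      (Real.exp (-(ρ / 4) * t) * (-(ρ / 4))) t := fun t => by
    simpa using ((hasDerivAt_id t).const_mul (-(ρ / 4))).exp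
  have hmono : ∀ t, T ≤ t → Real.exp (-(ρ / 4) * T) * q T ≤ Real.exp (-(ρ / 4) * t) * q t := by
    intro t ht
    refine le_of_hasDerivAt_nonneg (f := fun t => Real.exp (-(ρ / 4) * t) * q t)
      (fun t ht => (hexp t).mul (hq' t ht)) (fun t ht => ?_) le_rfl ht
    have := mul_le_mul_of_nonneg_left (hlow t ht) (Real.exp_pos (-(ρ / 4) * t)).le
    linarith
  have hlim : Tendsto (fun t : ℝ => Real.exp (-(ρ / 4) * t) * (3 * C ^ 2)) atTop (𝓝 0) := by
    have h1 : Tendsto (fun t : ℝ => -(ρ / 4) * t) atTop atBot :=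
      tendsto_id.const_mul_atTop_of_neg (by linarith)
    simpa using (Real.tendsto_exp_atBot.comp h1).mul_const (3 * C ^ 2)
  have hle : Real.exp (-(ρ / 4) * T) * q T ≤ 0 := by
    refine ge_of_tendsto hlim ?_
    filter_upwards [eventually_ge_atTop T] with t ht
    refine (hmono t ht).trans ?_
    gcongr
    have : ∀ j ∈ Finset.univ, ‖d t j‖ ^ 2 ≤ C ^ 2 := fun j _ => by
      have := (norm_le_pi_norm (d t) j).trans (hC t ht)
      gcongr
    refine (Finset.sum_le_sum this).trans (le_of_eq ?_)
    simp
  have hq0 : q T = 0 := by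
    have h1 : 0 ≤ q T := Finset.sum_nonneg fun j _ => sq_nonneg _
    have h2 := Real.exp_pos (-(ρ / 4) * T)
    nlinarith
  ext j
  have := (Finset.sum_eq_zero_iff_of_nonneg fun i _ => sq_nonneg _).1 hq0 j (Finset.mem_univ j)
  simpa using this

/-- The curve is s ↦ s (1, W s) for real s. The constant K with |z i| ≤ K |s| on asymptotic orbits
is fixed before the graph is built, so that every such orbit eventually lies in the part of the
blow-up that the graph theorem controls. There the difference between the orbit and the graph
expands while it stays bounded, hence it is zero. -/
theorem SaddleCenterForm.exists_stableCurve (h : SaddleCenterForm Y En ρ σ a b) :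
    ∃ W, IsStableCurve Y 0 ρ W := by
  have hρ := h.rho_pos
  have hρc : (ρ : ℂ) ≠ 0 := by exact_mod_cast hρ.ne'
  obtain ⟨K, hK, horb⟩ := h.orbit_le_stable
  obtain ⟨r, W, ψ, N, hr, hWd, hW0, hWK, hWr, hψr, hinv, hψc, hY⟩ := h.exists_stable_graph hK
  set γ : ℂ → CPt := fun s => s • blow (W s) with hγ
  have hmem : ∀ {s : ℝ}, (s : ℂ) ∈ Metric.ball (0 : ℂ) r ↔ |s| < r := by
    intro s; rw [mem_ball_zero_iff, Complex.norm_real, Real.norm_eq_abs]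
  have hWat : ∀ s ∈ Metric.ball (0 : ℂ) r, DifferentiableAt ℂ W s := fun s hs =>
    (hWd s hs).differentiableAt (Metric.isOpen_ball.mem_nhds hs)
  have hγ' : ∀ s ∈ Metric.ball (0 : ℂ) r, HasDerivAt γ (blow (W s) + s • fib (deriv W s)) s :=
    fun s hs => hasDerivAt_smul_blow (hWat s hs)
  have hγ0 : γ 0 = 0 := by simp [hγ]
  have hγreal : ∀ s : ℝ, |s| < r → γ s ∈ Set.range emb := by
    intro s hs
    rcases eq_or_ne s 0 with rfl | hs0
    · rw [Complex.ofReal_zero, hγ0, mem_range_emb_iff]; simp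
    · exact real_smul_mem_range_emb s (blow_mem_range_emb (hWr s (hmem.2 hs) hs0))
  have hYγ : ∀ s ∈ Metric.ball (0 : ℂ) r,
      Y (γ s) = (-(ρ * s) * ψ s (W s)) • (blow (W s) + s • fib (deriv W s)) := by
    intro s hs
    rw [(hY s hs (W s) (hWK s hs)).1, ← hinv s hs]
    ext i
    fin_cases i <;> simp [blow, fib] <;> ring
  have hψreal : ∀ s : ℝ, |s| < r → s ≠ 0 → ψ s (W s) = ((ψ s (W s)).re : ℂ) := fun s hs hs0 =>
    (Complex.conj_eq_iff_re.1 (hψr s (hmem.2 hs) hs0 _ (hWr s (hmem.2 hs) hs0)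
      (hWK s (hmem.2 hs)))).symm
  have hψbd : ∀ s ∈ Metric.ball (0 : ℂ) r, ∀ V, ‖V‖ ≤ K →
      1 / 2 ≤ (ψ s V).re ∧ (ψ s V).re ≤ 3 / 2 := by
    intro s hs V hV
    have h1 := (Complex.abs_re_le_norm _).trans (hY s hs V hV).2.1
    rw [Complex.sub_re, Complex.one_re, abs_le] at h1
    constructor <;> linarith [h1.1, h1.2]
  -- the parametrized curve
  let ι : EuclideanSpace ℝ (Fin 1) →L[ℝ] ℂ :=
    Complex.ofRealCLM.comp (EuclideanSpace.proj (0 : Fin 1))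
  have hι : ∀ x, ι x = ((x 0 : ℝ) : ℂ) := fun x => rfl
  have hιball : ∀ x ∈ Metric.ball (0 : EuclideanSpace ℝ (Fin 1)) r, ι x ∈ Metric.ball (0 : ℂ) r := by
    intro x hx
    rw [mem_ball_zero_iff, euclidean_one_norm] at hx
    exact hmem.2 hx
  have habs : ∀ x ∈ Metric.ball (0 : EuclideanSpace ℝ (Fin 1)) r, |x 0| < r := by
    intro x hx
    rwa [mem_ball_zero_iff, euclidean_one_norm] at hx
  have hfd : ∀ x ∈ Metric.ball (0 : EuclideanSpace ℝ (Fin 1)) r, ∀ v,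
      fderiv ℝ (fun x => γ (ι x)) x v =
        ((v 0 : ℝ) : ℂ) • (blow (W (ι x)) + ι x • fib (deriv W (ι x))) := by
    intro x hx v
    have h1 := ((hγ' _ (hιball x hx)).hasFDerivAt.restrictScalars ℝ).comp x ι.hasFDerivAt
    have h2 : fderiv ℝ (fun x => γ (ι x)) x = _ := h1.fderiv
    rw [h2]
    simp [hι]
  have h0ball : (0 : EuclideanSpace ℝ (Fin 1)) ∈ Metric.ball (0 : EuclideanSpace ℝ (Fin 1)) r :=
    Metric.mem_ball_self hr
  have hmk : ∀ t : ℝ, ι (EuclideanSpace.single 0 t) = t := fun t => by simp [hι]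
  have hmkball : ∀ t : ℝ, |t| < r →
      EuclideanSpace.single (0 : Fin 1) t ∈ Metric.ball (0 : EuclideanSpace ℝ (Fin 1)) r := by
    intro t ht
    rw [mem_ball_zero_iff, euclidean_one_norm]
    simpa using ht
  refine ⟨(fun x => γ (ι x)) '' Metric.ball 0 r, ⟨fun x => γ (ι x), r, hr, ?_, ?_, rfl, ?_, ?_, ?_,
    ?_⟩, ?_, ?_⟩
  · have h1 : ContDiffOn ℂ ((⊤ : ℕ∞) : WithTop ℕ∞) γ (Metric.ball 0 r) :=
      DifferentiableOn.contDiffOn (fun s hs => (hγ' s hs).differentiableAt.differentiableWithinAt)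
        Metric.isOpen_ball
    exact (h1.restrict_scalars ℝ).comp ι.contDiff.contDiffOn hιball
  -- The stable coordinate of s (1, W s) is s itself, so its real part is a continuous left inverse
  -- of the parametrization.
  · refine IsEmbedding.of_comp (g := fun z : CPt => EuclideanSpace.single (0 : Fin 1) (z 0).re)
      ?_ ?_ ?_
    · refine ContinuousOn.domRestrict ?_
      intro x hx
      exact (((hγ' _ (hιball x hx)).continuousAt).comp ι.continuous.continuousAt).continuousWithinAt
    · have h1 : Continuous fun z : CPt => (z 0).re := by fun_prop
      have h2 : Continuous fun t : ℝ => EuclideanSpace.single (0 : Fin 1) t := by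
        have : (fun t : ℝ => EuclideanSpace.single (0 : Fin 1) t) =
            fun t : ℝ => t • EuclideanSpace.single (0 : Fin 1) (1 : ℝ) := by
          ext t i; fin_cases i; simp
        rw [this]; fun_prop
      exact h2.comp h1
    · convert! IsEmbedding.subtypeVal using 1
      ext x i
      fin_cases i
      simp [hγ, blow, hι, Set.domRestrict]
  · rintro _ ⟨x, hx, rfl⟩
    exact hγreal _ (habs x hx)
  · simp [hγ0]
  · ext v
    simp only [Set.mem_range, Set.mem_ofPred_eq]
    have e0 : blow (W (ι 0)) + ι 0 • fib (deriv W (ι 0)) = ![1, 0, 0, 0] := by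
      ext i; fin_cases i <;> simp [blow, hW0]
    constructor
    · rintro ⟨y, rfl⟩
      rw [hfd 0 h0ball, e0]
      constructor
      · refine real_smul_mem_range_emb _ ?_
        rw [mem_range_emb_iff]; simp
      · rw [h.linear]
        ext i; fin_cases i <;> simp
    · rintro ⟨hv, hv'⟩
      rw [h.linear] at hv'
      have c1 := congrFun hv' 1
      have c2 := congrFun hv' 2
      simp only [Matrix.cons_val, Pi.smul_apply, smul_eq_mul] at c1 c2
      have v1 : v 1 = 0 := by
        have : (2 * (ρ : ℂ)) * v 1 = 0 := by linear_combination c1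
        simpa [hρc] using this
      have v2 : v 2 = 0 := by
        have h1 : (ρ + Complex.I * σ : ℂ) * v 2 = 0 := by linear_combination c2
        rcases mul_eq_zero.1 h1 with h2 | h2
        · have := congrArg Complex.re h2
          simp at this
          exact absurd this hρ.ne'
        · exact h2
      obtain ⟨v0, -, v3⟩ := mem_range_emb_iff.1 hv
      refine ⟨EuclideanSpace.single 0 (v 0).re, ?_⟩
      rw [hfd 0 h0ball, e0]
      ext i
      fin_cases i
      · simpa using Complex.conj_eq_iff_re.1 v0
      · simp [v1]
      · simp [v2]
      · simp [v3, v2]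
  · intro x hx
    constructor
    · intro v w hvw
      simp only [hfd x hx] at hvw
      have := congrFun hvw 0
      simp [blow, fib] at this
      ext i; fin_cases i; exact this
    · rcases eq_or_ne (x 0) 0 with hx0 | hx0
      · refine ⟨0, ?_⟩
        have : ι x = 0 := by rw [hι, hx0]; simp
        show _ = Y (γ (ι x))
        rw [hYγ _ (hιball x hx), this]
        simp
      · refine ⟨EuclideanSpace.single 0 (-(ρ * x 0) * (ψ (ι x) (W (ι x))).re), ?_⟩
        show _ = Y (γ (ι x))
        rw [hfd x hx, hYγ _ (hιball x hx)]
        congr 1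
        have := hψreal (x 0) (habs x hx) hx0
        rw [← hι] at this
        conv_rhs => rw [this]
        simp [hι]
  · rintro _ ⟨x, hx, rfl⟩
    rcases eq_or_ne (x 0) 0 with hx0 | hx0
    · have hx00 : ι x = 0 := by rw [hι, hx0]; simp
      refine ⟨fun _ => 0, by simp [hx00, hγ0], fun t ht => ⟨⟨0, h0ball, by simp [hγ0]⟩, ?_⟩,
        tendsto_const_nhds⟩
      rw [h.zero]
      exact hasDerivWithinAt_const _ _ _
    · set s₀ := x 0 with hs₀
      set e : ℝ → ℝ := fun τ => s₀ * Real.exp (-(ρ * τ)) with he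
      have he0 : ∀ τ, e τ ≠ 0 := fun τ => mul_ne_zero hx0 (Real.exp_pos _).ne'
      have hed : ∀ τ, HasDerivAt e (-(ρ * e τ)) τ := by
        intro τ
        have h1 := ((hasDerivAt_id τ).const_mul ρ).fun_neg.exp.const_mul s₀
        refine h1.congr_deriv ?_
        simp only [he, id]; ring
      have her : ∀ τ, 0 ≤ τ → |e τ| < r := by
        intro τ hτ
        have h1 : Real.exp (-(ρ * τ)) ≤ 1 := Real.exp_le_one_iff.2 (by
          have := mul_nonneg hρ.le hτ; linarith)
        rw [he, abs_mul, abs_of_pos (Real.exp_pos _)]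
        have := habs x hx
        nlinarith [abs_nonneg s₀]
      -- The orbit on the curve is s₀ e^{-ρτ} with τ' = p τ. The maximum with 0 extends p to
      -- negative τ, where the base point could leave the disc of radius r.
      set p : ℝ → ℝ := fun τ => (ψ (e (max τ 0)) (W (e (max τ 0)))).re with hp
      have hpc : Continuous p := by
        have h1 : Continuous fun τ : ℝ => ((e (max τ 0) : ℝ) : ℂ) := by
          simp only [he]; fun_prop
        have h2 := hψc.comp_continuous h1 fun τ => hmem.2 (her _ (le_max_right _ _))
        exact Complex.continuous_re.comp h2
      have hpb : ∀ τ, 1 / 2 ≤ p τ ∧ p τ ≤ 3 / 2 := fun τ =>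
        hψbd _ (hmem.2 (her _ (le_max_right _ _))) _ (hWK _ (hmem.2 (her _ (le_max_right _ _))))
      obtain ⟨τ, hτ0, hτd, hτm, hτt⟩ := exists_time_change hpc (fun x => (hpb x).1)
        fun x => (hpb x).2
      have hτnn : ∀ t, 0 ≤ t → 0 ≤ τ t := fun t ht => hτ0 ▸ hτm ht
      refine ⟨fun t => γ (e (τ t)), ?_, fun t ht => ⟨?_, ?_⟩, ?_⟩
      · simp [hτ0, he, hι, hs₀]
      · exact ⟨EuclideanSpace.single 0 (e (τ t)), hmkball _ (her _ (hτnn t ht)), by simp [hmk]⟩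
      · have hb := her _ (hτnn t ht)
        have h1 : HasDerivAt (fun t => ((e (τ t) : ℝ) : ℂ)) ((-(ρ * e (τ t)) * p (τ t) : ℝ) : ℂ) t :=
          ((hed (τ t)).comp t (hτd t)).ofReal_comp
        have h2 := (hγ' _ (hmem.2 hb)).scomp t h1
        refine (h2.congr_deriv ?_).hasDerivWithinAt
        rw [hYγ _ (hmem.2 hb), hψreal _ hb (he0 _)]
        congr 1
        simp [hp, max_eq_left (hτnn t ht)]
      · have h1 : Tendsto (fun t => ((e (τ t) : ℝ) : ℂ)) atTop (𝓝 0) := by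
          have h2 : Tendsto (fun τ : ℝ => -(ρ * τ)) atTop atBot :=
            tendsto_neg_atTop_atBot.comp (tendsto_id.const_mul_atTop hρ)
          have h3 : Tendsto e atTop (𝓝 0) := by
            simpa [he] using (Real.tendsto_exp_atBot.comp h2).const_mul s₀
          have := (Complex.continuous_ofReal.tendsto 0).comp (h3.comp hτt)
          simpa [Function.comp_def] using this
        have h2 := (hγ' 0 (Metric.mem_ball_self hr)).continuousAt.tendsto.comp h1
        rwa [hγ0] at h2
  · intro z hz hlim
    have hz' : ∀ t, 0 < t → z t ∈ Set.range emb ∧ HasDerivAt z (Y (z t)) t := fun t ht =>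
      ⟨(hz t ht.le).1, (hz t ht.le).2.hasDerivAt (Ici_mem_nhds ht)⟩
    have hlin : ∀ᶠ w in 𝓝 (0 : CPt), ‖Y w - fderiv ℂ Y 0 w‖ ≤ ρ / K * ‖w‖ := by
      have := (h.analytic.differentiableAt.hasFDerivAt.isLittleO).def
        (show (0 : ℝ) < ρ / K by positivity)
      simpa [h.zero] using this
    obtain ⟨T, hT⟩ := eventually_atTop.1 ((horb z hz' hlim).and ((hlim.eventually hlin).and
      (hlim.eventually (Metric.ball_mem_nhds (0 : CPt) hr))))
    refine ⟨max T 1, fun t₁ ht₁ => ?_⟩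
    have hTt : ∀ t, t₁ ≤ t → T ≤ t := fun t ht => (le_max_left _ _).trans (ht₁.trans ht)
    have hpos : ∀ t, t₁ ≤ t → 0 < t := fun t ht =>
      lt_of_lt_of_le one_pos ((le_max_right _ _).trans (ht₁.trans ht))
    rcases eq_or_ne (z t₁ 0) 0 with h0 | h0
    · have hz0 : z t₁ = 0 := by
        ext i
        have := (hT t₁ (hTt _ le_rfl)).1 i
        rw [h0, norm_zero, mul_zero] at this
        simpa using norm_le_zero_iff.1 this
      exact ⟨0, h0ball, by simp [hγ0, hz0]⟩
    set s : ℝ → ℝ := fun t => (z t 0).re with hs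
    have hzs : ∀ t, t₁ ≤ t → z t 0 = s t := fun t ht =>
      (Complex.conj_eq_iff_re.1 (mem_range_emb_iff.1 (hz' t (hpos t ht)).1).1).symm
    have hsd : ∀ t, t₁ ≤ t → HasDerivAt s (Y (z t) 0).re t := by
      intro t ht
      have h1 := hasDerivAt_pi.1 (hz' t (hpos t ht)).2 0
      exact (Complex.reCLM.hasFDerivAt.comp_hasDerivAt t h1 :)
    have hsr : ∀ t, t₁ ≤ t → |s t| < r := by
      intro t ht
      have h1 := (hT t (hTt t ht)).2.2
      rw [dist_zero_right] at h1
      have h2 := norm_le_pi_norm (z t) 0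
      rw [hzs t ht, Complex.norm_real, Real.norm_eq_abs] at h2
      linarith
    -- Near the equilibrium |s' + ρ s| ≤ ρ |s|, hence s s' ≥ -2ρ s² and e^{4ρt} s² is nondecreasing.
    -- The stable coordinate never vanishes once it is nonzero, so division by it is legitimate.
    have hsne : ∀ t, t₁ ≤ t → s t ≠ 0 := by
      intro t ht
      have hmono := le_of_hasDerivAt_nonneg (f := fun t => Real.exp (4 * ρ * t) * s t ^ 2)
        (f' := fun t => Real.exp (4 * ρ * t) * (4 * ρ) * s t ^ 2 +
          Real.exp (4 * ρ * t) * (2 * s t * (Y (z t) 0).re)) (T := t₁)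
        (fun t ht => by
          have h1 : HasDerivAt (fun t => Real.exp (4 * ρ * t))
              (Real.exp (4 * ρ * t) * (4 * ρ)) t := by
            simpa using ((hasDerivAt_id t).const_mul (4 * ρ)).exp
          refine (h1.mul ((hsd t ht).pow 2)).congr_deriv ?_
          simp)
        (fun t ht => by
          have e0 := (Complex.abs_re_le_norm _).trans
            ((norm_le_pi_norm _ 0).trans (hT t (hTt t ht)).2.1)
          rw [Pi.sub_apply, h.linear, Matrix.cons_val_zero, hzs t ht, Complex.sub_re] at e0
          have r0 : (-(ρ : ℂ) * (s t : ℂ)).re = -ρ * s t := by simp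
          rw [r0] at e0
          have hn : ‖z t‖ ≤ K * |s t| := by
            rw [pi_norm_le_iff_of_nonneg (by positivity)]
            intro i
            have := (hT t (hTt t ht)).1 i
            rwa [hzs t ht, Complex.norm_real, Real.norm_eq_abs] at this
          have e1 : |(Y (z t) 0).re - -ρ * s t| ≤ ρ * |s t| := by
            refine e0.trans ?_
            calc ρ / K * ‖z t‖ ≤ ρ / K * (K * |s t|) := by gcongr
              _ = ρ * |s t| := by field_simp
          have e2 : |s t * ((Y (z t) 0).re - -ρ * s t)| ≤ ρ * s t ^ 2 := by
            rw [abs_mul, ← sq_abs (s t)]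
            nlinarith [abs_nonneg (s t)]
          have e3 := (abs_le.1 e2).1
          have e4 := Real.exp_pos (4 * ρ * t)
          have : 0 ≤ 4 * ρ * s t ^ 2 + 2 * s t * (Y (z t) 0).re := by nlinarith [sq_nonneg (s t)]
          nlinarith [mul_nonneg e4.le this]) le_rfl ht
      intro h1
      simp only [h1] at hmono
      have h2 : 0 < Real.exp (4 * ρ * t₁) * s t₁ ^ 2 := by
        have : s t₁ ≠ 0 := by
          intro h3
          rw [hzs t₁ le_rfl, h3] at h0
          simp at h0
        positivity
      simp at hmono
      linarith
    set V : ℝ → Fin 3 → ℂ := fun t j => z t j.succ / s t with hV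
    have hzV : ∀ t, t₁ ≤ t → z t = (s t : ℂ) • blow (V t) := by
      intro t ht
      have hc : (s t : ℂ) ≠ 0 := by exact_mod_cast hsne t ht
      ext i
      fin_cases i
      · simpa [blow] using hzs t ht
      · simp [blow, hV]; field_simp
      · simp [blow, hV]; field_simp
      · simp [blow, hV]; field_simp
    have hVK : ∀ t, t₁ ≤ t → ‖V t‖ ≤ K := by
      intro t ht
      rw [pi_norm_le_iff_of_nonneg hK.le]
      intro j
      have h1 := (hT t (hTt t ht)).1 j.succ
      rw [hzs t ht] at h1
      have hc : 0 < ‖(s t : ℂ)‖ := norm_pos_iff.2 (by exact_mod_cast hsne t ht)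
      simp only [hV, norm_div]
      rwa [div_le_iff₀ hc]
    have hVr : ∀ t, t₁ ≤ t → V t ∈ realFibre := by
      intro t ht
      obtain ⟨-, h1, h3⟩ := mem_range_emb_iff.1 (hz' t (hpos t ht)).1
      constructor
      · simp [hV, h1]
      · simp only [hV, map_div₀, Complex.conj_ofReal]
        rw [show (2 : Fin 3).succ = 3 from rfl, show (1 : Fin 3).succ = 2 from rfl, h3]
    have hball : ∀ t, t₁ ≤ t → (s t : ℂ) ∈ Metric.ball (0 : ℂ) r := fun t ht => hmem.2 (hsr t ht)
    have hψV : ∀ t, t₁ ≤ t → ψ (s t) (V t) = ((ψ (s t) (V t)).re : ℂ) := fun t ht =>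
      (Complex.conj_eq_iff_re.1 (hψr _ (hball t ht) (hsne t ht) _ (hVr t ht) (hVK t ht))).symm
    have hYV : ∀ t, t₁ ≤ t → Y (z t) = ψ (s t) (V t) • (-(ρ * s t : ℂ) • blow (V t) +
        (s t : ℂ) • fib (N (s t) (V t))) := fun t ht => by
      have := (hY _ (hball t ht) _ (hVK t ht)).1
      rwa [← hzV t ht] at this
    have hsd' : ∀ t, t₁ ≤ t → HasDerivAt (fun t => (s t : ℂ)) (ψ (s t) (V t) * -(ρ * s t)) t := by
      intro t ht
      refine ((hsd t ht).ofReal_comp).congr_deriv ?_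
      rw [hYV t ht]
      conv_rhs => rw [hψV t ht]
      rw [hψV t ht]
      simp [blow, fib]
    have hVd : ∀ t, t₁ ≤ t → ∀ j, HasDerivAt (fun t => V t j) (ψ (s t) (V t) * N (s t) (V t) j) t := by
      intro t ht j
      have hc : (s t : ℂ) ≠ 0 := by exact_mod_cast hsne t ht
      have h1 := hasDerivAt_pi.1 (hz' t (hpos t ht)).2 j.succ
      refine (h1.fun_div (hsd' t ht) hc).congr_deriv ?_
      have e1 : z t j.succ = s t * V t j := by simp only [hV]; field_simp
      have e2 : Y (z t) j.succ = ψ (s t) (V t) * (-(ρ * s t) * V t j + s t * N (s t) (V t) j) := by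
        rw [hYV t ht]
        fin_cases j <;> simp [blow, fib]
      rw [e1, e2]
      field_simp
      ring
    have hWd' : ∀ t, t₁ ≤ t → HasDerivAt (fun t => W (s t)) (ψ (s t) (V t) • N (s t) (W (s t))) t := by
      intro t ht
      refine ((hWat _ (hball t ht)).hasDerivAt.scomp t (hsd' t ht)).congr_deriv ?_
      rw [← hinv _ (hball t ht), smul_smul]
    -- Orbit and graph are compared over the same base orbit s t with the same factor ψ (s, V). The
    -- invariance equation of the graph holds in the rescaled time, so W (s t) moves with the
    -- velocity ψ (s, V) N (s, W).
    have hzero := eq_zero_of_expanding (d := fun t => V t - W (s t))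
      (d' := fun t => (fun j => ψ (s t) (V t) * N (s t) (V t) j) - ψ (s t) (V t) • N (s t) (W (s t)))
      (ψ := fun t => (ψ (s t) (V t)).re) (T := t₁) (C := 2 * K) hρ
      (fun j => blowRate_re (σ := σ) hρ j)
      (fun t ht => (hasDerivAt_pi.2 (hVd t ht)).sub (hWd' t ht))
      (fun t ht => (hψbd _ (hball t ht) _ (hVK t ht)).1)
      (fun t ht => ⟨fun j => N (s t) (V t) j - N (s t) (W (s t)) j -
          blowRate ρ σ j * (V t j - W (s t) j), fun j => by
        simp only [Pi.sub_apply, Pi.smul_apply, smul_eq_mul]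
        rw [← hψV t ht]
        ring, fun j => (hY _ (hball t ht) _ (hVK t ht)).2.2 _ (hWK _ (hball t ht)) j⟩)
      (fun t ht => (norm_sub_le _ _).trans (by
        linarith [hVK t ht, hWK _ (hball t ht)]))
    refine ⟨EuclideanSpace.single 0 (s t₁), hmkball _ (hsr _ le_rfl), ?_⟩
    simp only [hmk]
    rw [hzV t₁ le_rfl, sub_eq_zero.1 hzero]

end

/-! ### Polar coordinates of the center directions and the energy relation. -/

section

variable {Y : CPt → CPt} {En : CPt → ℂ} {ρ σ : ℝ} {a b : ℂ}

/-- The coefficients of the quadratic part of a real first integral are real. -/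
theorem conj_quadratic_of_real {Q : CPt → CPt →L[ℂ] CPt →L[ℂ] ℂ} (hQ : AnalyticAt ℂ Q 0)
    (hEn : ∀ᶠ z in 𝓝 (0 : CPt), En z = Q z z z)
    (hreal : ∀ᶠ z in 𝓝 (0 : CPt), z ∈ Set.range emb → conj (En z) = En z)
    {v : CPt} (hv : v ∈ Set.range emb) : conj (Q 0 v v) = Q 0 v v := by
  -- The value of Q 0 at (v, v) is the limit of En (t v) / t² for real t → 0, and each of these
  -- quotients is real.
  have hline : Tendsto (fun t : ℝ => (t : ℂ) • v) (𝓝[≠] 0) (𝓝 0) := by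
    have : Continuous fun t : ℝ => (t : ℂ) • v := by fun_prop
    simpa using (this.tendsto 0).mono_left nhdsWithin_le_nhds
  have h1 : Tendsto (fun t : ℝ => Q ((t : ℂ) • v) v v) (𝓝[≠] 0) (𝓝 (Q 0 v v)) := by
    have h2 : ContinuousAt (fun z => Q z v v) 0 :=
      (hQ.continuousAt.clm_apply continuousAt_const).clm_apply continuousAt_const
    exact h2.tendsto.comp hline
  have h3 : Tendsto (fun t : ℝ => conj (Q ((t : ℂ) • v) v v)) (𝓝[≠] 0) (𝓝 (conj (Q 0 v v))) :=
    (Complex.continuous_conj.tendsto _).comp h1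
  refine tendsto_nhds_unique (h3.congr' ?_) h1
  filter_upwards [hline.eventually hEn, hline.eventually hreal, eventually_mem_nhdsWithin]
    with t e1 e2 ht
  have e3 := e2 (real_smul_mem_range_emb t hv)
  rw [e1] at e3
  simp only [map_smul, smul_apply, smul_eq_mul, map_mul, Complex.conj_ofReal] at e3
  have ht' : (t : ℂ) ≠ 0 := by exact_mod_cast ht
  exact mul_left_cancel₀ ht' (mul_left_cancel₀ ht' e3)

/-- The point `(S, U, p, p⁻¹)` in blown-up polar coordinates of the center directions. -/
def polarVec (q : (ℂ × ℂ) × (Fin 3 → ℂ)) : CPt := ![q.2 0, q.2 1, q.1.1, q.1.1⁻¹]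

/-- The radius, `E (1 + n)`, where `E` is the scaled energy. -/
def polarRadius (q : (ℂ × ℂ) × (Fin 3 → ℂ)) : ℂ := q.1.2 * (1 + q.2 2)

/-- The domain of the base variables: `p` in an annulus, `E` in a disc. -/
def annulusDisc (r : ℝ) : Set (ℂ × ℂ) := {x | 1 / 2 < ‖x.1‖ ∧ ‖x.1‖ < 2 ∧ ‖x.2‖ < r}

theorem isOpen_annulusDisc (r : ℝ) : IsOpen (annulusDisc r) :=
  (isOpen_lt continuous_const continuous_fst.norm).inter
    ((isOpen_lt continuous_fst.norm continuous_const).inter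
      (isOpen_lt continuous_snd.norm continuous_const))

/-- The rotation by the angle `c τ` of the base. -/
def rotFlow (c : ℝ) (τ : ℝ) : ℂ × ℂ →L[ℂ] ℂ × ℂ :=
  Complex.exp (c * τ * Complex.I) • (ContinuousLinearMap.fst ℂ ℂ ℂ).prod 0 +
    (0 : ℂ × ℂ →L[ℂ] ℂ).prod (ContinuousLinearMap.snd ℂ ℂ ℂ)

theorem rotFlow_apply (c τ : ℝ) (x : ℂ × ℂ) :
    rotFlow c τ x = (Complex.exp (c * τ * Complex.I) * x.1, x.2) := by
  simp [rotFlow]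

theorem norm_exp_rot (c τ : ℝ) : ‖Complex.exp (c * τ * Complex.I)‖ = 1 := by
  rw [← Complex.ofReal_mul]; exact Complex.norm_exp_ofReal_mul_I _

theorem rotFlow_mem {c τ r : ℝ} {x : ℂ × ℂ} (hx : x ∈ annulusDisc r) :
    rotFlow c τ x ∈ annulusDisc r := by
  rw [rotFlow_apply]
  simpa [annulusDisc, norm_exp_rot] using hx

theorem continuous_rotFlow (c : ℝ) : Continuous (rotFlow c) := by
  unfold rotFlow
  fun_prop

theorem rotFlow_zero (c : ℝ) : rotFlow c 0 = ContinuousLinearMap.id ℂ (ℂ × ℂ) := by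
  refine ContinuousLinearMap.ext fun x => ?_
  rw [rotFlow_apply]
  simp

theorem rotFlow_add (c t τ : ℝ) : rotFlow c (t + τ) = (rotFlow c τ).comp (rotFlow c t) := by
  refine ContinuousLinearMap.ext fun x => ?_
  rw [ContinuousLinearMap.comp_apply, rotFlow_apply, rotFlow_apply, rotFlow_apply, ← mul_assoc,
    ← Complex.exp_add]
  congr 3
  push_cast; ring

/-- The generator of `rotFlow c`. -/
def rotGen (c : ℝ) : ℂ × ℂ →L[ℂ] ℂ × ℂ :=
  ((c : ℂ) * Complex.I) • (ContinuousLinearMap.fst ℂ ℂ ℂ).prod 0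

theorem hasDerivAt_rotFlow (c : ℝ) : HasDerivAt (rotFlow c) (rotGen c) 0 := by
  have h1 : HasDerivAt (fun τ : ℝ => Complex.exp (c * τ * Complex.I)) (c * Complex.I) 0 := by
    have h2 : HasDerivAt (fun τ : ℝ => (c : ℂ) * τ * Complex.I) (c * Complex.I) 0 := by
      simpa using ((Complex.ofRealCLM.hasDerivAt (x := (0 : ℝ))).const_mul (c : ℂ)).mul_const
        Complex.I
    simpa using h2.cexp
  exact (h1.smul_const ((ContinuousLinearMap.fst ℂ ℂ ℂ).prod 0)).add_const _

/-- The leading part of the energy equation for the radius. -/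
def energyStep (α : ℂ) (W : Fin 3 → ℂ) : ℂ :=
  -(1 / 2) * (W 2 ^ 2 + α * (W 0 * W 1) * (1 + W 2) ^ 2)

/-- With radius E (1 + n) the energy equals b E² exactly when (1 + n)² (1 + α S U + E (1 + n) e) =
1. Solved for the linear term in n = W 2, this is a fixed point equation whose part at E = 0 is
`energyStep`. That part has no linear terms, so on the ball of radius κ its Lipschitz constant is of
order κ (1 + |α|); the choice of κ makes it at most 1 / 4. -/
theorem energyStep_bounds (α : ℂ) {κ : ℝ} (hκ : κ = 1 / (32 * (1 + ‖α‖))) {W W' : Fin 3 → ℂ}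
    (hW : ‖W‖ ≤ κ) (hW' : ‖W'‖ ≤ κ) :
    ‖energyStep α W‖ ≤ κ / 2 ∧ ‖energyStep α W - energyStep α W'‖ ≤ ‖W - W'‖ / 4 := by
  have hα : 0 ≤ ‖α‖ := norm_nonneg α
  have hκ0 : 0 < κ := by rw [hκ]; positivity
  have hκα : κ * (1 + ‖α‖) = 1 / 32 := by rw [hκ]; field_simp
  have hκ1 : κ ≤ 1 / 32 := by nlinarith
  have hi : ∀ i, ‖W i‖ ≤ κ := fun i => (norm_le_pi_norm W i).trans hW
  have hi' : ∀ i, ‖W' i‖ ≤ κ := fun i => (norm_le_pi_norm W' i).trans hW'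
  have hd : ∀ i, ‖W i - W' i‖ ≤ ‖W - W'‖ := fun i => norm_le_pi_norm (W - W') i
  set d := ‖W - W'‖
  have hd0 : 0 ≤ d := norm_nonneg _
  have hm : ‖1 + W 2‖ ≤ 2 := (norm_add_le _ _).trans (by rw [norm_one]; linarith [hi 2])
  have hm' : ‖1 + W' 2‖ ≤ 2 := (norm_add_le _ _).trans (by rw [norm_one]; linarith [hi' 2])
  have hhalf : ‖(-(1 / 2) : ℂ)‖ = 1 / 2 := by norm_num
  constructor
  · have h1 : ‖W 2 ^ 2 + α * (W 0 * W 1) * (1 + W 2) ^ 2‖ ≤ κ ^ 2 + ‖α‖ * (κ * κ) * 2 ^ 2 := by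
      refine (norm_add_le _ _).trans ?_
      rw [norm_pow, norm_mul, norm_mul, norm_mul, norm_pow]
      gcongr <;> apply_rules [hi]
    rw [energyStep, norm_mul, hhalf]
    nlinarith [mul_nonneg hκ0.le hα]
  · have h1 : energyStep α W - energyStep α W' = -(1 / 2) * ((W 2 - W' 2) * (W 2 + W' 2) +
        α * ((W 0 - W' 0) * W 1 * (1 + W 2) ^ 2 + W' 0 * (W 1 - W' 1) * (1 + W 2) ^ 2 +
          W' 0 * W' 1 * ((W 2 - W' 2) * ((1 + W 2) + (1 + W' 2))))) := by
      unfold energyStep; ring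
    have e1 : ‖(W 2 - W' 2) * (W 2 + W' 2)‖ ≤ d * (κ + κ) := by
      rw [norm_mul]
      gcongr
      · exact hd 2
      · exact (norm_add_le _ _).trans (add_le_add (hi 2) (hi' 2))
    have e2 : ‖(W 0 - W' 0) * W 1 * (1 + W 2) ^ 2‖ ≤ d * κ * 2 ^ 2 := by
      rw [norm_mul, norm_mul, norm_pow]
      gcongr
      · exact hd 0
      · exact hi 1
    have e3 : ‖W' 0 * (W 1 - W' 1) * (1 + W 2) ^ 2‖ ≤ κ * d * 2 ^ 2 := by
      rw [norm_mul, norm_mul, norm_pow]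
      gcongr
      · exact hi' 0
      · exact hd 1
    have e4 : ‖W' 0 * W' 1 * ((W 2 - W' 2) * ((1 + W 2) + (1 + W' 2)))‖ ≤
        κ * κ * (d * (2 + 2)) := by
      rw [norm_mul, norm_mul, norm_mul]
      gcongr
      · exact hi' 0
      · exact hi' 1
      · exact hd 2
      · exact (norm_add_le _ _).trans (add_le_add hm hm')
    have e5 : ‖(W 0 - W' 0) * W 1 * (1 + W 2) ^ 2 + W' 0 * (W 1 - W' 1) * (1 + W 2) ^ 2 +
          W' 0 * W' 1 * ((W 2 - W' 2) * ((1 + W 2) + (1 + W' 2)))‖ ≤ 9 * κ * d := by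
      refine (norm_add_le _ _).trans ((add_le_add ((norm_add_le _ _).trans (add_le_add e2 e3))
        e4).trans ?_)
      nlinarith [mul_nonneg hκ0.le hd0]
    rw [h1, norm_mul, hhalf]
    have e6 : ‖α * ((W 0 - W' 0) * W 1 * (1 + W 2) ^ 2 + W' 0 * (W 1 - W' 1) * (1 + W 2) ^ 2 +
          W' 0 * W' 1 * ((W 2 - W' 2) * ((1 + W 2) + (1 + W' 2))))‖ ≤ ‖α‖ * (9 * κ * d) := by
      rw [norm_mul]; gcongr
    have e7 := (norm_add_le _ _).trans (add_le_add e1 e6)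
    have e8 : κ * ‖α‖ ≤ 1 / 32 := by nlinarith
    nlinarith [mul_nonneg hκ0.le hd0, mul_le_mul_of_nonneg_right e8 hd0,
      mul_le_mul_of_nonneg_right hκ1 hd0]

theorem analyticAt_polarVec {q : (ℂ × ℂ) × (Fin 3 → ℂ)} (hq : q.1.1 ≠ 0) :
    AnalyticAt ℂ polarVec q := by
  have h1 : AnalyticAt ℂ (fun q : (ℂ × ℂ) × (Fin 3 → ℂ) => q.1.1) q :=
    AnalyticAt.comp (g := Prod.fst) (f := Prod.fst) analyticAt_fst analyticAt_fst
  refine AnalyticAt.pi fun i => ?_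
  fin_cases i
  · exact analyticAt_pi_iff.1 analyticAt_snd 0
  · exact analyticAt_pi_iff.1 analyticAt_snd 1
  · exact h1
  · exact h1.inv hq

theorem analyticAt_polarRadius (q : (ℂ × ℂ) × (Fin 3 → ℂ)) : AnalyticAt ℂ polarRadius q := by
  have h1 : AnalyticAt ℂ (fun q : (ℂ × ℂ) × (Fin 3 → ℂ) => q.1.2) q :=
    AnalyticAt.comp (g := Prod.snd) (f := Prod.fst) analyticAt_snd analyticAt_fst
  exact h1.mul (analyticAt_const.add (analyticAt_pi_iff.1 analyticAt_snd 2))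

end

/-! ### The vector field in polar coordinates of the center directions. -/

section

variable {Y : CPt → CPt} {En : CPt → ℂ} {ρ σ : ℝ} {a b : ℂ}

/-- The radial part of the nonlinear terms in polar coordinates of the center directions. -/
def radialPart (β : CPt) (p : ℂ) : ℂ := (β 2 / p + β 3 * p) / 2

/-- The angular part of the nonlinear terms in polar coordinates of the center directions. -/
def angularPart (β : CPt) (p : ℂ) : ℂ := (β 2 / p - β 3 * p) / (2 * Complex.I)

/-- The vector `(S', U', p', (p⁻¹)')` when the angle grows at unit speed. -/
def polarVel (p S U : ℂ) : CPt := ![S, U, Complex.I * p, -(Complex.I * p⁻¹)]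

/-- The nonlinear terms of the equations of the invariant graph over the center directions. -/
def centerTerm (ρ σ : ℝ) (β : CPt) (e : ℂ) (q : (ℂ × ℂ) × (Fin 3 → ℂ)) : Fin 3 → ℂ :=
  ![(1 + q.2 2) * ((β 0 - q.2 0 * radialPart β q.1.1 + ρ * q.2 0 * angularPart β q.1.1 / σ) /
      (σ + polarRadius q * angularPart β q.1.1)),
    (1 + q.2 2) * ((β 1 - q.2 1 * radialPart β q.1.1 - ρ * q.2 1 * angularPart β q.1.1 / σ) /
      (σ + polarRadius q * angularPart β q.1.1)),
    -(1 / 2) * ((1 + q.2 2) ^ 3 * e)]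

theorem analyticAt_radialPart {q : (ℂ × ℂ) × (Fin 3 → ℂ)} {β : (ℂ × ℂ) × (Fin 3 → ℂ) → CPt}
    (hβ : AnalyticAt ℂ β q) (hq : q.1.1 ≠ 0) :
    AnalyticAt ℂ (fun q => radialPart (β q) q.1.1) q ∧
      AnalyticAt ℂ (fun q => angularPart (β q) q.1.1) q := by
  have hp : AnalyticAt ℂ (fun q : (ℂ × ℂ) × (Fin 3 → ℂ) => q.1.1) q :=
    AnalyticAt.comp (g := Prod.fst) (f := Prod.fst) analyticAt_fst analyticAt_fst
  have h2 := analyticAt_pi_iff.1 hβ 2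
  have h3 := analyticAt_pi_iff.1 hβ 3
  exact ⟨((h2.div hp hq).add (h3.mul hp)).div analyticAt_const two_ne_zero,
    ((h2.div hp hq).sub (h3.mul hp)).div analyticAt_const (by simp)⟩

theorem analyticAt_centerTerm {q : (ℂ × ℂ) × (Fin 3 → ℂ)} {β : (ℂ × ℂ) × (Fin 3 → ℂ) → CPt}
    {e : (ℂ × ℂ) × (Fin 3 → ℂ) → ℂ} (hβ : AnalyticAt ℂ β q) (he : AnalyticAt ℂ e q)
    (hq : q.1.1 ≠ 0) (hσ : (σ : ℂ) ≠ 0)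
    (hχ : (σ : ℂ) + polarRadius q * angularPart (β q) q.1.1 ≠ 0) :
    AnalyticAt ℂ (fun q => centerTerm ρ σ (β q) (e q) q) q := by
  obtain ⟨hr, ha⟩ := analyticAt_radialPart hβ hq
  have hW : ∀ i, AnalyticAt ℂ (fun q : (ℂ × ℂ) × (Fin 3 → ℂ) => q.2 i) q := fun i =>
    analyticAt_pi_iff.1 analyticAt_snd i
  have hβi : ∀ i, AnalyticAt ℂ (fun q => β q i) q := fun i => analyticAt_pi_iff.1 hβ i
  have hχa : AnalyticAt ℂ (fun q => (σ : ℂ) + polarRadius q * angularPart (β q) q.1.1) q :=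
    analyticAt_const.add ((analyticAt_polarRadius q).mul ha)
  have hm := (analyticAt_const (v := (1 : ℂ))).add (hW 2)
  refine AnalyticAt.pi fun i => ?_
  fin_cases i
  · exact hm.mul ((((hβi 0).sub ((hW 0).mul hr)).add
      (((analyticAt_const.mul (hW 0)).mul ha).div analyticAt_const hσ)).div hχa hχ)
  · exact hm.mul ((((hβi 1).sub ((hW 1).mul hr)).sub
      (((analyticAt_const.mul (hW 1)).mul ha).div analyticAt_const hσ)).div hχa hχ)
  · exact analyticAt_const.mul ((hm.pow 3).mul he)

/-- The field in polar coordinates of the center directions. -/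
theorem polar_decomposition {ρ σ : ℝ} (hσ : (σ : ℂ) ≠ 0) {β : CPt} {e : ℂ}
    {q : (ℂ × ℂ) × (Fin 3 → ℂ)} (hq : q.1.1 ≠ 0)
    (hχ : (σ : ℂ) + polarRadius q * angularPart β q.1.1 ≠ 0) :
    (![-ρ * polarVec q 0, ρ * polarVec q 1, Complex.I * σ * polarVec q 2,
      -(Complex.I * σ) * polarVec q 3] : CPt) + polarRadius q • β =
    (polarRadius q * radialPart β q.1.1) • polarVec q +
      ((σ : ℂ) + polarRadius q * angularPart β q.1.1) •
        polarVel q.1.1 (-(ρ / σ) * q.2 0 + q.1.2 * centerTerm ρ σ β e q 0)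
          (ρ / σ * q.2 1 + q.1.2 * centerTerm ρ σ β e q 1) := by
  -- χ is the angular speed. Dividing the two hyperbolic equations by χ makes the angle the
  -- independent variable and leaves the constant rates ∓ρ / σ.
  set χ := (σ : ℂ) + polarRadius q * angularPart β q.1.1 with hχd
  have hε : polarRadius q = q.1.2 * (1 + q.2 2) := rfl
  ext i
  fin_cases i
  · simp [polarVec, polarVel, centerTerm, ← hχd]
    have : χ * (-((ρ : ℂ) / σ * q.2 0) + q.1.2 * ((1 + q.2 2) * ((β 0 - q.2 0 *
        radialPart β q.1.1 + ρ * q.2 0 * angularPart β q.1.1 / σ) / χ))) =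
        -χ * ((ρ : ℂ) / σ * q.2 0) + (q.1.2 * (1 + q.2 2)) * (β 0 - q.2 0 *
        radialPart β q.1.1 + ρ * q.2 0 * angularPart β q.1.1 / σ) := by
      field_simp
    rw [this, ← hε, hχd]
    field_simp
    ring
  · simp [polarVec, polarVel, centerTerm, ← hχd]
    have : χ * ((ρ : ℂ) / σ * q.2 1 + q.1.2 * ((1 + q.2 2) * ((β 1 - q.2 1 *
        radialPart β q.1.1 - ρ * q.2 1 * angularPart β q.1.1 / σ) / χ))) =
        χ * ((ρ : ℂ) / σ * q.2 1) + (q.1.2 * (1 + q.2 2)) * (β 1 - q.2 1 *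
        radialPart β q.1.1 - ρ * q.2 1 * angularPart β q.1.1 / σ) := by
      field_simp
    rw [this, ← hε, hχd]
    field_simp
    ring
  · simp [polarVec, polarVel, hχd, radialPart, angularPart]
    field_simp
    ring
  · simp [polarVec, polarVel, hχd, radialPart, angularPart]
    field_simp
    ring

theorem norm_polarVec_le {q : (ℂ × ℂ) × (Fin 3 → ℂ)} (h1 : 1 / 2 < ‖q.1.1‖) (h2 : ‖q.1.1‖ < 2)
    (hW : ‖q.2‖ ≤ 1) : ‖polarVec q‖ ≤ 2 := by
  have hi : ∀ i, ‖q.2 i‖ ≤ 1 := fun i => (norm_le_pi_norm q.2 i).trans hW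
  rw [pi_norm_le_iff_of_nonneg (by norm_num)]
  intro i
  fin_cases i
  · exact (hi 0).trans (by norm_num)
  · exact (hi 1).trans (by norm_num)
  · exact h2.le
  · change ‖q.1.1⁻¹‖ ≤ 2
    rw [norm_inv]
    exact inv_le_of_inv_le₀ (by norm_num) (by linarith)

theorem norm_polarRadius_le {q : (ℂ × ℂ) × (Fin 3 → ℂ)} (hW : ‖q.2‖ ≤ 1) :
    ‖polarRadius q‖ ≤ 2 * ‖q.1.2‖ := by
  have h1 : ‖1 + q.2 2‖ ≤ 2 :=
    (norm_add_le _ _).trans (by rw [norm_one]; linarith [(norm_le_pi_norm q.2 2).trans hW])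
  rw [polarRadius, norm_mul, mul_comm]
  gcongr

/-- The real fibre coordinates. -/
def realTriples : Set (Fin 3 → ℂ) := {W | ∀ i, conj (W i) = W i}

theorem isClosed_realTriples : IsClosed realTriples := by
  simp only [realTriples, Set.ofPred_forall]
  exact isClosed_iInter fun i =>
    isClosed_eq (Complex.continuous_conj.comp (continuous_apply i)) (continuous_apply i)

theorem conj_eq_inv_of_norm_one {p : ℂ} (hp : ‖p‖ = 1) : conj p = p⁻¹ := by
  rw [Complex.inv_def, Complex.normSq_eq_norm_sq, hp]; simp

theorem polarVec_mem_range_emb {p E : ℂ} (hp : ‖p‖ = 1) {W : Fin 3 → ℂ} (hW : W ∈ realTriples) :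
    polarVec ((p, E), W) ∈ Set.range emb := by
  rw [mem_range_emb_iff]
  exact ⟨hW 0, hW 1, (conj_eq_inv_of_norm_one hp).symm⟩

theorem conj_polarRadius {p E : ℂ} (hE : conj E = E) {W : Fin 3 → ℂ} (hW : W ∈ realTriples) :
    conj (polarRadius ((p, E), W)) = polarRadius ((p, E), W) := by
  simp [polarRadius, hE, hW 2]

theorem conj_radialPart {β : CPt} {p : ℂ} (hp : ‖p‖ = 1) (hβ : β ∈ Set.range emb) :
    conj (radialPart β p) = radialPart β p ∧ conj (angularPart β p) = angularPart β p := by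
  rw [mem_range_emb_iff] at hβ
  have hp0 : p ≠ 0 := by rintro rfl; simp at hp
  have hc := conj_eq_inv_of_norm_one hp
  constructor
  · simp only [radialPart, map_div₀, map_add, map_mul, hβ.2.2, Complex.conj_conj, hc, map_ofNat]
    field_simp
    ring
  · simp only [angularPart, map_div₀, map_sub, map_mul, hβ.2.2, Complex.conj_conj, hc, map_ofNat,
      Complex.conj_I]
    field_simp
    ring

theorem centerTerm_mem_realTriples {β : CPt} {e p E : ℂ} {W : Fin 3 → ℂ} (hp : ‖p‖ = 1)
    (hE : conj E = E) (hW : W ∈ realTriples) (hβ : β ∈ Set.range emb) (he : conj e = e) :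
    centerTerm ρ σ β e ((p, E), W) ∈ realTriples := by
  obtain ⟨hr, ha⟩ := conj_radialPart hp hβ
  have hR := conj_polarRadius (p := p) hE hW
  rw [mem_range_emb_iff] at hβ
  intro i
  fin_cases i
  · simp [centerTerm, hr, ha, hR, hW 0, hW 2, hβ.1]
  · simp [centerTerm, hr, ha, hR, hW 1, hW 2, hβ.2.1]
  · simp [centerTerm, hW 2, he]
    exact Or.inl (map_ofNat _ 2)

end

/-! ### Uniform estimates on an annulus times a small disc of energies. -/

section

variable {Y : CPt → CPt} {En : CPt → ℂ} {ρ σ : ℝ} {a b : ℂ}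

set_option maxSynthPendingDepth 10 in
/-- Uniform estimates for a saddle-center in polar coordinates of the center directions. -/
theorem SaddleCenterForm.exists_polar_estimates (h : SaddleCenterForm Y En ρ σ a b) (hσ : 0 < σ)
    {κ : ℝ} (hκ1 : κ ≤ 1 / 32) {η : ℝ} (hη : 0 < η) :
    ∃ r > 0, ∃ (β : (ℂ × ℂ) × (Fin 3 → ℂ) → CPt) (e : (ℂ × ℂ) × (Fin 3 → ℂ) → ℂ)
      (G : (ℂ × ℂ) × (Fin 3 → ℂ) → Fin 3 → ℂ),
      (∀ q, G q = centerTerm ρ σ (β q) (e q) q) ∧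
      ∀ x ∈ annulusDisc r, ∀ W, ‖W‖ ≤ κ →
        (AnalyticAt ℂ G (x, W) ∧ ‖x.2‖ * ‖G (x, W)‖ ≤ η ∧
          ∀ W', ‖W'‖ ≤ κ → ‖x.2‖ * ‖G (x, W) - G (x, W')‖ ≤ η * ‖W - W'‖) ∧
        ((σ : ℂ) + polarRadius (x, W) * angularPart (β (x, W)) x.1 ≠ 0 ∧
          Y (polarRadius (x, W) • polarVec (x, W)) = polarRadius (x, W) •
            ((![-ρ * polarVec (x, W) 0, ρ * polarVec (x, W) 1, Complex.I * σ * polarVec (x, W) 2,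
              -(Complex.I * σ) * polarVec (x, W) 3] : CPt) + polarRadius (x, W) • β (x, W))) ∧
        (DifferentiableAt ℂ En (polarRadius (x, W) • polarVec (x, W)) ∧
          fderiv ℂ En (polarRadius (x, W) • polarVec (x, W))
            (Y (polarRadius (x, W) • polarVec (x, W))) = 0 ∧
          En (polarRadius (x, W) • polarVec (x, W)) =
            b * polarRadius (x, W) ^ 2 * (1 + a / b * (W 0 * W 1) + polarRadius (x, W) * e (x, W)) ∧
          ((1 + W 2) ^ 2 * (1 + a / b * (W 0 * W 1) + polarRadius (x, W) * e (x, W)) = 1 →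
            x.2 ≠ 0 →
            fderiv ℂ En (polarRadius (x, W) • polarVec (x, W)) (polarVec (x, W)) ≠ 0)) ∧
        (‖x.1‖ = 1 → conj x.2 = x.2 → x.2 ≠ 0 → W ∈ realTriples →
          G (x, W) ∈ realTriples ∧
          conj ((σ : ℂ) + polarRadius (x, W) * angularPart (β (x, W)) x.1) =
            (σ : ℂ) + polarRadius (x, W) * angularPart (β (x, W)) x.1) := by
  obtain ⟨B, hB, hYB⟩ := exists_quadratic_remainder h.analytic
  obtain ⟨Q, hQ, hQE, hQ0⟩ := h.en_quad
  obtain ⟨R, hR, -, hRQ⟩ := exists_analytic_hadamard hQ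
  have hb := h.b_ne
  have hσc : (σ : ℂ) ≠ 0 := by exact_mod_cast hσ.ne'
  -- the coefficients are real
  have hreal_coeff : ∀ v ∈ Set.range emb, conj (Q 0 v v) = Q 0 v v := fun v hv =>
    conj_quadratic_of_real hQ hQE h.en_real hv
  have hbr : conj b = b := by
    have h1 := hreal_coeff ![0, 0, 1, 1] (by rw [mem_range_emb_iff]; simp)
    rw [hQ0] at h1
    simpa using h1
  have har : conj a = a := by
    have h1 := hreal_coeff ![1, 1, 0, 0] (by rw [mem_range_emb_iff]; simp)
    rw [hQ0] at h1
    simpa using h1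
  set zq : (ℂ × ℂ) × (Fin 3 → ℂ) → CPt := fun q => polarRadius q • polarVec q with hzq
  set β : (ℂ × ℂ) × (Fin 3 → ℂ) → CPt := fun q => B (zq q) (polarVec q) (polarVec q) with hβ
  set e : (ℂ × ℂ) × (Fin 3 → ℂ) → ℂ :=
    fun q => R (zq q) (polarVec q) (polarVec q) (polarVec q) / b with he
  set d : (ℂ × ℂ) × (Fin 3 → ℂ) → ℂ :=
    fun q => fderiv ℂ Q (zq q) (polarVec q) (polarVec q) (polarVec q) with hd
  set G : (ℂ × ℂ) × (Fin 3 → ℂ) → Fin 3 → ℂ := fun q => centerTerm ρ σ (β q) (e q) q with hG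
  -- At E = 0 the radius vanishes, so B, R and the derivative of Q are evaluated at the origin,
  -- where they are analytic. Compactness of the annulus then gives one disc of energies for all
  -- angles.
  set Z : Set (ℂ × ℂ) := (Metric.closedBall (0 : ℂ) 2 \ Metric.ball (0 : ℂ) (1 / 2)) ×ˢ {0} with hZ
  have hZc : IsCompact Z :=
    ((isCompact_closedBall (0 : ℂ) 2).diff Metric.isOpen_ball).prod isCompact_singleton
  have hZ0 : ∀ x ∈ Z, x.1 ≠ 0 ∧ x.2 = 0 := by
    rintro x ⟨hx1, hx2⟩
    refine ⟨?_, hx2⟩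
    rintro h0
    apply hx1.2
    rw [h0]
    exact Metric.mem_ball_self (by norm_num)
  have hvec : ∀ x ∈ Z, ∀ W, AnalyticAt ℂ polarVec (x, W) := fun x hx W =>
    analyticAt_polarVec (hZ0 x hx).1
  have hz0 : ∀ x ∈ Z, ∀ W, zq (x, W) = 0 := by
    intro x hx W
    simp [hzq, polarRadius, (hZ0 x hx).2]
  have hzan : ∀ x ∈ Z, ∀ W, AnalyticAt ℂ zq (x, W) := fun x hx W =>
    (analyticAt_polarRadius _).smul (hvec x hx W)
  have hβan : ∀ x ∈ Z, ∀ W, AnalyticAt ℂ β (x, W) := by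
    intro x hx W
    have h1 : AnalyticAt ℂ (fun q => B (zq q)) (x, W) :=
      AnalyticAt.comp (g := B) (f := zq) (by rwa [hz0 x hx W]) (hzan x hx W)
    exact analyticAt_clm_apply (analyticAt_clm_apply h1 (hvec x hx W)) (hvec x hx W)
  have hean : ∀ x ∈ Z, ∀ W, AnalyticAt ℂ e (x, W) := by
    intro x hx W
    have h1 : AnalyticAt ℂ (fun q => R (zq q)) (x, W) :=
      AnalyticAt.comp (g := R) (f := zq) (by rwa [hz0 x hx W]) (hzan x hx W)
    exact (analyticAt_clm_apply (analyticAt_clm_apply (analyticAt_clm_apply h1 (hvec x hx W))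
      (hvec x hx W)) (hvec x hx W)).div analyticAt_const hb
  have hdan : ∀ x ∈ Z, ∀ W, AnalyticAt ℂ d (x, W) := by
    intro x hx W
    have h1 : AnalyticAt ℂ (fun q => fderiv ℂ Q (zq q)) (x, W) :=
      AnalyticAt.comp (g := fderiv ℂ Q) (f := zq) (by rw [hz0 x hx W]; exact hQ.fderiv)
        (hzan x hx W)
    exact analyticAt_clm_apply (analyticAt_clm_apply (analyticAt_clm_apply h1 (hvec x hx W))
      (hvec x hx W)) (hvec x hx W)
  have hGan : ∀ x ∈ Z, ∀ W, AnalyticAt ℂ G (x, W) := by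
    intro x hx W
    refine analyticAt_centerTerm (hβan x hx W) (hean x hx W) (hZ0 x hx).1 hσc ?_
    simpa [polarRadius, (hZ0 x hx).2] using hσ.ne'
  have hνan : ∀ x ∈ Z, ∀ W, AnalyticAt ℂ (fun q => angularPart (β q) q.1.1) (x, W) :=
    fun x hx W => (analyticAt_radialPart (hβan x hx W) (hZ0 x hx).1).2
  obtain ⟨δ₁, hδ₁, C₁, hC₁, hbd₁⟩ := exists_uniform_bounds hZc (K := κ)
    fun x hx W _ => hGan x hx W
  obtain ⟨δ₂, hδ₂, C₂, hC₂, hbd₂⟩ := exists_uniform_bounds hZc (K := κ)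
    (G := fun q => angularPart (β q) q.1.1) fun x hx W _ => hνan x hx W
  obtain ⟨δ₃, hδ₃, C₃, hC₃, hbd₃⟩ := exists_uniform_bounds hZc (K := κ)
    fun x hx W _ => hdan x hx W
  obtain ⟨δ₄, hδ₄, hev⟩ := Metric.eventually_nhds_iff_ball.1 (hYB.and (h.real.and
    (hQE.eventually_nhds.and (hRQ.and (h.en_invariant.and (h.en_real.and
      (h.en_analytic.eventually_analyticAt.and hQ.eventually_analyticAt)))))))
  -- Since |polarRadius| ≤ 2 |E| and ‖polarVec‖ ≤ 2, r · 4 ≤ δ₄ keeps the point in the ball of the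
  -- local expansions. The last three conditions bound the nonlinear terms by η, keep the angular
  -- speed away from zero, and keep the radial derivative of the energy away from zero.
  obtain ⟨r, hr, hr1, hr2, hr3, hr4, hr5, hr6, hr7⟩ : ∃ r > 0, r ≤ δ₁ ∧ r ≤ δ₂ ∧ r ≤ δ₃ ∧
      r * 4 ≤ δ₄ ∧ r * C₁ ≤ η ∧ r * (2 * C₂) ≤ σ / 2 ∧ r * (2 * C₃) ≤ ‖b‖ / 4 := by
    have ev : ∀ c d : ℝ, 0 < d → ∀ᶠ r in 𝓝[>] (0 : ℝ), r * c ≤ d := by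
      intro c d hd
      have : Tendsto (fun r : ℝ => r * c) (𝓝 0) (𝓝 (0 * c)) := tendsto_id.mul_const c
      rw [zero_mul] at this
      exact nhdsWithin_le_nhds ((this.eventually_lt_const hd).mono fun _ => le_of_lt)
    have h0 : ∀ᶠ r in 𝓝[>] (0 : ℝ), 0 < r := eventually_mem_nhdsWithin
    have hbn : 0 < ‖b‖ := norm_pos_iff.2 hb
    have := h0.and ((ev 1 δ₁ hδ₁).and ((ev 1 δ₂ hδ₂).and ((ev 1 δ₃ hδ₃).and
      ((ev 4 δ₄ hδ₄).and ((ev C₁ η hη).and ((ev (2 * C₂) (σ / 2) (by positivity)).and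
      (ev (2 * C₃) (‖b‖ / 4) (by positivity))))))))
    obtain ⟨r, h0, h1, h2, h3, h4, h5, h6, h7⟩ := Eventually.exists this
    exact ⟨r, h0, by simpa using h1, by simpa using h2, by simpa using h3, h4, h5, h6, h7⟩
  refine ⟨r, hr, β, e, G, fun _ => rfl, ?_⟩
  rintro ⟨p, E⟩ ⟨hp1, hp2, hE⟩ W hW
  simp only at hp1 hp2 hE
  have hp0 : p ≠ 0 := norm_pos_iff.1 (by linarith)
  have hnear : ∀ δ, r ≤ δ → ∃ z ∈ Z, dist (p, E) z ≤ δ := by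
    intro δ hδ
    refine ⟨(p, 0), ⟨⟨by simpa using hp2.le, by simpa using hp1.le⟩, rfl⟩, ?_⟩
    rw [Prod.dist_eq, dist_self, dist_zero_right]
    exact max_le (hr.le.trans hδ) (hE.le.trans hδ)
  have hW1 : ‖W‖ ≤ 1 := by linarith
  set q : (ℂ × ℂ) × (Fin 3 → ℂ) := ((p, E), W) with hq
  have hε : ‖polarRadius q‖ ≤ 2 * ‖E‖ := norm_polarRadius_le hW1
  have hv : ‖polarVec q‖ ≤ 2 := norm_polarVec_le hp1 hp2 hW1
  have hzb : zq q ∈ Metric.ball (0 : CPt) δ₄ := by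
    rw [mem_ball_zero_iff]
    simp only [hzq]
    rw [norm_smul]
    calc ‖polarRadius q‖ * ‖polarVec q‖ ≤ 2 * ‖E‖ * 2 := by gcongr
      _ < r * 4 := by linarith
      _ ≤ δ₄ := hr4
  obtain ⟨hY1, hY2, hE1, hR1, hI1, hER, hEa, hQa⟩ := hev _ hzb
  have hχ : (σ : ℂ) + polarRadius q * angularPart (β q) p ≠ 0 := by
    intro h0
    have h1 := (hbd₂ _ (hnear δ₂ hr2) W hW).2.1
    have h2 : (σ : ℂ) = -(polarRadius q * angularPart (β q) p) := by linear_combination h0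
    have h3 : σ = ‖polarRadius q‖ * ‖angularPart (β q) p‖ := by
      rw [← norm_mul, ← norm_neg, ← h2, Complex.norm_real, Real.norm_of_nonneg hσ.le]
    have h4 : ‖polarRadius q‖ * ‖angularPart (β q) p‖ ≤ 2 * ‖E‖ * C₂ := by gcongr
    nlinarith
  have hYz : Y (zq q) = polarRadius q • ((![-ρ * polarVec q 0, ρ * polarVec q 1,
      Complex.I * σ * polarVec q 2, -(Complex.I * σ) * polarVec q 3] : CPt) +
      polarRadius q • β q) := by
    rw [hY1, h.zero, zero_add, ← h.linear]
    simp only [hβ, hzq, map_smul, smul_apply, smul_add]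
  have hvv : Q 0 (polarVec q) (polarVec q) = b * (1 + a / b * (W 0 * W 1)) := by
    rw [hQ0]
    simp only [polarVec, hq, Matrix.cons_val]
    field_simp
    ring
  have hQvv : Q (zq q) (polarVec q) (polarVec q) =
      b * (1 + a / b * (W 0 * W 1) + polarRadius q * e q) := by
    rw [hR1]
    simp only [add_apply, hvv, he]
    have : R (zq q) (zq q) (polarVec q) (polarVec q) =
        polarRadius q * R (zq q) (polarVec q) (polarVec q) (polarVec q) := by
      conv_lhs => rw [show R (zq q) (zq q) = R (zq q) (polarRadius q • polarVec q) from rfl]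
      simp only [map_smul, smul_apply, smul_eq_mul]
    rw [this]
    field_simp
  have hEq : En (zq q) = b * polarRadius q ^ 2 *
      (1 + a / b * (W 0 * W 1) + polarRadius q * e q) := by
    rw [hE1.self_of_nhds]
    have : Q (zq q) (zq q) (zq q) = polarRadius q ^ 2 * Q (zq q) (polarVec q) (polarVec q) := by
      conv_lhs => rw [show Q (zq q) (zq q) (zq q) =
        Q (zq q) (polarRadius q • polarVec q) (polarRadius q • polarVec q) from rfl]
      simp only [map_smul, smul_apply, smul_eq_mul]
      ring
    rw [this, hQvv]
    ring
  refine ⟨⟨(hbd₁ _ (hnear δ₁ hr1) W hW).1, ?_, fun W' hW' => ?_⟩, ⟨hχ, hYz⟩,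
    ⟨hEa.differentiableAt, hI1, hEq, fun hmain hE0 hzero => ?_⟩, fun hpn hEr hE0 hWr => ?_⟩
  · calc ‖E‖ * ‖G q‖ ≤ r * C₁ := by
          gcongr
          exact (hbd₁ _ (hnear δ₁ hr1) W hW).2.1
      _ ≤ η := hr5
  · calc ‖E‖ * ‖G q - G ((p, E), W')‖ ≤ r * (C₁ * ‖W - W'‖) := by
          refine mul_le_mul hE.le ((hbd₁ _ (hnear δ₁ hr1) W hW).2.2 W' hW') (norm_nonneg _) hr.le
      _ = r * C₁ * ‖W - W'‖ := by ring
      _ ≤ η * ‖W - W'‖ := by gcongr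
  · -- the derivative of the energy in the radial direction
    have hm : ‖(1 : ℂ) + W 2‖ ≤ 2 :=
      (norm_add_le _ _).trans (by rw [norm_one]; linarith [(norm_le_pi_norm W 2).trans hW1])
    have hm0 : 1 + W 2 ≠ 0 := by
      intro h0
      rw [h0] at hmain
      simp at hmain
    have hε0 : polarRadius q ≠ 0 := mul_ne_zero hE0 hm0
    have hder := (hQa.differentiableAt.hasFDerivAt.clm_apply (hasFDerivAt_id (zq q))).clm_apply
      (hasFDerivAt_id (zq q))
    have hder2 := hder.congr_of_eventuallyEq hE1
    change fderiv ℂ En (zq q) (polarVec q) = 0 at hzero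
    rw [hder2.fderiv] at hzero
    simp only [add_apply, ContinuousLinearMap.comp_apply, ContinuousLinearMap.flip_apply,
      ContinuousLinearMap.id_apply, id_eq] at hzero
    have e1 : Q (zq q) (zq q) (polarVec q) = polarRadius q * Q (zq q) (polarVec q) (polarVec q) := by
      conv_lhs => rw [show Q (zq q) (zq q) = Q (zq q) (polarRadius q • polarVec q) from rfl]
      simp only [map_smul, smul_apply, smul_eq_mul]
    have e2 : Q (zq q) (polarVec q) (zq q) = polarRadius q * Q (zq q) (polarVec q) (polarVec q) := by
      conv_lhs => rw [show Q (zq q) (polarVec q) (zq q) =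
        Q (zq q) (polarVec q) (polarRadius q • polarVec q) from rfl]
      simp only [map_smul, smul_eq_mul]
    have e3 : fderiv ℂ Q (zq q) (polarVec q) (zq q) (zq q) = polarRadius q ^ 2 * d q := by
      conv_lhs => rw [show fderiv ℂ Q (zq q) (polarVec q) (zq q) (zq q) =
        fderiv ℂ Q (zq q) (polarVec q) (polarRadius q • polarVec q)
          (polarRadius q • polarVec q) from rfl]
      simp only [map_smul, smul_apply, smul_eq_mul, hd]
      ring
    rw [e1, e2, e3, hQvv] at hzero
    -- If the radial derivative vanished, the energy relation would turn it into ε d (1 + n)² = -2b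
    -- with ε the radius. The left side is at most 8 r C₃ ≤ |b|, a contradiction.
    have e4 : polarRadius q * d q * (1 + W 2) ^ 2 = -(2 * b) := by
      have h1 : polarRadius q * (polarRadius q * d q + 2 * (b * (1 + a / b * (W 0 * W 1) +
        polarRadius q * e q))) = 0 := by linear_combination hzero
      have h2 := (mul_eq_zero.1 h1).resolve_left hε0
      linear_combination (1 + W 2) ^ 2 * h2 - 2 * b * hmain
    have e5 : ‖d q‖ ≤ C₃ := (hbd₃ _ (hnear δ₃ hr3) W hW).2.1
    have e6 : 2 * ‖b‖ = ‖polarRadius q‖ * ‖d q‖ * ‖1 + W 2‖ ^ 2 := by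
      rw [← norm_pow, ← norm_mul, ← norm_mul, e4, norm_neg, norm_mul]
      norm_num
    have e7 : ‖polarRadius q‖ * ‖d q‖ * ‖1 + W 2‖ ^ 2 ≤ 2 * r * C₃ * 2 ^ 2 := by
      gcongr
      exact hε.trans (by linarith)
    have hbn : 0 < ‖b‖ := norm_pos_iff.2 hb
    linarith
  · -- reality
    have hm0 : 1 + W 2 ≠ 0 := by
      intro h0
      have h1 : W 2 = -1 := by linear_combination h0
      have h2 := (norm_le_pi_norm W 2).trans hW
      rw [h1, norm_neg, norm_one] at h2
      linarith
    have hε0 : polarRadius q ≠ 0 := mul_ne_zero hE0 hm0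
    have hεr : conj (polarRadius q) = polarRadius q := conj_polarRadius hEr hWr
    obtain ⟨ε, hεe⟩ := Complex.conj_eq_iff_real.1 hεr
    have hvr : polarVec q ∈ Set.range emb := polarVec_mem_range_emb hpn hWr
    have hzr : zq q ∈ Set.range emb := by
      simp only [hzq, hεe]
      exact real_smul_mem_range_emb ε hvr
    have hYr := hY2 hzr
    -- The nonlinear part β is recovered from the field by division by the square of the radius, so
    -- its reality is available only for E ≠ 0.
    have hβr : β q ∈ Set.range emb := by
      have h1 : ∀ i, polarRadius q ^ 2 * β q i = Y (zq q) i - polarRadius q *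
          (![-ρ * polarVec q 0, ρ * polarVec q 1,
            Complex.I * σ * polarVec q 2, -(Complex.I * σ) * polarVec q 3] : CPt) i := by
        intro i
        rw [hYz]
        simp only [Pi.smul_apply, Pi.add_apply, smul_eq_mul]
        ring
      have hε2 : polarRadius q ^ 2 ≠ 0 := pow_ne_zero 2 hε0
      rw [mem_range_emb_iff] at hYr hvr ⊢
      refine ⟨mul_left_cancel₀ hε2 ?_, mul_left_cancel₀ hε2 ?_, mul_left_cancel₀ hε2 ?_⟩
      · have h2 := congrArg conj (h1 0)
        rw [map_mul, map_pow, hεr] at h2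
        rw [h2, h1 0]
        simp [hYr.1, hvr.1, hεr]
      · have h2 := congrArg conj (h1 1)
        rw [map_mul, map_pow, hεr] at h2
        rw [h2, h1 1]
        simp [hYr.2.1, hvr.2.1, hεr]
      · have h2 := congrArg conj (h1 2)
        rw [map_mul, map_pow, hεr] at h2
        rw [h2, h1 3]
        simp [hYr.2.2, hvr.2.2, hεr]
    have her : conj (e q) = e q := by
      have h1 := hER hzr
      rw [hEq] at h1
      simp only [map_mul, map_pow, map_add, map_one, map_div₀, hbr, har, hεr, hWr 0, hWr 1] at h1
      have h2 := mul_left_cancel₀ (mul_ne_zero hb (pow_ne_zero 2 hε0)) h1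
      exact mul_left_cancel₀ hε0 (add_left_cancel h2)
    refine ⟨centerTerm_mem_realTriples hpn hEr hWr hβr her, ?_⟩
    have := (conj_radialPart hpn hβr).2
    change conj ((σ : ℂ) + polarRadius q * angularPart (β q) p) =
      (σ : ℂ) + polarRadius q * angularPart (β q) p
    rw [map_add, map_mul, hεr, this, Complex.conj_ofReal]

end

/-! ### The invariant graph over the center directions. -/

section

variable {Y : CPt → CPt} {En : CPt → ℂ} {ρ σ : ℝ} {a b : ℂ}

theorem energyStep_mem {α : ℂ} (hα : conj α = α) {W : Fin 3 → ℂ} (hW : W ∈ realTriples) :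
    conj (energyStep α W) = energyStep α W := by
  simp only [energyStep, map_mul, map_neg, map_div₀, map_one, map_ofNat, map_add, map_pow, hα,
    hW 0, hW 1, hW 2]

/-- The angular derivative of the surface splits into a multiple of `polarVec`, due to the change of
the radius, and the radius times `polarVel`. Together with `polar_decomposition` this shows that the
field is tangent to the surface up to a multiple of `polarVec`. -/
theorem fderiv_radius_smul_polarVec {W : ℂ × ℂ → Fin 3 → ℂ} {p E : ℂ} (hp : p ≠ 0)
    (hW : DifferentiableAt ℂ W (p, E)) {S U : ℂ}
    (hS : fderiv ℂ W (p, E) (Complex.I * p, 0) 0 = S)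
    (hU : fderiv ℂ W (p, E) (Complex.I * p, 0) 1 = U) :
    fderiv ℂ (fun x => polarRadius (x, W x) • polarVec (x, W x)) (p, E) (Complex.I * p, 0) =
      (E * fderiv ℂ W (p, E) (Complex.I * p, 0) 2) • polarVec ((p, E), W (p, E)) +
      polarRadius ((p, E), W (p, E)) • polarVel p S U := by
  have hWi := fun i => hasFDerivAt_pi'.1 hW.hasFDerivAt i
  have h1 : HasFDerivAt (fun x : ℂ × ℂ => x.1) (ContinuousLinearMap.fst ℂ ℂ ℂ) (p, E) :=
    hasFDerivAt_fst
  have h2 : HasFDerivAt (fun x : ℂ × ℂ => x.2) (ContinuousLinearMap.snd ℂ ℂ ℂ) (p, E) :=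
    hasFDerivAt_snd
  have h3 : HasFDerivAt (fun x => polarRadius (x, W x)) _ (p, E) := h2.mul ((hWi 2).const_add 1)
  have h5 : HasFDerivAt (fun x : ℂ × ℂ => x.1⁻¹)
      ((-(p ^ 2)⁻¹) • ContinuousLinearMap.fst ℂ ℂ ℂ) (p, E) :=
    (hasDerivAt_inv hp).comp_hasFDerivAt (p, E) h1
  have h4 : HasFDerivAt (fun x => polarVec (x, W x))
      (ContinuousLinearMap.pi ![(ContinuousLinearMap.proj 0).comp (fderiv ℂ W (p, E)),
        (ContinuousLinearMap.proj 1).comp (fderiv ℂ W (p, E)), ContinuousLinearMap.fst ℂ ℂ ℂ,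
        (-(p ^ 2)⁻¹) • ContinuousLinearMap.fst ℂ ℂ ℂ]) (p, E) := by
    refine hasFDerivAt_pi.2 fun i => ?_
    fin_cases i
    · exact hWi 0
    · exact hWi 1
    · exact h1
    · exact h5
  rw [(h3.fun_smul h4).fderiv]
  ext i
  fin_cases i
  · simp [polarVel, ← hS, polarRadius]; ring
  · simp [polarVel, ← hU, polarRadius]; ring
  · simp [polarVel, polarRadius]; ring
  · simp [polarVel, polarRadius]; field_simp; ring

/-- Over the center directions, in polar coordinates, the field has an invariant graph. -/
theorem SaddleCenterForm.exists_center_graph (h : SaddleCenterForm Y En ρ σ a b) (hσ : 0 < σ) :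
    ∃ r > 0, ∃ W : ℂ × ℂ → Fin 3 → ℂ, DifferentiableOn ℂ W (annulusDisc r) ∧
      (∀ x ∈ annulusDisc r, ‖W x‖ ≤ 1 / 2) ∧
      (∀ x ∈ annulusDisc r, x.2 = 0 → W x = 0) ∧
      ∀ x ∈ annulusDisc r, ‖x.1‖ = 1 → conj x.2 = x.2 → x.2 ≠ 0 → W x ∈ realTriples ∧
        ∃ χ : ℝ, Y (polarRadius (x, W x) • polarVec (x, W x)) = (χ : ℂ) •
          fderiv ℂ (fun x => polarRadius (x, W x) • polarVec (x, W x)) x (Complex.I * x.1, 0) := by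
  have hρ := h.rho_pos
  have hb := h.b_ne
  have hσc : (σ : ℂ) ≠ 0 := by exact_mod_cast hσ.ne'
  set α : ℂ := a / b with hα
  set κ : ℝ := 1 / (32 * (1 + ‖α‖)) with hκ
  have hαn := norm_nonneg α
  have hκ0 : 0 < κ := by positivity
  have hκ1 : κ ≤ 1 / 32 := by
    rw [hκ]
    apply one_div_le_one_div_of_le (by norm_num)
    linarith
  have hαr : conj α = α := by
    obtain ⟨Q, hQ, hQE, hQ0⟩ := h.en_quad
    have h1 := conj_quadratic_of_real hQ hQE h.en_real (v := ![0, 0, 1, 1])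
      (by rw [mem_range_emb_iff]; simp)
    have h2 := conj_quadratic_of_real hQ hQE h.en_real (v := ![1, 1, 0, 0])
      (by rw [mem_range_emb_iff]; simp)
    rw [hQ0] at h1 h2
    simp only [Matrix.cons_val, mul_one, mul_zero, zero_add, add_zero] at h1 h2
    rw [hα, map_div₀, h1, h2]
  have hc : 0 < ρ / σ := by positivity
  -- The bounds κ / 2 and κ ρ / σ make the ball of radius κ invariant, for the energy component and
  -- for the two Laplace integrals. The bounds 1 / 4 and ρ / (2σ) give the contraction factor 1 / 2;
  -- in the energy component the other 1 / 4 comes from `energyStep`.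
  set η : ℝ := min (min (κ / 2) (κ * (ρ / σ))) (min (1 / 4) (ρ / σ / 2)) with hηd
  have hη : 0 < η := by
    rw [hηd]
    refine lt_min (lt_min ?_ ?_) (lt_min ?_ ?_) <;> positivity
  have hη1 : η ≤ κ / 2 := (min_le_left _ _).trans (min_le_left _ _)
  have hη2 : η ≤ κ * (ρ / σ) := (min_le_left _ _).trans (min_le_right _ _)
  have hη3 : η ≤ 1 / 4 := (min_le_right _ _).trans (min_le_left _ _)
  have hη4 : η ≤ ρ / σ / 2 := (min_le_right _ _).trans (min_le_right _ _)
  obtain ⟨r, hr, β, e, G, hG, hmain⟩ := h.exists_polar_estimates hσ hκ1 hη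
  set Ω := annulusDisc r with hΩ
  have hΩo : IsOpen Ω := isOpen_annulusDisc r
  set c : ℂ := ((ρ / σ : ℝ) : ℂ) with hcd
  have hcre : 0 < c.re := by rw [hcd, Complex.ofReal_re]; exact hc
  set g : (ℂ × ℂ → Fin 3 → ℂ) → Fin 3 → ℂ × ℂ → ℂ := fun W j x => x.2 * G (x, W x) j with hg
  -- The component S contracts along the rotation and is determined by the past, hence the backward
  -- flow; U expands and is determined by the future. The third component solves no differential
  -- equation: it is given by the energy relation.
  set T : (ℂ × ℂ → Fin 3 → ℂ) → ℂ × ℂ → Fin 3 → ℂ := fun W x =>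
    ![flowIntegral c (rotFlow (-1)) (g W 0) x, -flowIntegral c (rotFlow 1) (g W 1) x,
      energyStep α (W x) + g W 2 x] with hT
  set S : Set (ℂ × ℂ) := {x | x ∈ Ω ∧ ‖x.1‖ = 1 ∧ conj x.2 = x.2 ∧ x.2 ≠ 0} with hS
  have hflow : ∀ d : ℝ, ∀ τ : ℝ, 0 ≤ τ → ∀ x ∈ Ω, rotFlow d τ x ∈ Ω :=
    fun d τ _ x hx => rotFlow_mem hx
  have hflowS : ∀ d : ℝ, ∀ τ : ℝ, ∀ x ∈ S, rotFlow d τ x ∈ S := by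
    rintro d τ x ⟨hx1, hx2, hx3, hx4⟩
    refine ⟨rotFlow_mem hx1, ?_, ?_, ?_⟩ <;> rw [rotFlow_apply]
    · simp [norm_exp_rot, hx2]
    · exact hx3
    · exact hx4
  have hgd : ∀ W ∈ holClass Ω κ S realTriples, ∀ j, DifferentiableOn ℂ (g W j) Ω := by
    intro W hW j x hx
    have h1 := (hmain x hx (W x) (hW.2.1 x hx)).1.1.differentiableAt
    have hWd := (hW.1 x hx).differentiableAt (hΩo.mem_nhds hx)
    have h2 : DifferentiableAt ℂ (fun x => G (x, W x)) x :=
      DifferentiableAt.comp (g := G) (f := fun x => (x, W x)) x h1 (differentiableAt_id.prodMk hWd)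
    exact (differentiableAt_snd.mul (differentiableAt_pi.1 h2 j)).differentiableWithinAt
  have hgb : ∀ W ∈ holClass Ω κ S realTriples, ∀ j, ∀ x ∈ Ω, ‖g W j x‖ ≤ η := by
    intro W hW j x hx
    have h1 := (hmain x hx (W x) (hW.2.1 x hx)).1.2.1
    simp only [hg, norm_mul]
    refine le_trans ?_ h1
    gcongr
    exact norm_le_pi_norm (G (x, W x)) j
  have hgl : ∀ W ∈ holClass Ω κ S realTriples, ∀ W' ∈ holClass Ω κ S realTriples, ∀ D : ℝ,
      (∀ x ∈ Ω, ‖W x - W' x‖ ≤ D) → ∀ j, ∀ x ∈ Ω, ‖g W j x - g W' j x‖ ≤ η * D := by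
    intro W hW W' hW' D hD j x hx
    have h1 := (hmain x hx (W x) (hW.2.1 x hx)).1.2.2 (W' x) (hW'.2.1 x hx)
    simp only [hg]
    rw [← mul_sub, norm_mul]
    refine (mul_le_mul_of_nonneg_left (norm_le_pi_norm (G (x, W x) - G (x, W' x)) j)
      (norm_nonneg _)).trans (h1.trans ?_)
    gcongr
    exact hD x hx
  have hgr : ∀ W ∈ holClass Ω κ S realTriples, ∀ j, ∀ x ∈ S, conj (g W j x) = g W j x := by
    intro W hW j x hx
    have h1 := ((hmain x hx.1 (W x) (hW.2.1 x hx.1)).2.2.2 hx.2.1 hx.2.2.1 hx.2.2.2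
      (hW.2.2 x hx)).1
    simp only [hg, map_mul, hx.2.2.1, h1 j]
  have hcr : conj c = c := Complex.conj_ofReal _
  obtain ⟨W, hW, hfix⟩ := exists_holomorphic_fixedPoint hΩo hκ0.le (S := S) (fun x hx => hx.1)
    isClosed_realTriples (by simp [realTriples]) T
    (by
      intro W hW
      refine ⟨?_, ?_, ?_⟩
      · refine differentiableOn_pi.2 fun j => ?_
        fin_cases j
        · exact differentiableOn_flowIntegral hcre hΩo (continuous_rotFlow _) (hflow _)
            (hgd W hW 0) (hgb W hW 0)
        · exact (differentiableOn_flowIntegral hcre hΩo (continuous_rotFlow _) (hflow _)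
            (hgd W hW 1) (hgb W hW 1)).neg
        · have hWi := fun i => differentiableOn_pi.1 hW.1 i
          exact (((hWi 2).pow 2).add (((differentiableOn_const α).mul
            ((hWi 0).mul (hWi 1))).mul (((hWi 2).const_add 1).pow 2))).const_mul _ |>.add
            (hgd W hW 2)
      · intro x hx
        rw [pi_norm_le_iff_of_nonneg hκ0.le]
        have hdiv : η / c.re ≤ κ := by
          rw [div_le_iff₀ hcre, hcd, Complex.ofReal_re]; exact hη2
        intro j
        fin_cases j
        · exact (norm_flowIntegral_le hcre (hflow _) (hgb W hW 0) hx).trans hdiv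
        · simp only [hT]
          refine (norm_neg _).le.trans ?_
          exact (norm_flowIntegral_le hcre (hflow _) (hgb W hW 1) hx).trans hdiv
        · refine (norm_add_le _ _).trans ?_
          have h1 := (energyStep_bounds α hκ (hW.2.1 x hx) (hW.2.1 x hx)).1
          linarith [hgb W hW 2 x hx]
      · intro x hx j
        fin_cases j
        · change conj (flowIntegral c (rotFlow (-1)) (g W 0) x) = _
          rw [conj_flowIntegral, hcr]
          exact flowIntegral_congr fun τ _ => hgr W hW 0 _ (hflowS _ τ x hx)
        · change conj (-flowIntegral c (rotFlow 1) (g W 1) x) = _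
          rw [map_neg, conj_flowIntegral, hcr]
          exact congrArg Neg.neg (flowIntegral_congr fun τ _ => hgr W hW 1 _ (hflowS _ τ x hx))
        · change conj (energyStep α (W x) + g W 2 x) = _
          rw [map_add, energyStep_mem hαr (hW.2.2 x hx), hgr W hW 2 x hx]
          rfl)
    (by
      intro W hW W' hW' D hD x hx
      have hD0 : 0 ≤ D := (norm_nonneg _).trans (hD x hx)
      have hdiv : η * D / c.re ≤ D / 2 := by
        rw [div_le_iff₀ hcre, hcd, Complex.ofReal_re]; nlinarith
      rw [pi_norm_le_iff_of_nonneg (by positivity)]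
      intro j
      fin_cases j
      · exact (norm_flowIntegral_sub_le hcre (continuous_rotFlow _) (hflow _)
          (hgd W hW 0).continuousOn (hgd W' hW' 0).continuousOn (hgb W hW 0) (hgb W' hW' 0)
          (hgl W hW W' hW' D hD 0) hx).trans hdiv
      · change ‖-flowIntegral c (rotFlow 1) (g W 1) x - -flowIntegral c (rotFlow 1) (g W' 1) x‖ ≤ _
        rw [neg_sub_neg, norm_sub_rev]
        exact (norm_flowIntegral_sub_le hcre (continuous_rotFlow _) (hflow _)
          (hgd W hW 1).continuousOn (hgd W' hW' 1).continuousOn (hgb W hW 1) (hgb W' hW' 1)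
          (hgl W hW W' hW' D hD 1) hx).trans hdiv
      · change ‖energyStep α (W x) + g W 2 x - (energyStep α (W' x) + g W' 2 x)‖ ≤ _
        rw [add_sub_add_comm]
        refine (norm_add_le _ _).trans ?_
        have h1 := (energyStep_bounds α hκ (hW.2.1 x hx) (hW'.2.1 x hx)).2
        have h2 := hgl W hW W' hW' D hD 2 x hx
        have h3 := hD x hx
        nlinarith)
  have hsmall : ∀ x ∈ Ω, ∀ i, ‖W x i‖ ≤ 1 / 32 := fun x hx i =>
    (norm_le_pi_norm (W x) i).trans ((hW.2.1 x hx).trans hκ1)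
  -- the energy relation
  have henergy : ∀ x ∈ Ω, (1 + W x 2) ^ 2 * (1 + α * (W x 0 * W x 1) +
      polarRadius (x, W x) * e (x, W x)) = 1 := by
    intro x hx
    have h1 := congrFun (hfix x hx) 2
    simp only [hT, hg, hG, Matrix.cons_val, energyStep, centerTerm] at h1
    have h2 : polarRadius (x, W x) = x.2 * (1 + W x 2) := rfl
    rw [h2]
    linear_combination -2 * h1
  refine ⟨r, hr, W, hW.1, fun x hx => (hW.2.1 x hx).trans (by linarith), ?_, ?_⟩
  · intro x hx hx0
    have hz : ∀ d : ℝ, ∀ j, flowIntegral c (rotFlow d) (g W j) x = 0 := by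
      intro d j
      have : flowIntegral c (rotFlow d) (g W j) x = flowIntegral c (rotFlow d) (fun _ => 0) x :=
        flowIntegral_congr fun τ _ => by simp [hg, rotFlow_apply, hx0]
      rw [this]
      simp [flowIntegral]
    have h0 : W x 0 = 0 := by rw [← hfix x hx]; exact hz _ 0
    have h1 : W x 1 = 0 := by
      rw [← hfix x hx]
      change -flowIntegral c (rotFlow 1) (g W 1) x = 0
      rw [hz, neg_zero]
    have h2 : W x 2 = 0 := by
      have h3 := congrFun (hfix x hx) 2
      simp only [hT, hg, Matrix.cons_val, energyStep, h0, hx0] at h3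
      have h4 : W x 2 * (2 + W x 2) = 0 := by linear_combination -2 * h3
      refine (mul_eq_zero.1 h4).resolve_right fun h5 => ?_
      have h6 := hsmall x hx 2
      rw [show W x 2 = -2 by linear_combination h5] at h6
      norm_num at h6
    ext j
    fin_cases j
    · exact h0
    · exact h1
    · exact h2
  · rintro ⟨p, E⟩ hx hp hE hE0
    have hxS : (p, E) ∈ S := ⟨hx, hp, hE, hE0⟩
    have hWr := hW.2.2 _ hxS
    have hp0 : p ≠ 0 := by rintro rfl; simp at hp
    obtain ⟨-, ⟨hχ, hYz⟩, ⟨hEd, hEY, hEq, hEne⟩, hreal⟩ := hmain _ hx (W (p, E)) (hW.2.1 _ hx)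
    refine ⟨hWr, ?_⟩
    obtain ⟨χ, hχe⟩ := Complex.conj_eq_iff_real.1 (hreal hp hE hE0 hWr).2
    refine ⟨χ, ?_⟩
    have hWd := (hW.1 _ hx).differentiableAt (hΩo.mem_nhds hx)
    have hgen : ∀ d : ℝ, rotGen d (p, E) = (d * Complex.I * p, 0) := fun d => by simp [rotGen]
    have hWi := fun i => hasFDerivAt_pi'.1 hWd.hasFDerivAt i
    have hD0 : fderiv ℂ W (p, E) (Complex.I * p, 0) 0 = -c * W (p, E) 0 + g W 0 (p, E) := by
      have h1 := fderiv_flowIntegral hcre hΩo (continuous_rotFlow (-1)) (hflow _) (hgd W hW 0)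
        (hgb W hW 0) (rotFlow_zero _) (rotFlow_add _) (hasDerivAt_rotFlow _) hx
      have h2 : HasFDerivAt (flowIntegral c (rotFlow (-1)) (g W 0)) _ (p, E) :=
        (hWi 0).congr_of_eventuallyEq (by
          filter_upwards [hΩo.mem_nhds hx] with y hy
          rw [← hfix y hy]; rfl)
      rw [h2.fderiv, hgen, show flowIntegral c (rotFlow (-1)) (g W 0) (p, E) = W (p, E) 0 by
        rw [← hfix _ hx]; rfl] at h1
      have h3 : (((-1 : ℝ) : ℂ) * Complex.I * p, (0 : ℂ)) = -(Complex.I * p, (0 : ℂ)) := by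
        ext <;> simp
      rw [h3, map_neg] at h1
      simp only [ContinuousLinearMap.comp_apply, ContinuousLinearMap.proj_apply] at h1
      linear_combination -h1
    have hD1 : fderiv ℂ W (p, E) (Complex.I * p, 0) 1 = c * W (p, E) 1 + g W 1 (p, E) := by
      have h1 := fderiv_flowIntegral hcre hΩo (continuous_rotFlow 1) (hflow _) (hgd W hW 1)
        (hgb W hW 1) (rotFlow_zero _) (rotFlow_add _) (hasDerivAt_rotFlow _) hx
      have h2 : HasFDerivAt (flowIntegral c (rotFlow 1) (g W 1)) _ (p, E) :=
        (hWi 1).neg.congr_of_eventuallyEq (by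
          filter_upwards [hΩo.mem_nhds hx] with y hy
          simp only [Pi.neg_apply]
          rw [← hfix y hy]
          exact (neg_neg _).symm)
      rw [h2.fderiv, hgen, show flowIntegral c (rotFlow 1) (g W 1) (p, E) = -W (p, E) 1 by
        rw [← hfix _ hx]; exact (neg_neg _).symm] at h1
      simp only [Complex.ofReal_one, one_mul, neg_apply,
        ContinuousLinearMap.comp_apply, ContinuousLinearMap.proj_apply] at h1
      linear_combination -h1
    have hX := fderiv_radius_smul_polarVec hp0 hWd hD0 hD1
    set z : CPt := polarRadius ((p, E), W (p, E)) • polarVec ((p, E), W (p, E)) with hz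
    set X : ℂ × ℂ → CPt := fun x => polarRadius (x, W x) • polarVec (x, W x) with hXd
    have hdec := polar_decomposition (ρ := ρ) hσc (β := β ((p, E), W (p, E)))
      (e := e ((p, E), W (p, E))) (q := ((p, E), W (p, E))) hp0 hχ
    have hcc : c = (ρ : ℂ) / σ := by rw [hcd]; push_cast; rfl
    rw [hdec] at hYz
    simp only [← hG, hχe] at hYz
    rw [hD0, hD1] at *
    -- The equation of the radius has not been used, so tangency is known only up to a term μ ·
    -- `polarVec`. The energy removes it: it is b E² on the surface, hence constant in the angle, it
    -- is invariant under the field, and its derivative along `polarVec` is not zero.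
    have hYμ : ∃ μ : ℂ, Y z = (χ : ℂ) • fderiv ℂ X (p, E) (Complex.I * p, 0) +
        μ • polarVec ((p, E), W (p, E)) := by
      refine ⟨polarRadius ((p, E), W (p, E)) * (polarRadius ((p, E), W (p, E)) *
        radialPart (β ((p, E), W (p, E))) p) - χ * (E * fderiv ℂ W (p, E) (Complex.I * p, 0) 2), ?_⟩
      rw [hYz, hX]
      simp only [hg, hcc]
      module
    obtain ⟨μ, hμ⟩ := hYμ
    have hXdiff : DifferentiableAt ℂ X (p, E) := by
      have h1 : AnalyticAt ℂ (fun q : (ℂ × ℂ) × (Fin 3 → ℂ) => polarRadius q • polarVec q)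
          ((p, E), W (p, E)) := (analyticAt_polarRadius _).smul (analyticAt_polarVec hp0)
      exact DifferentiableAt.comp (g := fun q : (ℂ × ℂ) × (Fin 3 → ℂ) => polarRadius q • polarVec q)
        (f := fun x => (x, W x)) (p, E) h1.differentiableAt (differentiableAt_id.prodMk hWd)
    have hconst : fderiv ℂ En z (fderiv ℂ X (p, E) (Complex.I * p, 0)) = 0 := by
      have h1 : HasFDerivAt (fun x => En (X x)) ((fderiv ℂ En z).comp (fderiv ℂ X (p, E))) (p, E) :=
        HasFDerivAt.comp (g := En) (f := X) (p, E) hEd.hasFDerivAt hXdiff.hasFDerivAt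
      have h2 : HasFDerivAt (fun x : ℂ × ℂ => b * x.2 ^ 2) _ (p, E) :=
        ((hasFDerivAt_snd (𝕜 := ℂ) (E := ℂ) (F := ℂ) (p := (p, E))).pow 2).const_mul b
      have h3 := h1.unique (h2.congr_of_eventuallyEq (by
        filter_upwards [hΩo.mem_nhds hx] with y hy
        have h4 := (hmain y hy (W y) (hW.2.1 y hy)).2.2.1.2.2.1
        have h5 := henergy y hy
        have h6 : polarRadius (y, W y) = y.2 * (1 + W y 2) := rfl
        simp only [hXd]
        rw [h4]
        calc b * polarRadius (y, W y) ^ 2 * (1 + a / b * (W y 0 * W y 1) +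
              polarRadius (y, W y) * e (y, W y)) = b * y.2 ^ 2 * ((1 + W y 2) ^ 2 *
              (1 + α * (W y 0 * W y 1) + polarRadius (y, W y) * e (y, W y))) := by
              rw [h6]; ring
          _ = b * y.2 ^ 2 := by rw [h5, mul_one]))
      have h7 := congrArg (fun L => L (Complex.I * p, 0)) h3
      simpa using h7
    have hμ0 : μ = 0 := by
      have h1 : fderiv ℂ En z (Y z) = 0 := hEY
      rw [hμ, map_add, map_smul, map_smul, hconst, smul_zero, zero_add, smul_eq_mul] at h1
      exact (mul_eq_zero.1 h1).resolve_right (hEne (henergy _ hx) hE0)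
    rw [hμ0, zero_smul, add_zero] at hμ
    exact hμ

end

/-! ### Small C¹ perturbations of a plane. -/

section

/-- A map that is `C¹` off the origin and whose derivative tends to zero there is `C¹`. -/
theorem contDiffOn_one_of_punctured {F : Type*} [NormedAddCommGroup F] [NormedSpace ℝ F] {f : ℂ → F}
    {r : ℝ} (hf : ∀ z ∈ Metric.ball (0 : ℂ) r, z ≠ 0 → ContDiffAt ℝ 1 f z)
    (h0 : HasFDerivAt f (0 : ℂ →L[ℝ] F) 0) (hlim : Tendsto (fderiv ℝ f) (𝓝[≠] 0) (𝓝 0)) :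
    ContDiffOn ℝ 1 f (Metric.ball 0 r) := by
  have hd : DifferentiableOn ℝ f (Metric.ball 0 r) := by
    intro z hz
    by_cases hz0 : z = 0
    · rw [hz0]; exact h0.differentiableAt.differentiableWithinAt
    · exact ((hf z hz hz0).differentiableAt one_ne_zero).differentiableWithinAt
  rw [show (1 : WithTop ℕ∞) = 0 + 1 by rfl, contDiffOn_succ_iff_fderiv_of_isOpen Metric.isOpen_ball]
  refine ⟨hd, by simp, contDiffOn_zero.2 fun z hz => ContinuousAt.continuousWithinAt ?_⟩
  by_cases hz0 : z = 0
  · rw [hz0]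
    rw [← h0.fderiv] at hlim
    exact continuousAt_iff_punctured_nhds.2 hlim
  · exact ((hf z hz hz0).fderiv_right (m := 0) le_rfl).continuousAt

/-- A small `C¹` perturbation of a linear isometric embedding of the plane. -/
theorem isInvariantManifold_of_plane {X : CPt → CPt} {E : Set CPt} {L : ℂ →L[ℝ] CPt} {f : ℂ → CPt}
    {r : ℝ} (hr : 0 < r) (hL : ∀ z, ‖L z‖ = ‖z‖) (hf : ContDiffOn ℝ 1 f (Metric.ball 0 r))
    (hf0 : f 0 = 0) (hdf : HasFDerivAt f (0 : ℂ →L[ℝ] CPt) 0)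
    (hreal : ∀ z ∈ Metric.ball (0 : ℂ) r, L z + f z ∈ Set.range emb) (hE : Set.range L = E)
    (hX : ∀ z ∈ Metric.ball (0 : ℂ) r,
      X (L z + f z) ∈ Set.range (fderiv ℝ (fun z => L z + f z) z)) :
    ∃ W, IsInvariantManifold X 0 E 2 1 W := by
  have hcont : ContinuousAt (fderiv ℝ f) 0 :=
    (hf.continuousOn_fderiv_of_isOpen Metric.isOpen_ball le_rfl).continuousAt
      (Metric.ball_mem_nhds 0 hr)
  -- Where the derivative of f is below 1 / 2, the sum of the isometry L and f expands and contracts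
  -- distances by at most a factor 2. So it is an embedding with injective derivative.
  obtain ⟨s, hs, hs1⟩ := Metric.eventually_nhds_iff_ball.1
    (hcont.norm.eventually_lt_const (u := 1 / 2) (by simp only [hdf.fderiv, norm_zero]; norm_num))
  set t := min r s with ht
  have ht0 : 0 < t := lt_min hr hs
  have htr : Metric.ball (0 : ℂ) t ⊆ Metric.ball 0 r := Metric.ball_subset_ball (min_le_left _ _)
  have hts : Metric.ball (0 : ℂ) t ⊆ Metric.ball 0 s := Metric.ball_subset_ball (min_le_right _ _)
  have hfd : ∀ z ∈ Metric.ball (0 : ℂ) t, DifferentiableAt ℝ f z := fun z hz =>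
    (hf.contDiffAt (Metric.isOpen_ball.mem_nhds (htr hz))).differentiableAt one_ne_zero
  have hlip : ∀ z ∈ Metric.ball (0 : ℂ) t, ∀ w ∈ Metric.ball (0 : ℂ) t,
      ‖f w - f z‖ ≤ 1 / 2 * ‖w - z‖ := fun z hz w hw =>
    (convex_ball (0 : ℂ) t).norm_image_sub_le_of_norm_fderiv_le hfd
      (fun z hz => (hs1 z (hts hz)).le) hz hw
  set e : EuclideanSpace ℝ (Fin 2) ≃ₗᵢ[ℝ] ℂ := Complex.orthonormalBasisOneI.repr.symm with he
  have hball : ∀ v, v ∈ Metric.ball (0 : EuclideanSpace ℝ (Fin 2)) t ↔ e v ∈ Metric.ball (0 : ℂ) t := by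
    intro v; simp
  set γ : EuclideanSpace ℝ (Fin 2) → CPt := fun v => L (e v) + f (e v) with hγ
  have hder : ∀ v ∈ Metric.ball (0 : EuclideanSpace ℝ (Fin 2)) t,
      HasFDerivAt γ ((L + fderiv ℝ f (e v)).comp (e : EuclideanSpace ℝ (Fin 2) →L[ℝ] ℂ)) v := by
    intro v hv
    have h1 : HasFDerivAt (fun z => L z + f z) (L + fderiv ℝ f (e v)) (e v) :=
      L.hasFDerivAt.add (hfd _ ((hball v).1 hv)).hasFDerivAt
    exact h1.comp v (e : EuclideanSpace ℝ (Fin 2) →L[ℝ] ℂ).hasFDerivAt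
  have hsurj : ∀ M : ℂ →L[ℝ] CPt,
      Set.range (M.comp (e : EuclideanSpace ℝ (Fin 2) →L[ℝ] ℂ)) = Set.range M := by
    intro M
    exact e.surjective.range_comp M
  refine ⟨_, γ, t, ht0, ?_, ?_, rfl, ?_, ?_, ?_, ?_⟩
  · have h1 : ContDiffOn ℝ 1 (fun z => L z + f z) (Metric.ball 0 t) :=
      L.contDiff.contDiffOn.add (hf.mono htr)
    exact h1.comp e.contDiff.contDiffOn fun v hv => (hball v).1 hv
  · have hdist : ∀ v ∈ Metric.ball (0 : EuclideanSpace ℝ (Fin 2)) t,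
        ∀ w ∈ Metric.ball (0 : EuclideanSpace ℝ (Fin 2)) t,
        1 / 2 * ‖v - w‖ ≤ ‖γ v - γ w‖ ∧ ‖γ v - γ w‖ ≤ 2 * ‖v - w‖ := by
      intro v hv w hw
      have h1 := hlip _ ((hball w).1 hw) _ ((hball v).1 hv)
      have h2 : ‖L (e v - e w)‖ = ‖v - w‖ := by rw [hL, ← map_sub, e.norm_map]
      have h3 : γ v - γ w = L (e v - e w) + (f (e v) - f (e w)) := by
        simp only [hγ, map_sub]; abel
      rw [← map_sub, e.norm_map] at h1
      rw [h3]
      constructor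
      · have := norm_sub_le_norm_add (L (e v - e w)) (f (e v) - f (e w))
        linarith
      · have := norm_add_le (L (e v - e w)) (f (e v) - f (e w))
        linarith [norm_nonneg (v - w)]
    have ha : AntilipschitzWith 2
        ((Metric.ball (0 : EuclideanSpace ℝ (Fin 2)) t).domRestrict γ) := by
      refine AntilipschitzWith.of_le_mul_dist fun v w => ?_
      have := (hdist v v.2 w w.2).1
      rw [Subtype.dist_eq, dist_eq_norm, dist_eq_norm]
      simp only [Set.domRestrict_apply, NNReal.coe_ofNat]
      linarith
    have hl : LipschitzWith 2
        ((Metric.ball (0 : EuclideanSpace ℝ (Fin 2)) t).domRestrict γ) := by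
      refine LipschitzWith.of_dist_le_mul fun v w => ?_
      have := (hdist v v.2 w w.2).2
      rw [Subtype.dist_eq, dist_eq_norm, dist_eq_norm]
      simpa using this
    exact (ha.isUniformEmbedding hl.uniformContinuous).isEmbedding
  · rintro _ ⟨v, hv, rfl⟩
    exact hreal _ (htr ((hball v).1 hv))
  · simp [hγ, hf0]
  · rw [(hder 0 (Metric.mem_ball_self ht0)).fderiv, hsurj, map_zero, hdf.fderiv, add_zero, hE]
  · intro v hv
    rw [(hder v hv).fderiv]
    refine ⟨?_, ?_⟩
    · rw [injective_iff_map_eq_zero]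
      intro w hw
      simp only [ContinuousLinearMap.comp_apply, add_apply] at hw
      have h1 : ‖fderiv ℝ f (e v) (e w)‖ ≤ 1 / 2 * ‖w‖ := by
        refine ((fderiv ℝ f (e v)).le_opNorm _).trans ?_
        have := (hs1 _ (hts ((hball v).1 hv))).le
        have h2 : ‖e w‖ = ‖w‖ := e.norm_map w
        rw [h2]
        gcongr
      have h2 : ‖L (e w)‖ = ‖w‖ := by rw [hL, e.norm_map]
      have h3 : L (e w) = -fderiv ℝ f (e v) (e w) := eq_neg_of_add_eq_zero_left hw
      rw [h3, norm_neg] at h2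
      have : ‖w‖ ≤ 0 := by linarith
      exact norm_le_zero_iff.1 this
    · rw [hsurj]
      have h1 : HasFDerivAt (fun z => L z + f z) (L + fderiv ℝ f (e v)) (e v) :=
        L.hasFDerivAt.add (hfd _ ((hball v).1 hv)).hasFDerivAt
      have := hX _ (htr ((hball v).1 hv))
      rwa [h1.fderiv] at this

end

/-! ### Functions of polar coordinates near the origin. -/

section

/-- Polar coordinates of the plane. -/
def polarMap (z : ℂ) : ℂ × ℂ := (z / (‖z‖ : ℂ), (‖z‖ : ℂ))

theorem norm_polarMap_fst {z : ℂ} (hz : z ≠ 0) : ‖(polarMap z).1‖ = 1 := by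
  simp [polarMap, hz]

theorem polarMap_mem {z : ℂ} {r : ℝ} (hz : z ≠ 0) (hr : ‖z‖ < r) : polarMap z ∈ annulusDisc r := by
  refine ⟨?_, ?_, ?_⟩
  · rw [norm_polarMap_fst hz]; norm_num
  · rw [norm_polarMap_fst hz]; norm_num
  · simpa [polarMap] using hr

/-- The derivative of z / ‖z‖ is of order 1 / ‖z‖; it is bounded after multiplication by ‖z‖, the
weight that occurs in `contDiff_polar_remainder`. The value on i z expresses that rotations act on
the angle alone. -/
theorem hasFDerivAt_polarMap {z : ℂ} (hz : z ≠ 0) :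
    ∃ A : ℂ →L[ℝ] ℂ × ℂ, HasFDerivAt polarMap A z ∧ ContDiffAt ℝ 1 polarMap z ∧
      A (Complex.I * z) = (Complex.I * (polarMap z).1, 0) ∧
      ∀ v, ‖(A v).2‖ ≤ ‖v‖ ∧ ‖z‖ * ‖(A v).1‖ ≤ 2 * ‖v‖ := by
  have hz0 : ‖z‖ ≠ 0 := norm_ne_zero_iff.2 hz
  have hzc : (‖z‖ : ℂ) ≠ 0 := by exact_mod_cast hz0
  have hn1 : ContDiffAt ℝ 1 (fun z : ℂ => (‖z‖ : ℂ)) z :=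
    Complex.ofRealCLM.contDiff.contDiffAt.comp z (contDiffAt_norm ℝ hz)
  have hc : ContDiffAt ℝ 1 polarMap z := by
    have h1 : ContDiffAt ℝ 1 (fun z : ℂ => z / (‖z‖ : ℂ)) z := by
      simp only [div_eq_mul_inv]
      exact contDiffAt_id.mul (hn1.inv hzc)
    exact h1.prodMk hn1
  have hA := (hc.differentiableAt one_ne_zero).hasFDerivAt
  set A := fderiv ℝ polarMap z with hAd
  have hN : HasFDerivAt (fun z : ℂ => ‖z‖) (fderiv ℝ (fun z : ℂ => ‖z‖) z) z :=
    ((contDiffAt_norm (n := 1) ℝ hz).differentiableAt one_ne_zero).hasFDerivAt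
  set N := fderiv ℝ (fun z : ℂ => ‖z‖) z with hNd
  have hNb : ∀ v, ‖(N v : ℂ)‖ ≤ ‖v‖ := by
    intro v
    rw [Complex.norm_real]
    have h1 : ‖N‖ ≤ (1 : NNReal) := norm_fderiv_le_of_lipschitz ℝ lipschitzWith_one_norm
    have h2 := N.le_opNorm v
    calc ‖N v‖ ≤ ‖N‖ * ‖v‖ := h2
      _ ≤ 1 * ‖v‖ := by gcongr; simpa using h1
      _ = ‖v‖ := one_mul _
  have h2 : ∀ v, (A v).2 = N v := by
    intro v
    have e1 : HasFDerivAt (fun z => (polarMap z).2) ((ContinuousLinearMap.snd ℝ ℂ ℂ).comp A) z :=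
      hA.snd
    have e2 : HasFDerivAt (fun z => (polarMap z).2) (Complex.ofRealCLM.comp N) z :=
      Complex.ofRealCLM.hasFDerivAt.comp z hN
    exact congrArg (fun L => L v) (e1.unique e2)
  have h1 : ∀ v, (‖z‖ : ℂ) * (A v).1 = v - (polarMap z).1 * N v := by
    intro v
    have e1 : HasFDerivAt (fun z => (polarMap z).1) ((ContinuousLinearMap.fst ℝ ℂ ℂ).comp A) z :=
      hA.fst
    have e2 := (Complex.ofRealCLM.hasFDerivAt.comp z hN).mul' e1
    have e3 : HasFDerivAt (fun w : ℂ => w) _ z := e2.congr_of_eventuallyEq (by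
      filter_upwards [isOpen_ne.mem_nhds hz] with w hw
      have : (‖w‖ : ℂ) ≠ 0 := by exact_mod_cast norm_ne_zero_iff.2 hw
      simp [polarMap]
      field_simp)
    have e4 := congrArg (fun L => L v) (e3.unique (hasFDerivAt_id z))
    simp at e4
    linear_combination e4
  have hI : N (Complex.I * z) = 0 := by
    have e1 : HasDerivAt (fun t : ℝ => Complex.exp (t * Complex.I) * z) (Complex.I * z) 0 := by
      have : HasDerivAt (fun t : ℝ => Complex.exp (t * Complex.I)) Complex.I 0 := by
        have h3 : HasDerivAt (fun t : ℝ => (t : ℂ) * Complex.I) Complex.I 0 := by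
          simpa using (Complex.ofRealCLM.hasDerivAt (x := (0 : ℝ))).mul_const Complex.I
        simpa using h3.cexp
      exact this.mul_const z
    have e2 : HasDerivAt (fun t : ℝ => ‖Complex.exp (t * Complex.I) * z‖) (N (Complex.I * z)) 0 :=
      HasFDerivAt.comp_hasDerivAt_of_eq (0 : ℝ) hN e1 (by simp)
    have e3 : (fun t : ℝ => ‖Complex.exp (t * Complex.I) * z‖) = fun _ => ‖z‖ := by
      ext t; rw [norm_mul, Complex.norm_exp_ofReal_mul_I, one_mul]
    rw [e3] at e2
    exact e2.unique (hasDerivAt_const _ _)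
  refine ⟨A, hA, hc, ?_, fun v => ⟨by rw [h2]; exact hNb v, ?_⟩⟩
  · ext
    · have := h1 (Complex.I * z)
      rw [hI] at this
      simp only [Complex.ofReal_zero, mul_zero, sub_zero] at this
      simp only [polarMap]
      field_simp
      linear_combination this
    · rw [h2, hI]; simp
  · have e1 : ‖z‖ * ‖(A v).1‖ = ‖(‖z‖ : ℂ) * (A v).1‖ := by simp
    rw [e1, h1]
    refine (norm_sub_le _ _).trans ?_
    rw [norm_mul, norm_polarMap_fst hz, one_mul]
    linarith [hNb v]

/-- A vector function of polar coordinates that vanishes at the radius zero. -/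
theorem contDiff_polar_remainder {κ : ℂ × ℂ → CPt} {r : ℝ} (hr : 0 < r)
    (hκ : DifferentiableOn ℂ κ (annulusDisc r)) (hκ0 : ∀ x ∈ annulusDisc r, x.2 = 0 → κ x = 0) :
    ContDiffOn ℝ 1 (fun z : ℂ => (‖z‖ : ℂ) • κ (polarMap z)) (Metric.ball 0 r) ∧
      HasFDerivAt (fun z : ℂ => (‖z‖ : ℂ) • κ (polarMap z)) (0 : ℂ →L[ℝ] CPt) 0 := by
  have hΩ := isOpen_annulusDisc r
  have hC := contDiffOn_one_of_differentiableOn hΩ hκ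
  have hdκ : ContinuousOn (fderiv ℂ κ) (annulusDisc r) :=
    hC.continuousOn_fderiv_of_isOpen hΩ le_rfl
  -- the function that bounds the derivative
  set k : ℂ × ℂ → ℝ := fun x => ‖κ x‖ +
    2 * ‖(fderiv ℂ κ x).comp (ContinuousLinearMap.inl ℂ ℂ ℂ)‖ + ‖x.2‖ * ‖fderiv ℂ κ x‖ with hk
  have hkc : ContinuousOn k (annulusDisc r) :=
    (hκ.continuousOn.norm.add ((hdκ.clm_comp continuousOn_const).norm.const_smul (2 : ℝ))).add
      (continuous_snd.norm.continuousOn.mul hdκ.norm)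
  -- As κ vanishes on E = 0, so does its derivative in p, the only one that meets the singular
  -- derivative of z / ‖z‖. The full derivative carries the factor |E|.
  have hk0 : ∀ x ∈ annulusDisc r, x.2 = 0 → k x = 0 := by
    rintro ⟨p, E⟩ hx hE
    simp only at hE
    subst hE
    have h1 : HasFDerivAt (fun p => κ (p, 0))
        ((fderiv ℂ κ (p, 0)).comp (ContinuousLinearMap.inl ℂ ℂ ℂ)) p :=
      ((hκ _ hx).differentiableAt (hΩ.mem_nhds hx)).hasFDerivAt.comp p (hasFDerivAt_prodMk_left p 0)
    have h2 : HasFDerivAt (fun p => κ (p, 0)) (0 : ℂ →L[ℂ] CPt) p := by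
      refine (hasFDerivAt_const (0 : CPt) p).congr_of_eventuallyEq ?_
      have : Tendsto (fun p : ℂ => (p, (0 : ℂ))) (𝓝 p) (𝓝 (p, 0)) :=
        (Continuous.tendsto (by fun_prop) p)
      filter_upwards [this (hΩ.mem_nhds hx)] with q hq
      exact hκ0 _ hq rfl
    simp [hk, hκ0 _ hx rfl, h1.unique h2]
  -- z / ‖z‖ has no limit at the origin, so continuity alone does not suffice; uniform continuity on
  -- the circle times a closed disc gives the limit uniformly in the angle.
  have hkt : Tendsto (fun z => k (polarMap z)) (𝓝[≠] 0) (𝓝 0) := by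
    set Z : Set (ℂ × ℂ) := Metric.sphere (0 : ℂ) 1 ×ˢ Metric.closedBall (0 : ℂ) (r / 2) with hZ
    have hZc : IsCompact Z := (isCompact_sphere _ _).prod (isCompact_closedBall _ _)
    have hZs : Z ⊆ annulusDisc r := by
      rintro ⟨p, E⟩ ⟨h1, h2⟩
      simp only [mem_sphere_iff_norm, sub_zero, mem_closedBall_zero_iff] at h1 h2
      refine ⟨?_, ?_, ?_⟩
      · simp only [h1]; norm_num
      · simp only [h1]; norm_num
      · simp only; linarith
    have hu := hZc.uniformContinuousOn_of_continuous (hkc.mono hZs)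
    rw [Metric.uniformContinuousOn_iff] at hu
    rw [Metric.tendsto_nhdsWithin_nhds]
    intro ε hε
    obtain ⟨δ, hδ, hδu⟩ := hu ε hε
    refine ⟨min δ (r / 2), lt_min hδ (by positivity), fun z hz hzd => ?_⟩
    have hz : z ≠ 0 := hz
    rw [dist_zero_right] at hzd
    have h1 : polarMap z ∈ Z := ⟨by simpa using norm_polarMap_fst hz,
      by simpa [polarMap] using (hzd.trans_le (min_le_right _ _)).le⟩
    have h2 : ((polarMap z).1, (0 : ℂ)) ∈ Z := ⟨h1.1, Metric.mem_closedBall_self (by positivity)⟩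
    have h3 := hδu _ h1 _ h2 (by
      rw [Prod.dist_eq, dist_self, dist_zero_right]
      simpa [polarMap, hδ] using hzd.trans_le (min_le_left _ _))
    rwa [hk0 _ (hZs h2) rfl] at h3
  set f : ℂ → CPt := fun z : ℂ => (‖z‖ : ℂ) • κ (polarMap z) with hf
  have hball : ∀ z ∈ Metric.ball (0 : ℂ) r, z ≠ 0 → polarMap z ∈ annulusDisc r := fun z hz hz0 =>
    polarMap_mem hz0 (by simpa using hz)
  have hfc : ∀ z ∈ Metric.ball (0 : ℂ) r, z ≠ 0 → ContDiffAt ℝ 1 f z := by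
    intro z hz hz0
    have hn1 : ContDiffAt ℝ 1 (fun z : ℂ => (‖z‖ : ℂ)) z :=
      Complex.ofRealCLM.contDiff.contDiffAt.comp z (contDiffAt_norm ℝ hz0)
    have h1 : ContDiffAt ℝ 1 κ (polarMap z) :=
      ((hC _ (hball z hz hz0)).contDiffAt (hΩ.mem_nhds (hball z hz hz0))).restrict_scalars ℝ
    obtain ⟨A, -, hA, -⟩ := hasFDerivAt_polarMap hz0
    exact hn1.smul (h1.comp z hA)
  have hfd : ∀ z ∈ Metric.ball (0 : ℂ) r, z ≠ 0 → ‖fderiv ℝ f z‖ ≤ k (polarMap z) := by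
    intro z hz hz0
    obtain ⟨A, hA, -, -, hAb⟩ := hasFDerivAt_polarMap hz0
    have h1 := ((hκ _ (hball z hz hz0)).differentiableAt
      (hΩ.mem_nhds (hball z hz hz0))).hasFDerivAt.restrictScalars ℝ
    have h2 : HasFDerivAt (fun z => κ (polarMap z)) _ z := h1.comp z hA
    have h3 : HasFDerivAt (fun z : ℂ => (‖z‖ : ℂ)) ((ContinuousLinearMap.snd ℝ ℂ ℂ).comp A) z :=
      hA.snd
    rw [(h3.fun_smul h2).fderiv]
    have hk1 : 0 ≤ k (polarMap z) := by simp only [hk]; positivity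
    refine ContinuousLinearMap.opNorm_le_bound _ hk1 fun v => ?_
    obtain ⟨b1, b2⟩ := hAb v
    set D := fderiv ℂ κ (polarMap z) with hD
    have e1 : D (A v) = (D.comp (ContinuousLinearMap.inl ℂ ℂ ℂ)) (A v).1 +
        D (0, (A v).2) := by
      rw [ContinuousLinearMap.comp_apply, ← map_add]
      simp
    have e2 : ‖(D.comp (ContinuousLinearMap.inl ℂ ℂ ℂ)) (A v).1‖ ≤
      ‖D.comp (ContinuousLinearMap.inl ℂ ℂ ℂ)‖ * ‖(A v).1‖ := ContinuousLinearMap.le_opNorm _ _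
    have e3 : ‖D (0, (A v).2)‖ ≤ ‖D‖ * ‖v‖ := by
      refine (D.le_opNorm _).trans ?_
      gcongr
      simpa [Prod.norm_def] using b1
    have e4 : ‖(polarMap z).2‖ = ‖z‖ := by simp [polarMap]
    change ‖(‖z‖ : ℂ) • D (A v) + (A v).2 • κ (polarMap z)‖ ≤ _
    refine (norm_add_le _ _).trans ?_
    rw [norm_smul, norm_smul, Complex.norm_real, norm_norm, e1]
    have e5 := norm_add_le ((D.comp (ContinuousLinearMap.inl ℂ ℂ ℂ)) (A v).1) (D (0, (A v).2))
    simp only [hk, e4, ← hD]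
    set c := ‖D.comp (ContinuousLinearMap.inl ℂ ℂ ℂ)‖
    have hc : 0 ≤ c := norm_nonneg _
    calc ‖z‖ * ‖(D.comp (ContinuousLinearMap.inl ℂ ℂ ℂ)) (A v).1 + D (0, (A v).2)‖ +
          ‖(A v).2‖ * ‖κ (polarMap z)‖
        ≤ ‖z‖ * (c * ‖(A v).1‖ + ‖D‖ * ‖v‖) + ‖v‖ * ‖κ (polarMap z)‖ := by
          gcongr
          exact e5.trans (add_le_add e2 e3)
      _ = c * (‖z‖ * ‖(A v).1‖) + ‖z‖ * ‖D‖ * ‖v‖ + ‖v‖ * ‖κ (polarMap z)‖ := by ring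
      _ ≤ c * (2 * ‖v‖) + ‖z‖ * ‖D‖ * ‖v‖ + ‖v‖ * ‖κ (polarMap z)‖ := by gcongr
      _ = _ := by ring
  have hev : ∀ᶠ z in 𝓝[≠] (0 : ℂ), z ∈ Metric.ball (0 : ℂ) r ∧ z ≠ 0 :=
    (eventually_nhdsWithin_of_eventually_nhds (Metric.ball_mem_nhds (0 : ℂ) hr)).and
      eventually_mem_nhdsWithin
  have h0 : HasFDerivAt f (0 : ℂ →L[ℝ] CPt) 0 := by
    rw [hasFDerivAt_iff_isLittleO_nhds_zero, Asymptotics.isLittleO_iff]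
    intro c hc
    have h1 := hkt.eventually_lt_const hc
    rw [eventually_nhdsWithin_iff] at h1
    filter_upwards [h1] with z hz
    by_cases hz0 : z = 0
    · simp [hz0, hf]
    · have h2 : ‖κ (polarMap z)‖ ≤ c := by
        refine le_trans ?_ (hz hz0).le
        simp only [hk]
        have := norm_nonneg (fderiv ℂ κ (polarMap z))
        have := norm_nonneg ((fderiv ℂ κ (polarMap z)).comp (ContinuousLinearMap.inl ℂ ℂ ℂ))
        have := mul_nonneg (norm_nonneg (polarMap z).2) (norm_nonneg (fderiv ℂ κ (polarMap z)))
        linarith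
      simp only [zero_add, hf, norm_zero, Complex.ofReal_zero, zero_smul, sub_zero,
        zero_apply, norm_smul, Complex.norm_real, norm_norm]
      rw [mul_comm]
      gcongr
  refine ⟨contDiffOn_one_of_punctured hfc h0 ?_, h0⟩
  exact squeeze_zero_norm' (hev.mono fun z hz => hfd z hz.1 hz.2) hkt

end

/-! ### The center manifold of the normal form. -/

section

variable {Y : CPt → CPt} {En : CPt → ℂ} {ρ σ : ℝ} {a b : ℂ}

/-- The real plane of the center directions. -/
def centerPlane : ℂ →L[ℝ] CPt :=
  ContinuousLinearMap.pi ![0, 0, ContinuousLinearMap.id ℝ ℂ, Complex.conjCLE.toContinuousLinearMap]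

theorem centerPlane_apply (z : ℂ) : centerPlane z = ![0, 0, z, conj z] := by
  ext i
  fin_cases i <;> simp [centerPlane]

theorem norm_centerPlane (z : ℂ) : ‖centerPlane z‖ = ‖z‖ := by
  rw [centerPlane_apply]
  refine le_antisymm ?_ ?_
  · rw [pi_norm_le_iff_of_nonneg (norm_nonneg z)]
    intro i
    fin_cases i <;> simp
  · exact norm_le_pi_norm (![0, 0, z, conj z] : CPt) 2

/-- The square of the linear part is ρ² on the hyperbolic plane and -σ² on the center plane, and ρ²
+ σ² ≠ 0 separates the two. -/
theorem SaddleCenterForm.range_centerPlane (h : SaddleCenterForm Y En ρ σ a b) (hσ : 0 < σ) :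
    Set.range centerPlane = {v | v ∈ Set.range emb ∧
      fderiv ℂ Y 0 (fderiv ℂ Y 0 v) = (-σ ^ 2 : ℂ) • v} := by
  have hne : (ρ : ℂ) ^ 2 + σ ^ 2 ≠ 0 := by
    have := h.rho_pos
    have h1 : 0 < ρ ^ 2 + σ ^ 2 := by positivity
    exact_mod_cast h1.ne'
  ext v
  constructor
  · rintro ⟨z, rfl⟩
    rw [centerPlane_apply]
    refine ⟨by rw [mem_range_emb_iff]; simp, ?_⟩
    rw [h.linear, h.linear]
    ext i
    fin_cases i
    · simp
    · simp
    · simp; linear_combination (σ : ℂ) ^ 2 * z * Complex.I_sq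
    · simp; linear_combination (σ : ℂ) ^ 2 * conj z * Complex.I_sq
  · rintro ⟨hv, hv2⟩
    rw [h.linear, h.linear] at hv2
    rw [mem_range_emb_iff] at hv
    have e0 := congrFun hv2 0
    have e1 := congrFun hv2 1
    simp at e0 e1
    have h0 : v 0 = 0 := (mul_eq_zero.1 (show ((ρ : ℂ) ^ 2 + σ ^ 2) * v 0 = 0 by
      linear_combination e0)).resolve_left hne
    have h1 : v 1 = 0 := (mul_eq_zero.1 (show ((ρ : ℂ) ^ 2 + σ ^ 2) * v 1 = 0 by
      linear_combination e1)).resolve_left hne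
    refine ⟨v 2, ?_⟩
    rw [centerPlane_apply]
    ext i
    fin_cases i
    · exact h0.symm
    · exact h1.symm
    · rfl
    · exact hv.2.2.symm

/-- A saddle-center has a center manifold. -/
theorem SaddleCenterForm.exists_centerSurface (h : SaddleCenterForm Y En ρ σ a b) (hσ : 0 < σ) :
    ∃ W, IsCenterSurface Y 0 σ W := by
  obtain ⟨r, hr, W, hWd, hWb, hW0, hW⟩ := h.exists_center_graph hσ
  have hΩ := isOpen_annulusDisc r
  set X : ℂ × ℂ → CPt := fun x => polarRadius (x, W x) • polarVec (x, W x) with hX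
  -- κ is the deviation of the surface from the center plane divided by the scaled energy E, which
  -- is the modulus |z|. It vanishes at E = 0 because W does, and this is what makes the surface C¹
  -- and tangent to the plane at the origin.
  set κ : ℂ × ℂ → CPt := fun x => (1 + W x 2) • polarVec (x, W x) - ![0, 0, x.1, x.1⁻¹] with hκ
  have hp0 : ∀ x ∈ annulusDisc r, x.1 ≠ 0 := fun x hx => norm_pos_iff.1 (by linarith [hx.1])
  have hvd : ∀ x ∈ annulusDisc r, DifferentiableAt ℂ (fun x => polarVec (x, W x)) x := by
    intro x hx
    have hWx := (hWd x hx).differentiableAt (hΩ.mem_nhds hx)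
    exact DifferentiableAt.comp (g := polarVec) (f := fun x => (x, W x)) x
      (analyticAt_polarVec (hp0 x hx)).differentiableAt (differentiableAt_id.prodMk hWx)
  have hWi : ∀ x ∈ annulusDisc r, ∀ i, DifferentiableAt ℂ (fun x => W x i) x := fun x hx =>
    differentiableAt_pi.1 ((hWd x hx).differentiableAt (hΩ.mem_nhds hx))
  have hκd : DifferentiableOn ℂ κ (annulusDisc r) := by
    intro x hx
    have h1 : DifferentiableAt ℂ (fun x : ℂ × ℂ => (![0, 0, x.1, x.1⁻¹] : CPt)) x := by
      refine differentiableAt_pi.2 fun i => ?_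
      fin_cases i
      · exact differentiableAt_const _
      · exact differentiableAt_const _
      · exact differentiableAt_fst
      · exact differentiableAt_fst.inv (hp0 x hx)
    exact ((((hWi x hx 2).const_add 1).smul (hvd x hx)).sub h1).differentiableWithinAt
  have hκ0 : ∀ x ∈ annulusDisc r, x.2 = 0 → κ x = 0 := by
    intro x hx hx2
    simp only [hκ, hW0 x hx hx2, polarVec]
    ext i
    fin_cases i <;> simp
  obtain ⟨hC, hD⟩ := contDiff_polar_remainder hr hκd hκ0
  have hXd : ∀ x ∈ annulusDisc r, DifferentiableAt ℂ X x := fun x hx =>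
    (differentiableAt_snd.mul ((hWi x hx 2).const_add 1)).smul (hvd x hx)
  have hsum : ∀ z : ℂ, centerPlane z + (‖z‖ : ℂ) • κ (polarMap z) = X (polarMap z) := by
    intro z
    by_cases hz : z = 0
    · simp [hz, hX, polarMap, polarRadius]
    have hzc : (‖z‖ : ℂ) ≠ 0 := by exact_mod_cast norm_ne_zero_iff.2 hz
    have h1 : centerPlane z = (‖z‖ : ℂ) • (![0, 0, (polarMap z).1, (polarMap z).1⁻¹] : CPt) := by
      rw [centerPlane_apply, ← conj_eq_inv_of_norm_one (norm_polarMap_fst hz)]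
      ext i
      fin_cases i
      · simp
      · simp
      · simp [polarMap]; field_simp
      · simp [polarMap]; field_simp
    rw [h1, ← smul_add]
    simp only [hκ, hX, polarRadius, add_sub_cancel, smul_smul]
    rfl
  have hmain : ∀ z ∈ Metric.ball (0 : ℂ) r, z ≠ 0 → W (polarMap z) ∈ realTriples ∧
      ∃ χ : ℝ, Y (X (polarMap z)) = (χ : ℂ) •
        fderiv ℂ X (polarMap z) (Complex.I * (polarMap z).1, 0) := by
    intro z hz hz0
    exact hW _ (polarMap_mem hz0 (by simpa using hz)) (norm_polarMap_fst hz0)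
      (Complex.conj_ofReal _) (by simpa [polarMap] using hz0)
  refine isInvariantManifold_of_plane hr norm_centerPlane hC (by simp) hD ?_
    (h.range_centerPlane hσ) ?_
  · intro z hz
    rw [hsum]
    by_cases hz0 : z = 0
    · rw [hz0, mem_range_emb_iff]
      simp [hX, polarMap, polarRadius]
    have hWr := (hmain z hz hz0).1
    have h1 : conj (polarRadius (polarMap z, W (polarMap z))) =
        polarRadius (polarMap z, W (polarMap z)) :=
      conj_polarRadius (p := (polarMap z).1) (E := (polarMap z).2) (Complex.conj_ofReal _) hWr
    obtain ⟨ε, hε⟩ := Complex.conj_eq_iff_real.1 h1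
    simp only [hX, hε]
    exact real_smul_mem_range_emb ε (polarVec_mem_range_emb (p := (polarMap z).1)
      (E := (polarMap z).2) (norm_polarMap_fst hz0) hWr)
  · intro z hz
    simp only [hsum]
    by_cases hz0 : z = 0
    · refine ⟨0, ?_⟩
      rw [map_zero, hz0]
      simp [hX, polarMap, polarRadius, h.zero]
    obtain ⟨χ, hχ⟩ := (hmain z hz hz0).2
    obtain ⟨A, hA, -, hAI, -⟩ := hasFDerivAt_polarMap hz0
    have hzm : polarMap z ∈ annulusDisc r := polarMap_mem hz0 (by simpa using hz)
    have h1 : HasFDerivAt (fun z => X (polarMap z)) _ z :=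
      ((hXd _ hzm).hasFDerivAt.restrictScalars ℝ).comp z hA
    refine ⟨χ • (Complex.I * z), ?_⟩
    rw [h1.fderiv, hχ, map_smul, ContinuousLinearMap.comp_apply, hAI]
    ext i
    simp

end

section

/-! ### Affine changes of coordinates -/

section Transport

variable {X : CPt → CPt} {P : CPt} (T : CPt ≃L[ℂ] CPt)

/-- The vector field `X` in the affine coordinates `z = P + T w`. -/
def pullField (X : CPt → CPt) (P : CPt) (w : CPt) : CPt := T.symm (X (P + T w))

theorem fderiv_pullField (hX : DifferentiableAt ℂ X P) (v : CPt) :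
    fderiv ℂ (pullField T X P) 0 v = T.symm (fderiv ℂ X P (T v)) := by
  have h1 : HasFDerivAt (fun w => P + T w) (T : CPt →L[ℂ] CPt) 0 :=
    T.hasFDerivAt.const_add P
  have h2 : HasFDerivAt X (fderiv ℂ X P) (P + T 0) := by simpa using hX.hasFDerivAt
  have h3 : HasFDerivAt (pullField T X P)
      ((T.symm : CPt →L[ℂ] CPt).comp ((fderiv ℂ X P).comp (T : CPt →L[ℂ] CPt))) 0 :=
    (T.symm : CPt →L[ℂ] CPt).hasFDerivAt.comp 0 (h2.comp 0 h1)
  rw [h3.fderiv]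
  rfl

theorem IsInvariantManifold.of_pull {E E' : Set CPt} {k : ℕ} {n : WithTop ℕ∞} {W : Set CPt}
    (hP : P ∈ Set.range emb) (hT : ∀ w ∈ Set.range emb, T w ∈ Set.range emb) (hn : n ≠ 0)
    (hE : T '' E = E') (h : IsInvariantManifold (pullField T X P) 0 E k n W) :
    IsInvariantManifold X P E' k n ((fun w => P + T w) '' W) := by
  obtain ⟨γ, r, hr, hγ, hγe, rfl, hγr, hγ0, hγE, hγX⟩ := h
  have hd : ∀ s ∈ Metric.ball (0 : EuclideanSpace ℝ (Fin k)) r,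
      HasFDerivAt (fun s => P + T (γ s))
        (((T : CPt →L[ℂ] CPt).restrictScalars ℝ).comp (fderiv ℝ γ s)) s := by
    intro s hs
    have h1 := ((hγ.contDiffAt (Metric.isOpen_ball.mem_nhds hs)).differentiableAt hn).hasFDerivAt
    exact (((T : CPt →L[ℂ] CPt).restrictScalars ℝ).hasFDerivAt.comp s h1).const_add P
  have hrange : ∀ L : EuclideanSpace ℝ (Fin k) →L[ℝ] CPt,
      Set.range (((T : CPt →L[ℂ] CPt).restrictScalars ℝ).comp L) = T '' Set.range L := by
    intro L
    exact Set.range_comp T L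
  refine ⟨fun s => P + T (γ s), r, hr, ?_, ?_, ?_, ?_, by simp [hγ0], ?_, ?_⟩
  · exact contDiffOn_const.add
      (((T : CPt →L[ℂ] CPt).restrictScalars ℝ).contDiff.comp_contDiffOn hγ)
  · have h1 : IsEmbedding (fun w : CPt => P + T w) :=
      (Homeomorph.addLeft P).isEmbedding.comp T.toHomeomorph.isEmbedding
    exact h1.comp hγe
  · rw [← Set.image_comp]; rfl
  · rintro _ ⟨w, hw, rfl⟩
    exact add_mem_range_emb hP (hT w (hγr hw))
  · rw [(hd 0 (Metric.mem_ball_self hr)).fderiv, hrange, hγE, hE]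
  · intro s hs
    rw [(hd s hs).fderiv]
    obtain ⟨h1, v, hv⟩ := hγX s hs
    refine ⟨?_, v, ?_⟩
    · exact T.injective.comp h1
    · change T (fderiv ℝ γ s v) = X (P + T (γ s))
      rw [hv]
      simp [pullField]

theorem IsStableCurve.of_pull {ρ : ℝ} {W : Set CPt} (hX : DifferentiableAt ℂ X P)
    (hP : P ∈ Set.range emb) (hT : ∀ w, T w ∈ Set.range emb ↔ w ∈ Set.range emb)
    (h : IsStableCurve (pullField T X P) 0 ρ W) :
    IsStableCurve X P ρ ((fun w => P + T w) '' W) := by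
  obtain ⟨h1, h2, h3⟩ := h
  have hPs : ∀ z, P + T (T.symm (z - P)) = z := fun z => by simp
  have hreal : ∀ z, z ∈ Set.range emb → T.symm (z - P) ∈ Set.range emb := by
    intro z hz
    rw [← hT, T.apply_symm_apply, sub_eq_add_neg]
    have : -P = ((-1 : ℝ) : ℂ) • P := by simp
    rw [this]
    exact add_mem_range_emb hz (real_smul_mem_range_emb _ hP)
  refine ⟨h1.of_pull T hP (fun w hw => (hT w).2 hw) (by simp) ?_, ?_, ?_⟩
  · ext v
    constructor
    · rintro ⟨w, ⟨hw, hw2⟩, rfl⟩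
      refine ⟨(hT w).2 hw, ?_⟩
      rw [fderiv_pullField T hX] at hw2
      rw [← T.apply_symm_apply (fderiv ℂ X P (T w)), hw2, map_smul]
    · rintro ⟨hv, hv2⟩
      refine ⟨T.symm v, ⟨(hT _).1 (by simpa using hv), ?_⟩, by simp⟩
      rw [fderiv_pullField T hX, T.apply_symm_apply, hv2, map_smul]
  · rintro _ ⟨w, hw, rfl⟩
    obtain ⟨z, hz0, hz, hzl⟩ := h2 w hw
    refine ⟨fun t => P + T (z t), by simp only [hz0], fun t ht => ⟨⟨z t, (hz t ht).1, rfl⟩, ?_⟩, ?_⟩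
    · have h4 := (((T : CPt →L[ℂ] CPt).restrictScalars ℝ).hasFDerivAt.comp_hasDerivWithinAt t
        (hz t ht).2).const_add P
      have h5 : T (pullField T X P (z t)) = X (P + T (z t)) := by simp [pullField]
      rw [← h5]
      exact h4
    · have h4 : Continuous fun w : CPt => P + T w := by fun_prop
      simpa [Function.comp_def] using (h4.tendsto 0).comp hzl
  · intro z hz hzl
    obtain ⟨t₀, ht₀⟩ := h3 (fun t => T.symm (z t - P)) (by
      intro t ht
      refine ⟨hreal _ (hz t ht).1, ?_⟩
      have h4 := ((T.symm : CPt →L[ℂ] CPt).restrictScalars ℝ).hasFDerivAt.comp_hasDerivWithinAt t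
        ((hz t ht).2.sub_const P)
      have h5 : pullField T X P (T.symm (z t - P)) = T.symm (X (z t)) := by
        rw [pullField, hPs]
      rw [h5]
      exact h4) (by
      have h4 : Continuous fun w : CPt => T.symm (w - P) := by fun_prop
      simpa [Function.comp_def] using (h4.tendsto P).comp hzl)
    exact ⟨t₀, fun t ht => ⟨_, ht₀ t ht, hPs _⟩⟩

theorem IsCenterSurface.of_pull {σ : ℝ} {W : Set CPt} (hX : DifferentiableAt ℂ X P)
    (hP : P ∈ Set.range emb) (hT : ∀ w, T w ∈ Set.range emb ↔ w ∈ Set.range emb)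
    (h : IsCenterSurface (pullField T X P) 0 σ W) :
    IsCenterSurface X P σ ((fun w => P + T w) '' W) := by
  refine IsInvariantManifold.of_pull T hP (fun w hw => (hT w).2 hw) one_ne_zero ?_ h
  ext v
  constructor
  · rintro ⟨w, ⟨hw, hw2⟩, rfl⟩
    refine ⟨(hT w).2 hw, ?_⟩
    rw [fderiv_pullField T hX, fderiv_pullField T hX, T.apply_symm_apply] at hw2
    rw [← T.apply_symm_apply (fderiv ℂ X P (fderiv ℂ X P (T w))), hw2, map_smul]
  · rintro ⟨hv, hv2⟩
    refine ⟨T.symm v, ⟨(hT _).1 (by simpa using hv), ?_⟩, by simp⟩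
    rw [fderiv_pullField T hX, fderiv_pullField T hX, T.apply_symm_apply, T.apply_symm_apply, hv2,
      map_smul]

end Transport

/-! ### The conjugation -/

/-- The conjugation whose fixed points are the real points. -/
def cj : CPt →L[ℝ] CPt :=
  ContinuousLinearMap.pi ![Complex.conjCLE.toContinuousLinearMap.comp (ContinuousLinearMap.proj 0),
    Complex.conjCLE.toContinuousLinearMap.comp (ContinuousLinearMap.proj 1),
    Complex.conjCLE.toContinuousLinearMap.comp (ContinuousLinearMap.proj 3),
    Complex.conjCLE.toContinuousLinearMap.comp (ContinuousLinearMap.proj 2)]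

theorem cj_apply (z : CPt) : cj z = ![conj (z 0), conj (z 1), conj (z 3), conj (z 2)] := by
  ext i
  fin_cases i <;> simp [cj]

theorem cj_cj (z : CPt) : cj (cj z) = z := by
  simp only [cj_apply]
  ext i
  fin_cases i <;> simp

theorem cj_smul (c : ℂ) (z : CPt) : cj (c • z) = conj c • cj z := by
  simp only [cj_apply]
  ext i
  fin_cases i <;> simp

theorem cj_eq_self_iff {z : CPt} : cj z = z ↔ z ∈ Set.range emb := by
  rw [mem_range_emb_iff, cj_apply]
  constructor
  · intro h
    exact ⟨congrFun h 0, congrFun h 1, (congrFun h 3).symm⟩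
  · rintro ⟨h0, h1, h3⟩
    ext i
    fin_cases i
    · exact h0
    · exact h1
    · simp [h3]
    · exact h3.symm

/-- A symmetric Hamiltonian has a symmetric vector field. -/
theorem hamVF_cj {F : CPt → ℂ} {z : CPt} (hz : DifferentiableAt ℂ F z)
    (hz' : DifferentiableAt ℂ F (cj z)) (h : ∀ᶠ y in 𝓝 z, F (cj y) = conj (F y)) :
    hamVF F (cj z) = cj (hamVF F z) := by
  have h1 : HasFDerivAt (fun y => F (cj y))
      (((fderiv ℂ F (cj z)).restrictScalars ℝ).comp cj) z :=
    (hz'.hasFDerivAt.restrictScalars ℝ).comp z cj.hasFDerivAt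
  have h2 : HasFDerivAt (fun y => conj (F y))
      (Complex.conjCLE.toContinuousLinearMap.comp ((fderiv ℂ F z).restrictScalars ℝ)) z :=
    Complex.conjCLE.toContinuousLinearMap.hasFDerivAt.comp z (hz.hasFDerivAt.restrictScalars ℝ)
  have h3 : ∀ v, fderiv ℂ F (cj z) (cj v) = conj (fderiv ℂ F z v) := fun v =>
    congrArg (fun L => L v) (h1.unique (h2.congr_of_eventuallyEq h))
  have e0 : cj (Pi.single 0 1) = Pi.single 0 1 := by
    rw [cj_apply]; ext i; fin_cases i <;> simp
  have e1 : cj (Pi.single 1 1) = Pi.single 1 1 := by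
    rw [cj_apply]; ext i; fin_cases i <;> simp
  have e2 : cj (Pi.single 2 1) = Pi.single 3 1 := by
    rw [cj_apply]; ext i; fin_cases i <;> simp
  have e3 : cj (Pi.single 3 1) = Pi.single 2 1 := by
    rw [cj_apply]; ext i; fin_cases i <;> simp
  have k0 := h3 (Pi.single 0 1)
  have k1 := h3 (Pi.single 1 1)
  have k2 := h3 (Pi.single 2 1)
  have k3 := h3 (Pi.single 3 1)
  rw [e0] at k0
  rw [e1] at k1
  rw [e2] at k2
  rw [e3] at k3
  rw [cj_apply (hamVF F z)]
  ext i
  fin_cases i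
  · simp [hamVF, k1]
  · simp [hamVF, k0]
  · simp [hamVF, k2]
  · simp [hamVF, k3]

theorem form_eq_zero_of_forall {v : CPt} (h : ∀ w, form v w = 0) : v = 0 := by
  have h0 := h (Pi.single 1 1)
  have h1 := h (Pi.single 0 1)
  have h2 := h (Pi.single 3 1)
  have h3 := h (Pi.single 2 1)
  simp [form] at h0 h1 h2 h3
  ext i
  fin_cases i
  · exact h0
  · exact h1
  · exact h2
  · exact h3

theorem analyticAt_hamVF {F : CPt → ℂ} {z : CPt} (h : AnalyticAt ℂ F z) :
    AnalyticAt ℂ (hamVF F) z := by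
  have hd : ∀ v, AnalyticAt ℂ (fun z => fderiv ℂ F z v) z := fun v =>
    analyticAt_clm_apply h.fderiv analyticAt_const
  refine AnalyticAt.pi fun i => ?_
  fin_cases i
  · exact hd _
  · exact (hd _).neg
  · exact analyticAt_const.mul (hd _)
  · exact analyticAt_const.mul (hd _)

/-- The second derivative of a function from its quadratic remainder. -/
theorem fderiv_fderiv_of_quadratic {f : CPt → ℂ} {B : CPt → CPt →L[ℂ] CPt →L[ℂ] ℂ}
    {c : ℂ} {A : CPt →L[ℂ] ℂ} (hB : AnalyticAt ℂ B 0) (h : ∀ᶠ z in 𝓝 0, f z = c + A z + B z z z)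
    (v w : CPt) : fderiv ℂ (fun z => fderiv ℂ f z w) 0 v = B 0 v w + B 0 w v := by
  have h1 : ∀ᶠ z in 𝓝 0, fderiv ℂ f z w = A w + (fderiv ℂ B z w z z + B z w z + B z z w) := by
    filter_upwards [h.eventually_nhds, hB.eventually_analyticAt] with z hz hBz
    have e1 := ((A.hasFDerivAt (x := z)).const_add c).add
      ((hBz.differentiableAt.hasFDerivAt.clm_apply (hasFDerivAt_id z)).clm_apply (hasFDerivAt_id z))
    have e2 := e1.congr_of_eventuallyEq hz
    rw [e2.fderiv]
    simp only [add_apply, ContinuousLinearMap.comp_apply, ContinuousLinearMap.flip_apply,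
      ContinuousLinearMap.id_apply, id_eq]
    ring
  have hBd := hB.differentiableAt.hasFDerivAt
  have hid := hasFDerivAt_id (𝕜 := ℂ) (0 : CPt)
  have hw := hasFDerivAt_const (𝕜 := ℂ) w (0 : CPt)
  have hD : DifferentiableAt ℂ (fun z => fderiv ℂ B z w) 0 :=
    hB.fderiv.differentiableAt.clm_apply (differentiableAt_const w)
  have e1 := (hasFDerivAt_const (𝕜 := ℂ) (A w) (0 : CPt)).add
    ((((hD.hasFDerivAt.clm_apply hid).clm_apply hid).add ((hBd.clm_apply hw).clm_apply hid)).add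
      ((hBd.clm_apply hid).clm_apply hw))
  have e2 := e1.congr_of_eventuallyEq h1
  rw [e2.fderiv]
  simp
  ring

end

/-! ### Symmetric Hamiltonian systems at a saddle-center. -/

section

theorem form_swap (v w : CPt) : form v w = -form w v := by
  simp only [form]; ring

/-- The frame of eigenvectors of a saddle-center. -/
theorem exists_eigenframe {A : CPt →L[ℂ] CPt} {ρ σ : ℝ} (hρ : 0 < ρ) (hσ : σ ≠ 0) {e₀ e₁ e₂ : CPt}
    (hAcj : ∀ v, A (cj v) = cj (A v)) (h0 : cj e₀ = e₀) (h1 : cj e₁ = e₁) (n0 : e₀ ≠ 0)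
    (n1 : e₁ ≠ 0) (n2 : e₂ ≠ 0) (A0 : A e₀ = (-ρ : ℂ) • e₀) (A1 : A e₁ = (ρ : ℂ) • e₁)
    (A2 : A e₂ = (Complex.I * σ) • e₂) :
    ∃ T : CPt ≃L[ℂ] CPt, (∀ w, T w = w 0 • e₀ + w 1 • e₁ + w 2 • e₂ + w 3 • cj e₂) ∧
      (∀ w, T w ∈ Set.range emb ↔ w ∈ Set.range emb) ∧
      ∀ w, A (T w) = T ![-ρ * w 0, ρ * w 1, Complex.I * σ * w 2, -(Complex.I * σ) * w 3] := by
  have A3 : A (cj e₂) = (-(Complex.I * σ)) • cj e₂ := by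
    rw [hAcj, A2, cj_smul]; simp
  have n3 : cj e₂ ≠ 0 := fun h => n2 (by rw [← cj_cj e₂, h, map_zero])
  set μ : Fin 4 → ℂ := ![-ρ, ρ, Complex.I * σ, -(Complex.I * σ)] with hμ
  set e : Fin 4 → CPt := ![e₀, e₁, e₂, cj e₂] with he
  have hinj : Function.Injective μ := by
    intro i j hij
    have hre := congrArg Complex.re hij
    have him := congrArg Complex.im hij
    have s1 : σ ≠ -σ := fun h => hσ (by linarith)
    have s2 : -σ ≠ σ := fun h => hσ (by linarith)
    have s3 : -ρ ≠ ρ := fun h => hρ.ne' (by linarith)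
    have s4 : ρ ≠ -ρ := fun h => hρ.ne' (by linarith)
    fin_cases i <;> fin_cases j <;> simp [hμ] at hre him ⊢ <;>
      first
      | exact absurd hre hρ.ne'
      | exact absurd hre.symm hρ.ne'
      | exact absurd him hσ
      | exact absurd hre s3
      | exact absurd hre s4
      | exact absurd him s1
      | exact absurd him s2
  have hli : LinearIndependent ℂ e := by
    refine Module.End.eigenvectors_linearIndependent' (A : CPt →ₗ[ℂ] CPt) μ hinj e fun i => ?_
    fin_cases i
    · exact ⟨Module.End.mem_eigenspace_iff.2 A0, n0⟩
    · exact ⟨Module.End.mem_eigenspace_iff.2 A1, n1⟩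
    · exact ⟨Module.End.mem_eigenspace_iff.2 A2, n2⟩
    · exact ⟨Module.End.mem_eigenspace_iff.2 A3, n3⟩
  set b := basisOfLinearIndependentOfCardEqFinrank hli (by simp) with hb
  set T : CPt ≃L[ℂ] CPt := b.equivFun.symm.toContinuousLinearEquiv with hT
  have hTw : ∀ w, T w = w 0 • e₀ + w 1 • e₁ + w 2 • e₂ + w 3 • cj e₂ := by
    intro w
    have : T w = ∑ i, w i • b i := Module.Basis.equivFun_symm_apply b w
    rw [this, Fin.sum_univ_four]
    simp [hb, he]
  have hTcj : ∀ w, T (cj w) = cj (T w) := by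
    intro w
    rw [hTw, hTw, cj_apply w]
    simp only [map_add, cj_smul, h0, h1, cj_cj, Matrix.cons_val]
    abel
  refine ⟨T, hTw, fun w => ?_, fun w => ?_⟩
  · rw [← cj_eq_self_iff, ← cj_eq_self_iff, ← hTcj]
    exact T.injective.eq_iff
  · rw [hTw, hTw]
    simp only [map_add, map_smul, A0, A1, A2, A3, smul_smul, Matrix.cons_val]
    congr 1
    · congr 1
      · congr 1
        · congr 1; ring
        · congr 1; ring
      · congr 1; ring
    · congr 1; ring

/-- The linear part of a symmetric Hamiltonian vector field commutes with the conjugation. -/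
theorem fderiv_hamVF_cj {F : CPt → ℂ} {P : CPt} (hF : AnalyticAt ℂ F P) (hPcj : cj P = P)
    (hsym : ∀ᶠ y in 𝓝 P, F (cj y) = conj (F y)) :
    (∀ᶠ y in 𝓝 P, hamVF F (cj y) = cj (hamVF F y)) ∧
      ∀ v, fderiv ℂ (hamVF F) P (cj v) = cj (fderiv ℂ (hamVF F) P v) := by
  have hX := (analyticAt_hamVF hF).differentiableAt.hasFDerivAt.restrictScalars ℝ
  have hcjt : Tendsto cj (𝓝 P) (𝓝 P) := by
    have := cj.continuous.tendsto P
    rwa [hPcj] at this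
  have hXcj : ∀ᶠ y in 𝓝 P, hamVF F (cj y) = cj (hamVF F y) := by
    filter_upwards [hF.eventually_analyticAt, hcjt.eventually hF.eventually_analyticAt,
      hsym.eventually_nhds] with y h1 h2 h3
    exact hamVF_cj h1.differentiableAt h2.differentiableAt h3
  refine ⟨hXcj, fun v => ?_⟩
  have hX' := hX
  rw [← hPcj] at hX'
  have h1 := HasFDerivAt.comp P hX' (cj.hasFDerivAt (x := P))
  have h2 := (cj.hasFDerivAt (x := hamVF F P)).comp P hX
  have h3 := congrArg (fun L => L v) (h1.unique (h2.congr_of_eventuallyEq hXcj))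
  simpa [hPcj] using h3

/-- A symmetric Hamiltonian system at an equilibrium of saddle-center type, in the frame of
eigenvectors. -/
theorem exists_saddleCenterForm {F : CPt → ℂ} {P : CPt} (hF : AnalyticAt ℂ F P)
    (hP : P ∈ Set.range emb) (hsym : ∀ᶠ y in 𝓝 P, F (cj y) = conj (F y)) (h0 : hamVF F P = 0)
    {ρ σ : ℝ} (hρ : 0 < ρ) (hσ : σ ≠ 0) {e₀ e₁ e₂ : CPt} (he0 : cj e₀ = e₀) (he1 : cj e₁ = e₁)
    (n0 : e₀ ≠ 0) (n1 : e₁ ≠ 0) (n2 : e₂ ≠ 0)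
    (A0 : fderiv ℂ (hamVF F) P e₀ = (-ρ : ℂ) • e₀) (A1 : fderiv ℂ (hamVF F) P e₁ = (ρ : ℂ) • e₁)
    (A2 : fderiv ℂ (hamVF F) P e₂ = (Complex.I * σ) • e₂) :
    ∃ T : CPt ≃L[ℂ] CPt, (∀ w, T w ∈ Set.range emb ↔ w ∈ Set.range emb) ∧
      ∃ En a b, SaddleCenterForm (pullField T (hamVF F) P) En ρ σ a b := by
  have hX := analyticAt_hamVF hF
  set X := hamVF F with hXd
  set A := fderiv ℂ X P with hA
  have hPcj : cj P = P := cj_eq_self_iff.2 hP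
  obtain ⟨hXcj, hAcj⟩ := fderiv_hamVF_cj hF hPcj hsym
  rw [← hXd, ← hA] at hAcj
  obtain ⟨T, hTw, hTr, hAT⟩ := exists_eigenframe hρ hσ hAcj he0 he1 n0 n1 n2 A0 A1 A2
  refine ⟨T, hTr, ?_⟩
  set τ : CPt → CPt := fun w => P + T w with hτ
  have hτ0 : τ 0 = P := by simp [hτ]
  have hτc : Continuous τ := by fun_prop
  have hτt : Tendsto τ (𝓝 0) (𝓝 P) := by
    have := hτc.tendsto 0
    rwa [hτ0] at this
  have hτa : ∀ w, AnalyticAt ℂ τ w := fun w =>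
    analyticAt_const.add ((T : CPt →L[ℂ] CPt).analyticAt w)
  have hτd : ∀ w, HasFDerivAt τ (T : CPt →L[ℂ] CPt) w := fun w => T.hasFDerivAt.const_add P
  have hDF : fderiv ℂ F P = 0 := by
    ext w
    rw [← form_hamVF, ← hXd, h0]
    simp [form]
  set En : CPt → ℂ := fun w => F (τ w) - F P with hEn
  have hEna : AnalyticAt ℂ En 0 := by
    have h1 : AnalyticAt ℂ F (τ 0) := by rwa [hτ0]
    exact (AnalyticAt.comp (g := F) (f := τ) h1 (hτa 0)).sub analyticAt_const
  have hEnd : ∀ᶠ w in 𝓝 0, ∀ v, fderiv ℂ En w v = form (X (τ w)) (T v) := by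
    filter_upwards [hτt.eventually hF.eventually_analyticAt] with w hw v
    have h1 : HasFDerivAt En ((fderiv ℂ F (τ w)).comp (T : CPt →L[ℂ] CPt)) w :=
      (hw.differentiableAt.hasFDerivAt.comp w (hτd w)).sub_const _
    rw [h1.fderiv, hXd, form_hamVF]
    rfl
  have hDE : fderiv ℂ En 0 = 0 := by
    ext v
    rw [hEnd.self_of_nhds v, hτ0, h0]
    simp [form]
  obtain ⟨B, hB, hBE⟩ := exists_quadratic_remainder hEna
  -- The Hessian of the energy is form (A ·, ·). It is symmetric while the form is antisymmetric, so
  -- A is skew for the form.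
  have hS : ∀ v w, B 0 v w + B 0 w v = form (A (T v)) (T w) := by
    intro v w
    rw [← fderiv_fderiv_of_quadratic hB hBE v w]
    have h1 : HasFDerivAt (fun z => X (τ z)) (A.comp (T : CPt →L[ℂ] CPt)) 0 := by
      refine HasFDerivAt.comp (g := X) (0 : CPt) ?_ (hτd 0)
      rw [hτ0]
      exact hX.differentiableAt.hasFDerivAt
    have h2 := fun i => hasFDerivAt_pi'.1 h1 i
    have h3 : HasFDerivAt (fun z => form (X (τ z)) (T w)) _ 0 :=
      (((h2 0).mul_const (T w 1)).sub ((h2 1).mul_const (T w 0))).add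
        ((((h2 2).mul_const (T w 3)).sub ((h2 3).mul_const (T w 2))).const_mul Complex.I)
    rw [(h3.congr_of_eventuallyEq (hEnd.mono fun z hz => hz w)).fderiv]
    simp [form]
    ring
  -- orthogonality of eigenvectors
  have hskew : ∀ v w, form (A (T v)) (T w) = -form (T v) (A (T w)) := by
    intro v w
    rw [← hS, add_comm, hS, form_swap]
  have hbil : ∀ (x y : CPt) (c : ℂ), form (c • x) y = c * form x y ∧
      form x (c • y) = c * form x y := by
    intro x y c
    constructor <;> simp only [form, Pi.smul_apply, smul_eq_mul] <;> ring
  -- For a skew A, eigenvectors pair to zero unless their eigenvalues are opposite. Only e₀ with e₁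
  -- and e₂ with its conjugate remain, which puts the quadratic part of the energy into normal form.
  have horth : ∀ i j : Fin 4, ∀ c d : ℂ, A (T (Pi.single i 1)) = c • T (Pi.single i 1) →
      A (T (Pi.single j 1)) = d • T (Pi.single j 1) → c + d ≠ 0 →
      form (T (Pi.single i 1)) (T (Pi.single j 1)) = 0 := by
    intro i j c d hc hd hcd
    have h1 := hskew (Pi.single i 1) (Pi.single j 1)
    rw [hc, hd, (hbil _ _ _).1, (hbil _ _ _).2] at h1
    refine (mul_eq_zero.1 (show (c + d) * form (T (Pi.single i 1)) (T (Pi.single j 1)) = 0 by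
      linear_combination h1)).resolve_left hcd
  have t0 : T (Pi.single 0 1) = e₀ := by rw [hTw]; simp
  have t1 : T (Pi.single 1 1) = e₁ := by rw [hTw]; simp
  have t2 : T (Pi.single 2 1) = e₂ := by rw [hTw]; simp
  have t3 : T (Pi.single 3 1) = cj e₂ := by rw [hTw]; simp
  have A3 : A (cj e₂) = (-(Complex.I * σ)) • cj e₂ := by
    rw [hAcj, A2, cj_smul]; simp
  have hρσ : ∀ s s' : ℝ, s * ρ ≠ 0 → (s : ℂ) * ρ + s' * (Complex.I * σ) ≠ 0 := by
    intro s s' hs h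
    have := congrArg Complex.re h
    simp at this
    rcases this with h | h <;> simp [h] at hs
  have o02 : form e₀ e₂ = 0 := by
    rw [← t0, ← t2]
    refine horth 0 2 (-ρ) (Complex.I * σ) (by rw [t0, A0]) (by rw [t2, A2]) ?_
    simpa using hρσ (-1) 1 (by simpa using hρ.ne')
  have o03 : form e₀ (cj e₂) = 0 := by
    rw [← t0, ← t3]
    refine horth 0 3 (-ρ) (-(Complex.I * σ)) (by rw [t0, A0]) (by rw [t3, A3]) ?_
    simpa using hρσ (-1) (-1) (by simpa using hρ.ne')
  have o12 : form e₁ e₂ = 0 := by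
    rw [← t1, ← t2]
    refine horth 1 2 ρ (Complex.I * σ) (by rw [t1, A1]) (by rw [t2, A2]) ?_
    simpa using hρσ 1 1 (by simpa using hρ.ne')
  have o13 : form e₁ (cj e₂) = 0 := by
    rw [← t1, ← t3]
    refine horth 1 3 ρ (-(Complex.I * σ)) (by rw [t1, A1]) (by rw [t3, A3]) ?_
    simpa using hρσ 1 (-1) (by simpa using hρ.ne')
  have hadd : ∀ x y z : CPt, form (x + y) z = form x z + form y z ∧
      form x (y + z) = form x y + form x z := by
    intro x y z
    constructor <;> simp only [form, Pi.add_apply] <;> ring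
  have hself : ∀ x, form x x = 0 := fun x => by simp only [form]; ring
  have hσc : Complex.I * (σ : ℂ) ≠ 0 := mul_ne_zero Complex.I_ne_zero (by exact_mod_cast hσ)
  refine ⟨En, -ρ * form e₀ e₁, Complex.I * σ * form e₂ (cj e₂), ?_⟩
  refine ⟨hρ, ?_, ?_, ?_, ?_, ?_, hEna, ⟨B, hB, ?_, ?_⟩, ?_, ?_⟩
  -- If e₂ also paired to zero with its conjugate, it would be in the kernel of the form, which is
  -- nondegenerate.
  · refine mul_ne_zero hσc fun h23 => n2 (form_eq_zero_of_forall fun w => ?_)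
    obtain ⟨v, rfl⟩ := T.surjective w
    rw [hTw]
    simp only [(hadd _ _ _).2, (hbil _ _ _).2, form_swap e₂ e₀, form_swap e₂ e₁, o02, o12, hself,
      h23]
    simp
  · have h1 : AnalyticAt ℂ X (τ 0) := by rwa [hτ0]
    exact ((T.symm : CPt →L[ℂ] CPt).analyticAt _).comp
      (AnalyticAt.comp (g := X) (f := τ) h1 (hτa 0))
  · simp [pullField, h0]
  · intro v
    rw [fderiv_pullField T hX.differentiableAt, ← hA, hAT, T.symm_apply_apply]
  · filter_upwards [hτt.eventually hXcj] with w hw hwr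
    have hτr : τ w ∈ Set.range emb := add_mem_range_emb hP ((hTr w).2 hwr)
    rw [← hTr]
    simp only [pullField, T.apply_symm_apply]
    rw [← cj_eq_self_iff]
    change cj (X (τ w)) = X (τ w)
    rw [← hw, cj_eq_self_iff.2 hτr]
  · filter_upwards [hBE] with w hw
    rw [hw, hDE, hEn]
    simp [hτ0]
  · intro v
    have h1 := hS v v
    have h2 : B 0 v v = form (A (T v)) (T v) / 2 := by rw [← h1]; ring
    rw [h2, hAT, hTw, hTw]
    simp only [(hadd _ _ _).1, (hadd _ _ _).2, (hbil _ _ _).1, (hbil _ _ _).2, Matrix.cons_val,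
      form_swap e₁ e₀, form_swap e₂ e₀, form_swap e₂ e₁, form_swap (cj e₂) e₀,
      form_swap (cj e₂) e₁, form_swap (cj e₂) e₂, o02, o03, o12, o13, hself]
    ring
  · filter_upwards [hEnd] with w hw
    rw [hw, pullField, T.apply_symm_apply]
    exact hself _
  · filter_upwards [hτt.eventually hsym] with w hw hwr
    have hτr : τ w ∈ Set.range emb := add_mem_range_emb hP ((hTr w).2 hwr)
    have h1 := hsym.self_of_nhds
    rw [hPcj] at h1
    rw [cj_eq_self_iff.2 hτr] at hw
    simp only [hEn, map_sub, ← hw, ← h1]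

/-- The invariant manifolds of a symmetric Hamiltonian system at a saddle-center. -/
theorem exists_invariant_manifolds {F : CPt → ℂ} {P : CPt} (hF : AnalyticAt ℂ F P)
    (hP : P ∈ Set.range emb) (hsym : ∀ᶠ y in 𝓝 P, F (cj y) = conj (F y)) (h0 : hamVF F P = 0)
    {ρ σ : ℝ} (hρσ : IsSaddleCenter (linearPart (hamVF F) P) ρ σ) :
    (∃ W, IsStableCurve (hamVF F) P ρ W) ∧ (∃ W, IsUnstableCurve (hamVF F) P ρ W) ∧
      ∃ W, IsCenterSurface (hamVF F) P σ W := by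
  obtain ⟨hρ, hσ, hch⟩ := hρσ
  have hX := analyticAt_hamVF hF
  set A := fderiv ℂ (hamVF F) P with hA
  set M := linearPart (hamVF F) P with hM
  have hMA : ∀ v, M.mulVec v = A v := by
    intro v
    have hv : v = ∑ j, v j • (Pi.single j 1 : CPt) := by
      ext i; simp [Finset.sum_apply, Pi.single_apply]
    conv_rhs => rw [hv, map_sum]
    ext i
    simp [Matrix.mulVec, dotProduct, hM, linearPart, hA, mul_comm]
  have hPcj : cj P = P := cj_eq_self_iff.2 hP
  have hAcj := (fderiv_hamVF_cj hF hPcj hsym).2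
  rw [← hA] at hAcj
  have heig : ∀ c : ℂ, (c ^ 2 - (ρ : ℂ) ^ 2) * (c ^ 2 + (σ : ℂ) ^ 2) = 0 →
      ∃ v, v ≠ 0 ∧ A v = c • v := by
    intro c hc
    have h1 : M.charpoly.eval c = 0 := by rw [hch]; simpa using hc
    rw [Matrix.eval_charpoly] at h1
    obtain ⟨v, hv, hv2⟩ := Matrix.exists_mulVec_eq_zero_iff.2 h1
    refine ⟨v, hv, ?_⟩
    rw [Matrix.sub_mulVec, hMA, sub_eq_zero] at hv2
    rw [← hv2]
    ext i
    simp [Matrix.mulVec, dotProduct, Matrix.scalar_apply, Matrix.diagonal_apply]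
  have hreal : ∀ c : ℝ, ((c : ℂ) ^ 2 - (ρ : ℂ) ^ 2) * ((c : ℂ) ^ 2 + (σ : ℂ) ^ 2) = 0 →
      ∃ v, cj v = v ∧ v ≠ 0 ∧ A v = (c : ℂ) • v := by
    intro c hc
    obtain ⟨v, hv, hvA⟩ := heig c hc
    have h1 : A (cj v) = (c : ℂ) • cj v := by rw [hAcj, hvA, cj_smul, Complex.conj_ofReal]
    -- A real eigenvector for a real eigenvalue: twice the real part v + cj v, or i v when that
    -- vanishes.
    by_cases h2 : v + cj v = 0
    · refine ⟨Complex.I • v, ?_, ?_, ?_⟩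
      · rw [cj_smul, eq_neg_of_add_eq_zero_right h2]; simp
      · simpa using hv
      · rw [map_smul, hvA, smul_comm]
    · refine ⟨v + cj v, ?_, h2, ?_⟩
      · rw [map_add, cj_cj, add_comm]
      · rw [map_add, hvA, h1, smul_add]
  obtain ⟨e₀, c0, n0, A0⟩ := hreal (-ρ) (by simp)
  obtain ⟨e₁, c1, n1, A1⟩ := hreal ρ (by simp)
  obtain ⟨e₂, n2, A2⟩ := heig (Complex.I * σ) (by rw [mul_pow, Complex.I_sq]; ring)
  have hXd := hX.differentiableAt
  -- Reversal of time is the Hamiltonian -F. The roles of e₀ and e₁ are exchanged and the frequency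
  -- of e₂ changes sign, for which reason the normal form is set up for any nonzero σ.
  have hneg : hamVF (fun z => -F z) = fun z => -hamVF F z := by
    funext z
    ext i
    fin_cases i <;> simp [hamVF]
  have hnegd : ∀ v, fderiv ℂ (hamVF (fun z => -F z)) P v = -A v := by
    intro v
    rw [hneg, fderiv_fun_neg]
    rfl
  obtain ⟨T, hT, En, a, b, hform⟩ := exists_saddleCenterForm hF hP hsym h0 hρ hσ.ne' c0 c1 n0 n1 n2
    (by rw [← hA, A0]; simp) A1 A2
  obtain ⟨T', hT', En', a', b', hform'⟩ := exists_saddleCenterForm (F := fun z => -F z) hF.neg hP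
    (hsym.mono fun y hy => by rw [hy, map_neg]) (by rw [hneg]; simp [h0]) hρ (neg_ne_zero.2 hσ.ne')
    c1 c0 n1 n0 n2 (by rw [hnegd, A1, neg_smul]) (by rw [hnegd, A0]; simp)
    (by rw [hnegd, A2]; simp)
  obtain ⟨W₁, hW₁⟩ := hform.exists_stableCurve
  obtain ⟨W₂, hW₂⟩ := hform'.exists_stableCurve
  obtain ⟨W₃, hW₃⟩ := hform.exists_centerSurface hσ
  have h2 := hW₂.of_pull T' (by rw [hneg]; exact hXd.neg) hP hT'
  rw [hneg] at h2
  exact ⟨⟨_, hW₁.of_pull T hXd hP hT⟩, ⟨_, h2⟩, ⟨_, hW₃.of_pull T hXd hP hT⟩⟩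

end

section

/-! ### Rational formulas for the Poincaré coordinates

Here `s = √(2L - ηξ)`, and `w = exp (i F)` with the eccentric longitude `F = u + g`. -/

/-- The action `L`. -/
def kL (s η ξ : ℂ) : ℂ := (s ^ 2 + η * ξ) / 2

/-- The position `q₁ + i q₂`. -/
def kQ (w s η ξ : ℂ) : ℂ := kL s η ξ / (2 * w) * (s * w - η) ^ 2

/-- The conjugate position `q₁ - i q₂`. -/
def kQ' (w s η ξ : ℂ) : ℂ := kL s η ξ / (2 * w) * (s - ξ * w) ^ 2

/-- The momentum `p₁ + i p₂`. -/
def kP (w s η ξ : ℂ) : ℂ := Complex.I / kL s η ξ * ((s * w + η) / (s - ξ * w))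

/-- The conjugate momentum `p₁ - i p₂`. -/
def kP' (w s η ξ : ℂ) : ℂ := -(Complex.I / kL s η ξ) * ((s + ξ * w) / (s * w - η))

/-- The distance to the origin. -/
def kr (w s η ξ : ℂ) : ℂ := kL s η ξ / (2 * w) * ((s * w - η) * (s - ξ * w))

/-- The difference `λ - F` given by Kepler's equation. -/
def kD (w s η ξ : ℂ) : ℂ := -(s / (2 * Complex.I * kL s η ξ)) * (w * ξ - η / w)

/-- The eccentric longitude. -/
def eccLong (lam L : ℝ) (η : ℂ) : ℝ :=
  eccentricAnomaly (‖η‖ * √(2 * L - ‖η‖ ^ 2) / L) (lam - Complex.arg η) + Complex.arg η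

/-- The unit complex number at the angle `F`. -/
def expI (F : ℂ) : ℂ := Complex.exp (Complex.I * F)

theorem expI_ne_zero (F : ℂ) : expI F ≠ 0 := Complex.exp_ne_zero _

theorem expI_ofReal (x : ℝ) : expI x = (Real.cos x : ℂ) + Complex.I * (Real.sin x : ℂ) := by
  rw [expI, mul_comm, Complex.exp_mul_I, Complex.ofReal_cos, Complex.ofReal_sin]; ring

theorem expI_add (x y : ℂ) : expI (x + y) = expI x * expI y := by
  simp only [expI, mul_add, Complex.exp_add]

theorem conj_expI (x : ℝ) : conj (expI x) = (expI x)⁻¹ := by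
  rw [expI, ← Complex.exp_conj, ← Complex.exp_neg]; simp

theorem norm_expI (x : ℝ) : ‖expI x‖ = 1 := by
  rw [expI, mul_comm]; exact Complex.norm_exp_ofReal_mul_I x

theorem expI_neg_real (u : ℝ) :
    (expI (u : ℂ))⁻¹ = (Real.cos u : ℂ) - Complex.I * (Real.sin u : ℂ) := by
  rw [← conj_expI, expI_ofReal, map_add, map_mul, Complex.conj_ofReal, Complex.conj_ofReal,
    Complex.conj_I]
  ring

section Real

variable {L : ℝ} {η : ℂ}

/-- The square root `s` at real points. -/
def rs (L : ℝ) (η : ℂ) : ℝ := √(2 * L - ‖η‖ ^ 2)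

theorem rs_pos (hη : ‖η‖ ^ 2 < L) : 0 < rs L η :=
  Real.sqrt_pos.2 (by nlinarith [norm_nonneg η, sq_nonneg ‖η‖])

theorem rs_sq (hη : ‖η‖ ^ 2 < L) : rs L η ^ 2 = 2 * L - ‖η‖ ^ 2 :=
  Real.sq_sqrt (by nlinarith [sq_nonneg ‖η‖])

theorem mul_conj_norm (η : ℂ) : η * conj η = (‖η‖ : ℂ) ^ 2 := by
  rw [Complex.mul_conj, Complex.normSq_eq_norm_sq]; push_cast; rfl

theorem kL_real (hη : ‖η‖ ^ 2 < L) : kL (rs L η) η (conj η) = L := by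
  have h1 : (rs L η : ℂ) ^ 2 = 2 * L - (‖η‖ : ℂ) ^ 2 := by exact_mod_cast rs_sq hη
  rw [kL, h1, mul_conj_norm]; ring

theorem arg_polar (η : ℂ) : η = ‖η‖ * expI (Complex.arg η) ∧
    conj η = ‖η‖ * (expI (Complex.arg η))⁻¹ := by
  have h1 : η = ‖η‖ * expI (Complex.arg η) := by
    rw [expI, mul_comm Complex.I]; exact (Complex.norm_mul_exp_arg_mul_I η).symm
  refine ⟨h1, ?_⟩
  conv_lhs => rw [h1, map_mul, conj_expI, Complex.conj_ofReal]

/-- The eccentricity. -/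
theorem ecc_bounds (hη : ‖η‖ ^ 2 < L) :
    0 ≤ ‖η‖ * rs L η / L ∧ ‖η‖ * rs L η / L < 1 ∧
      1 - (‖η‖ * rs L η / L) ^ 2 = ((L - ‖η‖ ^ 2) / L) ^ 2 := by
  have hL : 0 < L := (sq_nonneg _).trans_lt hη
  have h1 := rs_sq hη
  have h2 : 1 - (‖η‖ * rs L η / L) ^ 2 = ((L - ‖η‖ ^ 2) / L) ^ 2 := by
    rw [div_pow, mul_pow, h1]; field_simp; ring
  have h0 : 0 ≤ ‖η‖ * rs L η / L := by have := rs_pos hη; positivity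
  refine ⟨h0, ?_, h2⟩
  have h3 : 0 < ((L - ‖η‖ ^ 2) / L) ^ 2 := by
    have : 0 < L - ‖η‖ ^ 2 := by linarith
    positivity
  nlinarith

/-- The angle part of Kepler's equation. -/
theorem kD_real (hη : ‖η‖ ^ 2 < L) (u : ℝ) :
    kD (expI ((u + Complex.arg η : ℝ) : ℂ)) (rs L η) η (conj η) =
      ((-(‖η‖ * rs L η / L * Real.sin u) : ℝ) : ℂ) := by
  have hL : (L : ℂ) ≠ 0 := by exact_mod_cast ((sq_nonneg _).trans_lt hη).ne'
  obtain ⟨e1, e2⟩ := arg_polar η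
  have hγ := expI_ne_zero (Complex.arg η)
  have hw : expI ((u + Complex.arg η : ℝ) : ℂ) = expI u * expI (Complex.arg η) := by
    rw [← expI_add]; push_cast; rfl
  have hu := expI_ne_zero u
  have hinv := expI_neg_real u
  have h1 : expI (((u + Complex.arg η : ℝ)) : ℂ) * conj η - η / expI ((u + Complex.arg η : ℝ) : ℂ) =
      2 * Complex.I * ‖η‖ * Real.sin u := by
    have h2 : expI u * expI (Complex.arg η) * conj η - η / (expI u * expI (Complex.arg η)) =
        ‖η‖ * (expI u - (expI (u : ℂ))⁻¹) := by
      rw [e2]; nth_rewrite 4 [e1]; field_simp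
    rw [hw, h2, hinv, expI_ofReal]
    ring
  rw [kD, kL_real hη, h1]
  push_cast
  field_simp

/-- The term e sin u, as a function of w = e^{i (u + g)}, η and its conjugate, no longer refers to
the angle g. Existence and uniqueness are those of `eccentricAnomaly_iff`, with g added to both
sides of Kepler's equation. -/
theorem kepler_iff (hη : ‖η‖ ^ 2 < L) (lam F : ℝ) :
    (F : ℂ) + kD (expI F) (rs L η) η (conj η) = lam ↔ F = eccLong lam L η := by
  obtain ⟨h0, h1, -⟩ := ecc_bounds hη
  have h2 := kD_real hη (F - Complex.arg η)
  rw [sub_add_cancel] at h2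
  have h3 := eccentricAnomaly_iff h0 h1 (lam - Complex.arg η) (F - Complex.arg η)
  rw [h2]
  have h4 : F = eccLong lam L η ↔
      eccentricAnomaly (‖η‖ * rs L η / L) (lam - Complex.arg η) = F - Complex.arg η := by
    unfold eccLong rs
    constructor <;> intro h <;> linarith
  rw [h4, h3]
  constructor
  · intro h
    have : F + -(‖η‖ * rs L η / L * Real.sin (F - Complex.arg η)) = lam := by exact_mod_cast h
    linarith
  · intro h
    have : F + -(‖η‖ * rs L η / L * Real.sin (F - Complex.arg η)) = lam := by linarith
    exact_mod_cast this

/-- The factors of the radius do not vanish at real points. -/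
theorem real_factors_ne_zero (hη : ‖η‖ ^ 2 < L) {w : ℂ} (hw : ‖w‖ = 1) :
    (rs L η : ℂ) * w - η ≠ 0 ∧ (rs L η : ℂ) - conj η * w ≠ 0 := by
  have h1 : ‖η‖ < rs L η := by
    have := rs_sq hη
    nlinarith [rs_pos hη, norm_nonneg η]
  have h2 := (rs_pos hη).le
  constructor <;> intro h
  · have := congrArg norm (sub_eq_zero.1 h)
    rw [norm_mul, hw, Complex.norm_real, Real.norm_of_nonneg h2] at this
    linarith
  · have := congrArg norm (sub_eq_zero.1 h)
    rw [norm_mul, hw, Complex.norm_real, Real.norm_of_nonneg h2, Complex.norm_conj] at this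
    linarith

/-- The rational formulas at real points. -/
theorem phiPoi_formulas (hη : ‖η‖ ^ 2 < L) (lam : ℝ) :
    let c := phiPoi lam L η (conj η)
    let w := expI (eccLong lam L η)
    0 < c.r ∧ c.G = L - ‖η‖ ^ 2 ∧ (c.R ^ 2 + c.G ^ 2 / c.r ^ 2) / 2 - 1 / c.r = -1 / (2 * L ^ 2) ∧
      (c.r : ℂ) = kr w (rs L η) η (conj η) ∧
      (c.r : ℂ) * expI c.θ = kQ w (rs L η) η (conj η) ∧
      ((c.R : ℂ) + Complex.I * (c.G / c.r : ℝ)) * expI c.θ = kP w (rs L η) η (conj η) := by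
  intro c w
  have hL : 0 < L := (sq_nonneg _).trans_lt hη
  have hLc : (L : ℂ) ≠ 0 := by exact_mod_cast hL.ne'
  obtain ⟨h0, h1, h2⟩ := ecc_bounds hη
  set e : ℝ := ‖η‖ * rs L η / L with he
  set G : ℝ := L - ‖η‖ ^ 2 with hG
  have hGp : 0 < G := by rw [hG]; linarith
  have hre : (η * conj η).re = ‖η‖ ^ 2 := by
    rw [mul_conj_norm]; norm_cast
  have hee : √(1 - (L - (η * conj η).re) ^ 2 / L ^ 2) = e := by
    rw [hre, ← hG, ← div_pow, ← h2, sub_sub_cancel, Real.sqrt_sq h0]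
  set g := Complex.arg η with hg
  set u : ℝ := eccentricAnomaly e (lam - g) with hu
  have hse : √(1 - e ^ 2) = G / L := by rw [h2, Real.sqrt_sq (by positivity)]
  set f : ℝ := Complex.arg ⟨Real.cos u - e, G / L * Real.sin u⟩ with hf
  have hcr : c.r = L ^ 2 * (1 - e * Real.cos u) := by simp only [c, phiPoi, hee]; rfl
  have hcθ : c.θ = f + g := by simp only [c, phiPoi, hee, hse]; rfl
  have hcR : c.R = e * Real.sin u / (L * (1 - e * Real.cos u)) := by simp only [c, phiPoi, hee]; rfl
  have hcG : c.G = G := by simp only [c, phiPoi, hre]; rfl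
  have hpos : 0 < 1 - e * Real.cos u := by nlinarith [Real.cos_le_one u, Real.neg_one_le_cos u]
  have hr : 0 < c.r := by rw [hcr]; positivity
  have hw : w = expI u * expI g := by
    simp only [w]
    rw [← expI_add]
    have : eccLong lam L η = u + g := rfl
    rw [this]; push_cast; rfl
  have hcs : Real.cos u ^ 2 + Real.sin u ^ 2 = 1 := Real.cos_sq_add_sin_sq u
  -- the true anomaly
  have hfz : ((1 - e * Real.cos u : ℝ) : ℂ) * expI f =
      (Real.cos u - e : ℝ) + Complex.I * (G / L * Real.sin u : ℝ) := by
    set zf : ℂ := ⟨Real.cos u - e, G / L * Real.sin u⟩ with hzf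
    -- The vector that defines the true anomaly has length 1 - e cos u, so multiplying e^{if} by
    -- this factor gives the vector itself.
    have hn : ‖zf‖ = 1 - e * Real.cos u := by
      rw [Complex.norm_def, Complex.normSq_mk, ← Real.sqrt_sq hpos.le]
      congr 1
      have : (G / L) ^ 2 = 1 - e ^ 2 := h2.symm
      linear_combination (Real.sin u ^ 2) * this + (1 - e ^ 2) * hcs
    have := (arg_polar zf).1
    rw [hn] at this
    rw [← this, hzf, Complex.mk_eq_add_mul_I, mul_comm Complex.I]
  obtain ⟨e1, e2⟩ := arg_polar η
  rw [← hg] at e1 e2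
  have hγ := expI_ne_zero g
  have hue := expI_ne_zero u
  set a : ℂ := (‖η‖ : ℂ) with ha
  set s : ℂ := (rs L η : ℂ) with hs
  set cu : ℂ := (Real.cos u : ℂ) with hcu
  set su : ℂ := (Real.sin u : ℂ) with hsu
  have hcu' : Complex.cos u = cu := (Complex.ofReal_cos u).symm
  have hsu' : Complex.sin u = su := (Complex.ofReal_sin u).symm
  have hcsc : cu ^ 2 + su ^ 2 = 1 := by rw [hcu, hsu]; exact_mod_cast hcs
  have hss : s ^ 2 = 2 * L - a ^ 2 := by rw [hs, ha]; exact_mod_cast rs_sq hη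
  have hec : (e : ℂ) = a * s / L := by rw [he]; push_cast; rfl
  have hGc : (G : ℂ) = L - a ^ 2 := by rw [hG]; push_cast; rfl
  have hE : expI u = cu + Complex.I * su := expI_ofReal u
  have hE' : (expI (u : ℂ))⁻¹ = cu - Complex.I * su := expI_neg_real u
  have hkL : kL s η (conj η) = L := kL_real hη
  -- the radius
  have hkr : kr w s η (conj η) = L / 2 * (s ^ 2 + a ^ 2 - s * a * (expI u + (expI (u : ℂ))⁻¹)) := by
    rw [kr, hkL, hw, e2]
    nth_rewrite 1 [e1]
    field_simp
    ring
  have hrr : (c.r : ℂ) = kr w s η (conj η) := by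
    rw [hkr, hE', hE, hcr, hss]
    push_cast
    rw [hcu', hec]
    field_simp
    ring
  have hkQ : kQ w s η (conj η) =
      expI g * (L / 2 * (s ^ 2 * expI u - 2 * s * a + a ^ 2 * (expI (u : ℂ))⁻¹)) := by
    rw [kQ, hkL, hw]
    nth_rewrite 1 [e1]
    field_simp
    ring
  have hQ : (c.r : ℂ) * expI c.θ = kQ w s η (conj η) := by
    have h3 : (c.r : ℂ) * expI c.θ = L ^ 2 * expI g * (((1 - e * Real.cos u : ℝ) : ℂ) * expI f) := by
      rw [hcr, hcθ]
      push_cast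
      rw [expI_add]
      ring
    rw [h3, hfz, hkQ, hE', hE, hss]
    push_cast
    rw [hcu', hsu', hec, hGc]
    field_simp
    ring
  have hcrc : (c.r : ℂ) ≠ 0 := by exact_mod_cast hr.ne'
  have hwn : ‖w‖ = 1 := norm_expI _
  have hw0 : w ≠ 0 := expI_ne_zero _
  obtain ⟨n1, n2⟩ := real_factors_ne_zero hη hwn
  refine ⟨hr, hcG, ?_, hrr, hQ, ?_⟩
  · rw [hcR, hcG, hcr]
    have : G ^ 2 = L ^ 2 * (1 - e ^ 2) := by rw [h2]; field_simp
    field_simp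
    rw [this]
    linear_combination (L ^ 2 * e ^ 2) * hcs
  · have hRr : (c.R : ℂ) * c.r = s * a * su := by
      have : c.R * c.r = rs L η * ‖η‖ * Real.sin u := by
        have h4 : c.R * c.r = L * e * Real.sin u := by rw [hcR, hcr]; field_simp
        rw [h4, he]; field_simp
      rw [hs, ha, hsu]
      exact_mod_cast this
    have h4 : s * a * su + Complex.I * G =
        Complex.I / (2 * w) * ((s - conj η * w) * (s * w + η)) := by
      have h5 : Complex.I / (2 * w) * ((s - conj η * w) * (s * w + η)) =
          Complex.I / 2 * (s ^ 2 - a ^ 2 + s * a * ((expI (u : ℂ))⁻¹ - expI u)) := by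
        rw [hw, e2]
        nth_rewrite 1 [e1]
        field_simp
        ring
      rw [h5, hE', hE, hGc, hss]
      linear_combination (s * a * su) * Complex.I_sq
    -- Both expressions for the momentum are multiplied by r², which turns R + i G / r and e^{iθ}
    -- into the polynomial quantities R r + i G and Q.
    have h6 : ((c.R : ℂ) + Complex.I * (c.G / c.r : ℝ)) * expI c.θ * (c.r : ℂ) ^ 2 =
        (s * a * su + Complex.I * G) * kQ w s η (conj η) := by
      rw [← hQ, ← hRr, hcG]
      push_cast
      field_simp
    have h7 : kP w s η (conj η) * (c.r : ℂ) ^ 2 =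
        (s * a * su + Complex.I * G) * kQ w s η (conj η) := by
      rw [h4, hrr, kr, kQ, kP, hkL]
      field_simp
    exact mul_right_cancel₀ (pow_ne_zero 2 hcrc) (h6.trans h7.symm)

end Real

end

/-! ### The symplectic form in the rational coordinates. -/

section

/-- One half of the symplectic form in the rational coordinates. -/
theorem wedge_half {w L A I : ℂ} (D : ℂ) (hw : w ≠ 0) (hL : L ≠ 0) (hA : A ≠ 0)
    (α₁ α₂ κ₁ κ₂ L₁ L₂ φ₁ φ₂ : ℂ) :
    (L₁ * A ^ 2 / (2 * w) + L * A * α₁ / w - L * A ^ 2 * φ₁ / (2 * w)) *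
        (-(I * L₂ * D / (L ^ 2 * A)) + I / L * (κ₂ / A - D * α₂ / A ^ 2)) -
      (L₂ * A ^ 2 / (2 * w) + L * A * α₂ / w - L * A ^ 2 * φ₂ / (2 * w)) *
        (-(I * L₁ * D / (L ^ 2 * A)) + I / L * (κ₁ / A - D * α₁ / A ^ 2)) =
    I / (2 * w * L) * (A * (L₁ * κ₂ - L₂ * κ₁) + D * (L₁ * α₂ - L₂ * α₁) +
      2 * L * (α₁ * κ₂ - α₂ * κ₁) + A * D * (φ₁ * L₂ - φ₂ * L₁) -
      A * L * (φ₁ * κ₂ - φ₂ * κ₁) + D * L * (φ₁ * α₂ - φ₂ * α₁)) := by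
  field_simp
  ring

/-- The symplectic form in the rational coordinates: the sum of the two halves. -/
theorem wedge_sum {w s η ξ L I : ℂ} (hI : I ^ 2 = -1) (hw : w ≠ 0) (hL : L ≠ 0) (hLs : s^2 = 2*L - η*ξ)
   (F₁ s₁ η₁ ξ₁ F₂ s₂ η₂ ξ₂ L₁ L₂ : ℂ)
  (h1 : L₁ = s*s₁ + (η₁*ξ+η*ξ₁)/2) (h2 : L₂ = s*s₂ + (η₂*ξ+η*ξ₂)/2) :
  let dA := fun F' s' η' : ℂ => s' * w + s * (w * (I * F')) - η'
  let dC := fun F' s' η' : ℂ => s' * w + s * (w * (I * F')) + η'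
  let dB := fun F' s' ξ' : ℂ => s' - (ξ' * w + ξ * (w * (I * F')))
  let dD := fun F' s' ξ' : ℂ => s' + (ξ' * w + ξ * (w * (I * F')))
  let dl := fun F' s' η' ξ' L' : ℂ => F' - (s'/(2*I*L) - s*L'/(2*I*L^2))*(w*ξ-η/w) - s/(2*I*L)*((w*(I*F'))*ξ + w*ξ' - (η'/w - η*(I*F')/w))
  let W := fun A D φ₁ φ₂ α₁ α₂ κ₁ κ₂ => A * (L₁ * κ₂ - L₂ * κ₁) + D * (L₁ * α₂ - L₂ * α₁) +
      2 * L * (α₁ * κ₂ - α₂ * κ₁) + A * D * (φ₁ * L₂ - φ₂ * L₁) -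
      A * L * (φ₁ * κ₂ - φ₂ * κ₁) + D * L * (φ₁ * α₂ - φ₂ * α₁)
  I / (2 * w * L) * W (s-ξ*w) (s*w+η) (I*F₁) (I*F₂) (dB F₁ s₁ ξ₁) (dB F₂ s₂ ξ₂) (dC F₁ s₁ η₁) (dC F₂ s₂ η₂) -
  I / (2 * w * L) * W (s*w-η) (s+ξ*w) (I*F₁) (I*F₂) (dA F₁ s₁ η₁) (dA F₂ s₂ η₂) (dD F₁ s₁ ξ₁) (dD F₂ s₂ ξ₂) 
   = 2 * (dl F₁ s₁ η₁ ξ₁ L₁ * L₂ - dl F₂ s₂ η₂ ξ₂ L₂ * L₁ + I * (η₁*ξ₂ - η₂*ξ₁)) := by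
  -- `dl` is the differential of λ = F + (λ - F), so the right side is twice dλ ∧ dL + i dη ∧ dξ. On
  -- the left, by `wedge_half`, stand dQ' ∧ dP and dQ ∧ dP'; the minus sign is the sign in `kP'`.
  intro dA dC dB dD dl W
  have hI0 : I ≠ 0 := by rintro rfl; norm_num at hI
  have hη : s ^ 2 + η * ξ = 2 * L := by linear_combination hLs
  simp only [W, dA, dC, dB, dD, dl, h1, h2]
  have hI3 : I ^ 3 = -I := by rw [pow_succ, hI]; ring
  have hLd : L = (s^2 + η*ξ)/2 := by linear_combination -hη/2
  field_simp
  ring_nf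
  simp only [hI, hI3]
  rw [hLd]
  ring

/-! ### Derivatives of the rational formulas along curves. -/

section Curves

variable {F s η ξ : ℝ → ℂ} {F' s' η' ξ' : ℂ} {t : ℝ}

theorem hasDerivAt_expI (hF : HasDerivAt F F' t) :
    HasDerivAt (fun t => expI (F t)) (expI (F t) * (Complex.I * F')) t :=
  (hF.const_mul Complex.I).cexp

theorem hasDerivAt_kL (hs : HasDerivAt s s' t) (hη : HasDerivAt η η' t) (hξ : HasDerivAt ξ ξ' t) :
    HasDerivAt (fun t => kL (s t) (η t) (ξ t)) (s t * s' + (η' * ξ t + η t * ξ') / 2) t := by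
  refine (((hs.fun_pow 2).add (hη.fun_mul hξ)).div_const 2).congr_deriv ?_
  simp only [Nat.cast_ofNat, Nat.add_one_sub_one, pow_one]
  ring

variable {L' : ℂ}

theorem hasDerivAt_kQ (hF : HasDerivAt F F' t) (hs : HasDerivAt s s' t) (hη : HasDerivAt η η' t) 
    (hL : HasDerivAt (fun t => kL (s t) (η t) (ξ t)) L' t) :
    HasDerivAt (fun t => kQ (expI (F t)) (s t) (η t) (ξ t))
      (L' * (s t * expI (F t) - η t) ^ 2 / (2 * expI (F t)) + kL (s t) (η t) (ξ t) *
        (s t * expI (F t) - η t) * (s' * expI (F t) + s t * (expI (F t) * (Complex.I * F')) - η') /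
        expI (F t) - kL (s t) (η t) (ξ t) * (s t * expI (F t) - η t) ^ 2 * (Complex.I * F') /
        (2 * expI (F t))) t := by
  have hw := hasDerivAt_expI hF
  have hw0 := expI_ne_zero (F t)
  refine ((hL.fun_div (hw.const_mul 2) (by simpa using hw0)).fun_mul
    (((hs.fun_mul hw).sub hη).fun_pow 2)).congr_deriv ?_
  simp only [Nat.cast_ofNat, Nat.add_one_sub_one, pow_one, Pi.sub_apply]
  field_simp
  ring

theorem hasDerivAt_kQ' (hF : HasDerivAt F F' t) (hs : HasDerivAt s s' t) (hξ : HasDerivAt ξ ξ' t) 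
    (hL : HasDerivAt (fun t => kL (s t) (η t) (ξ t)) L' t) :
    HasDerivAt (fun t => kQ' (expI (F t)) (s t) (η t) (ξ t))
      (L' * (s t - ξ t * expI (F t)) ^ 2 / (2 * expI (F t)) + kL (s t) (η t) (ξ t) *
        (s t - ξ t * expI (F t)) * (s' - (ξ' * expI (F t) + ξ t * (expI (F t) * (Complex.I * F')))) /
        expI (F t) - kL (s t) (η t) (ξ t) * (s t - ξ t * expI (F t)) ^ 2 * (Complex.I * F') /
        (2 * expI (F t))) t := by
  have hw := hasDerivAt_expI hF
  have hw0 := expI_ne_zero (F t)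
  refine ((hL.fun_div (hw.const_mul 2) (by simpa using hw0)).fun_mul
    ((hs.sub (hξ.fun_mul hw)).fun_pow 2)).congr_deriv ?_
  simp only [Nat.cast_ofNat, Nat.add_one_sub_one, pow_one, Pi.sub_apply]
  field_simp
  ring

theorem hasDerivAt_kP (hF : HasDerivAt F F' t) (hs : HasDerivAt s s' t) (hη : HasDerivAt η η' t) (hξ : HasDerivAt ξ ξ' t) 
    (hL : HasDerivAt (fun t => kL (s t) (η t) (ξ t)) L' t) (hL0 : kL (s t) (η t) (ξ t) ≠ 0)
    (hB : s t - ξ t * expI (F t) ≠ 0) :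
    HasDerivAt (fun t => kP (expI (F t)) (s t) (η t) (ξ t))
      (-(Complex.I * L' * (s t * expI (F t) + η t) / (kL (s t) (η t) (ξ t) ^ 2 *
        (s t - ξ t * expI (F t)))) + Complex.I / kL (s t) (η t) (ξ t) *
        ((s' * expI (F t) + s t * (expI (F t) * (Complex.I * F')) + η') / (s t - ξ t * expI (F t)) -
        (s t * expI (F t) + η t) * (s' - (ξ' * expI (F t) + ξ t *
        (expI (F t) * (Complex.I * F')))) / (s t - ξ t * expI (F t)) ^ 2)) t := by
  have hw := hasDerivAt_expI hF
  refine (((hasDerivAt_const t Complex.I).fun_div hL hL0).fun_mul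
    (((hs.fun_mul hw).add hη).fun_div (hs.sub (hξ.fun_mul hw)) hB)).congr_deriv ?_
  simp only [Pi.sub_apply, Pi.add_apply]
  field_simp
  ring

theorem hasDerivAt_kP' (hF : HasDerivAt F F' t) (hs : HasDerivAt s s' t) (hη : HasDerivAt η η' t) (hξ : HasDerivAt ξ ξ' t) 
    (hL : HasDerivAt (fun t => kL (s t) (η t) (ξ t)) L' t) (hL0 : kL (s t) (η t) (ξ t) ≠ 0)
    (hA : s t * expI (F t) - η t ≠ 0) :
    HasDerivAt (fun t => kP' (expI (F t)) (s t) (η t) (ξ t))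
      (-(-(Complex.I * L' * (s t + ξ t * expI (F t)) / (kL (s t) (η t) (ξ t) ^ 2 *
        (s t * expI (F t) - η t))) + Complex.I / kL (s t) (η t) (ξ t) *
        ((s' + (ξ' * expI (F t) + ξ t * (expI (F t) * (Complex.I * F')))) /
        (s t * expI (F t) - η t) - (s t + ξ t * expI (F t)) * (s' * expI (F t) + s t *
        (expI (F t) * (Complex.I * F')) - η') / (s t * expI (F t) - η t) ^ 2))) t := by
  have hw := hasDerivAt_expI hF
  refine (((hasDerivAt_const t Complex.I).fun_div hL hL0).fun_neg.fun_mul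
    ((hs.add (hξ.fun_mul hw)).fun_div ((hs.fun_mul hw).sub hη) hA)).congr_deriv ?_
  simp only [Pi.sub_apply, Pi.add_apply]
  field_simp
  ring

theorem hasDerivAt_kD (hF : HasDerivAt F F' t) (hs : HasDerivAt s s' t) (hη : HasDerivAt η η' t) (hξ : HasDerivAt ξ ξ' t) 
    (hL : HasDerivAt (fun t => kL (s t) (η t) (ξ t)) L' t) (hL0 : kL (s t) (η t) (ξ t) ≠ 0) :
    HasDerivAt (fun t => F t + kD (expI (F t)) (s t) (η t) (ξ t))
      (F' - (s' / (2 * Complex.I * kL (s t) (η t) (ξ t)) - s t * L' / (2 * Complex.I *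
        kL (s t) (η t) (ξ t) ^ 2)) * (expI (F t) * ξ t - η t / expI (F t)) -
        s t / (2 * Complex.I * kL (s t) (η t) (ξ t)) * ((expI (F t) * (Complex.I * F')) * ξ t +
        expI (F t) * ξ' - (η' / expI (F t) - η t * (Complex.I * F') / expI (F t)))) t := by
  have hw := hasDerivAt_expI hF
  have hw0 := expI_ne_zero (F t)
  refine (hF.add ((hs.fun_div (hL.const_mul (2 * Complex.I)) (by simpa using hL0)).fun_neg.fun_mul
    ((hw.fun_mul hξ).sub (hη.fun_div hw hw0)))).congr_deriv ?_
  simp only [Pi.sub_apply]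
  have hI := Complex.I_ne_zero
  field_simp
  ring

end Curves

end

/-! ### The holomorphic eccentric longitude. -/

section

/-- The square root `s = √(2L - ηξ)` in the variables `(λ, L, η, ξ)`. -/
def cs (c : CPt) : ℂ := (2 * c 1 - c 2 * c 3) ^ (1 / 2 : ℂ)

theorem cpow_half_sq (z : ℂ) : (z ^ (1 / 2 : ℂ)) ^ 2 = z := by
  rw [← Complex.cpow_nat_mul]
  norm_num

theorem cpow_half_ofReal {x : ℝ} (hx : 0 ≤ x) : ((x : ℂ)) ^ (1 / 2 : ℂ) = (√x : ℂ) := by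
  rw [Real.sqrt_eq_rpow, Complex.ofReal_cpow hx]
  norm_num

theorem kL_cs (c : CPt) : kL (cs c) (c 2) (c 3) = c 1 := by
  rw [kL, cs, cpow_half_sq]; ring

theorem analyticAt_coord_apply (c : CPt) (i : Fin 4) : AnalyticAt ℂ (fun c : CPt => c i) c :=
  (ContinuousLinearMap.proj (R := ℂ) (φ := fun _ : Fin 4 => ℂ) i).analyticAt c

section Analytic

variable {E : Type*} [NormedAddCommGroup E] [NormedSpace ℂ E] {F s η ξ : E → ℂ} {x : E}

theorem analyticAt_cpow_half {f : E → ℂ} (hf : AnalyticAt ℂ f x) (hx : f x ∈ Complex.slitPlane) :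
    AnalyticAt ℂ (fun y => f y ^ (1 / 2 : ℂ)) x := hf.cpow analyticAt_const hx

theorem analyticAt_expI (hF : AnalyticAt ℂ F x) : AnalyticAt ℂ (fun y => expI (F y)) x :=
  (analyticAt_const.mul hF).cexp

theorem analyticAt_kL (hs : AnalyticAt ℂ s x) (hη : AnalyticAt ℂ η x) (hξ : AnalyticAt ℂ ξ x) :
    AnalyticAt ℂ (fun y => kL (s y) (η y) (ξ y)) x :=
  ((hs.pow 2).add (hη.mul hξ)).div analyticAt_const two_ne_zero

theorem analyticAt_kepler (hF : AnalyticAt ℂ F x) (hs : AnalyticAt ℂ s x) (hη : AnalyticAt ℂ η x)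
    (hξ : AnalyticAt ℂ ξ x) (hL : kL (s x) (η x) (ξ x) ≠ 0) :
    AnalyticAt ℂ (fun y => kQ (expI (F y)) (s y) (η y) (ξ y)) x ∧
    AnalyticAt ℂ (fun y => kQ' (expI (F y)) (s y) (η y) (ξ y)) x ∧
    AnalyticAt ℂ (fun y => kr (expI (F y)) (s y) (η y) (ξ y)) x ∧
    AnalyticAt ℂ (fun y => kD (expI (F y)) (s y) (η y) (ξ y)) x ∧
    (s x - ξ x * expI (F x) ≠ 0 →
      AnalyticAt ℂ (fun y => kP (expI (F y)) (s y) (η y) (ξ y)) x) := by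
  have hw := analyticAt_expI hF
  have hw0 := expI_ne_zero (F x)
  have hk := analyticAt_kL hs hη hξ
  have h1 := hk.div (analyticAt_const.mul hw) (by simpa using hw0 : (2 : ℂ) * expI (F x) ≠ 0)
  have hA := (hs.mul hw).sub hη
  have hB := hs.sub (hξ.mul hw)
  refine ⟨h1.mul (hA.pow 2), h1.mul (hB.pow 2), h1.mul (hA.mul hB), ?_, fun hB0 => ?_⟩
  · exact (hs.div (analyticAt_const.mul hk) (by simpa using hL)).neg.mul
      ((hw.mul hξ).sub (hη.div hw hw0))
  · exact (analyticAt_const.div hk hL).mul (((hs.mul hw).add hη).div hB hB0)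

end Analytic

section Base

variable {lam L : ℝ} {η : ℂ}

theorem cs_emb (hη : ‖η‖ ^ 2 < L) : cs (emb (lam, L, η)) = rs L η := by
  have h1 : (2 : ℂ) * emb (lam, L, η) 1 - emb (lam, L, η) 2 * emb (lam, L, η) 3 =
      ((2 * L - ‖η‖ ^ 2 : ℝ) : ℂ) := by
    simp [emb, mul_conj_norm]
  rw [cs, h1, cpow_half_ofReal (by nlinarith [sq_nonneg ‖η‖]), rs]

theorem analyticAt_cs (hη : ‖η‖ ^ 2 < L) : AnalyticAt ℂ cs (emb (lam, L, η)) := by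
  refine analyticAt_cpow_half ((analyticAt_const.mul (analyticAt_coord_apply _ 1)).sub
    ((analyticAt_coord_apply _ 2).mul (analyticAt_coord_apply _ 3))) ?_
  have h1 : (2 : ℂ) * emb (lam, L, η) 1 - emb (lam, L, η) 2 * emb (lam, L, η) 3 =
      ((2 * L - ‖η‖ ^ 2 : ℝ) : ℂ) := by
    simp [emb, mul_conj_norm]
  rw [h1]
  exact Complex.ofReal_mem_slitPlane.2 (by nlinarith [sq_nonneg ‖η‖])

/-- The derivative of Kepler's equation in the longitude. -/
theorem hasDerivAt_kepler {F s η ξ : ℂ} (hL : kL s η ξ ≠ 0) :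
    HasDerivAt (fun F => F + kD (expI F) s η ξ) (kr (expI F) s η ξ / kL s η ξ ^ 2) F := by
  have hw0 := expI_ne_zero F
  have hw : HasDerivAt expI (expI F * (Complex.I * 1)) F :=
    ((hasDerivAt_id F).const_mul Complex.I).cexp
  have hI := Complex.I_ne_zero
  refine ((hasDerivAt_id F).add (((hw.mul_const ξ).sub
    ((hasDerivAt_const F η).fun_div hw hw0)).const_mul
      (-(s / (2 * Complex.I * kL s η ξ))))).congr_deriv ?_
  have h2 : kL s η ξ = (s ^ 2 + η * ξ) / 2 := rfl
  rw [kr]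
  field_simp
  rw [h2]
  ring

theorem kr_ne_zero (hη : ‖η‖ ^ 2 < L) :
    kr (expI (eccLong lam L η)) (rs L η) η (conj η) ≠ 0 := by
  have h := phiPoi_formulas hη lam
  intro h0
  have h1 := h.2.2.2.1
  rw [h0] at h1
  exact h.1.ne' (Complex.ofReal_eq_zero.1 h1)

theorem continuous_emb : Continuous emb := by
  refine continuous_pi fun i => ?_
  fin_cases i <;> simp [emb] <;> fun_prop

theorem kepler_conj {M : ℝ} {y : ℂ} (hy : ‖y‖ ^ 2 < M) (F : ℂ) :
    conj F + kD (expI (conj F)) (rs M y) y (conj y) =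
      conj (F + kD (expI F) (rs M y) y (conj y)) := by
  have h1 : conj (expI F) = (expI (conj F))⁻¹ := by
    rw [expI, expI, ← Complex.exp_conj, ← Complex.exp_neg]; simp
  have h2 := kL_real hy
  simp only [kD, h2]
  simp only [map_sub, map_add, map_mul, map_neg, map_div₀, Complex.conj_conj, h1,
    Complex.conj_ofReal, Complex.conj_I, map_ofNat]
  have := expI_ne_zero (conj F)
  have hM : (M : ℂ) ≠ 0 := by exact_mod_cast ((sq_nonneg _).trans_lt hy).ne'
  field_simp
  ring

/-- The implicit function theorem in one unknown. The last conclusion keeps local uniqueness on a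
full neighbourhood of the base point; the reality of the eccentric longitude at real points rests on
it. -/
theorem exists_implicit_function {E : Type*} [NormedAddCommGroup E] [NormedSpace ℂ E]
    [CompleteSpace E] {f : E × ℂ → ℂ} {c₀ : E} {F₀ d : ℂ} (hfa : AnalyticAt ℂ f (c₀, F₀))
    (hf0 : f (c₀, F₀) = 0) (hd : HasDerivAt (fun F => f (c₀, F)) d F₀) (hd0 : d ≠ 0) :
    ∃ Fh : E → ℂ, AnalyticAt ℂ Fh c₀ ∧ Fh c₀ = F₀ ∧ (∀ᶠ c in 𝓝 c₀, f (c, Fh c) = 0) ∧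
      ∀ᶠ p in 𝓝 (c₀, F₀), f p = 0 → Fh p.1 = p.2 := by
  have hinv : (fderiv ℂ f (c₀, F₀) ∘L .inr ℂ E ℂ).IsInvertible := by
    have h2 : HasFDerivAt (fun F => f (c₀, F)) (fderiv ℂ f (c₀, F₀) ∘L .inr ℂ E ℂ) F₀ :=
      hfa.differentiableAt.hasFDerivAt.comp F₀ (hasFDerivAt_prodMk_right c₀ F₀)
    rw [h2.unique hd.hasFDerivAt]
    refine ⟨ContinuousLinearEquiv.unitsEquivAut ℂ (Units.mk0 _ hd0), ?_⟩
    ext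
    simp
  have hcd : ContDiffAt ℂ (⊤ : WithTop ℕ∞) f (c₀, F₀) := hfa.contDiffAt
  refine ⟨hcd.implicitFunction (by simp) hinv,
    (hcd.contDiffAt_implicitFunction (by simp) hinv).analyticAt,
    hcd.implicitFunction_apply_self (by simp) hinv, ?_, ?_⟩
  · have := hcd.eventually_apply_implicitFunction (by simp) hinv
    rwa [hf0] at this
  · have huniq := hcd.eventually_apply_eq_iff_implicitFunction (by simp) hinv
    rw [hf0] at huniq
    filter_upwards [huniq] with p hp using hp.1

/-- Near a real point, Kepler's equation has a holomorphic solution, which at the real points is the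
eccentric longitude. -/
theorem exists_local_longitude (hη : ‖η‖ ^ 2 < L) :
    ∃ Fh : CPt → ℂ, AnalyticAt ℂ Fh (emb (lam, L, η)) ∧
      (∀ᶠ c in 𝓝 (emb (lam, L, η)), Fh c + kD (expI (Fh c)) (cs c) (c 2) (c 3) = c 0) ∧
      ∀ᶠ z in 𝓝 ((lam, L, η) : RealPt), Fh (emb z) = eccLong z.1 z.2.1 z.2.2 := by
  set c₀ : CPt := emb (lam, L, η) with hc₀
  set F₀ : ℂ := (eccLong lam L η : ℂ) with hF₀
  have hcs : cs c₀ = rs L η := cs_emb hη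
  have hL : (L : ℂ) ≠ 0 := by exact_mod_cast ((sq_nonneg _).trans_lt hη).ne'
  set f : CPt × ℂ → ℂ := fun p => p.2 + kD (expI p.2) (cs p.1) (p.1 2) (p.1 3) - p.1 0 with hf
  have hci : ∀ i, AnalyticAt ℂ (fun p : CPt × ℂ => p.1 i) (c₀, F₀) := fun i =>
    AnalyticAt.comp (g := fun c : CPt => c i) (f := Prod.fst) (analyticAt_coord_apply _ i)
      analyticAt_fst
  have hcsa : AnalyticAt ℂ (fun p : CPt × ℂ => cs p.1) (c₀, F₀) :=
    AnalyticAt.comp (g := cs) (f := Prod.fst) (analyticAt_cs hη) analyticAt_fst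
  have hfa : AnalyticAt ℂ f (c₀, F₀) := by
    have h1 := (analyticAt_kepler (F := fun p : CPt × ℂ => p.2) analyticAt_snd hcsa (hci 2) (hci 3)
      (by rw [kL_cs]; simpa [hc₀, emb] using hL)).2.2.2.1
    exact (analyticAt_snd.add h1).sub (hci 0)
  have hf0 : f (c₀, F₀) = 0 := by
    have := (kepler_iff hη lam (eccLong lam L η)).2 rfl
    simp only [hf, hcs, sub_eq_zero]
    exact this
  have hconj : ∀ (z : RealPt) (F : ℂ), ‖z.2.2‖ ^ 2 < z.2.1 →
      f (emb z, conj F) = conj (f (emb z, F)) := by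
    rintro ⟨l, M, y⟩ F hy
    have h4 : cs (emb (l, M, y)) = rs M y := cs_emb hy
    have h5 := kepler_conj hy F
    have h6 : f (emb (l, M, y), conj F) =
      conj F + kD (expI (conj F)) (rs M y) y (conj y) - (l : ℂ) := by rw [← h4]; rfl
    have h7 : f (emb (l, M, y), F) =
      F + kD (expI F) (rs M y) y (conj y) - (l : ℂ) := by rw [← h4]; rfl
    rw [h6, h7, h5, map_sub, Complex.conj_ofReal]
  have hk0 : kL (rs L η) η (conj η) ≠ 0 := by rw [kL_real hη]; exact hL
  have hd : HasDerivAt (fun F => f (c₀, F)) (kr (expI F₀) (rs L η) η (conj η) /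
      kL (rs L η) η (conj η) ^ 2) F₀ := by
    have h1 := (hasDerivAt_kepler (F := F₀) hk0).sub_const (lam : ℂ)
    rw [← hcs] at h1 ⊢
    exact h1
  obtain ⟨Fh, hFa, hF0, hsol, huniq⟩ := exists_implicit_function hfa hf0 hd
    (div_ne_zero (kr_ne_zero hη) (pow_ne_zero 2 hk0))
  refine ⟨Fh, hFa, ?_, ?_⟩
  · filter_upwards [hsol] with c hc
    exact sub_eq_zero.1 hc
  -- At a real point the conjugate of a solution is a solution, and it is still close to F₀. By
  -- local uniqueness the solution is real, and a real solution is the eccentric longitude by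
  -- `kepler_iff`.
  · have hembc : Tendsto emb (𝓝 ((lam, L, η) : RealPt)) (𝓝 c₀) := by
      exact continuous_emb.tendsto _
    have hlim : Tendsto (fun c => (c, conj (Fh c))) (𝓝 c₀) (𝓝 (c₀, F₀)) := by
      have h1 : Tendsto (fun c => conj (Fh c)) (𝓝 c₀) (𝓝 (conj (Fh c₀))) :=
        (Complex.continuous_conj.tendsto _).comp hFa.continuousAt
      rw [hF0, hF₀, Complex.conj_ofReal] at h1
      exact tendsto_id.prodMk_nhds h1
    have hopen : ∀ᶠ z in 𝓝 ((lam, L, η) : RealPt), ‖z.2.2‖ ^ 2 < z.2.1 := by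
      refine IsOpen.mem_nhds (isOpen_lt ?_ ?_) hη <;> fun_prop
    filter_upwards [hembc.eventually hsol, hembc.eventually (hlim.eventually huniq), hopen]
      with z hz1 hz2 hz3
    have h1 : f (emb z, conj (Fh (emb z))) = 0 := by rw [hconj z _ hz3, hz1, map_zero]
    have h2 := hz2 h1
    obtain ⟨x, hx⟩ := Complex.conj_eq_iff_real.1 h2.symm
    have h3 := sub_eq_zero.1 hz1
    obtain ⟨l, M, y⟩ := z
    have h4 : cs (emb (l, M, y)) = rs M y := cs_emb hz3
    rw [h4, hx] at h3
    rw [hx]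
    exact_mod_cast (kepler_iff hz3 l x).1 h3

end Base

end

section

/-! ### The chart in the unscaled Poincaré coordinates -/

/-- The Cartesian state with Poincaré coordinates `(λ, L, η, conj η)`. -/
def cartPoi (z : RealPt) : Cart := phiPol (phiPoi z.1 z.2.1 z.2.2 (conj z.2.2))

/-- The domain of the Poincaré coordinates. -/
def poiDomain : Set RealPt := {z | ‖z.2.2‖ ^ 2 < z.2.1}

theorem isOpen_poiDomain : IsOpen poiDomain := by
  refine isOpen_lt ?_ ?_ <;> fun_prop

/-- The complex position of a Cartesian state. -/
def cQ (c : Cart) : ℂ := c 0 + Complex.I * c 1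

/-- The complex momentum of a Cartesian state. -/
def cP (c : Cart) : ℂ := c 2 + Complex.I * c 3

theorem cart_ext {c d : Cart} (hQ : cQ c = cQ d) (hP : cP c = cP d) : c = d := by
  have h0 := congrArg Complex.re hQ
  have h1 := congrArg Complex.im hQ
  have h2 := congrArg Complex.re hP
  have h3 := congrArg Complex.im hP
  simp [cQ, cP] at h0 h1 h2 h3
  ext i
  fin_cases i <;> assumption

theorem conj_cQ (c : Cart) : conj (cQ c) = c 0 - Complex.I * c 1 := by
  simp [cQ, sub_eq_add_neg]

theorem conj_cP (c : Cart) : conj (cP c) = c 2 - Complex.I * c 3 := by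
  simp [cP, sub_eq_add_neg]

/-- The unit complex number at the eccentric longitude. -/
def eccUnit (z : RealPt) : ℂ := expI (eccLong z.1 z.2.1 z.2.2)

theorem norm_eccUnit (z : RealPt) : ‖eccUnit z‖ = 1 := norm_expI _

theorem eccUnit_ne_zero (z : RealPt) : eccUnit z ≠ 0 := expI_ne_zero _

theorem cartPoi_formulas {z : RealPt} (hz : z ∈ poiDomain) :
    cQ (cartPoi z) = kQ (eccUnit z) (rs z.2.1 z.2.2) z.2.2 (conj z.2.2) ∧
    cP (cartPoi z) = kP (eccUnit z) (rs z.2.1 z.2.2) z.2.2 (conj z.2.2) := by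
  obtain ⟨-, -, -, -, h1, h2⟩ := phiPoi_formulas hz z.1
  rw [eccUnit, ← h1, ← h2, expI_ofReal]
  constructor
  · simp only [cQ, cartPoi, phiPol, Matrix.cons_val]
    push_cast
    ring
  · simp only [cP, cartPoi, phiPol, Matrix.cons_val]
    push_cast
    linear_combination (-((phiPoi z.1 z.2.1 z.2.2 (conj z.2.2)).G : ℂ) /
      (phiPoi z.1 z.2.1 z.2.2 (conj z.2.2)).r *
      Complex.sin (phiPoi z.1 z.2.1 z.2.2 (conj z.2.2)).θ) * Complex.I_sq

theorem conj_kepler {L : ℝ} {η w : ℂ} (hη : ‖η‖ ^ 2 < L) (hw : ‖w‖ = 1) :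
    conj (kQ w (rs L η) η (conj η)) = kQ' w (rs L η) η (conj η) ∧
    conj (kP w (rs L η) η (conj η)) = kP' w (rs L η) η (conj η) := by
  have hw0 : w ≠ 0 := by rintro rfl; simp at hw
  have hcw : conj w = w⁻¹ := (Complex.inv_eq_conj hw).symm
  obtain ⟨n1, n2⟩ := real_factors_ne_zero hη hw
  have hL : (L : ℂ) ≠ 0 := by exact_mod_cast ((sq_nonneg _).trans_lt hη).ne'
  rw [kQ, kQ', kP, kP', kL_real hη]
  simp only [map_mul, map_div₀, map_pow, map_sub, map_add, Complex.conj_conj, Complex.conj_ofReal,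
    hcw, Complex.conj_I, map_ofNat]
  constructor
  · field_simp
  · have n3 : (rs L η : ℂ) - η * w⁻¹ ≠ 0 := by
      intro h
      apply n1
      field_simp at h
      linear_combination h
    have n4 : (w * rs L η - η : ℂ) ≠ 0 := by rwa [mul_comm w]
    field_simp

/-- The first integrals in polar coordinates. -/
theorem phiPol_invariants (c : Polar) (hr : 0 < c.r) :
    phiPol c 0 ^ 2 + phiPol c 1 ^ 2 = c.r ^ 2 ∧
    phiPol c 2 ^ 2 + phiPol c 3 ^ 2 = c.R ^ 2 + c.G ^ 2 / c.r ^ 2 ∧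
    phiPol c 0 * phiPol c 3 - phiPol c 1 * phiPol c 2 = c.G := by
  have h := Real.cos_sq_add_sin_sq c.θ
  simp only [phiPol, Matrix.cons_val]
  refine ⟨by linear_combination c.r ^ 2 * h, ?_, ?_⟩
  · field_simp
    linear_combination (c.r ^ 2 * c.R ^ 2 + c.G ^ 2) * h
  · field_simp
    linear_combination c.G * h

theorem cartPoi_invariants {z : RealPt} (hz : z ∈ poiDomain) :
    0 < (phiPoi z.1 z.2.1 z.2.2 (conj z.2.2)).r ∧
    √(cartPoi z 0 ^ 2 + cartPoi z 1 ^ 2) = (phiPoi z.1 z.2.1 z.2.2 (conj z.2.2)).r ∧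
    (cartPoi z 2 ^ 2 + cartPoi z 3 ^ 2) / 2 - 1 / √(cartPoi z 0 ^ 2 + cartPoi z 1 ^ 2) =
      -1 / (2 * z.2.1 ^ 2) ∧
    cartPoi z 0 * cartPoi z 3 - cartPoi z 1 * cartPoi z 2 = z.2.1 - ‖z.2.2‖ ^ 2 := by
  obtain ⟨h1, h2, h3, -⟩ := phiPoi_formulas hz z.1
  obtain ⟨i1, i2, i3⟩ := phiPol_invariants _ h1
  have h4 : √(cartPoi z 0 ^ 2 + cartPoi z 1 ^ 2) = (phiPoi z.1 z.2.1 z.2.2 (conj z.2.2)).r := by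
    rw [cartPoi, i1, Real.sqrt_sq h1.le]
  refine ⟨h1, h4, ?_, ?_⟩
  · rw [h4, ← h3, cartPoi, i2]
  · rw [cartPoi, i3, h2]

theorem cartPoi_mem {z : RealPt} (hz : z ∈ poiDomain) : cartPoi z ∈ directElliptic := by
  obtain ⟨h1, h2, h3, h4⟩ := cartPoi_invariants hz
  have hL : 0 < z.2.1 := (sq_nonneg _).trans_lt hz
  refine ⟨?_, ?_, ?_⟩
  · rintro ⟨e1, e2⟩
    rw [e1, e2] at h2
    simp at h2
    linarith
  · rw [h3]
    have : 0 < 1 / (2 * z.2.1 ^ 2) := by positivity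
    rw [neg_div]
    linarith
  · rw [h4]
    have : ‖z.2.2‖ ^ 2 < z.2.1 := hz
    linarith

/-- The eccentricity vector and the eccentric longitude, from the Cartesian state. -/
theorem recover {w s η ξ : ℂ} (hw : w ≠ 0) (hL : kL s η ξ ≠ 0) (hB : s - ξ * w ≠ 0) :
    -Complex.I * ((s ^ 2 - η * ξ) / 2) * kP w s η ξ - kQ w s η ξ / kr w s η ξ =
      η * s / kL s η ξ ∧
    kQ w s η ξ / kL s η ξ + η * s - Complex.I * kr w s η ξ * kP w s η ξ = s ^ 2 * w := by
  have hI := Complex.I_sq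
  rw [kP, kQ, kr]
  constructor
  · field_simp
    rw [kL, hI]
    ring
  · rw [mul_comm ξ w] at hB
    field_simp
    rw [hI]
    ring

/-- The Cartesian states of the Kepler problem in the rational coordinates. -/
theorem kepler_algebra {Q Q' P P' r G L E E' I : ℂ} (hI : I ^ 2 = -1) (hr : r ≠ 0) (hL : L ≠ 0)
    (hQ : Q * Q' = r ^ 2) (hP : P * P' = 2 / r - 1 / L ^ 2) (hG : Q' * P - Q * P' = 2 * I * G)
    (hE : E = -I * G * P - Q / r) (hE' : E' = I * G * P' - Q' / r) :
    (Q / L + L * E - I * r * P) * (Q / L + L * E + I * r * P) = (L * E) ^ 2 ∧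
    L ^ 2 * (E * E') = L ^ 2 - G ^ 2 ∧
    (Q / L + L * E - I * r * P) * (Q' / L + L * E' + I * r * P') = (L + G) ^ 2 := by
  have hrP : r * (P * P') = 2 - r / L ^ 2 := by rw [hP]; field_simp
  have hQr : Q * Q' / r = r := by rw [hQ]; field_simp
  have hEE : L ^ 2 * (E * E') = L ^ 2 - G ^ 2 := by
    have : E * E' = 1 - G ^ 2 / L ^ 2 := by
      rw [hE, hE']
      have h1 : (-I * G * P - Q / r) * (I * G * P' - Q' / r) =
          -I ^ 2 * G ^ 2 * (P * P') + I * G / r * (Q' * P - Q * P') + Q * Q' / r ^ 2 := by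
        field_simp; ring
      rw [h1, hG, hQ, hP, hI]
      field_simp
      linear_combination 2 * G ^ 2 * L ^ 2 * hI
    rw [this]; field_simp
  have hQE : Q * E' + Q' * E = 2 * G ^ 2 - 2 * r := by
    rw [hE, hE']
    have h1 : Q * (I * G * P' - Q' / r) + Q' * (-I * G * P - Q / r) =
        -(I * G) * (Q' * P - Q * P') - 2 * (Q * Q' / r) := by ring
    rw [h1, hG, hQr]
    linear_combination (-2 * G ^ 2) * hI
  have hEP : r * (E * P' - E' * P) = -2 * I * G * (2 - r / L ^ 2) + 2 * I * G := by
    rw [← hrP, hE, hE']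
    field_simp
    linear_combination hG
  refine ⟨?_, hEE, ?_⟩
  · have h1 : 1 / L ^ 2 = 2 / r - P * P' := by rw [hP]; ring
    have h2 : (Q / L + L * E - I * r * P) * (Q / L + L * E + I * r * P) =
        Q ^ 2 * (1 / L ^ 2) + 2 * Q * E + (L * E) ^ 2 - I ^ 2 * r ^ 2 * P ^ 2 := by
      field_simp; ring
    rw [h2, h1, hI, hE, ← hQ]
    linear_combination (Q * P) * hG
  · have h2 : (Q / L + L * E - I * r * P) * (Q' / L + L * E' + I * r * P') =
        Q * Q' / L ^ 2 + (Q * E' + Q' * E) - I * r / L * (Q' * P - Q * P') + L ^ 2 * (E * E') +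
          I * L * (r * (E * P' - E' * P)) - I ^ 2 * r * (r * (P * P')) := by
      field_simp; ring
    rw [h2, hQ, hQE, hG, hEE, hEP, hrP]
    field_simp
    ring_nf
    rw [hI]
    ring

theorem kD_mem_real {L : ℝ} {η : ℂ} (hη : ‖η‖ ^ 2 < L) (F : ℝ) :
    ∃ x : ℝ, (F : ℂ) + kD (expI F) (rs L η) η (conj η) = x := by
  have := kD_real hη (F - Complex.arg η)
  rw [sub_add_cancel] at this
  rw [this]
  exact ⟨_, (Complex.ofReal_add _ _).symm⟩

/-- The coordinates are rebuilt from the first integrals: L from the Kepler energy, η = E L / s from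
the eccentricity vector `E` with s² = L + G, and w from `X`, which must equal s² w by `recover` and
has modulus s² by `kepler_algebra`. Then λ is defined by Kepler's equation. -/
theorem directElliptic_subset : directElliptic ⊆ cartPoi '' poiDomain := by
  rintro c ⟨hc0, hcE, hcG⟩
  have hI := Complex.I_sq
  have hrr : 0 < c 0 ^ 2 + c 1 ^ 2 := by
    by_contra h
    exact hc0 ⟨by nlinarith [sq_nonneg (c 0), sq_nonneg (c 1)],
      by nlinarith [sq_nonneg (c 0), sq_nonneg (c 1)]⟩
  set r : ℝ := √(c 0 ^ 2 + c 1 ^ 2) with hr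
  have hrp : 0 < r := Real.sqrt_pos.2 hrr
  have hr2 : r ^ 2 = c 0 ^ 2 + c 1 ^ 2 := Real.sq_sqrt hrr.le
  set G : ℝ := c 0 * c 3 - c 1 * c 2 with hG
  set e : ℝ := 2 / r - (c 2 ^ 2 + c 3 ^ 2) with he
  have hep : 0 < e := by
    have : 2 / r = 2 * (1 / r) := by ring
    rw [he, this]; linarith
  set L : ℝ := 1 / √e with hL
  have hLp : 0 < L := by have := Real.sqrt_pos.2 hep; positivity
  have hL2 : 1 / L ^ 2 = e := by rw [hL, div_pow, Real.sq_sqrt hep.le]; simp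
  set Q := cQ c with hQ
  set P := cP c with hP
  have hQn : Q * conj Q = (r : ℂ) ^ 2 := by
    rw [hQ, conj_cQ, cQ]
    have : (r : ℂ) ^ 2 = (c 0 : ℂ) ^ 2 + (c 1 : ℂ) ^ 2 := by exact_mod_cast hr2
    rw [this]; linear_combination (-(c 1 : ℂ) ^ 2) * hI
  have hPn : P * conj P = 2 / (r : ℂ) - 1 / (L : ℂ) ^ 2 := by
    have h1 : 1 / (L : ℂ) ^ 2 = 2 / r - ((c 2 : ℂ) ^ 2 + (c 3 : ℂ) ^ 2) := by
      exact_mod_cast hL2.trans he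
    rw [h1, hP, conj_cP, cP]; linear_combination (-(c 3 : ℂ) ^ 2) * hI
  have hGc : conj Q * P - Q * conj P = 2 * Complex.I * G := by
    rw [hQ, hP, conj_cP, conj_cQ, cP, cQ, hG]; push_cast; ring
  set E : ℂ := -Complex.I * G * P - Q / r with hE
  have hE' : conj E = Complex.I * G * conj P - conj Q / r := by
    rw [hE]; simp
  have hrc : (r : ℂ) ≠ 0 := by exact_mod_cast hrp.ne'
  have hLc : (L : ℂ) ≠ 0 := by exact_mod_cast hLp.ne'
  obtain ⟨k1, k2, k3⟩ := kepler_algebra hI hrc hLc hQn hPn hGc hE hE'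
  have hEn : L ^ 2 * ‖E‖ ^ 2 = L ^ 2 - G ^ 2 := by
    rw [mul_conj_norm] at k2
    exact_mod_cast k2
  set s : ℝ := √(L + G) with hs
  have hsp : 0 < s := Real.sqrt_pos.2 (by linarith)
  have hs2 : s ^ 2 = L + G := Real.sq_sqrt (by linarith)
  have hsc : (s : ℂ) ≠ 0 := by exact_mod_cast hsp.ne'
  set η : ℂ := E * L / s with hη
  have hηn : ‖η‖ ^ 2 = L - G := by
    rw [hη, norm_div, norm_mul, Complex.norm_real, Complex.norm_real, Real.norm_of_nonneg hLp.le,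
      Real.norm_of_nonneg hsp.le, div_pow, hs2, div_eq_iff (by linarith)]
    linear_combination hEn
  have hηL : ‖η‖ ^ 2 < L := by rw [hηn]; linarith
  have hrs : rs L η = s := by rw [rs, hηn, hs]; congr 1; ring
  set X : ℂ := Q / L + L * E - Complex.I * r * P with hX
  have hXn : ‖X‖ = s ^ 2 := by
    have h1 : conj X = conj Q / L + L * conj E + Complex.I * r * conj P := by
      rw [hX]; simp
    have h2 : X * conj X = ((L + G : ℝ) : ℂ) ^ 2 := by rw [h1, k3]; push_cast; rfl
    rw [mul_conj_norm] at h2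
    have h3 : ‖X‖ ^ 2 = (L + G) ^ 2 := by exact_mod_cast h2
    rw [hs2]
    exact (sq_eq_sq₀ (norm_nonneg _) (by linarith)).1 h3
  set w : ℂ := X / (s : ℂ) ^ 2 with hw
  have hwn : ‖w‖ = 1 := by
    rw [hw, norm_div, hXn, norm_pow, Complex.norm_real, Real.norm_of_nonneg hsp.le]
    field_simp
  have hw0 : w ≠ 0 := by intro h; rw [h] at hwn; simp at hwn
  have hwF : expI (Complex.arg w) = w := by
    have := (arg_polar w).1
    rw [hwn] at this
    simpa using this.symm
  obtain ⟨lam, hlam⟩ := kD_mem_real hηL (Complex.arg w)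
  have hecc := (kepler_iff hηL lam (Complex.arg w)).1 hlam
  have hz : ((lam, L, η) : RealPt) ∈ poiDomain := hηL
  refine ⟨(lam, L, η), hz, ?_⟩
  obtain ⟨f1, f2⟩ := cartPoi_formulas hz
  have hu : eccUnit (lam, L, η) = w := by rw [eccUnit, ← hecc, hwF]
  obtain ⟨n1, n2⟩ := real_factors_ne_zero hηL hwn
  simp only [hu] at f1 f2
  rw [hrs] at f1 f2 n1 n2
  have hkL : kL s η (conj η) = L := by rw [← hrs]; exact kL_real hηL
  have hsη : (s : ℂ) * η = L * E := by rw [hη]; field_simp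
  have hXw : X = s ^ 2 * w := by rw [hw]; field_simp
  -- The companion of X. Position and momentum are linear in X, Y and E, so Y = η² / w allows them
  -- to be compared with the rational formulas.
  set Y : ℂ := Q / L + L * E + Complex.I * r * P with hY
  have hYw : Y = η ^ 2 / w := by
    have : X * Y = s ^ 2 * η ^ 2 := by rw [k1, ← hsη]; ring
    rw [hXw] at this
    field_simp
    have h3 : (s : ℂ) ^ 2 * (Y * w) = s ^ 2 * η ^ 2 := by linear_combination this
    exact mul_left_cancel₀ (pow_ne_zero 2 hsc) h3
  have hQk : kQ w s η (conj η) = Q := by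
    have h1 : kQ w s η (conj η) = L / 2 * (s ^ 2 * w - 2 * (s * η) + η ^ 2 / w) := by
      rw [kQ, hkL]; field_simp; ring
    rw [h1, ← hXw, ← hYw, hsη, hX, hY]
    field_simp
    ring
  have hrk : kr w s η (conj η) = r := by
    have h1 : conj (s * w - η) = (s - conj η * w) / w := by
      simp only [map_sub, map_mul, Complex.conj_ofReal, ← Complex.inv_eq_conj hwn]
      field_simp
    have h2 : kr w s η (conj η) = L / 2 * (‖(s : ℂ) * w - η‖ : ℂ) ^ 2 := by
      rw [kr, hkL, ← mul_conj_norm, h1]; field_simp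
    have h3 : ‖Q‖ = L / 2 * ‖(s : ℂ) * w - η‖ ^ 2 := by
      rw [← hQk, kQ, hkL, norm_mul, norm_div, norm_mul, hwn, norm_pow]
      simp [abs_of_pos hLp]
    have h4 : ‖Q‖ = r := by
      rw [mul_conj_norm] at hQn
      have : ‖Q‖ ^ 2 = r ^ 2 := by exact_mod_cast hQn
      exact (sq_eq_sq₀ (norm_nonneg _) hrp.le).1 this
    rw [h2, ← h4, h3]
    push_cast
    rfl
  have hPk : kP w s η (conj η) = P := by
    have h1 : (r : ℂ) * kP w s η (conj η) = Complex.I / 2 * (s ^ 2 * w - η ^ 2 / w) := by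
      rw [← hrk, kr, kP, hkL, mul_comm (conj η)]
      rw [mul_comm (conj η)] at n2
      field_simp; ring
    rw [← hXw, ← hYw, hX, hY] at h1
    have h2 : (r : ℂ) * kP w s η (conj η) = r * P := by
      rw [h1]; linear_combination (-(r : ℂ) * P) * hI
    exact mul_left_cancel₀ hrc h2
  exact cart_ext (f1.trans hQk) (f2.trans hPk)

theorem cartPoi_image : cartPoi '' poiDomain = directElliptic :=
  Set.Subset.antisymm (Set.image_subset_iff.2 fun _ hz => cartPoi_mem hz) directElliptic_subset

theorem expI_eq_iff {x y : ℝ} : expI x = expI y ↔ ∃ k : ℤ, y = x + 2 * Real.pi * k := by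
  rw [eq_comm, expI, expI, Complex.exp_eq_exp_iff_exists_int]
  refine exists_congr fun k => ?_
  have hI := Complex.I_ne_zero
  constructor
  · intro h
    have h1 : Complex.I * (y : ℂ) = Complex.I * ((x + 2 * Real.pi * k : ℝ) : ℂ) := by
      rw [h]; push_cast; ring
    exact_mod_cast mul_left_cancel₀ hI h1
  · rintro rfl
    push_cast
    ring

/-- Energy and angular momentum determine L and ‖η‖, the eccentricity vector determines η, and the
second identity of `recover` determines w = e^{iF}. In Kepler's equation λ - F depends on F only
through w, so the ambiguity of F by multiples of 2π is that of λ. -/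
theorem cartPoi_eq_iff {z z' : RealPt} (hz : z ∈ poiDomain) (hz' : z' ∈ poiDomain) :
    cartPoi z = cartPoi z' ↔ (∃ k : ℤ, z'.1 = z.1 + 2 * Real.pi * k) ∧ z.2 = z'.2 := by
  obtain ⟨f1, f2⟩ := cartPoi_formulas hz
  obtain ⟨g1, g2⟩ := cartPoi_formulas hz'
  obtain ⟨l, L, η⟩ := z
  obtain ⟨l', L', η'⟩ := z'
  have hη : ‖η‖ ^ 2 < L := hz
  have hη' : ‖η'‖ ^ 2 < L' := hz'
  have hkep := (kepler_iff hη l _).2 rfl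
  constructor
  · intro h
    obtain ⟨r0, r1, r2, r3⟩ := cartPoi_invariants hz
    obtain ⟨t0, t1, t2, t3⟩ := cartPoi_invariants hz'
    rw [h] at r1 r2 r3
    have hLp : 0 < L := (sq_nonneg _).trans_lt hη
    have hLp' : 0 < L' := (sq_nonneg _).trans_lt hη'
    have hLL : L = L' := by
      have h1 : -1 / (2 * L ^ 2) = -1 / (2 * L' ^ 2) := r2.symm.trans t2
      field_simp at h1
      exact (sq_eq_sq₀ hLp.le hLp'.le).1 (by linarith)
    subst hLL
    have hnn : ‖η‖ ^ 2 = ‖η'‖ ^ 2 := by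
      have : L - ‖η‖ ^ 2 = L - ‖η'‖ ^ 2 := r3.symm.trans t3
      linarith
    have hss : rs L η = rs L η' := by rw [rs, rs, hnn]
    have hrr := r1.symm.trans t1
    have k1 := (phiPoi_formulas hη l).2.2.2.1
    have k2 := (phiPoi_formulas hη' l').2.2.2.1
    have n2 := (real_factors_ne_zero hη (norm_eccUnit (l, L, η))).2
    have n4 := (real_factors_ne_zero hη' (norm_eccUnit (l', L, η'))).2
    have hLc : (L : ℂ) ≠ 0 := by exact_mod_cast hLp.ne'
    obtain ⟨a1, a2⟩ := recover (eccUnit_ne_zero _) (by rwa [kL_real hη]) n2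
    obtain ⟨b1, b2⟩ := recover (eccUnit_ne_zero _) (by rwa [kL_real hη']) n4
    simp only [eccUnit] at f1 f2 g1 g2 a1 a2 b1 b2
    rw [kL_real hη, ← f1, ← f2, ← k1, hss] at a1 a2
    rw [kL_real hη', ← g1, ← g2, ← k2] at b1 b2
    rw [mul_conj_norm] at a1 b1
    simp only at hrr
    rw [h, hrr] at a1 a2
    have hnnc : (‖η‖ : ℂ) ^ 2 = (‖η'‖ : ℂ) ^ 2 := by exact_mod_cast hnn
    rw [hnnc] at a1
    have hsc : (rs L η' : ℂ) ≠ 0 := by exact_mod_cast (rs_pos hη').ne'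
    have hηη : η = η' := by
      have h1 := a1.symm.trans b1
      field_simp at h1
      exact h1
    subst hηη
    refine ⟨?_, rfl⟩
    have hw := mul_left_cancel₀ (pow_ne_zero 2 hsc) (a2.symm.trans b2)
    obtain ⟨k, hk⟩ := expI_eq_iff.1 hw
    refine ⟨k, ?_⟩
    have hkep' := (kepler_iff hη' l' _).2 rfl
    rw [← hw, hk] at hkep'
    have : (l' : ℂ) = ((l + 2 * Real.pi * k : ℝ) : ℂ) := by
      rw [← hkep']
      push_cast
      rw [← hkep]
      ring
    exact_mod_cast this
  · rintro ⟨⟨k, hk⟩, h2⟩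
    simp only at hk
    obtain ⟨rfl, rfl⟩ := Prod.ext_iff.1 h2
    simp only at *
    have h3 : expI ((eccLong l L η + 2 * Real.pi * k : ℝ) : ℂ) = expI (eccLong l L η) :=
      (expI_eq_iff.2 ⟨k, rfl⟩).symm
    have h4 : eccLong l L η + 2 * Real.pi * k = eccLong l' L η := by
      refine (kepler_iff hη l' _).1 ?_
      rw [h3, hk]
      push_cast
      linear_combination hkep
    have h5 : eccUnit (l, L, η) = eccUnit (l', L, η) := by
      simp only [eccUnit]
      rw [← h4, h3]
    rw [h5] at f1 f2
    exact cart_ext (f1.trans g1.symm) (f2.trans g2.symm)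

end

/-! ### Analyticity and symplecticity of the Poincaré chart. -/

section

/-- `emb` as a real linear map. -/
def embL : RealPt →L[ℝ] CPt :=
  LinearMap.toContinuousLinearMap
    { toFun := emb
      map_add' := fun a b => by ext i; fin_cases i <;> simp [emb]
      map_smul' := fun c a => by ext i; fin_cases i <;> simp [emb] }

theorem analyticAt_comp_emb {f : CPt → ℂ} {z : RealPt} (hf : AnalyticAt ℂ f (emb z)) :
    AnalyticAt ℝ (fun z => f (emb z)) z :=
  AnalyticAt.comp (g := f) (f := embL) (hf.restrictScalars (𝕜 := ℝ)) (embL.analyticAt z)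

theorem analyticAt_re_im {E : Type*} [NormedAddCommGroup E] [NormedSpace ℝ E] {f : E → ℂ} {x : E}
    (hf : AnalyticAt ℝ f x) :
    AnalyticAt ℝ (fun y => (f y).re) x ∧ AnalyticAt ℝ (fun y => (f y).im) x :=
  ⟨AnalyticAt.comp (g := Complex.reCLM) (Complex.reCLM.analyticAt _) hf,
    AnalyticAt.comp (g := Complex.imCLM) (Complex.imCLM.analyticAt _) hf⟩

theorem hasDerivAt_cQ {c : ℝ → Cart} {c' : Cart} {t : ℝ} (h : HasDerivAt c c' t) :
    HasDerivAt (fun t => cQ (c t)) (cQ c') t ∧ HasDerivAt (fun t => cP (c t)) (cP c') t ∧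
    HasDerivAt (fun t => conj (cQ (c t))) (conj (cQ c')) t ∧
    HasDerivAt (fun t => conj (cP (c t))) (conj (cP c')) t := by
  have hi := fun i => (hasDerivAt_pi.1 h i).ofReal_comp
  have h1 : HasDerivAt (fun t => cQ (c t)) (cQ c') t := (hi 0).add ((hi 1).const_mul Complex.I)
  have h2 : HasDerivAt (fun t => cP (c t)) (cP c') t := (hi 2).add ((hi 3).const_mul Complex.I)
  exact ⟨h1, h2, h1.star, h2.star⟩

/-- The form is the real part of dQ ∧ dP̄ with Q = q₁ + i q₂ and P = p₁ + i p₂. All four of Q, P and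
their conjugates have rational formulas. -/
theorem cartForm_eq (v w : Cart) : (cartForm v w : ℂ) =
    (cQ v * conj (cP w) - cQ w * conj (cP v) + (conj (cQ v) * cP w - conj (cQ w) * cP v)) / 2 := by
  rw [conj_cQ, conj_cQ, conj_cP, conj_cP, cQ, cQ, cP, cP, cartForm]
  push_cast
  linear_combination ((v 1 : ℂ) * w 3 - w 1 * v 3) * Complex.I_sq

section Local

variable {z : RealPt}

/-- The rational formulas near a real point, with a holomorphic eccentric longitude. -/
theorem exists_local_formulas (hz : z ∈ poiDomain) :
    ∃ Fh : CPt → ℂ, AnalyticAt ℂ Fh (emb z) ∧ Fh (emb z) = eccLong z.1 z.2.1 z.2.2 ∧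
      (∀ᶠ c in 𝓝 (emb z), Fh c + kD (expI (Fh c)) (cs c) (c 2) (c 3) = c 0) ∧
      ∀ᶠ y in 𝓝 z, y ∈ poiDomain ∧
        expI (Fh (emb y)) = eccUnit y ∧
        cQ (cartPoi y) = kQ (expI (Fh (emb y))) (cs (emb y)) (emb y 2) (emb y 3) ∧
        cP (cartPoi y) = kP (expI (Fh (emb y))) (cs (emb y)) (emb y 2) (emb y 3) ∧
        conj (cQ (cartPoi y)) = kQ' (expI (Fh (emb y))) (cs (emb y)) (emb y 2) (emb y 3) ∧
        conj (cP (cartPoi y)) = kP' (expI (Fh (emb y))) (cs (emb y)) (emb y 2) (emb y 3) := by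
  obtain ⟨l, L, η⟩ := z
  obtain ⟨Fh, hF, hK, hE⟩ := exists_local_longitude (lam := l) hz
  refine ⟨Fh, hF, hE.self_of_nhds, hK, ?_⟩
  filter_upwards [hE, isOpen_poiDomain.mem_nhds hz] with y hy hy2
  have h1 : expI (Fh (emb y)) = eccUnit y := by rw [hy]; rfl
  obtain ⟨f1, f2⟩ := cartPoi_formulas hy2
  obtain ⟨g1, g2⟩ := conj_kepler hy2 (norm_eccUnit y)
  have h2 : cs (emb y) = rs y.2.1 y.2.2 := cs_emb (lam := y.1) hy2
  have h3 : emb y 2 = y.2.2 := rfl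
  have h4 : emb y 3 = conj y.2.2 := rfl
  rw [h1, h2, h3, h4, f1, f2, g1, g2]
  exact ⟨hy2, rfl, rfl, rfl, rfl, rfl⟩

theorem kL_emb (hz : z ∈ poiDomain) : kL (cs (emb z)) (emb z 2) (emb z 3) ≠ 0 := by
  rw [kL_cs]
  have h : (0 : ℝ) < z.2.1 := (sq_nonneg _).trans_lt hz
  change (z.2.1 : ℂ) ≠ 0
  exact_mod_cast h.ne'

theorem factors_emb (hz : z ∈ poiDomain) :
    cs (emb z) * eccUnit z - emb z 2 ≠ 0 ∧ cs (emb z) - emb z 3 * eccUnit z ≠ 0 := by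
  have h2 : cs (emb z) = rs z.2.1 z.2.2 := cs_emb (lam := z.1) hz
  rw [h2]
  exact real_factors_ne_zero hz (norm_eccUnit z)

theorem analyticAt_cartPoi (hz : z ∈ poiDomain) : AnalyticAt ℝ cartPoi z := by
  obtain ⟨Fh, hF, -, -, hev⟩ := exists_local_formulas hz
  obtain ⟨-, hw, -⟩ := hev.self_of_nhds
  have hcs : AnalyticAt ℂ cs (emb z) := analyticAt_cs (lam := z.1) hz
  obtain ⟨h1, -, -, -, h2⟩ := analyticAt_kepler hF hcs (analyticAt_coord_apply _ 2)
    (analyticAt_coord_apply _ 3) (kL_emb hz)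
  rw [hw] at h2
  obtain ⟨q0, q1⟩ := analyticAt_re_im (analyticAt_comp_emb h1)
  obtain ⟨q2, q3⟩ := analyticAt_re_im (analyticAt_comp_emb (h2 (factors_emb hz).2))
  rw [analyticAt_pi_iff]
  intro i
  fin_cases i
  · refine q0.congr (hev.mono fun y hy => ?_)
    simp [← hy.2.2.1, cQ]
  · refine q1.congr (hev.mono fun y hy => ?_)
    simp [← hy.2.2.1, cQ]
  · refine q2.congr (hev.mono fun y hy => ?_)
    simp [← hy.2.2.2.1, cP]
  · refine q3.congr (hev.mono fun y hy => ?_)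
    simp [← hy.2.2.2.1, cP]

/-- The directional derivatives of the chart. -/
theorem exists_derivatives (hz : z ∈ poiDomain) (v : RealPt) :
    ∃ F' s' : ℂ, let w := eccUnit z; let L : ℂ := z.2.1; let s := cs (emb z)
      let η := emb z 2; let ξ := emb z 3; let L' := emb v 1; let η' := emb v 2; let ξ' := emb v 3
      let D := fderiv ℝ cartPoi z v
      L' = s * s' + (η' * ξ + η * ξ') / 2 ∧
      emb v 0 = F' - (s' / (2 * Complex.I * L) - s * L' / (2 * Complex.I * L ^ 2)) *
        (w * ξ - η / w) - s / (2 * Complex.I * L) * ((w * (Complex.I * F')) * ξ + w * ξ' -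
          (η' / w - η * (Complex.I * F') / w)) ∧
      cQ D = (L' * (s * w - η) ^ 2 / (2 * w) + L * (s * w - η) * (s' * w + s * (w * (Complex.I * F')) - η') / w - L * (s * w - η) ^ 2 * (Complex.I * F') / (2 * w)) ∧
      conj (cQ D) = (L' * (s - ξ * w) ^ 2 / (2 * w) + L * (s - ξ * w) * (s' - (ξ' * w + ξ * (w * (Complex.I * F')))) / w - L * (s - ξ * w) ^ 2 * (Complex.I * F') / (2 * w)) ∧
      cP D = (-(Complex.I * L' * (s * w + η) / (L ^ 2 * (s - ξ * w))) + Complex.I / L *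
        ((s' * w + s * (w * (Complex.I * F')) + η') / (s - ξ * w) -
        (s * w + η) * (s' - (ξ' * w + ξ * (w * (Complex.I * F')))) / (s - ξ * w) ^ 2)) ∧
      conj (cP D) = (-(-(Complex.I * L' * (s + ξ * w) / (L ^ 2 * (s * w - η))) + Complex.I / L *
        ((s' + (ξ' * w + ξ * (w * (Complex.I * F')))) / (s * w - η) -
        (s + ξ * w) * (s' * w + s * (w * (Complex.I * F')) - η') / (s * w - η) ^ 2))) := by
  obtain ⟨Fh, hF, -, hK, hev⟩ := exists_local_formulas hz
  obtain ⟨-, hw, -⟩ := hev.self_of_nhds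
  have hcs : AnalyticAt ℂ cs (emb z) := analyticAt_cs (lam := z.1) hz
  have hline : HasDerivAt (fun t : ℝ => z + t • v) v 0 := by
    simpa using ((hasDerivAt_id (0 : ℝ)).smul_const v).const_add z
  have hz0 : z + (0 : ℝ) • v = z := by simp
  have hc : HasDerivAt (fun t : ℝ => emb (z + t • v)) (emb v) 0 :=
    (embL.hasFDerivAt.comp_hasDerivAt 0 hline : )
  have hci := hasDerivAt_pi.1 hc
  have hlin : Tendsto (fun t : ℝ => z + t • v) (𝓝 0) (𝓝 z) := by
    simpa only [hz0] using hline.continuousAt.tendsto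
  have hcomp : ∀ {f : CPt → ℂ}, AnalyticAt ℂ f (emb z) →
      HasDerivAt (fun t : ℝ => f (emb (z + t • v))) (fderiv ℂ f (emb z) (emb v)) 0 := by
    intro f hf
    have h1 : HasFDerivAt f ((fderiv ℂ f (emb z)).restrictScalars ℝ) (emb (z + (0 : ℝ) • v)) := by
      rw [hz0]
      exact hf.differentiableAt.hasFDerivAt.restrictScalars ℝ
    exact h1.comp_hasDerivAt (0 : ℝ) hc
  have dF := hcomp hF
  have ds := hcomp hcs
  have dL := hasDerivAt_kL ds (hci 2) (hci 3)
  have hL' : emb v 1 = cs (emb z) * fderiv ℂ cs (emb z) (emb v) +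
      (emb v 2 * emb z 3 + emb z 2 * emb v 3) / 2 := by
    have h1 := hci 1
    simp only [kL_cs, hz0] at dL
    exact h1.unique dL
  simp only [hz0] at dL
  rw [← hL'] at dL
  have hL0 := kL_emb hz
  have hLz : kL (cs (emb z)) (emb z 2) (emb z 3) = z.2.1 := kL_cs _
  obtain ⟨nA, nB⟩ := factors_emb hz
  have hcart : HasDerivAt (fun t : ℝ => cartPoi (z + t • v)) (fderiv ℝ cartPoi z v) 0 := by
    have h1 : HasFDerivAt cartPoi (fderiv ℝ cartPoi z) (z + (0 : ℝ) • v) := by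
      rw [hz0]
      exact (analyticAt_cartPoi hz).differentiableAt.hasFDerivAt
    exact h1.comp_hasDerivAt (0 : ℝ) hline
  obtain ⟨c1, c2, c3, c4⟩ := hasDerivAt_cQ hcart
  have hevt := hlin.eventually hev
  have hKt : ∀ᶠ t : ℝ in 𝓝 0, _ := (continuous_emb.tendsto _ |>.comp hlin).eventually hK
  refine ⟨fderiv ℂ Fh (emb z) (emb v), fderiv ℂ cs (emb z) (emb v), hL', ?_, ?_, ?_, ?_, ?_⟩
  · have h1 := hasDerivAt_kD dF ds (hci 2) (hci 3) dL (by rwa [hz0])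
    simp only [hz0, hw, hLz] at h1
    exact ((hci 0).congr_of_eventuallyEq hKt).unique h1
  · have h1 := hasDerivAt_kQ dF ds (hci 2) dL
    simp only [hz0, hw, hLz] at h1
    exact (c1.congr_of_eventuallyEq (hevt.mono fun t ht => ht.2.2.1.symm)).unique h1
  · have h1 := hasDerivAt_kQ' dF ds (hci 3) dL
    simp only [hz0, hw, hLz] at h1
    exact (c3.congr_of_eventuallyEq (hevt.mono fun t ht => ht.2.2.2.2.1.symm)).unique h1
  · have h1 := hasDerivAt_kP dF ds (hci 2) (hci 3) dL (by rwa [hz0]) (by rwa [hz0, hw])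
    simp only [hz0, hw, hLz] at h1
    exact (c2.congr_of_eventuallyEq (hevt.mono fun t ht => ht.2.2.2.1.symm)).unique h1
  · have h1 := hasDerivAt_kP' dF ds (hci 2) (hci 3) dL (by rwa [hz0]) (by rwa [hz0, hw])
    simp only [hz0, hw, hLz] at h1
    exact (c4.congr_of_eventuallyEq (hevt.mono fun t ht => ht.2.2.2.2.2.symm)).unique h1

/-- The wedge of the conjugate position with the momentum and that of the position with the
conjugate momentum are both instances of `wedge_half`; `wedge_sum` adds them with the correct sign.
-/
theorem cartForm_fderiv_cartPoi (hz : z ∈ poiDomain) (v w : RealPt) :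
    (cartForm (fderiv ℝ cartPoi z v) (fderiv ℝ cartPoi z w) : ℂ) = form (emb v) (emb w) := by
  obtain ⟨F₁, s₁, a1, a2, a3, a4, a5, a6⟩ := exists_derivatives hz v
  obtain ⟨F₂, s₂, b1, b2, b3, b4, b5, b6⟩ := exists_derivatives hz w
  obtain ⟨nA, nB⟩ := factors_emb hz
  have hL : (z.2.1 : ℂ) ≠ 0 := by
    have := kL_emb hz
    rwa [kL_cs] at this
  have hw := eccUnit_ne_zero z
  have hLs : cs (emb z) ^ 2 = 2 * (z.2.1 : ℂ) - emb z 2 * emb z 3 := by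
    have : kL (cs (emb z)) (emb z 2) (emb z 3) = z.2.1 := kL_cs _
    rw [← this, kL]; ring
  have hsum := wedge_sum Complex.I_sq hw hL hLs F₁ s₁ (emb v 2) (emb v 3) F₂ s₂ (emb w 2) (emb w 3)
    (emb v 1) (emb w 1) a1 b1
  have hB := wedge_half (I := Complex.I) (cs (emb z) * eccUnit z + emb z 2) hw hL nB
    (s₁ - (emb v 3 * eccUnit z + emb z 3 * (eccUnit z * (Complex.I * F₁))))
    (s₂ - (emb w 3 * eccUnit z + emb z 3 * (eccUnit z * (Complex.I * F₂))))
    (s₁ * eccUnit z + cs (emb z) * (eccUnit z * (Complex.I * F₁)) + emb v 2)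
    (s₂ * eccUnit z + cs (emb z) * (eccUnit z * (Complex.I * F₂)) + emb w 2)
    (emb v 1) (emb w 1) (Complex.I * F₁) (Complex.I * F₂)
  have hA := wedge_half (I := Complex.I) (cs (emb z) + emb z 3 * eccUnit z) hw hL nA
    (s₁ * eccUnit z + cs (emb z) * (eccUnit z * (Complex.I * F₁)) - emb v 2)
    (s₂ * eccUnit z + cs (emb z) * (eccUnit z * (Complex.I * F₂)) - emb w 2)
    (s₁ + (emb v 3 * eccUnit z + emb z 3 * (eccUnit z * (Complex.I * F₁))))
    (s₂ + (emb w 3 * eccUnit z + emb z 3 * (eccUnit z * (Complex.I * F₂))))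
    (emb v 1) (emb w 1) (Complex.I * F₁) (Complex.I * F₂)
  simp only at a2 b2 a3 a4 a5 a6 b3 b4 b5 b6 hsum
  rw [← a2, ← b2, ← hA, ← hB, ← a4, ← b4, ← a5, ← b5, ← a3, ← b3] at hsum
  rw [cartForm_eq, a6, b6, form]
  linear_combination hsum / 2

end Local

end

section

/-! ### The scaled chart -/

/-- The linear part of the scaling `L = 1 + δ² Λ`, `η = δ x`. -/
def scaleL (δ : ℝ) : RealPt →L[ℝ] RealPt :=
  LinearMap.toContinuousLinearMap
    { toFun := fun z => (z.1, δ ^ 2 * z.2.1, δ * z.2.2)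
      map_add' := fun a b => by simp [mul_add]
      map_smul' := fun c a => by
        simp only [Prod.smul_fst, Prod.smul_snd, smul_eq_mul, RingHom.id_apply, Complex.real_smul,
          Prod.smul_mk, Prod.mk.injEq, true_and]
        constructor <;> ring }

/-- The scaling. -/
def scale (δ : ℝ) (z : RealPt) : RealPt := scaleL δ z + (0, 1, 0)

theorem scale_apply (δ : ℝ) (z : RealPt) : scale δ z = (z.1, 1 + δ ^ 2 * z.2.1, δ * z.2.2) := by
  simp [scale, scaleL, add_comm]

theorem coord_eq (δ : ℝ) (z : RealPt) : coord δ z = cartPoi (scale δ z) := by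
  rw [scale_apply, coord, cartPoi, map_mul, Complex.conj_ofReal]

theorem mem_chartDomain_iff {δ : ℝ} {z : RealPt} : z ∈ chartDomain δ ↔ scale δ z ∈ poiDomain := by
  have h1 : ‖(δ : ℂ) * z.2.2‖ ^ 2 = δ ^ 2 * ‖z.2.2‖ ^ 2 := by
    rw [norm_mul, mul_pow, Complex.norm_real, Real.norm_eq_abs, sq_abs]
  rw [scale_apply, poiDomain, Set.mem_ofPred_eq, h1, chartDomain, Set.mem_ofPred_eq]
  refine ⟨fun h => h.2, fun h => ⟨lt_of_le_of_lt (by positivity) h, h⟩⟩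

theorem hasFDerivAt_scale (δ : ℝ) (z : RealPt) : HasFDerivAt (scale δ) (scaleL δ) z :=
  (scaleL δ).hasFDerivAt.add_const _

theorem analyticAt_coord {δ : ℝ} {z : RealPt} (hz : z ∈ chartDomain δ) :
    AnalyticAt ℝ (coord δ) z := by
  have h : coord δ = cartPoi ∘ scale δ := funext (coord_eq δ)
  rw [h]
  exact (analyticAt_cartPoi (mem_chartDomain_iff.1 hz)).comp
    (((scaleL δ).analyticAt z).add analyticAt_const)

theorem fderiv_coord {δ : ℝ} {z : RealPt} (hz : z ∈ chartDomain δ) :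
    fderiv ℝ (coord δ) z = fderiv ℝ cartPoi (scale δ z) ∘L scaleL δ := by
  have h : coord δ = cartPoi ∘ scale δ := funext (coord_eq δ)
  rw [h]
  exact ((analyticAt_cartPoi (mem_chartDomain_iff.1 hz)).differentiableAt.hasFDerivAt.comp z
    (hasFDerivAt_scale δ z)).fderiv

theorem cartForm_fderiv_coord {δ : ℝ} {z : RealPt} (hz : z ∈ chartDomain δ) (v w : RealPt) :
    (cartForm (fderiv ℝ (coord δ) z v) (fderiv ℝ (coord δ) z w) : ℂ) =
      (δ : ℂ) ^ 2 * form (emb v) (emb w) := by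
  rw [fderiv_coord hz]
  have := cartForm_fderiv_cartPoi (mem_chartDomain_iff.1 hz) (scaleL δ v) (scaleL δ w)
  rw [ContinuousLinearMap.comp_apply, ContinuousLinearMap.comp_apply, this]
  simp only [form, emb, scaleL, LinearMap.coe_toContinuousLinearMap', LinearMap.coe_mk,
    AddHom.coe_mk, Matrix.cons_val, map_mul, Complex.conj_ofReal]
  push_cast
  ring

theorem scale_bijective {δ : ℝ} (hδ : 0 < δ) : Function.Bijective (scale δ) := by
  have hδc : (δ : ℂ) ≠ 0 := by exact_mod_cast hδ.ne'
  constructor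
  · intro a b h
    rw [scale_apply, scale_apply] at h
    simp only [Prod.mk.injEq, add_right_inj, mul_eq_mul_left_iff,
      hδ.ne', hδc, pow_eq_zero_iff, ne_eq, OfNat.ofNat_ne_zero, not_false_eq_true, or_false] at h
    exact Prod.ext h.1 (Prod.ext h.2.1 h.2.2)
  · rintro ⟨a, b, c⟩
    refine ⟨(a, (b - 1) / δ ^ 2, c / δ), ?_⟩
    rw [scale_apply]
    have := hδ.ne'
    simp only [Prod.mk.injEq, true_and]
    constructor <;> field_simp
    ring

theorem coord_image {δ : ℝ} (hδ : 0 < δ) : coord δ '' chartDomain δ = directElliptic := by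
  rw [← cartPoi_image]
  ext c
  constructor
  · rintro ⟨z, hz, rfl⟩
    exact ⟨scale δ z, mem_chartDomain_iff.1 hz, (coord_eq δ z).symm⟩
  · rintro ⟨y, hy, rfl⟩
    obtain ⟨z, rfl⟩ := (scale_bijective hδ).2 y
    exact ⟨z, mem_chartDomain_iff.2 hy, coord_eq δ z⟩

theorem coord_eq_iff {δ : ℝ} (hδ : 0 < δ) {z z' : RealPt} (hz : z ∈ chartDomain δ)
    (hz' : z' ∈ chartDomain δ) : coord δ z = coord δ z' ↔
      (∃ k : ℤ, z'.1 = z.1 + 2 * Real.pi * k) ∧ z.2 = z'.2 := by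
  rw [coord_eq, coord_eq, cartPoi_eq_iff (mem_chartDomain_iff.1 hz) (mem_chartDomain_iff.1 hz'),
    scale_apply, scale_apply]
  have h1 := hδ.ne'
  have h2 : (δ : ℂ) ≠ 0 := by exact_mod_cast h1
  simp [Prod.ext_iff, h1, h2]

/-- The Hamiltonian in polar coordinates. -/
theorem h_phiPol {μ : ℝ} (hμ : μ ≠ 0) (c : Polar) (hr : 0 < c.r) :
    h μ (phiPol c) = ((c.R ^ 2 + c.G ^ 2 / c.r ^ 2) / 2 - 1 / c.r) - c.G + μ * H1pol μ c.r c.θ := by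
  obtain ⟨-, i2, i3⟩ := phiPol_invariants c hr
  have hcs := Real.cos_sq_add_sin_sq c.θ
  have e1 : (phiPol c 0 - μ) ^ 2 + phiPol c 1 ^ 2 =
      c.r ^ 2 - 2 * μ * c.r * Real.cos c.θ + μ ^ 2 := by
    simp only [phiPol, Matrix.cons_val]; linear_combination c.r ^ 2 * hcs
  have e2 : (phiPol c 0 - (μ - 1)) ^ 2 + phiPol c 1 ^ 2 =
      c.r ^ 2 + 2 * (1 - μ) * c.r * Real.cos c.θ + (1 - μ) ^ 2 := by
    simp only [phiPol, Matrix.cons_val]; linear_combination c.r ^ 2 * hcs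
  rw [h, e1, e2, i2, i3, H1pol]
  field_simp
  ring

/-- In Poincaré coordinates h = -1 / (2L²) - L + |η|² + μ H₁. At L = 1 + δ² Λ the constant and
quadratic terms of -1 / (2L²) - L are -3 / 2 and -3 / 2 · δ⁴ Λ², there is no linear term, and F_pend
is the rest; |η|² / δ⁴ = |x|² / δ² is the oscillator. -/
theorem energy_coord {δ : ℝ} (hδ : 0 < δ) {z : RealPt} (hz : z ∈ chartDomain δ) :
    ((h (δ ^ 4) (coord δ z) : ℝ) : ℂ) / (δ : ℂ) ^ 4 = H δ z - 3 / (2 * (δ : ℂ) ^ 4) := by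
  have hp := mem_chartDomain_iff.1 hz
  have hL : (0 : ℝ) < 1 + δ ^ 2 * z.2.1 := hz.1
  have hLc : (1 + (δ : ℂ) ^ 2 * z.2.1) ≠ 0 := by exact_mod_cast hL.ne'
  have hδc : (δ : ℂ) ≠ 0 := by exact_mod_cast hδ.ne'
  rw [scale_apply] at hp
  obtain ⟨h1, h2, h3, -⟩ := phiPoi_formulas hp z.1
  have e : conj ((δ : ℂ) * z.2.2) = δ * conj z.2.2 := by rw [map_mul, Complex.conj_ofReal]
  simp only [e] at h1 h2 h3
  have hn : ‖(δ : ℂ) * z.2.2‖ ^ 2 = δ ^ 2 * ‖z.2.2‖ ^ 2 := by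
    rw [norm_mul, mul_pow, Complex.norm_real, Real.norm_eq_abs, sq_abs]
  rw [coord, h_phiPol (by positivity) _ h1, h3, h2, hn, H, H1, Hpend, Hosc, Fpend, mul_conj_norm,
    H1Poi]
  push_cast
  field_simp
  ring

/-- The coordinates are an analytic, conformally symplectic chart, and transform the Hamiltonian. -/
theorem chart_properties {δ : ℝ} (hδ : 0 < δ) :
    AnalyticOnNhd ℝ (coord δ) (chartDomain δ) ∧
    coord δ '' chartDomain δ = directElliptic ∧
    (∀ z ∈ chartDomain δ, ∀ z' ∈ chartDomain δ, coord δ z = coord δ z' ↔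
      (∃ k : ℤ, z'.1 = z.1 + 2 * Real.pi * k) ∧ z.2 = z'.2) ∧
    (∀ z ∈ chartDomain δ, ∀ v w : RealPt,
      (cartForm (fderiv ℝ (coord δ) z v) (fderiv ℝ (coord δ) z w) : ℂ) =
        (δ : ℂ) ^ 2 * form (emb v) (emb w)) ∧
    ∀ z ∈ regularDomain δ,
      ((h (δ ^ 4) (coord δ z) : ℝ) : ℂ) / (δ : ℂ) ^ 4 = H δ z - 3 / (2 * (δ : ℂ) ^ 4) :=
  ⟨fun _ hz => analyticAt_coord hz, coord_image hδ,
    fun _ hz _ hz' => coord_eq_iff hδ hz hz', fun _ hz => cartForm_fderiv_coord hz,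
    fun _ hz => energy_coord hδ hz.1⟩

end

section

/-! ### Holomorphic extension from the real points of an antilinear involution -/

section Gluing

variable {E : Type*} [NormedAddCommGroup E] [NormedSpace ℂ E]

theorem differentiableOn_conj_conj {f : ℂ → ℂ} {S : Set ℂ} (hS : IsOpen S)
    (hf : DifferentiableOn ℂ f S) :
    DifferentiableOn ℂ (fun s => conj (f (conj s))) (conj ⁻¹' S) := by
  intro s hs
  have h1 : HasDerivAt f (deriv f (conj s)) (conj s) :=
    ((hf _ hs).differentiableAt (hS.mem_nhds hs)).hasDerivAt
  have h2 := h1.conj_conj.differentiableAt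
  rw [Complex.conj_conj] at h2
  exact h2.differentiableWithinAt

/-- A function on a convex invariant set that is holomorphic along lines is determined by its values
at the real points. -/
theorem eq_of_eq_real {c : E →L[ℝ] E} (hcc : ∀ v, c (c v) = v)
    (hcs : ∀ (s : ℂ) v, c (s • v) = conj s • c v) {B : Set E} (hBo : IsOpen B) (hBc : Convex ℝ B)
    (hB : ∀ y ∈ B, c y ∈ B) {f g : E → ℂ}
    (hf : ∀ a b, c a = a → c b = b →
      DifferentiableOn ℂ (fun s : ℂ => f (a + s • b)) {s | a + s • b ∈ B})
    (hg : ∀ a b, c a = a → c b = b →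
      DifferentiableOn ℂ (fun s : ℂ => g (a + s • b)) {s | a + s • b ∈ B})
    (hfg : ∀ y ∈ B, c y = y → f y = g y) {X : E} (hX : X ∈ B) : f X = g X := by
  have hI := Complex.I_ne_zero
  -- X = a + i b with a and b fixed by the involution. On the complex line s ↦ a + s b the real
  -- parameters give real points, so the identity theorem in one variable carries the equality from
  -- real s near 0 to s = i. Convexity and invariance of B ensure that a is in B and that the set of
  -- parameters is connected.
  set a : E := (1 / 2 : ℂ) • (X + c X) with ha
  set b : E := (1 / (2 * Complex.I) : ℂ) • (X - c X) with hb
  have hca : c a = a := by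
    rw [ha, hcs, map_add, hcc, add_comm (c X), map_div₀, map_one, map_ofNat]
  have hcb : c b = b := by
    rw [hb, hcs, map_sub, hcc]
    have : conj (1 / (2 * Complex.I)) = -(1 / (2 * Complex.I)) := by
      simp only [map_div₀, map_mul, Complex.conj_I, map_one, map_ofNat]; field_simp
    rw [this, neg_smul, ← smul_neg, neg_sub]
  have hab : a + Complex.I • b = X := by
    rw [ha, hb, smul_smul, show Complex.I * (1 / (2 * Complex.I)) = 1 / 2 by field_simp, ← smul_add]
    rw [show X + c X + (X - c X) = (2 : ℂ) • X by rw [two_smul]; abel, smul_smul]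
    norm_num
  have haB : a ∈ B := by
    have h1 := hBc hX (hB X hX) (by norm_num : (0 : ℝ) ≤ 1 / 2) (by norm_num : (0 : ℝ) ≤ 1 / 2)
      (by norm_num)
    have h2 : a = (1 / 2 : ℝ) • X + (1 / 2 : ℝ) • c X := by
      rw [ha, smul_add]
      congr 1 <;> rw [← Complex.coe_smul] <;> norm_num
    rwa [h2]
  set S : Set ℂ := {s | a + s • b ∈ B} with hS
  have hcont : Continuous fun s : ℂ => a + s • b := by fun_prop
  have hSo : IsOpen S := hBo.preimage hcont
  have hSc : Convex ℝ S := by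
    intro s hs t ht p q hp hq hpq
    have h1 := hBc hs ht hp hq hpq
    have h2 : p • (a + s • b) + q • (a + t • b) = a + (p • s + q • t) • b := by
      have : a = p • a + q • a := by rw [← add_smul, hpq, one_smul]
      conv_rhs => rw [this]
      rw [smul_add, smul_add, add_smul, smul_assoc, smul_assoc]
      abel
    rwa [h2] at h1
  have h0S : (0 : ℂ) ∈ S := by simpa [hS] using haB
  have hIS : Complex.I ∈ S := by simpa [hS, hab] using hX
  have hfa := (hf a b hca hcb).analyticOnNhd hSo
  have hga := (hg a b hca hcb).analyticOnNhd hSo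
  have hfreq : ∃ᶠ s in 𝓝[≠] (0 : ℂ), f (a + s • b) = g (a + s • b) := by
    have h1 : ∀ᶠ t : ℝ in 𝓝[≠] (0 : ℝ), f (a + (t : ℂ) • b) = g (a + (t : ℂ) • b) := by
      have h2 : ∀ᶠ t : ℝ in 𝓝 (0 : ℝ), (t : ℂ) ∈ S :=
        Complex.continuous_ofReal.continuousAt.eventually_mem
          (by simpa using hSo.mem_nhds h0S)
      filter_upwards [eventually_nhdsWithin_of_eventually_nhds h2] with t ht
      have h4 : c (a + (t : ℂ) • b) = a + (t : ℂ) • b := by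
        rw [map_add c a, hca, hcs, hcb, Complex.conj_ofReal]
      exact hfg _ ht h4
    have h3 : Tendsto (fun t : ℝ => (t : ℂ)) (𝓝[≠] 0) (𝓝[≠] 0) := by
      refine tendsto_nhdsWithin_of_tendsto_nhds_of_eventually_within _ ?_ ?_
      · exact (Complex.continuous_ofReal.tendsto' 0 0 Complex.ofReal_zero).mono_left
          nhdsWithin_le_nhds
      · filter_upwards [self_mem_nhdsWithin] with t ht
        exact Complex.ofReal_ne_zero.2 ht
    exact h3.frequently h1.frequently
  have := hfa.eqOn_of_preconnected_of_frequently_eq hga hSc.isPreconnected h0S hfreq hIS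
  simpa only [hab] using this

theorem differentiableOn_line {B : Set E} {f : E → ℂ} (hf : AnalyticOnNhd ℂ f B) (a b : E) :
    DifferentiableOn ℂ (fun s : ℂ => f (a + s • b)) {s | a + s • b ∈ B} := by
  intro s hs
  have h1 : DifferentiableAt ℂ (fun s : ℂ => a + s • b) s := by fun_prop
  exact ((hf _ hs).differentiableAt.comp s h1).differentiableWithinAt

theorem invariant_ball {c : E →L[ℝ] E} (hn : ∀ v, ‖c v‖ ≤ ‖v‖) {P : E} (hP : c P = P) {ε : ℝ} {y : E}
    (hy : y ∈ Metric.ball P ε) : c y ∈ Metric.ball P ε := by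
  rw [Metric.mem_ball, dist_eq_norm] at hy ⊢
  calc ‖c y - P‖ = ‖c (y - P)‖ := by rw [map_sub, hP]
    _ ≤ ‖y - P‖ := hn _
    _ < ε := hy

/-- The involution does not increase norms, so balls around real points are invariant, and
intersections of two of them are convex and invariant. By `eq_of_eq_real` the local extensions agree
there. The same principle, for f and its conjugate by the involution, gives the symmetry. -/
theorem exists_glued_extension {c : E →L[ℝ] E} (hcc : ∀ v, c (c v) = v)
    (hcs : ∀ (s : ℂ) v, c (s • v) = conj s • c v) (hn : ∀ v, ‖c v‖ ≤ ‖v‖) {R : Set E}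
    (hR : ∀ P ∈ R, c P = P) {H₀ : E → ℂ} (hreal : ∀ P ∈ R, conj (H₀ P) = H₀ P)
    (hloc : ∀ P ∈ R, ∃ f : E → ℂ, AnalyticAt ℂ f P ∧
      ∀ᶠ y in 𝓝 P, c y = y → y ∈ R ∧ f y = H₀ y) :
    ∃ (U : Set E) (Hc : E → ℂ), IsOpen U ∧ R ⊆ U ∧ (∀ P ∈ U, c P ∈ U) ∧ AnalyticOnNhd ℂ Hc U ∧
      (∀ P ∈ U, conj (Hc P) = Hc (c P)) ∧ ∀ P ∈ R, Hc P = H₀ P := by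
  have hloc' : ∀ P : R, ∃ (f : E → ℂ) (ε : ℝ), 0 < ε ∧ AnalyticOnNhd ℂ f (Metric.ball P ε) ∧
      ∀ y ∈ Metric.ball (P : E) ε, c y = y → y ∈ R ∧ f y = H₀ y := by
    rintro ⟨P, hP⟩
    obtain ⟨f, hf, hev⟩ := hloc P hP
    obtain ⟨ε, hε, hb⟩ := Metric.eventually_nhds_iff_ball.1 (hf.eventually_analyticAt.and hev)
    exact ⟨f, ε, hε, fun y hy => (hb y hy).1, fun y hy => (hb y hy).2⟩
  choose f ε hε hfa hfr using hloc'
  have hcompat : ∀ (P Q : R) (X : E), X ∈ Metric.ball (P : E) (ε P) →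
      X ∈ Metric.ball (Q : E) (ε Q) → f P X = f Q X := by
    intro P Q X hXP hXQ
    refine eq_of_eq_real hcc hcs (B := Metric.ball (P : E) (ε P) ∩ Metric.ball (Q : E) (ε Q))
      (Metric.isOpen_ball.inter Metric.isOpen_ball)
      ((convex_ball _ _).inter (convex_ball _ _))
      (fun y hy => ⟨invariant_ball hn (hR P P.2) hy.1, invariant_ball hn (hR Q Q.2) hy.2⟩)
      (fun a b _ _ => differentiableOn_line ((hfa P).mono Set.inter_subset_left) a b)
      (fun a b _ _ => differentiableOn_line ((hfa Q).mono Set.inter_subset_right) a b)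
      (fun y hy hcy => ?_) ⟨hXP, hXQ⟩
    rw [(hfr P y hy.1 hcy).2, (hfr Q y hy.2 hcy).2]
  have hconj : ∀ (P : R) (X : E), X ∈ Metric.ball (P : E) (ε P) → conj (f P X) = f P (c X) := by
    intro P X hX
    have hB := fun y hy => invariant_ball (ε := ε P) (y := y) hn (hR P P.2) hy
    have h1 : conj (f P (c (c X))) = f P (c X) := by
      refine eq_of_eq_real (f := fun y => conj (f P (c y))) (g := f P) hcc hcs
        Metric.isOpen_ball (convex_ball _ _) hB ?_
        (fun a b _ _ => differentiableOn_line (hfa P) a b) ?_ (hB X hX)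
      · intro a b ha hb
        have h2 : IsOpen {s : ℂ | a + s • b ∈ Metric.ball (P : E) (ε P)} :=
          Metric.isOpen_ball.preimage (by fun_prop)
        have h3 := differentiableOn_conj_conj h2 (differentiableOn_line (hfa P) a b)
        have h4 : ∀ s : ℂ, c (a + s • b) = a + conj s • b := by
          intro s; rw [map_add, hcs, ha, hb]
        simp only [h4]
        refine h3.mono fun s hs => ?_
        have := hB _ hs
        rwa [h4] at this
      · intro y hy hcy
        have h2 := hfr P y hy hcy
        simp only [hcy, h2.2, hreal y h2.1]
    rwa [hcc] at h1
  set U : Set E := ⋃ P : R, Metric.ball (P : E) (ε P) with hU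
  classical
  set Hc : E → ℂ := fun X => if h : ∃ P : R, X ∈ Metric.ball (P : E) (ε P) then f h.choose X else 0
    with hHc
  have hval : ∀ (P : R) (X : E), X ∈ Metric.ball (P : E) (ε P) → Hc X = f P X := by
    intro P X hX
    have h : ∃ P : R, X ∈ Metric.ball (P : E) (ε P) := ⟨P, hX⟩
    simp only [hHc, dif_pos h]
    exact hcompat _ _ _ h.choose_spec hX
  refine ⟨U, Hc, isOpen_iUnion fun _ => Metric.isOpen_ball, fun P hP => Set.mem_iUnion.2
    ⟨⟨P, hP⟩, Metric.mem_ball_self (hε _)⟩, ?_, ?_, ?_, ?_⟩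
  · intro X hX
    obtain ⟨P, hP⟩ := Set.mem_iUnion.1 hX
    exact Set.mem_iUnion.2 ⟨P, invariant_ball hn (hR P P.2) hP⟩
  · intro X hX
    obtain ⟨P, hP⟩ := Set.mem_iUnion.1 hX
    refine (hfa P X hP).congr ?_
    filter_upwards [Metric.isOpen_ball.mem_nhds hP] with Y hY using (hval P Y hY).symm
  · intro X hX
    obtain ⟨P, hP⟩ := Set.mem_iUnion.1 hX
    rw [hval P X hP, hval P _ (invariant_ball hn (hR P P.2) hP), hconj P X hP]
  · intro P hP
    have h1 := Metric.mem_ball_self (x := P) (hε ⟨P, hP⟩)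
    rw [hval ⟨P, hP⟩ P h1, (hfr ⟨P, hP⟩ P h1 (hR P hP)).2]

/-- Two functions that are analytic at a real point and agree at the real points nearby, agree. -/
theorem eventuallyEq_of_eq_real {c : E →L[ℝ] E} (hcc : ∀ v, c (c v) = v)
    (hcs : ∀ (s : ℂ) v, c (s • v) = conj s • c v) (hn : ∀ v, ‖c v‖ ≤ ‖v‖) {P : E} (hP : c P = P)
    {f g : E → ℂ} (hf : AnalyticAt ℂ f P) (hg : AnalyticAt ℂ g P)
    (hfg : ∀ᶠ y in 𝓝 P, c y = y → f y = g y) : f =ᶠ[𝓝 P] g := by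
  obtain ⟨ε, hε, hb⟩ := Metric.eventually_nhds_iff_ball.1
    ((hf.eventually_analyticAt.and hg.eventually_analyticAt).and hfg)
  filter_upwards [Metric.ball_mem_nhds P hε] with X hX
  exact eq_of_eq_real hcc hcs Metric.isOpen_ball (convex_ball _ _)
    (fun y hy => invariant_ball hn hP hy)
    (fun a b _ _ => differentiableOn_line (fun y hy => (hb y hy).1.1) a b)
    (fun a b _ _ => differentiableOn_line (fun y hy => (hb y hy).1.2) a b)
    (fun y hy => (hb y hy).2) hX

end Gluing

end

section

/-! ### The perturbation as a real-analytic function, up to `μ = 0` -/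

/-- The perturbation `H₁` in a form that is regular at `μ = 0`, as a function of `q₁ ± i q₂` and
`r = ‖q‖`. -/
def Kexp (Q Q' r μ : ℂ) : ℂ :=
  (-(Q + Q') + μ) / (r * ((Q - μ) * (Q' - μ)) ^ (1 / 2 : ℂ) *
      (r + ((Q - μ) * (Q' - μ)) ^ (1 / 2 : ℂ))) + 1 / ((Q - μ) * (Q' - μ)) ^ (1 / 2 : ℂ) -
    1 / ((Q - (μ - 1)) * (Q' - (μ - 1))) ^ (1 / 2 : ℂ)

/-- The perturbation `H₁` at a Cartesian state. -/
def realH1 (μ : ℝ) (c : Cart) : ℝ :=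
  (-(2 * c 0) + μ) / (√(c 0 ^ 2 + c 1 ^ 2) * √((c 0 - μ) ^ 2 + c 1 ^ 2) *
      (√(c 0 ^ 2 + c 1 ^ 2) + √((c 0 - μ) ^ 2 + c 1 ^ 2))) + 1 / √((c 0 - μ) ^ 2 + c 1 ^ 2) -
    1 / √((c 0 - (μ - 1)) ^ 2 + c 1 ^ 2)

theorem dist_sq (c : Cart) (a : ℝ) :
    (cQ c - a) * (conj (cQ c) - a) = (((c 0 - a) ^ 2 + c 1 ^ 2 : ℝ) : ℂ) := by
  rw [conj_cQ, cQ]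
  push_cast
  linear_combination (-(c 1 : ℂ) ^ 2) * Complex.I_sq

theorem dist_sq_pos {μ : ℝ} {c : Cart} (hc : ¬ IsCollision μ c) :
    0 < (c 0 - μ) ^ 2 + c 1 ^ 2 ∧ 0 < (c 0 - (μ - 1)) ^ 2 + c 1 ^ 2 := by
  constructor
  · by_contra h
    refine hc (Or.inl ⟨?_, ?_⟩) <;> nlinarith [sq_nonneg (c 0 - μ), sq_nonneg (c 1)]
  · by_contra h
    refine hc (Or.inr ⟨?_, ?_⟩) <;> nlinarith [sq_nonneg (c 0 - (μ - 1)), sq_nonneg (c 1)]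

theorem Kexp_real (c : Cart) (μ : ℝ) :
    Kexp (cQ c) (conj (cQ c)) (√(c 0 ^ 2 + c 1 ^ 2) : ℝ) μ = realH1 μ c := by
  have h2 := dist_sq c (μ - 1)
  push_cast at h2
  rw [Kexp, dist_sq, h2, ← Complex.ofReal_pow]
  have h3 : (((c 0 : ℂ) - (μ - 1)) ^ 2 + ((c 1 ^ 2 : ℝ) : ℂ)) =
      (((c 0 - (μ - 1)) ^ 2 + c 1 ^ 2 : ℝ) : ℂ) := by push_cast; ring
  rw [h3, cpow_half_ofReal (by positivity), cpow_half_ofReal (by positivity), conj_cQ, cQ, realH1]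
  push_cast
  ring

theorem analyticAt_Kexp {E : Type*} [NormedAddCommGroup E] [NormedSpace ℂ E]
    {Q Q' r m : E → ℂ} {x : E} {c : Cart} {μ : ℝ} (hQ : AnalyticAt ℂ Q x) (hQ' : AnalyticAt ℂ Q' x)
    (hr : AnalyticAt ℂ r x) (hm : AnalyticAt ℂ m x) (hQx : Q x = cQ c) (hQx' : Q' x = conj (cQ c))
    (hrx : r x = (√(c 0 ^ 2 + c 1 ^ 2) : ℝ)) (hmx : m x = μ) (hr0 : 0 < √(c 0 ^ 2 + c 1 ^ 2))
    (hc : ¬ IsCollision μ c) : AnalyticAt ℂ (fun y => Kexp (Q y) (Q' y) (r y) (m y)) x := by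
  obtain ⟨d1, d2⟩ := dist_sq_pos hc
  have e1 : (Q x - m x) * (Q' x - m x) = (((c 0 - μ) ^ 2 + c 1 ^ 2 : ℝ) : ℂ) := by
    rw [hQx, hQx', hmx, dist_sq]
  have e2 : (Q x - (m x - 1)) * (Q' x - (m x - 1)) =
      (((c 0 - (μ - 1)) ^ 2 + c 1 ^ 2 : ℝ) : ℂ) := by
    rw [hQx, hQx', hmx, ← dist_sq]; push_cast; ring
  have a1 : AnalyticAt ℂ (fun y => ((Q y - m y) * (Q' y - m y)) ^ (1 / 2 : ℂ)) x :=
    analyticAt_cpow_half ((hQ.sub hm).mul (hQ'.sub hm)) (by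
      rw [e1]; exact Complex.ofReal_mem_slitPlane.2 d1)
  have a2 : AnalyticAt ℂ (fun y => ((Q y - (m y - 1)) * (Q' y - (m y - 1))) ^ (1 / 2 : ℂ)) x :=
    analyticAt_cpow_half ((hQ.sub (hm.sub analyticAt_const)).mul
      (hQ'.sub (hm.sub analyticAt_const))) (by
      rw [e2]; exact Complex.ofReal_mem_slitPlane.2 d2)
  have v1 : ((Q x - m x) * (Q' x - m x)) ^ (1 / 2 : ℂ) = (√((c 0 - μ) ^ 2 + c 1 ^ 2) : ℝ) := by
    rw [e1, cpow_half_ofReal d1.le]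
  have v2 : ((Q x - (m x - 1)) * (Q' x - (m x - 1))) ^ (1 / 2 : ℂ) =
      (√((c 0 - (μ - 1)) ^ 2 + c 1 ^ 2) : ℝ) := by
    rw [e2, cpow_half_ofReal d2.le]
  have p1 := Real.sqrt_pos.2 d1
  have p2 := Real.sqrt_pos.2 d2
  have n1 : ((Q x - m x) * (Q' x - m x)) ^ (1 / 2 : ℂ) ≠ 0 := by
    rw [v1]; exact_mod_cast p1.ne'
  have n2 : ((Q x - (m x - 1)) * (Q' x - (m x - 1))) ^ (1 / 2 : ℂ) ≠ 0 := by
    rw [v2]; exact_mod_cast p2.ne'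
  have n3 : r x ≠ 0 := by rw [hrx]; exact_mod_cast hr0.ne'
  have n4 : r x + ((Q x - m x) * (Q' x - m x)) ^ (1 / 2 : ℂ) ≠ 0 := by
    rw [hrx, v1, ← Complex.ofReal_add]; exact_mod_cast (by positivity : (0 : ℝ) < _).ne'
  exact (((((hQ.add hQ').neg).add hm).div ((hr.mul a1).mul (hr.add a1))
    (mul_ne_zero (mul_ne_zero n3 n1) n4)).add (analyticAt_const.div a1 n1)).sub
      (analyticAt_const.div a2 n2)

theorem kr_eq_norm {z : RealPt} (hz : z ∈ poiDomain) :
    kr (eccUnit z) (cs (emb z)) (emb z 2) (emb z 3) =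
      (√(cartPoi z 0 ^ 2 + cartPoi z 1 ^ 2) : ℝ) := by
  rw [(cartPoi_invariants hz).2.1, (phiPoi_formulas hz z.1).2.2.2.1]
  have h2 : cs (emb z) = rs z.2.1 z.2.2 := cs_emb (lam := z.1) hz
  rw [h2]
  rfl

/-- Near a real point that is not a collision, the perturbation is the restriction of a holomorphic
function of the Poincaré coordinates and the mass ratio. -/
theorem exists_local_H1 {z : RealPt} (hz : z ∈ poiDomain) {μ : ℝ}
    (hc : ¬ IsCollision μ (cartPoi z)) : ∃ K : CPt × ℂ → ℂ, AnalyticAt ℂ K (emb z, (μ : ℂ)) ∧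
      ∀ᶠ p : RealPt × ℝ in 𝓝 (z, μ), K (emb p.1, (p.2 : ℂ)) = realH1 p.2 (cartPoi p.1) := by
  obtain ⟨Fh, hF, -, -, hev⟩ := exists_local_formulas hz
  obtain ⟨-, hw, hq, -, hq', -⟩ := hev.self_of_nhds
  have hcs : AnalyticAt ℂ cs (emb z) := analyticAt_cs (lam := z.1) hz
  obtain ⟨h1, h2, h3, -⟩ := analyticAt_kepler hF hcs (analyticAt_coord_apply _ 2)
    (analyticAt_coord_apply _ 3) (kL_emb hz)
  have hfst : ∀ {f : CPt → ℂ}, AnalyticAt ℂ f (emb z) →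
      AnalyticAt ℂ (fun p : CPt × ℂ => f p.1) (emb z, (μ : ℂ)) := fun hf =>
    AnalyticAt.comp (f := Prod.fst) (x := (emb z, (μ : ℂ))) hf analyticAt_fst
  refine ⟨fun p => Kexp (kQ (expI (Fh p.1)) (cs p.1) (p.1 2) (p.1 3))
    (kQ' (expI (Fh p.1)) (cs p.1) (p.1 2) (p.1 3)) (kr (expI (Fh p.1)) (cs p.1) (p.1 2) (p.1 3))
      p.2, analyticAt_Kexp (c := cartPoi z) (hfst h1) (hfst h2) (hfst h3) analyticAt_snd hq.symm
        hq'.symm ?_ rfl ?_ hc, ?_⟩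
  · rw [hw]; exact kr_eq_norm hz
  · rw [(cartPoi_invariants hz).2.1]; exact (cartPoi_invariants hz).1
  · have := (continuous_fst.tendsto (z, μ)).eventually hev
    filter_upwards [this] with p hp
    obtain ⟨hp0, hp1, hp2, -, hp3, -⟩ := hp
    rw [← hp2, ← hp3, hp1, kr_eq_norm hp0, Kexp_real]

/-- With D and D' the distances to the primaries, μ H₁ = (1/r - 1/D) + μ/D - μ/D', and D² - r² = μ
(μ - 2 q₁) gives 1/r - 1/D = μ (μ - 2 q₁) / (r D (r + D)). The division by μ is thus carried out
explicitly. -/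
theorem realH1_eq {z : RealPt} (hz : z ∈ poiDomain) {μ : ℝ} (hμ : μ ≠ 0)
    (hc : ¬ IsCollision μ (cartPoi z)) :
    H1Poi μ z.1 z.2.1 z.2.2 (conj z.2.2) = realH1 μ (cartPoi z) := by
  obtain ⟨hr, hr1, -⟩ := cartPoi_invariants hz
  obtain ⟨d1, d2⟩ := dist_sq_pos hc
  rw [realH1, H1Poi, H1pol, hr1]
  set p := phiPoi z.1 z.2.1 z.2.2 (conj z.2.2) with hp
  have hcs := Real.cos_sq_add_sin_sq p.θ
  have hcp : cartPoi z = phiPol p := rfl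
  have e1 : p.r ^ 2 - 2 * μ * p.r * Real.cos p.θ + μ ^ 2 =
      (cartPoi z 0 - μ) ^ 2 + cartPoi z 1 ^ 2 := by
    rw [hcp]; simp only [phiPol, Matrix.cons_val]; linear_combination (-p.r ^ 2) * hcs
  have e2 : p.r ^ 2 + 2 * (1 - μ) * p.r * Real.cos p.θ + (1 - μ) ^ 2 =
      (cartPoi z 0 - (μ - 1)) ^ 2 + cartPoi z 1 ^ 2 := by
    rw [hcp]; simp only [phiPol, Matrix.cons_val]; linear_combination (-p.r ^ 2) * hcs
  have e0 : cartPoi z 0 = p.r * Real.cos p.θ := rfl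
  have e3 : √((cartPoi z 0 - μ) ^ 2 + cartPoi z 1 ^ 2) ^ 2 =
      p.r ^ 2 - 2 * μ * cartPoi z 0 + μ ^ 2 := by
    rw [Real.sq_sqrt d1.le, ← e1, e0]; ring
  rw [e1, e2]
  have p1 := Real.sqrt_pos.2 d1
  have p2 := Real.sqrt_pos.2 d2
  set D := √((cartPoi z 0 - μ) ^ 2 + cartPoi z 1 ^ 2)
  set D' := √((cartPoi z 0 - (μ - 1)) ^ 2 + cartPoi z 1 ^ 2)
  have n : p.r + D ≠ 0 := by positivity
  field_simp
  linear_combination D' * e3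

theorem continuousAt_cartPoi {z : RealPt} (hz : z ∈ poiDomain) : ContinuousAt cartPoi z :=
  (analyticAt_cartPoi hz).continuousAt

theorem continuous_scale : Continuous fun p : RealPt × ℝ => scale p.2 p.1 := by
  simp only [scale_apply]; fun_prop

/-- Regularity is an open condition on the real points. -/
theorem eventually_regular {z : RealPt} {δ : ℝ} (hδ : 0 < δ) (hz : z ∈ regularDomain δ) :
    ∀ᶠ p : RealPt × ℝ in 𝓝 (z, δ), 0 < p.2 ∧ p.1 ∈ regularDomain p.2 := by
  have hp := mem_chartDomain_iff.1 hz.1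
  have hs : ContinuousAt (fun p : RealPt × ℝ => scale p.2 p.1) (z, δ) := continuous_scale.continuousAt
  have hc : ContinuousAt (fun p : RealPt × ℝ => coord p.2 p.1) (z, δ) := by
    simp only [coord_eq]
    exact ContinuousAt.comp (f := fun p : RealPt × ℝ => scale p.2 p.1) (g := cartPoi) (x := (z, δ))
      (continuousAt_cartPoi hp) hs
  have hci := fun i => (continuousAt_pi.1 hc i)
  have h2 : ContinuousAt (fun p : RealPt × ℝ => p.2) (z, δ) := continuousAt_snd
  obtain ⟨d1, d2⟩ := dist_sq_pos hz.2
  have o1 := ((((hci 0).sub (h2.pow 4)).pow 2).add ((hci 1).pow 2)).eventually (lt_mem_nhds d1)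
  have o2 := ((((hci 0).sub ((h2.pow 4).sub continuousAt_const)).pow 2).add
    ((hci 1).pow 2)).eventually (lt_mem_nhds d2)
  filter_upwards [o1, o2, hs.eventually_mem (isOpen_poiDomain.mem_nhds hp),
    h2.eventually (lt_mem_nhds hδ)] with p p1 p2 p3 p4
  refine ⟨p4, mem_chartDomain_iff.2 p3, ?_⟩
  rintro (⟨a, b⟩ | ⟨a, b⟩)
  · simp [a, b] at p1
  · simp [a, b] at p2

end

section

/-! ### The holomorphic extension of the Hamiltonian -/

/-- The conjugation of `(λ, Λ, x, y; δ)` as a real linear map. -/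
def conjL : CPt × ℂ →L[ℝ] CPt × ℂ := cj.prodMap Complex.conjCLE.toContinuousLinearMap

theorem conjL_apply (P : CPt × ℂ) : conjL P = conjPt P := by
  rcases P with ⟨a, b⟩
  simp [conjL, conjPt, cj_apply]

theorem conjL_conjL (P : CPt × ℂ) : conjL (conjL P) = P := by
  rcases P with ⟨a, b⟩
  simp [conjL, cj_cj]

theorem conjL_smul (s : ℂ) (P : CPt × ℂ) : conjL (s • P) = conj s • conjL P := by
  rcases P with ⟨a, b⟩
  simp [conjL, cj_smul]

theorem norm_cj_le (v : CPt) : ‖cj v‖ ≤ ‖v‖ := by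
  rw [pi_norm_le_iff_of_nonneg (norm_nonneg _), cj_apply]
  intro i
  fin_cases i <;> simp only [Fin.zero_eta, Fin.mk_one, Fin.reduceFinMk, Matrix.cons_val,
    Complex.norm_conj] <;> exact norm_le_pi_norm v _

theorem norm_conjL_le (P : CPt × ℂ) : ‖conjL P‖ ≤ ‖P‖ := by
  rcases P with ⟨a, b⟩
  have h : conjL (a, b) = (cj a, conj b) := by simp [conjL]
  rw [h, Prod.norm_mk, Prod.norm_mk, Complex.norm_conj]
  exact max_le_max (norm_cj_le a) le_rfl

/-- The real coordinates of a point. -/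
def realPart (P : CPt × ℂ) : RealPt × ℝ := (((P.1 0).re, (P.1 1).re, P.1 2), P.2.re)

theorem continuous_realPart : Continuous realPart := by unfold realPart; fun_prop

theorem realPart_emb (z : RealPt) (δ : ℝ) : realPart (emb z, (δ : ℂ)) = (z, δ) := by
  simp [realPart, emb]

theorem conjL_emb (z : RealPt) (δ : ℝ) : conjL (emb z, (δ : ℂ)) = (emb z, (δ : ℂ)) := by
  have h : cj (emb z) = emb z := cj_eq_self_iff.2 ⟨z, rfl⟩
  simp [conjL, h]

theorem eq_of_conjL_eq {P : CPt × ℂ} (h : conjL P = P) :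
    P = (emb (realPart P).1, ((realPart P).2 : ℂ)) := by
  obtain ⟨a, b⟩ := P
  have h' : (cj a, conj b) = (a, b) := by simpa [conjL] using h
  obtain ⟨z, rfl⟩ := cj_eq_self_iff.1 (Prod.ext_iff.1 h').1
  obtain ⟨x, rfl⟩ := Complex.conj_eq_iff_real.1 (Prod.ext_iff.1 h').2
  rw [realPart_emb]

theorem eventually_of_real {z : RealPt} {δ : ℝ} {p : CPt × ℂ → Prop}
    (h : ∀ᶠ q : RealPt × ℝ in 𝓝 (z, δ), p (emb q.1, (q.2 : ℂ))) :
    ∀ᶠ P in 𝓝 (emb z, (δ : ℂ)), conjL P = P → p P := by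
  have h1 : Tendsto realPart (𝓝 (emb z, (δ : ℂ))) (𝓝 (z, δ)) := by
    rw [← realPart_emb]; exact continuous_realPart.tendsto _
  filter_upwards [h1.eventually h] with P hP hc
  rw [eq_of_conjL_eq hc]
  exact hP

/-- The Hamiltonian at real points as a real number. -/
def realH (δ : ℝ) (z : RealPt) : ℝ :=
  -(3 / 2) * z.2.1 ^ 2 + ‖z.2.2‖ ^ 2 / δ ^ 2 + realH1 (δ ^ 4) (coord δ z) +
    (-(1 / (2 * (1 + δ ^ 2 * z.2.1) ^ 2)) - (1 + δ ^ 2 * z.2.1) + 3 / 2 +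
      3 / 2 * (δ ^ 2 * z.2.1) ^ 2) / δ ^ 4

/-- V enters H_pend and H₁ with opposite signs. Its singularity at cos λ = -1 therefore does not
appear in H, whose only singularities are the true collisions. -/
theorem H_eq_realH {δ : ℝ} (hδ : 0 < δ) {z : RealPt} (hz : z ∈ regularDomain δ) :
    H δ z = realH δ z := by
  have h1 := realH1_eq (mem_chartDomain_iff.1 hz.1) (by positivity : δ ^ 4 ≠ 0)
    (by rw [← coord_eq]; exact hz.2)
  rw [scale_apply] at h1
  simp only [map_mul, Complex.conj_ofReal] at h1
  rw [H, Hpend, Hosc, H1, h1, mul_conj_norm, realH, coord_eq, scale_apply, Fpend]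
  push_cast
  ring

/-- The scaling of the complex coordinates, with `μ = δ⁴`. -/
def scaleC (P : CPt × ℂ) : CPt × ℂ :=
  (![P.1 0, 1 + P.2 ^ 2 * P.1 1, P.2 * P.1 2, P.2 * P.1 3], P.2 ^ 4)

theorem scaleC_emb (δ : ℝ) (z : RealPt) :
    scaleC (emb z, (δ : ℂ)) = (emb (scale δ z), ((δ ^ 4 : ℝ) : ℂ)) := by
  simp [scaleC, scale_apply, emb]

theorem analyticAt_fst_apply (P : CPt × ℂ) (i : Fin 4) :
    AnalyticAt ℂ (fun P : CPt × ℂ => P.1 i) P :=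
  AnalyticAt.comp (f := Prod.fst) (x := P) (analyticAt_coord_apply _ i) analyticAt_fst

theorem analyticAt_scaleC (P : CPt × ℂ) : AnalyticAt ℂ scaleC P := by
  have h := analyticAt_fst_apply P
  have h2 : AnalyticAt ℂ (fun P : CPt × ℂ => P.2) P := analyticAt_snd
  refine AnalyticAt.prod (analyticAt_pi_iff.2 fun i => ?_) (h2.pow 4)
  fin_cases i
  · exact h 0
  · exact analyticAt_const.add ((h2.pow 2).mul (h 1))
  · exact h2.mul (h 2)
  · exact h2.mul (h 3)

/-- The Hamiltonian built on a holomorphic perturbation `K`. -/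
def hamOf (K : CPt × ℂ → ℂ) (P : CPt × ℂ) : ℂ :=
  -(3 / 2) * P.1 1 ^ 2 + P.1 2 * P.1 3 / P.2 ^ 2 + K (scaleC P) + Fpend (P.2 ^ 2 * P.1 1) / P.2 ^ 4

theorem analyticAt_hamOf {K : CPt × ℂ → ℂ} {P : CPt × ℂ} (hK : AnalyticAt ℂ K (scaleC P))
    (hP : P.2 ≠ 0) (hP1 : 1 + P.2 ^ 2 * P.1 1 ≠ 0) : AnalyticAt ℂ (hamOf K) P := by
  have h := analyticAt_fst_apply P
  have h2 : AnalyticAt ℂ (fun P : CPt × ℂ => P.2) P := analyticAt_snd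
  have hz := (h2.pow 2).mul (h 1)
  have h3 : AnalyticAt ℂ (fun P : CPt × ℂ => Fpend (P.2 ^ 2 * P.1 1)) P := by
    unfold Fpend
    refine AnalyticAt.add (AnalyticAt.add (AnalyticAt.sub (AnalyticAt.neg ?_) ?_) ?_) ?_
    · refine analyticAt_const.div (analyticAt_const.mul ((analyticAt_const.add hz).pow 2)) ?_
      exact mul_ne_zero two_ne_zero (pow_ne_zero 2 hP1)
    · exact analyticAt_const.add hz
    · exact analyticAt_const
    · exact analyticAt_const.mul (hz.pow 2)
  exact (((analyticAt_const.mul ((h 1).pow 2)).add (((h 2).mul (h 3)).div (h2.pow 2)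
    (pow_ne_zero 2 hP))).add (AnalyticAt.comp (f := scaleC) hK (analyticAt_scaleC P))).add
      (h3.div (h2.pow 4) (pow_ne_zero 4 hP))

theorem hamOf_real {K : CPt × ℂ → ℂ} {δ : ℝ} {z : RealPt}
    (hK : K (emb (scale δ z), ((δ ^ 4 : ℝ) : ℂ)) = realH1 (δ ^ 4) (cartPoi (scale δ z))) :
    hamOf K (emb z, (δ : ℂ)) = realH δ z := by
  rw [hamOf, scaleC_emb, hK, realH, coord_eq, Fpend]
  simp only [emb, Matrix.cons_val]
  rw [mul_conj_norm]
  push_cast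
  ring

/-- The real points `(λ, Λ, x, conj x; δ)` with `δ > 0` away from collision. -/
def realRegular : Set (CPt × ℂ) :=
  {P | ∃ (δ : ℝ) (z : RealPt), 0 < δ ∧ z ∈ regularDomain δ ∧ P = (emb z, (δ : ℂ))}

/-- The Hamiltonian in terms of the complex coordinates of a real point. -/
def hamReal (P : CPt × ℂ) : ℂ := realH (realPart P).2 (realPart P).1

theorem hamOf_local {K : CPt × ℂ → ℂ} {δ : ℝ} {z : RealPt} (hδ : 0 < δ) (hz : z ∈ regularDomain δ)
    (hK : AnalyticAt ℂ K (emb (scale δ z), ((δ ^ 4 : ℝ) : ℂ)))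
    (hKr : ∀ᶠ p : RealPt × ℝ in 𝓝 (scale δ z, δ ^ 4),
      K (emb p.1, (p.2 : ℂ)) = realH1 p.2 (cartPoi p.1)) :
    AnalyticAt ℂ (hamOf K) (emb z, (δ : ℂ)) ∧ ∀ᶠ P in 𝓝 (emb z, (δ : ℂ)), conjL P = P →
      P ∈ realRegular ∧ hamOf K P = hamReal P := by
  constructor
  · refine analyticAt_hamOf (by rwa [scaleC_emb]) (Complex.ofReal_ne_zero.2 hδ.ne') ?_
    have : (1 + δ ^ 2 * z.2.1 : ℝ) ≠ 0 := hz.1.1.ne'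
    simp only [emb, Matrix.cons_val]
    exact_mod_cast this
  · refine eventually_of_real ?_
    have hs : Tendsto (fun p : RealPt × ℝ => (scale p.2 p.1, p.2 ^ 4)) (𝓝 (z, δ))
        (𝓝 (scale δ z, δ ^ 4)) :=
      (continuous_scale.prodMk (continuous_snd.pow 4)).tendsto _
    filter_upwards [eventually_regular hδ hz, hs.eventually hKr] with p hp hp2
    refine ⟨⟨p.2, p.1, hp.1, hp.2, rfl⟩, ?_⟩
    rw [hamOf_real hp2, hamReal, realPart_emb]

/-- The set `realRegular` has no upper bound on δ, so it is open among the real points, as the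
gluing requires; the points with δ⁴ = 1 / 2 would otherwise be boundary points. -/
theorem exists_extension : ∃ (U : Set (CPt × ℂ)) (Hc : CPt × ℂ → ℂ), IsOpen U ∧ realRegular ⊆ U ∧
    (∀ P ∈ U, conjL P ∈ U) ∧ AnalyticOnNhd ℂ Hc U ∧ (∀ P ∈ U, conj (Hc P) = Hc (conjL P)) ∧
    ∀ P ∈ realRegular, Hc P = hamReal P := by
  refine exists_glued_extension conjL_conjL conjL_smul norm_conjL_le ?_ ?_ ?_
  · rintro P ⟨δ, z, -, -, rfl⟩
    exact conjL_emb z δ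
  · intro P _
    exact Complex.conj_ofReal _
  · rintro P ⟨δ, z, hδ, hz, rfl⟩
    obtain ⟨K, hK, hKr⟩ := exists_local_H1 (mem_chartDomain_iff.1 hz.1) (μ := δ ^ 4)
      (by rw [← coord_eq]; exact hz.2)
    exact ⟨hamOf K, hamOf_local hδ hz hK hKr⟩

theorem isRealAnalyticExtension {U : Set (CPt × ℂ)} {Hc : CPt × ℂ → ℂ} (hU : IsOpen U)
    (hRU : realRegular ⊆ U) (hcU : ∀ P ∈ U, conjL P ∈ U) (hHa : AnalyticOnNhd ℂ Hc U)
    (hHc : ∀ P ∈ U, conj (Hc P) = Hc (conjL P)) (hHr : ∀ P ∈ realRegular, Hc P = hamReal P) :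
    IsRealAnalyticExtension U Hc where
  isOpen := hU
  subset := by
    rintro P ⟨δ, z, hδ, -, hz, rfl⟩
    exact hRU ⟨δ, z, hδ, hz, rfl⟩
  conj_mem P hP := by rw [← conjL_apply]; exact hcU P hP
  analytic := hHa
  conj_eq P hP := by rw [← conjL_apply]; exact hHc P hP
  eq_H δ z hδ _ hz := by
    rw [hHr _ ⟨δ, z, hδ, hz, rfl⟩, hamReal, realPart_emb, H_eq_realH hδ hz]

/-- Any extension is locally given by the formula on a holomorphic perturbation. -/
theorem extension_eventuallyEq {Hc K : CPt × ℂ → ℂ} {δ : ℝ} {z : RealPt} (hδ : 0 < δ)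
    (hz : z ∈ regularDomain δ) (hHa : AnalyticAt ℂ Hc (emb z, (δ : ℂ)))
    (hHr : ∀ P ∈ realRegular, Hc P = hamReal P)
    (hK : AnalyticAt ℂ K (emb (scale δ z), ((δ ^ 4 : ℝ) : ℂ)))
    (hKr : ∀ᶠ p : RealPt × ℝ in 𝓝 (scale δ z, δ ^ 4),
      K (emb p.1, (p.2 : ℂ)) = realH1 p.2 (cartPoi p.1)) : Hc =ᶠ[𝓝 (emb z, (δ : ℂ))] hamOf K := by
  obtain ⟨h1, h2⟩ := hamOf_local hδ hz hK hKr
  refine eventuallyEq_of_eq_real conjL_conjL conjL_smul norm_conjL_le (conjL_emb z δ) hHa h1 ?_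
  filter_upwards [h2] with P hP hc
  rw [(hP hc).2, hHr P (hP hc).1]

end

section

/-! ### The equations of motion in the new coordinates -/

/-- The real vectors span the complex space: the directions x = 1 and x = i give the difference and
the sum of the last two components. -/
theorem eq_of_form_emb {v v' : CPt} (h : ∀ w : RealPt, form v (emb w) = form v' (emb w)) :
    v = v' := by
  have h1 := h (0, 1, 0)
  have h2 := h (1, 0, 0)
  have h3 := h (0, 0, 1)
  have h4 := h (0, 0, Complex.I)
  simp only [form, emb, Matrix.cons_val, Complex.ofReal_zero, Complex.ofReal_one, mul_zero, map_zero,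
    sub_zero, mul_one, add_zero, zero_sub, neg_inj, map_one, zero_add, Complex.conj_I] at h1 h2 h3 h4
  have hI := Complex.I_sq
  have e3 : v 2 - v 3 = v' 2 - v' 3 := mul_left_cancel₀ Complex.I_ne_zero h3
  have e4 : v 2 + v 3 = v' 2 + v' 3 := by
    linear_combination h4 + (v 2 + v 3 - v' 2 - v' 3) * hI
  ext i
  fin_cases i
  · exact h1
  · exact h2
  · change v 2 = v' 2
    linear_combination (e3 + e4) / 2
  · change v 3 = v' 3
    linear_combination (e4 - e3) / 2

theorem eq_of_cartForm {v v' : Cart} (h : ∀ w, cartForm v w = cartForm v' w) : v = v' := by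
  have e := fun i => h (Pi.single i 1)
  have h0 := e 0
  have h1 := e 1
  have h2 := e 2
  have h3 := e 3
  simp [cartForm] at h0 h1 h2 h3
  ext i
  fin_cases i <;> assumption

theorem cartForm_cartVF (F : Cart → ℝ) (z w : Cart) : cartForm (cartVF F z) w = fderiv ℝ F z w := by
  have hw : w = w 0 • (Pi.single 0 1 : Cart) + w 1 • (Pi.single 1 1 : Cart)
      + w 2 • (Pi.single 2 1 : Cart) + w 3 • (Pi.single 3 1 : Cart) := by
    ext i
    fin_cases i <;> simp
  conv_rhs => rw [hw]
  simp only [map_add, map_smul, smul_eq_mul, cartForm, cartVF, Matrix.cons_val]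
  ring

theorem differentiableAt_h {μ : ℝ} {c : Cart} (hc : ¬ IsCollision μ c) :
    DifferentiableAt ℝ (h μ) c := by
  obtain ⟨d1, d2⟩ := dist_sq_pos hc
  have hi : ∀ i : Fin 4, DifferentiableAt ℝ (fun c : Cart => c i) c := fun i =>
    (ContinuousLinearMap.proj (R := ℝ) (φ := fun _ : Fin 4 => ℝ) i).differentiableAt
  have s1 : DifferentiableAt ℝ (fun c : Cart => √((c 0 - μ) ^ 2 + c 1 ^ 2)) c :=
    ((((hi 0).sub_const μ).pow 2).add ((hi 1).pow 2)).sqrt d1.ne'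
  have s2 : DifferentiableAt ℝ (fun c : Cart => √((c 0 - (μ - 1)) ^ 2 + c 1 ^ 2)) c :=
    ((((hi 0).sub_const (μ - 1)).pow 2).add ((hi 1).pow 2)).sqrt d2.ne'
  have e1 := (s1.inv (Real.sqrt_pos.2 d1).ne').const_mul (1 - μ)
  have e2 := (s2.inv (Real.sqrt_pos.2 d2).ne').const_mul μ
  have e0 : DifferentiableAt ℝ (fun w : Cart => (w 2 ^ 2 + w 3 ^ 2) / 2 -
      (w 0 * w 3 - w 1 * w 2)) c := by fun_prop
  exact (e0.sub e1).sub e2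

section

variable {δ : ℝ} {z : RealPt}

/-- The derivative of the chart as a linear isomorphism. -/
theorem exists_coord_equiv (hδ : 0 < δ) (hz : z ∈ chartDomain δ) :
    ∃ e : RealPt ≃L[ℝ] Cart, HasStrictFDerivAt (coord δ) (e : RealPt →L[ℝ] Cart) z ∧
      fderiv ℝ (coord δ) z = e := by
  set D := fderiv ℝ (coord δ) z with hD
  have hinj : Function.Injective D := by
    rw [injective_iff_map_eq_zero]
    intro v hv
    have h1 : emb v = emb 0 := by
      refine eq_of_form_emb fun w => ?_
      have h2 := cartForm_fderiv_coord hz v w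
      have h3 := cartForm_fderiv_coord hz 0 w
      rw [← hD] at h2 h3
      rw [map_zero] at h3
      rw [hv] at h2
      have hδc : (δ : ℂ) ^ 2 ≠ 0 := pow_ne_zero 2 (Complex.ofReal_ne_zero.2 hδ.ne')
      exact mul_left_cancel₀ hδc (h2.symm.trans h3)
    have h2 := congrArg (fun c : CPt => realPart (c, 0)) h1
    have h3 : ∀ y : RealPt, realPart (emb y, 0) = (y, 0) := by
      intro y
      have := realPart_emb y 0
      rwa [Complex.ofReal_zero] at this
    simp only [h3] at h2
    exact (Prod.ext_iff.1 h2).1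
  have hfr : Module.finrank ℝ RealPt = Module.finrank ℝ Cart := by
    simp [Module.finrank_prod, Complex.finrank_real_complex]
  set e := (LinearEquiv.ofInjectiveOfFinrankEq (D : RealPt →ₗ[ℝ] Cart) hinj
    hfr).toContinuousLinearEquiv with he
  have hDe : D = e := ContinuousLinearMap.ext fun v => rfl
  refine ⟨e, ?_, hDe⟩
  rw [← hDe, hD]
  exact (analyticAt_coord hz).hasStrictFDerivAt

variable {Hc : CPt × ℂ → ℂ}

/-- The real vector representing the vector field. -/
theorem emb_eq_field_iff (hδ : 0 < δ) (hz : z ∈ regularDomain δ)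
    (hHa : AnalyticAt ℂ Hc (emb z, (δ : ℂ))) (hHr : ∀ P ∈ realRegular, Hc P = hamReal P)
    (X : RealPt) : emb X = field Hc δ (emb z) ↔
      fderiv ℝ (coord δ) z (δ ^ 2 • X) = cartVF (h (δ ^ 4)) (coord δ z) := by
  obtain ⟨e, he, hD⟩ := exists_coord_equiv hδ hz.1
  have hδc : (δ : ℂ) ≠ 0 := Complex.ofReal_ne_zero.2 hδ.ne'
  have hFa : DifferentiableAt ℂ (fun c => Hc (c, (δ : ℂ))) (emb z) :=
    (AnalyticAt.comp (f := fun c : CPt => (c, (δ : ℂ))) hHa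
      (analyticAt_id.prod analyticAt_const)).differentiableAt
  -- Along real directions the extension equals h / δ⁴ plus a constant, and real lines through z
  -- stay among the regular points.
  have hdF : ∀ w : RealPt, fderiv ℂ (fun c => Hc (c, (δ : ℂ))) (emb z) (emb w) =
      ((fderiv ℝ (h (δ ^ 4)) (coord δ z) (fderiv ℝ (coord δ) z w) : ℝ) : ℂ) / (δ : ℂ) ^ 4 := by
    intro w
    have hline : HasDerivAt (fun t : ℝ => z + t • w) w 0 := by
      simpa using ((hasDerivAt_id (0 : ℝ)).smul_const w).const_add z
    have hz0 : z + (0 : ℝ) • w = z := by simp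
    have hlin : Tendsto (fun t : ℝ => (z + t • w, δ)) (𝓝 0) (𝓝 (z, δ)) := by
      have := hline.continuousAt.tendsto
      rw [hz0] at this
      exact this.prodMk_nhds tendsto_const_nhds
    have h1 : HasDerivAt (fun t : ℝ => Hc (emb (z + t • w), (δ : ℂ)))
        (fderiv ℂ (fun c => Hc (c, (δ : ℂ))) (emb z) (emb w)) 0 := by
      have a1 : HasFDerivAt (fun c => Hc (c, (δ : ℂ))) ((fderiv ℂ (fun c => Hc (c, (δ : ℂ)))
          (emb z)).restrictScalars ℝ) (emb (z + (0 : ℝ) • w)) := by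
        rw [hz0]; exact hFa.hasFDerivAt.restrictScalars ℝ
      exact a1.comp_hasDerivAt (0 : ℝ) (embL.hasFDerivAt.comp_hasDerivAt 0 hline : )
    have h2 : HasDerivAt (fun t : ℝ => h (δ ^ 4) (coord δ (z + t • w)))
        (fderiv ℝ (h (δ ^ 4)) (coord δ z) (fderiv ℝ (coord δ) z w)) 0 := by
      have a1 : HasFDerivAt (h (δ ^ 4)) (fderiv ℝ (h (δ ^ 4)) (coord δ z))
          (coord δ (z + (0 : ℝ) • w)) := by
        rw [hz0]; exact (differentiableAt_h hz.2).hasFDerivAt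
      have a2 : HasFDerivAt (coord δ) (fderiv ℝ (coord δ) z) (z + (0 : ℝ) • w) := by
        rw [hz0]; exact (analyticAt_coord hz.1).differentiableAt.hasFDerivAt
      exact a1.comp_hasDerivAt (0 : ℝ) (a2.comp_hasDerivAt (0 : ℝ) hline)
    have h3 := (h2.ofReal_comp.div_const ((δ : ℂ) ^ 4)).add_const (3 / (2 * (δ : ℂ) ^ 4))
    refine (h1.congr_of_eventuallyEq ?_).unique h3
    filter_upwards [hlin.eventually (eventually_regular hδ hz)] with t ht
    rw [hHr _ ⟨δ, _, hδ, ht.2, rfl⟩, hamReal, realPart_emb, ← H_eq_realH hδ ht.2,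
      energy_coord hδ ht.2.1]
    ring
  have hsymp := cartForm_fderiv_coord hz.1
  -- The energy contributes δ⁴ and the symplectic form δ². The remaining factor δ² is the change of
  -- time, which appears as δ² X.
  have key : ∀ w, form (field Hc δ (emb z)) (emb w) = form (emb X) (emb w) ↔
      cartForm (cartVF (h (δ ^ 4)) (coord δ z)) (fderiv ℝ (coord δ) z w) =
        cartForm (fderiv ℝ (coord δ) z (δ ^ 2 • X)) (fderiv ℝ (coord δ) z w) := by
    intro w
    rw [cartForm_cartVF, field, form_hamVF, hdF w, ← Complex.ofReal_inj, hsymp, div_eq_iff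
      (pow_ne_zero 4 hδc)]
    have : form (emb (δ ^ 2 • X)) (emb w) = (δ : ℂ) ^ 2 * form (emb X) (emb w) := by
      simp [form, emb]; ring
    rw [this, ← mul_assoc, ← pow_add, mul_comm]
  constructor
  · intro hX
    symm
    refine eq_of_cartForm fun c => ?_
    obtain ⟨w, rfl⟩ := e.surjective c
    have := (key w).1 (by rw [hX])
    rwa [hD] at this ⊢
  · intro hX
    symm
    exact eq_of_form_emb fun w => (key w).2 (by rw [hX])

/-- From right to left only continuity of the curve is available: λ is determined by the state
modulo 2π, and continuity excludes jumps. Differentiability then comes from the local inverse of the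
chart. -/
theorem equations_iff (hδ : 0 < δ) (hHa : AnalyticOnNhd ℂ Hc realRegular)
    (hHr : ∀ P ∈ realRegular, Hc P = hamReal P) {J : Set ℝ} {z : ℝ → RealPt} (hJ : IsOpen J)
    (hzc : ContinuousOn z J) (hz : ∀ τ ∈ J, z τ ∈ regularDomain δ) :
    (∀ τ ∈ J, HasDerivAt (fun s => emb (z s)) (field Hc δ (emb (z τ))) τ) ↔
      ∀ t : ℝ, δ ^ 2 * t ∈ J → HasDerivAt (fun s => coord δ (z (δ ^ 2 * s)))
        (cartVF (h (δ ^ 4)) (coord δ (z (δ ^ 2 * t)))) t := by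
  have hd : δ ^ 2 ≠ 0 := by positivity
  have hiff := fun τ (hτ : τ ∈ J) =>
    emb_eq_field_iff hδ (hz τ hτ) (hHa _ ⟨δ, _, hδ, hz τ hτ, rfl⟩) hHr
  constructor
  · intro hA t ht
    have h1 := hA _ ht
    set proj : CPt →L[ℝ] RealPt := (Complex.reCLM.comp (ContinuousLinearMap.proj 0)).prod
      ((Complex.reCLM.comp (ContinuousLinearMap.proj 1)).prod (ContinuousLinearMap.proj 2)) with hp
    have hpe : ∀ y, proj (emb y) = y := by
      rintro ⟨a, b, c⟩; simp [hp, emb]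
    have h2 : HasDerivAt z (proj (field Hc δ (emb (z (δ ^ 2 * t))))) (δ ^ 2 * t) := by
      have := proj.hasFDerivAt.comp_hasDerivAt _ h1
      simpa only [Function.comp_def, hpe] using this
    have h3 : HasDerivAt (fun s => emb (z s)) (emb (proj (field Hc δ (emb (z (δ ^ 2 * t))))))
        (δ ^ 2 * t) := (embL.hasFDerivAt.comp_hasDerivAt _ h2 : )
    have h4 := (hiff _ ht _).1 (h3.unique h1)
    have h5 : HasDerivAt (fun s => z (δ ^ 2 * s))
        (δ ^ 2 • proj (field Hc δ (emb (z (δ ^ 2 * t))))) t :=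
      h2.scomp t (by simpa using (hasDerivAt_id t).const_mul (δ ^ 2))
    rw [← h4]
    exact (analyticAt_coord (hz _ ht).1).differentiableAt.hasFDerivAt.comp_hasDerivAt t h5
  · intro hB τ hτ
    have ht : δ ^ 2 * (τ / δ ^ 2) = τ := by field_simp
    have h1 := hB (τ / δ ^ 2) (by rwa [ht])
    rw [ht] at h1
    have h2 : HasDerivAt (fun s => coord δ (z s))
        ((δ ^ 2)⁻¹ • cartVF (h (δ ^ 4)) (coord δ (z τ))) τ := by
      have h3 : HasDerivAt (fun s : ℝ => s / δ ^ 2) (δ ^ 2)⁻¹ τ := by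
        simpa using (hasDerivAt_id τ).div_const (δ ^ 2)
      have h4 := h1.scomp τ h3
      refine h4.congr_of_eventuallyEq (Eventually.of_forall fun s => ?_)
      simp only [Function.comp_apply]
      congr 2
      field_simp
    obtain ⟨e, he, hD⟩ := exists_coord_equiv hδ (hz τ hτ).1
    have h3 : HasDerivAt z (e.symm ((δ ^ 2)⁻¹ • cartVF (h (δ ^ 4)) (coord δ (z τ)))) τ := by
      have h5 := he.to_localInverse.hasFDerivAt.comp_hasDerivAt τ h2
      have h6 : Tendsto z (𝓝 τ) (𝓝 (z τ)) := hzc.continuousAt (hJ.mem_nhds hτ)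
      exact h5.congr_of_eventuallyEq ((h6.eventually he.eventually_left_inverse).mono
        fun s hs => hs.symm)
    have h4 : emb (e.symm ((δ ^ 2)⁻¹ • cartVF (h (δ ^ 4)) (coord δ (z τ)))) =
        field Hc δ (emb (z τ)) := by
      rw [hiff τ hτ, hD, ← map_smul, smul_smul, mul_inv_cancel₀ hd, one_smul]
      exact e.apply_symm_apply _
    rw [← h4]
    exact (embL.hasFDerivAt.comp_hasDerivAt _ h3 : )

end

end

section

/-! ### Circular orbits and the limit potential -/

theorem circular_mem (lam : ℝ) : ((lam, 1, 0) : RealPt) ∈ poiDomain := by simp [poiDomain]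

theorem cartPoi_circular (lam : ℝ) :
    cartPoi (lam, 1, 0) 0 = Real.cos lam ∧ cartPoi (lam, 1, 0) 1 = Real.sin lam := by
  have hz := circular_mem lam
  have hF : lam = eccLong lam 1 0 := (kepler_iff hz lam lam).1 (by simp [kD])
  have h1 := (cartPoi_formulas hz).1
  have hk : kL (rs 1 0) 0 (conj (0 : ℂ)) = ((1 : ℝ) : ℂ) := kL_real hz
  have hs : (rs 1 0 : ℂ) ^ 2 = 2 := by
    have := rs_sq hz
    simp only [norm_zero] at this
    have h2 : rs 1 0 ^ 2 = 2 := by rw [this]; norm_num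
    exact_mod_cast h2
  simp only [eccUnit, ← hF, kQ, hk] at h1
  have hw := expI_ne_zero lam
  have h2 : cQ (cartPoi (lam, 1, 0)) = Real.cos lam + Complex.I * Real.sin lam := by
    rw [h1, ← expI_ofReal]
    field_simp
    push_cast
    linear_combination (expI lam) ^ 2 * hs
  have h3 := congrArg Complex.re h2
  have h4 := congrArg Complex.im h2
  simp [cQ, -Complex.ofReal_cos, -Complex.ofReal_sin] at h3 h4
  exact ⟨h3, h4⟩

theorem realH1_circular (lam : ℝ) :
    realH1 0 (cartPoi (lam, 1, 0)) = 1 - Real.cos lam - 1 / √(2 + 2 * Real.cos lam) := by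
  obtain ⟨h0, h1⟩ := cartPoi_circular lam
  have hcs := Real.cos_sq_add_sin_sq lam
  have e1 : Real.cos lam ^ 2 + Real.sin lam ^ 2 = 1 := hcs
  have e2 : (Real.cos lam - (0 - 1)) ^ 2 + Real.sin lam ^ 2 = 2 + 2 * Real.cos lam := by
    linear_combination hcs
  rw [realH1, h0, h1, sub_zero, e1, e2, Real.sqrt_one]
  ring

theorem V_ofReal (lam : ℝ) : V lam = ((1 - Real.cos lam - 1 / √(2 + 2 * Real.cos lam) : ℝ) : ℂ) := by
  have h1 : (2 + 2 * Complex.cos lam) = ((2 + 2 * Real.cos lam : ℝ) : ℂ) := by push_cast; rfl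
  rw [V, h1, cpow_half_ofReal (by linarith [Real.neg_one_le_cos lam])]
  push_cast
  rfl

theorem circular_regular {lam : ℝ} (h : Real.cos lam ≠ -1) :
    ¬ IsCollision 0 (cartPoi (lam, 1, 0)) := by
  obtain ⟨h0, h1⟩ := cartPoi_circular lam
  have hcs := Real.cos_sq_add_sin_sq lam
  rintro (⟨a, b⟩ | ⟨a, -⟩)
  · rw [h0] at a; rw [h1] at b; rw [a, b] at hcs; norm_num at hcs
  · rw [h0] at a; exact h (by rw [a]; norm_num)

/-- For small μ ≠ 0 the perturbation is `realH1` at a fixed circular state, which is continuous at μ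
= 0 as long as that state is not at the point (-1, 0). -/
theorem tendsto_H1Poi {lam : ℝ} (h : Real.cos lam ≠ -1) :
    Tendsto (fun μ : ℝ => ((H1Poi μ lam 1 0 0 : ℝ) : ℂ)) (𝓝[≠] 0) (𝓝 (V lam)) := by
  have hc := circular_regular h
  set c := cartPoi (lam, 1, 0) with hcdef
  have h0 : c 0 ^ 2 + c 1 ^ 2 = 1 := by
    rw [hcdef, (cartPoi_circular lam).1, (cartPoi_circular lam).2, Real.cos_sq_add_sin_sq]
  obtain ⟨d1, d2⟩ := dist_sq_pos hc
  have hcont : ContinuousAt (fun μ => realH1 μ c) 0 := by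
    have n1 : √((c 0 - 0) ^ 2 + c 1 ^ 2) ≠ 0 := (Real.sqrt_pos.2 d1).ne'
    have n2 : √((c 0 - (0 - 1)) ^ 2 + c 1 ^ 2) ≠ 0 := (Real.sqrt_pos.2 d2).ne'
    have n3 : √(c 0 ^ 2 + c 1 ^ 2) * √((c 0 - 0) ^ 2 + c 1 ^ 2) *
        (√(c 0 ^ 2 + c 1 ^ 2) + √((c 0 - 0) ^ 2 + c 1 ^ 2)) ≠ 0 := by
      rw [sub_zero, h0]; norm_num
    unfold realH1
    refine ContinuousAt.sub (ContinuousAt.add (ContinuousAt.div ?_ ?_ n3)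
      (ContinuousAt.div ?_ ?_ n1)) (ContinuousAt.div ?_ ?_ n2) <;> fun_prop
  have hlim : Tendsto (fun μ => ((realH1 μ c : ℝ) : ℂ)) (𝓝[≠] 0) (𝓝 (V lam)) := by
    rw [V_ofReal, ← realH1_circular, ← hcdef]
    exact ((Complex.continuous_ofReal.tendsto _).comp hcont.tendsto).mono_left nhdsWithin_le_nhds
  refine hlim.congr' ?_
  have o1 : ∀ᶠ μ : ℝ in 𝓝 0, 0 < (c 0 - μ) ^ 2 + c 1 ^ 2 :=
    ((by fun_prop : Continuous fun μ : ℝ => (c 0 - μ) ^ 2 + c 1 ^ 2).tendsto 0).eventually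
      (lt_mem_nhds d1)
  have o2 : ∀ᶠ μ : ℝ in 𝓝 0, 0 < (c 0 - (μ - 1)) ^ 2 + c 1 ^ 2 :=
    ((by fun_prop : Continuous fun μ : ℝ => (c 0 - (μ - 1)) ^ 2 + c 1 ^ 2).tendsto 0).eventually
      (lt_mem_nhds d2)
  filter_upwards [self_mem_nhdsWithin, eventually_nhdsWithin_of_eventually_nhds o1,
    eventually_nhdsWithin_of_eventually_nhds o2] with μ hμ p1 p2
  have := realH1_eq (circular_mem lam) (μ := μ) hμ (by
    rintro (⟨a, b⟩ | ⟨a, b⟩)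
    · rw [← hcdef] at a b; simp [a, b] at p1
    · rw [← hcdef] at a b; simp [a, b] at p2)
  simp only [map_zero] at this
  rw [this]

/-! ### The Lagrange point -/

theorem cartVF_h {μ : ℝ} {c : Cart} (hc : ¬ IsCollision μ c) :
    cartVF (h μ) c = ![c 2 + c 1, c 3 - c 0,
      c 3 - (1 - μ) * (c 0 - μ) / √((c 0 - μ) ^ 2 + c 1 ^ 2) ^ 3 -
        μ * (c 0 - (μ - 1)) / √((c 0 - (μ - 1)) ^ 2 + c 1 ^ 2) ^ 3,
      -c 2 - (1 - μ) * c 1 / √((c 0 - μ) ^ 2 + c 1 ^ 2) ^ 3 -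
        μ * c 1 / √((c 0 - (μ - 1)) ^ 2 + c 1 ^ 2) ^ 3] := by
  obtain ⟨d1, d2⟩ := dist_sq_pos hc
  have hv : ∀ v : Cart, fderiv ℝ (h μ) c v = c 2 * v 2 + c 3 * v 3 -
      (v 0 * c 3 + c 0 * v 3 - v 1 * c 2 - c 1 * v 2) +
      (1 - μ) * ((c 0 - μ) * v 0 + c 1 * v 1) / √((c 0 - μ) ^ 2 + c 1 ^ 2) ^ 3 +
      μ * ((c 0 - (μ - 1)) * v 0 + c 1 * v 1) / √((c 0 - (μ - 1)) ^ 2 + c 1 ^ 2) ^ 3 := by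
    intro v
    have hline : HasDerivAt (fun t : ℝ => c + t • v) v 0 := by
      simpa using ((hasDerivAt_id (0 : ℝ)).smul_const v).const_add c
    have hc0 : c + (0 : ℝ) • v = c := by simp
    have h1 : HasDerivAt (fun t : ℝ => h μ (c + t • v)) (fderiv ℝ (h μ) c v) 0 := by
      have a1 : HasFDerivAt (h μ) (fderiv ℝ (h μ) c) (c + (0 : ℝ) • v) := by
        rw [hc0]; exact (differentiableAt_h hc).hasFDerivAt
      exact a1.comp_hasDerivAt (0 : ℝ) hline
    have hi : ∀ i, HasDerivAt (fun t : ℝ => c i + t * v i) (v i) 0 := hasDerivAt_pi.1 hline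
    have hdist : ∀ a m : ℝ, 0 < (c 0 - a) ^ 2 + c 1 ^ 2 →
        HasDerivAt (fun t : ℝ => m / √((c 0 + t * v 0 - a) ^ 2 + (c 1 + t * v 1) ^ 2))
          (-(m * ((c 0 - a) * v 0 + c 1 * v 1) / √((c 0 - a) ^ 2 + c 1 ^ 2) ^ 3)) 0 := by
      intro a m ha
      have hp := Real.sqrt_pos.2 ha
      have g := ((((hi 0).sub_const a).fun_pow 2).fun_add ((hi 1).fun_pow 2)).sqrt (by
        simpa using ha.ne')
      refine ((hasDerivAt_const (0 : ℝ) m).fun_div g (by simpa using hp.ne')).congr_deriv ?_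
      simp only [zero_mul, add_zero, Nat.cast_ofNat, Nat.add_one_sub_one, pow_one]
      field_simp
      ring
    have h2 := ((((((hi 2).fun_pow 2).fun_add ((hi 3).fun_pow 2)).div_const (2 : ℝ)).fun_sub
      (((hi 0).fun_mul (hi 3)).fun_sub ((hi 1).fun_mul (hi 2)))).fun_sub
        (hdist μ (1 - μ) d1)).fun_sub (hdist (μ - 1) μ d2)
    rw [HasDerivAt.unique (f := fun t : ℝ => h μ (c + t • v)) h1 h2]
    simp
    ring
  ext i
  fin_cases i <;> simp [cartVF, hv] <;> ring

/-- The equation of the collinear equilibrium beyond the heavy primary. -/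
theorem isL3_iff {μ : ℝ} {c : Cart} : IsL3 μ c ↔ μ < c 0 ∧ c 1 = 0 ∧ c 2 = 0 ∧ c 3 = c 0 ∧
    c 0 = (1 - μ) / (c 0 - μ) ^ 2 + μ / (c 0 - μ + 1) ^ 2 := by
  rw [IsL3]
  refine and_congr_right fun h0 => and_congr_right fun h1 => ?_
  have hp : 0 < c 0 - μ := by linarith
  have hp' : 0 < c 0 - μ + 1 := by linarith
  have hc : ¬ IsCollision μ c := by rintro (⟨a, -⟩ | ⟨a, -⟩) <;> linarith
  have e1 : √((c 0 - μ) ^ 2 + c 1 ^ 2) = c 0 - μ := by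
    rw [h1, zero_pow two_ne_zero, add_zero, Real.sqrt_sq hp.le]
  have e2 : √((c 0 - (μ - 1)) ^ 2 + c 1 ^ 2) = c 0 - μ + 1 := by
    rw [h1, zero_pow two_ne_zero, add_zero, ← Real.sqrt_sq hp'.le]; congr 1; ring
  rw [cartVF_h hc, e1, e2, h1]
  have e3 : (1 - μ) * (c 0 - μ) / (c 0 - μ) ^ 3 = (1 - μ) / (c 0 - μ) ^ 2 := by field_simp
  have e4 : μ * (c 0 - (μ - 1)) / (c 0 - μ + 1) ^ 3 = μ / (c 0 - μ + 1) ^ 2 := by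
    field_simp; ring
  rw [e3, e4]
  constructor
  · intro h
    have k0 := congrFun h 0
    have k1 := congrFun h 1
    have k2 := congrFun h 2
    simp only [Matrix.cons_val, Pi.zero_apply] at k0 k1 k2
    exact ⟨by linarith, by linarith, by linarith⟩
  · rintro ⟨k0, k1, k2⟩
    ext i
    fin_cases i
    · simp [k0]
    · simp [k1]
    · simp only [Fin.reduceFinMk, Matrix.cons_val, Pi.zero_apply]; linarith
    · simp [k0]

/-- The right side of the equation decreases in the radius while the left side increases. -/
theorem L3_unique {μ r r' : ℝ} (hμ : 0 < μ) (hμ1 : μ < 1) (hr : μ < r) (hr' : μ < r')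
    (h : r = (1 - μ) / (r - μ) ^ 2 + μ / (r - μ + 1) ^ 2)
    (h' : r' = (1 - μ) / (r' - μ) ^ 2 + μ / (r' - μ + 1) ^ 2) : r = r' := by
  have key : ∀ a b : ℝ, μ < a → a < b →
      (1 - μ) / (b - μ) ^ 2 + μ / (b - μ + 1) ^ 2 ≤ (1 - μ) / (a - μ) ^ 2 + μ / (a - μ + 1) ^ 2 := by
    intro a b ha hab
    have h1 : 0 < a - μ := by linarith
    gcongr
  rcases lt_trichotomy r r' with hlt | heq | hgt
  · have := key r r' hr hlt; linarith
  · exact heq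
  · have := key r' r hr' hgt; linarith

/-- The difference of the two sides is negative at 1 and positive at 1 + 2μ. -/
theorem exists_L3_radius {μ : ℝ} (hμ : 0 < μ) (hμ1 : μ ≤ 1 / 100) :
    ∃ r : ℝ, 1 < r ∧ r < 1 + 2 * μ ∧ r = (1 - μ) / (r - μ) ^ 2 + μ / (r - μ + 1) ^ 2 := by
  set g : ℝ → ℝ := fun r => r - ((1 - μ) / (r - μ) ^ 2 + μ / (r - μ + 1) ^ 2) with hg
  have hcont : ContinuousOn g (Set.Icc 1 (1 + 2 * μ)) := by
    intro r hr
    have h1 : (r - μ) ^ 2 ≠ 0 := pow_ne_zero 2 (by linarith [hr.1] : (0 : ℝ) < r - μ).ne'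
    have h2 : (r - μ + 1) ^ 2 ≠ 0 := pow_ne_zero 2 (by linarith [hr.1] : (0 : ℝ) < r - μ + 1).ne'
    refine ContinuousAt.continuousWithinAt (continuousAt_id.sub (ContinuousAt.add
      (ContinuousAt.div ?_ ?_ h1) (ContinuousAt.div ?_ ?_ h2))) <;> fun_prop
  have g1 : g 1 < 0 := by
    have h1 : (1 : ℝ) < (1 - μ) / (1 - μ) ^ 2 := by
      rw [lt_div_iff₀ (by nlinarith)]; nlinarith
    have h2 : (0 : ℝ) < μ / (1 - μ + 1) ^ 2 := by
      have : (0 : ℝ) < 1 - μ + 1 := by linarith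
      positivity
    simp only [hg]; linarith
  have g2 : 0 < g (1 + 2 * μ) := by
    have h1 : (1 - μ) / (1 + 2 * μ - μ) ^ 2 < 1 := by
      rw [div_lt_one (by nlinarith)]; nlinarith
    have h2 : μ / (1 + 2 * μ - μ + 1) ^ 2 < μ := by
      apply div_lt_self hμ; nlinarith
    simp only [hg]; linarith
  obtain ⟨r, hr, hr0⟩ := intermediate_value_Ioo (by linarith) hcont (Set.mem_Ioo.2 ⟨g1, g2⟩)
  exact ⟨r, hr.1, hr.2, by have : g r = 0 := hr0; simp only [hg] at this; linarith⟩

/-- The state at the perihelion of an orbit, at rest in the rotating frame. -/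
theorem cartPoi_perihelion {r : ℝ} (h1 : 1 < r) (h2 : r ^ 3 < 2) :
    let L : ℝ := √(r / (2 - r ^ 3))
    let η : ℝ := L * (r ^ 3 - 1) / √(L + r ^ 2)
    ((0, L, (η : ℂ)) : RealPt) ∈ poiDomain ∧ cartPoi (0, L, (η : ℂ)) = ![r, 0, 0, r] := by
  intro L η
  -- The state (r, 0, 0, r) has radial momentum 0, angular momentum G = r² and Kepler energy r² / 2
  -- - 1 / r. Hence L² = r / (2 - r³) and e = r³ - 1, and η follows from η² = L - G together with L²
  -- - G² = L² e².
  have hd : 0 < 2 - r ^ 3 := by linarith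
  have hr0 : 0 < r := by linarith
  have hq : 0 < r / (2 - r ^ 3) := by positivity
  have hL : 0 < L := Real.sqrt_pos.2 hq
  have hL2 : L ^ 2 * (2 - r ^ 3) = r := by
    rw [Real.sq_sqrt hq.le]; field_simp
  have hs : 0 < √(L + r ^ 2) := Real.sqrt_pos.2 (by positivity)
  have hs2 : √(L + r ^ 2) ^ 2 = L + r ^ 2 := Real.sq_sqrt (by positivity)
  have hsη : √(L + r ^ 2) * η = L * (r ^ 3 - 1) := by
    simp only [η]; field_simp
  have hη2 : η ^ 2 = L - r ^ 2 := by
    have : (L + r ^ 2) * η ^ 2 = (L + r ^ 2) * (L - r ^ 2) := by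
      rw [← hs2, ← mul_pow, hsη, hs2]
      linear_combination (-r ^ 3) * hL2
    exact mul_left_cancel₀ (by positivity : L + r ^ 2 ≠ 0) this
  have hn : ‖(η : ℂ)‖ ^ 2 = L - r ^ 2 := by
    rw [Complex.norm_real, Real.norm_eq_abs, sq_abs, hη2]
  have hz : ‖(η : ℂ)‖ ^ 2 < L := by rw [hn]; nlinarith
  refine ⟨hz, ?_⟩
  have hrs : rs L η = √(L + r ^ 2) := by rw [rs, hn]; congr 1; ring
  have hF : (0 : ℝ) = eccLong 0 L η :=
    (kepler_iff hz 0 0).1 (by simp [kD, expI])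
  have hzm : ((0, L, (η : ℂ)) : RealPt) ∈ poiDomain := hz
  have hw : eccUnit (0, L, (η : ℂ)) = 1 := by simp only [eccUnit, ← hF]; simp [expI]
  obtain ⟨f1, f2⟩ := cartPoi_formulas hzm
  have n2 := (real_factors_ne_zero hz (norm_one (α := ℂ))).1
  have hkL : kL (√(L + r ^ 2) : ℝ) η η = L := by
    have := kL_real hz
    rwa [hrs, Complex.conj_ofReal] at this
  simp only [hw, kQ, kP, hrs, Complex.conj_ofReal, hkL] at f1 f2 n2
  set s := √(L + r ^ 2)
  have hη2c : (η : ℂ) ^ 2 = L - r ^ 2 := by exact_mod_cast hη2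
  have hs2c : (s : ℂ) ^ 2 = L + r ^ 2 := by exact_mod_cast hs2
  have hsηc : (s : ℂ) * η = L * (r ^ 3 - 1) := by exact_mod_cast hsη
  have hL2c : (L : ℂ) ^ 2 * (2 - r ^ 3) = r := by exact_mod_cast hL2
  have hLc : (L : ℂ) ≠ 0 := by exact_mod_cast hL.ne'
  have hm : (s : ℂ) - 1 * η ≠ 0 := by
    intro h; apply n2; linear_combination h
  refine cart_ext ?_ ?_
  · rw [f1]
    simp only [cQ, Matrix.cons_val]
    push_cast
    linear_combination (L / 2 : ℂ) * (hs2c + hη2c - 2 * hsηc) + hL2c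
  · rw [f2]
    simp only [cP, Matrix.cons_val]
    push_cast
    have hm' : (s : ℂ) - η ≠ 0 := by simpa using hm
    have e : (s * 1 + η : ℂ) / (s - η * 1) = L * r := by
      rw [mul_one, mul_one, div_eq_iff hm']
      have h4 : (s : ℂ) * (s + η - L * r * (s - η)) = 0 := by
        linear_combination (1 - L * r) * hs2c + (1 + L * r) * hsηc + (-(r : ℂ)) * hL2c
      have hsc : (s : ℂ) ≠ 0 := by exact_mod_cast hs.ne'
      linear_combination (mul_eq_zero.1 h4).resolve_left hsc
    rw [e]
    field_simp
    ring

end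

section

/-! ### The spectrum of a Hamiltonian matrix -/

/-- The matrix of the linear Hamiltonian vector field with quadratic part given by a symmetric
matrix, in the order `(λ, Λ, x, y)`. -/
def hamMatrix (B : Matrix (Fin 4) (Fin 4) ℂ) : Matrix (Fin 4) (Fin 4) ℂ :=
  Matrix.of ![fun j => B j 1, fun j => -B j 0, fun j => -Complex.I * B j 3,
    fun j => Complex.I * B j 2]

open Polynomial in
/-- The characteristic polynomial of a Hamiltonian matrix is even. -/
theorem charpoly_hamMatrix {B : Matrix (Fin 4) (Fin 4) ℂ} (hB : ∀ i j, B i j = B j i) :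
    ∃ a : ℂ, (hamMatrix B).charpoly = X ^ 4 + C a * X ^ 2 + C (hamMatrix B).det := by
  have hI : (C Complex.I : ℂ[X]) ^ 2 = -1 := by rw [← C_pow, Complex.I_sq]; simp
  have h2 : (C 2 : ℂ[X]) = 2 := rfl
  refine ⟨B 0 0 * B 1 1 - B 0 1 ^ 2 + 2 * Complex.I * (B 1 2 * B 0 3 - B 0 2 * B 1 3) +
    B 2 3 ^ 2 - B 2 2 * B 3 3, ?_⟩
  rw [Matrix.charpoly]
  simp only [Matrix.det_succ_row_zero, Fin.sum_univ_succ, Matrix.charmatrix, hamMatrix]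
  simp [Fin.succAbove, hB 1 0, hB 2 0, hB 3 0, hB 2 1, hB 3 1, hB 3 2]
  ring_nf
  simp only [hI, h2]
  ring

-- Conjugation only permutes the entries of the matrix, so in X⁴ + a X² + d both coefficients are
-- real. If d < 0, the roots of T² + a T + d are real of opposite signs; they are ρ² and -σ².
open Polynomial in
theorem exists_isSaddleCenter {B : Matrix (Fin 4) (Fin 4) ℂ} (hB : ∀ i j, B i j = B j i)
    (hconj : ∀ i j, conj (hamMatrix B i j) =
      hamMatrix B (Equiv.swap 2 3 i) (Equiv.swap 2 3 j)) (hdet : (hamMatrix B).det.re < 0) :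
    ∃ ρ σ, IsSaddleCenter (hamMatrix B) ρ σ := by
  obtain ⟨a, ha⟩ := charpoly_hamMatrix hB
  set M := hamMatrix B with hM
  set d := M.det with hd
  have hmap : M.map (starRingEnd ℂ) = Matrix.reindex (Equiv.swap 2 3) (Equiv.swap 2 3) M := by
    ext i j
    simp [hconj]
  have h1 : M.charpoly.map (starRingEnd ℂ) = M.charpoly := by
    rw [← Matrix.charpoly_map, hmap, Matrix.charpoly_reindex]
  rw [ha] at h1
  have ha' : conj a = a := by
    have := congrArg (fun p => coeff p 2) h1
    simpa [coeff_X_pow, coeff_C] using this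
  have hd' : conj d = d := by
    have := congrArg (fun p => coeff p 0) h1
    simpa [coeff_X_pow, coeff_C] using this
  obtain ⟨a, rfl⟩ := Complex.conj_eq_iff_real.1 ha'
  obtain ⟨e, he⟩ := Complex.conj_eq_iff_real.1 hd'
  rw [he, Complex.ofReal_re] at hdet
  set w := √(a ^ 2 - 4 * e) with hw
  have hw2 : w ^ 2 = a ^ 2 - 4 * e := Real.sq_sqrt (by nlinarith [sq_nonneg a])
  have hwa : |a| < w := by
    rw [hw, ← Real.sqrt_sq_eq_abs]
    exact Real.sqrt_lt_sqrt (sq_nonneg a) (by linarith)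
  obtain ⟨w1, w2⟩ := abs_lt.1 hwa
  have p1 : 0 < (w - a) / 2 := by linarith
  have p2 : 0 < (w + a) / 2 := by linarith
  refine ⟨√((w - a) / 2), √((w + a) / 2), Real.sqrt_pos.2 p1, Real.sqrt_pos.2 p2, ?_⟩
  have q1 : (√((w - a) / 2) : ℂ) ^ 2 = ((w - a) / 2 : ℝ) := by exact_mod_cast Real.sq_sqrt p1.le
  have q2 : (√((w + a) / 2) : ℂ) ^ 2 = ((w + a) / 2 : ℝ) := by exact_mod_cast Real.sq_sqrt p2.le
  have e1 : (a : ℂ) = ((w + a) / 2 : ℝ) - ((w - a) / 2 : ℝ) := by push_cast; ring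
  have e2 : (e : ℂ) = -(((w - a) / 2 : ℝ) * ((w + a) / 2 : ℝ)) := by
    have : e = -((w - a) / 2 * ((w + a) / 2)) := by linarith
    exact_mod_cast this
  rw [ha, he, q1, q2, e2]
  nth_rewrite 1 [e1]
  simp only [map_sub, map_neg, map_mul]
  ring

/-- Multiplication of the last two rows by δ² removes δ from `L3Matrix`, multiplies the determinant
by δ⁴ > 0 and does not increase the errors when δ ≤ 1. So continuity of the determinant at one fixed
matrix gives an ε independent of δ. -/
theorem exists_det_neg : ∃ ε > 0, ∀ δ : ℝ, 0 < δ → δ ≤ 1 → ∀ M : Matrix (Fin 4) (Fin 4) ℂ,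
    (∀ i j, ‖M i j - L3Matrix δ i j‖ < ε) → M.det.re < 0 := by
  set T₀ : Fin 4 → Fin 4 → ℂ := ![![0, -3, 0, 0], ![-7 / 8, 0, 0, 0], ![0, 0, -Complex.I, 0],
    ![0, 0, 0, Complex.I]] with hT₀
  have hcont : Continuous fun A : Fin 4 → Fin 4 → ℂ => (Matrix.of A).det.re :=
    Complex.continuous_re.comp (Continuous.matrix_det continuous_id)
  have h0 : (Matrix.of T₀).det.re < 0 := by
    simp [hT₀, Matrix.det_succ_row_zero, Fin.sum_univ_succ, Fin.succAbove]
    norm_num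
  obtain ⟨ε, hε, hb⟩ := Metric.eventually_nhds_iff.1 (hcont.tendsto T₀ |>.eventually (gt_mem_nhds h0))
  refine ⟨ε, hε, fun δ hδ hδ1 M hM => ?_⟩
  set v : Fin 4 → ℂ := ![1, 1, (δ : ℂ) ^ 2, (δ : ℂ) ^ 2] with hv
  have hδc : (δ : ℂ) ≠ 0 := Complex.ofReal_ne_zero.2 hδ.ne'
  have hv1 : ∀ i, ‖v i‖ ≤ 1 := by
    have : |δ| ≤ 1 := by rwa [abs_of_pos hδ]
    intro i
    fin_cases i <;> simp [hv, this]
  have hT : ∀ i j, v i * L3Matrix δ i j = T₀ i j := by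
    intro i j
    fin_cases i <;> fin_cases j <;> simp [hv, hT₀, L3Matrix] <;> field_simp
  have h1 := hb (y := fun i j => v i * M i j) (by
    rw [dist_pi_lt_iff hε]
    intro i
    rw [dist_pi_lt_iff hε]
    intro j
    rw [dist_eq_norm, ← hT, ← mul_sub, norm_mul]
    exact (mul_le_of_le_one_left (norm_nonneg _) (hv1 i)).trans_lt (hM i j))
  have h2 : (Matrix.of fun i j => v i * M i j).det = ((δ ^ 4 : ℝ) : ℂ) * M.det := by
    rw [Matrix.det_mul_column]
    simp [hv, Fin.prod_univ_succ]
    ring_nf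
    simp
  rw [h2, Complex.re_ofReal_mul] at h1
  have h3 : 0 < δ ^ 4 := by positivity
  by_contra h4
  nlinarith

end

section

/-! ### The linear part at the Lagrange point -/

/-- The Hessian as a matrix. -/
def hessian (F : CPt → ℂ) (P : CPt) : Matrix (Fin 4) (Fin 4) ℂ :=
  Matrix.of fun i j => fderiv ℂ (fderiv ℂ F) P (Pi.single i 1) (Pi.single j 1)

theorem linearPart_hamVF {F : CPt → ℂ} {P : CPt} (hF : AnalyticAt ℂ F P) :
    linearPart (hamVF F) P = hamMatrix (hessian F P) := by
  have h1 := hF.fderiv.differentiableAt.hasFDerivAt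
  have h2 : ∀ v, HasFDerivAt (fun c => fderiv ℂ F c v)
      ((ContinuousLinearMap.apply ℂ ℂ v).comp (fderiv ℂ (fderiv ℂ F) P)) P := fun v =>
    (ContinuousLinearMap.apply ℂ ℂ v).hasFDerivAt.comp P h1
  have h3 := hasFDerivAt_pi'.1 (analyticAt_hamVF hF).differentiableAt.hasFDerivAt
  ext i j
  rw [linearPart, Matrix.of_apply]
  fin_cases i
  · exact congrArg (fun A : CPt →L[ℂ] ℂ => A (Pi.single j 1)) ((h3 0).unique (h2 _))
  · exact congrArg (fun A : CPt →L[ℂ] ℂ => A (Pi.single j 1)) ((h3 1).unique (h2 _).fun_neg)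
  · exact congrArg (fun A : CPt →L[ℂ] ℂ => A (Pi.single j 1)) ((h3 2).unique ((h2 _).const_mul _))
  · exact congrArg (fun A : CPt →L[ℂ] ℂ => A (Pi.single j 1)) ((h3 3).unique ((h2 _).const_mul _))

theorem hessian_symm {F : CPt → ℂ} {P : CPt} (hF : AnalyticAt ℂ F P) (i j : Fin 4) :
    hessian F P i j = hessian F P j i :=
  (hF.contDiffAt (n := 2)).isSymmSndFDerivAt (by simp) _ _

/-- The derivative of the scaling. -/
def scaleD (δ : ℂ) (v : CPt) : CPt × ℂ := (![v 0, δ ^ 2 * v 1, δ * v 2, δ * v 3], 0)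

theorem scaleC_line (δ t : ℂ) (c v : CPt) :
    scaleC (c + t • v, δ) = scaleC (c, δ) + t • scaleD δ v := by
  refine Prod.ext ?_ (by simp [scaleC, scaleD])
  ext i
  fin_cases i <;> simp [scaleC, scaleD] <;> ring

section

variable {K : CPt × ℂ → ℂ} {δ : ℂ} {c : CPt}

theorem hasDerivAt_line (c v : CPt) (i : Fin 4) (t : ℂ) :
    HasDerivAt (fun t : ℂ => (c + t • v) i) (v i) t := by
  simpa using ((hasDerivAt_id t).mul_const (v i)).const_add (c i)

theorem fderiv_hamOf (hK : AnalyticAt ℂ K (scaleC (c, δ))) (hδ : δ ≠ 0) (hc : 1 + δ ^ 2 * c 1 ≠ 0)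
    (v : CPt) : fderiv ℂ (fun c => hamOf K (c, δ)) c v =
      (v 2 * c 3 + c 2 * v 3) / δ ^ 2 + fderiv ℂ K (scaleC (c, δ)) (scaleD δ v) +
        (1 / (1 + δ ^ 2 * c 1) ^ 3 - 1) * v 1 / δ ^ 2 := by
  have hl := fun i => hasDerivAt_line c v i 0
  have hc0 : c + (0 : ℂ) • v = c := by simp
  have hF : AnalyticAt ℂ (fun c => hamOf K (c, δ)) c :=
    AnalyticAt.comp (f := fun c : CPt => (c, δ)) (analyticAt_hamOf (P := (c, δ)) hK hδ hc)
      (analyticAt_id.prod analyticAt_const)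
  have h1 : HasDerivAt (fun t : ℂ => hamOf K (c + t • v, δ))
      (fderiv ℂ (fun c => hamOf K (c, δ)) c v) 0 :=
    hF.differentiableAt.hasFDerivAt.hasLineDerivAt v
  have h2 : HasDerivAt (fun t : ℂ => K (scaleC (c + t • v, δ)))
      (fderiv ℂ K (scaleC (c, δ)) (scaleD δ v)) 0 := by
    simp only [scaleC_line]
    exact hK.differentiableAt.hasFDerivAt.hasLineDerivAt _
  have h3 : HasDerivAt (fun t : ℂ => 1 + δ ^ 2 * (c + t • v) 1) (δ ^ 2 * v 1) 0 :=
    ((hl 1).const_mul _).const_add _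
  have h4 := ((((hl 1).fun_pow 2).const_mul (-(3 / 2) : ℂ)).fun_add
    (((hl 2).fun_mul (hl 3)).div_const (δ ^ 2))).fun_add h2 |>.fun_add
    (((((((hasDerivAt_const (0 : ℂ) (1 : ℂ)).fun_div ((h3.fun_pow 2).const_mul 2) (by
      rw [hc0]; exact mul_ne_zero two_ne_zero (pow_ne_zero 2 hc))).fun_neg.fun_sub h3).add_const
        (3 / 2)).fun_add ((((hl 1).const_mul (δ ^ 2)).fun_pow 2).const_mul (3 / 2))).div_const
          (δ ^ 4)))
  rw [HasDerivAt.unique (f := fun t : ℂ => hamOf K (c + t • v, δ)) h1 h4]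
  simp only [hc0, Nat.cast_ofNat, Nat.add_one_sub_one, pow_one]
  field_simp
  ring

/-- The quadratic term -3 / 2 · Λ² and F_pend / δ⁴ recombine to the Kepler term: the second
derivative in Λ is that of -1 / (2L²), namely -3 / L⁴ at L = 1 + δ² Λ. -/
theorem hessian_hamOf (hK : AnalyticAt ℂ K (scaleC (c, δ))) (hδ : δ ≠ 0) (hc : 1 + δ ^ 2 * c 1 ≠ 0)
    (w v : CPt) : fderiv ℂ (fderiv ℂ (fun c => hamOf K (c, δ))) c w v =
      (v 2 * w 3 + w 2 * v 3) / δ ^ 2 +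
        fderiv ℂ (fderiv ℂ K) (scaleC (c, δ)) (scaleD δ w) (scaleD δ v) -
        3 / (1 + δ ^ 2 * c 1) ^ 4 * (w 1 * v 1) := by
  have hl := fun i => hasDerivAt_line c w i 0
  have hc0 : c + (0 : ℂ) • w = c := by simp
  have hFa : AnalyticAt ℂ (fun c => hamOf K (c, δ)) c :=
    AnalyticAt.comp (f := fun c : CPt => (c, δ)) (analyticAt_hamOf (P := (c, δ)) hK hδ hc)
      (analyticAt_id.prod analyticAt_const)
  have h1 : HasDerivAt (fun t : ℂ => fderiv ℂ (fun c => hamOf K (c, δ)) (c + t • w) v)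
      (fderiv ℂ (fderiv ℂ (fun c => hamOf K (c, δ))) c w v) 0 :=
    ((ContinuousLinearMap.apply ℂ ℂ v).hasFDerivAt.comp c
      hFa.fderiv.differentiableAt.hasFDerivAt).hasLineDerivAt w
  have h2 : HasDerivAt (fun t : ℂ => fderiv ℂ K (scaleC (c + t • w, δ)) (scaleD δ v))
      (fderiv ℂ (fderiv ℂ K) (scaleC (c, δ)) (scaleD δ w) (scaleD δ v)) 0 := by
    simp only [scaleC_line]
    exact ((ContinuousLinearMap.apply ℂ ℂ (scaleD δ v)).hasFDerivAt.comp (scaleC (c, δ))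
      hK.fderiv.differentiableAt.hasFDerivAt).hasLineDerivAt (scaleD δ w)
  have h3 : HasDerivAt (fun t : ℂ => 1 + δ ^ 2 * (c + t • w) 1) (δ ^ 2 * w 1) 0 :=
    ((hl 1).const_mul _).const_add _
  have h4 := ((((hl 3).const_mul (v 2)).fun_add ((hl 2).mul_const (v 3))).div_const
    (δ ^ 2)).fun_add h2 |>.fun_add
      ((((((hasDerivAt_const (0 : ℂ) (1 : ℂ)).fun_div (h3.fun_pow 3) (by
        rw [hc0]; exact pow_ne_zero 3 hc)).sub_const 1).mul_const (v 1)).div_const (δ ^ 2)))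
  have hline : Tendsto (fun t : ℂ => c + t • w) (𝓝 0) (𝓝 c) := by
    have : Continuous fun t : ℂ => c + t • w := by fun_prop
    simpa using this.tendsto 0
  have ev1 : ∀ᶠ y in 𝓝 c, AnalyticAt ℂ K (scaleC (y, δ)) := by
    have : ContinuousAt (fun y : CPt => scaleC (y, δ)) c :=
      ContinuousAt.comp (g := scaleC) (f := fun y : CPt => (y, δ)) (analyticAt_scaleC _).continuousAt
        (by fun_prop)
    exact this.tendsto.eventually hK.eventually_analyticAt
  have ev2 : ∀ᶠ y : CPt in 𝓝 c, 1 + δ ^ 2 * y 1 ≠ 0 :=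
    (continuousAt_const.add (continuousAt_const.mul
      (analyticAt_coord_apply c 1).continuousAt)).eventually_ne hc
  have h5 := h4.congr_of_eventuallyEq ((hline.eventually (ev1.and ev2)).mono fun t ht =>
    fderiv_hamOf ht.1 hδ ht.2 v)
  rw [h1.unique h5]
  simp only [hc0, Nat.cast_ofNat]
  field_simp
  ring

end

/-- The second derivative of the perturbation at the circular orbit. -/
theorem hessian_circular {K : CPt × ℂ → ℂ} (hK : AnalyticAt ℂ K (emb (0, 1, 0), ((0 : ℝ) : ℂ)))
    (hKr : ∀ᶠ p : RealPt × ℝ in 𝓝 ((0, 1, 0), 0),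
      K (emb p.1, (p.2 : ℂ)) = realH1 p.2 (cartPoi p.1)) :
    fderiv ℂ (fderiv ℂ K) (emb (0, 1, 0), ((0 : ℝ) : ℂ)) (Pi.single 0 1, 0) (Pi.single 0 1, 0) =
      7 / 8 := by
  set P : CPt × ℂ := (emb (0, 1, 0), ((0 : ℝ) : ℂ)) with hP
  set e : CPt × ℂ := (Pi.single 0 1, 0) with he
  have hline : ∀ t : ℝ, P + t • e = (emb (t, 1, 0), ((0 : ℝ) : ℂ)) := by
    intro t
    refine Prod.ext ?_ (by simp [hP, he])
    ext i
    have h : (P + t • e).1 i = emb (0, 1, 0) i + t * (Pi.single 0 1 : CPt) i := by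
      simp [hP, he]
    rw [h]
    fin_cases i <;> simp [emb]
  have hPt : Tendsto (fun t : ℝ => P + t • e) (𝓝 0) (𝓝 P) := by
    have : Continuous fun t : ℝ => P + t • e := by fun_prop
    simpa using this.tendsto 0
  -- Along the circular orbits at μ = 0 the perturbation is the potential V, and V' = sin λ (1 - (2
  -- + 2 cos λ)^{-3/2}) gives V''(0) = 1 - 1 / 8.
  have hKt : ∀ᶠ t : ℝ in 𝓝 0, K (P + t • e) =
      ((1 - Real.cos t - 1 / √(2 + 2 * Real.cos t) : ℝ) : ℂ) := by
    have h1 : Tendsto (fun t : ℝ => (((t, 1, 0) : RealPt), (0 : ℝ))) (𝓝 0) (𝓝 ((0, 1, 0), 0)) := by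
      have : Continuous fun t : ℝ => (((t, 1, 0) : RealPt), (0 : ℝ)) := by fun_prop
      exact this.tendsto 0
    filter_upwards [h1.eventually hKr] with t ht
    rw [hline, ht, realH1_circular]
  have hcos : ∀ᶠ t : ℝ in 𝓝 0, 0 < 2 + 2 * Real.cos t := by
    have : Continuous fun t : ℝ => 2 + 2 * Real.cos t := by fun_prop
    exact (this.tendsto 0).eventually (lt_mem_nhds (by norm_num))
  have hroot : ∀ t : ℝ, 0 < 2 + 2 * Real.cos t → HasDerivAt (fun t : ℝ => √(2 + 2 * Real.cos t))
      (2 * -Real.sin t / (2 * √(2 + 2 * Real.cos t))) t := fun t ht =>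
    (((Real.hasDerivAt_cos t).const_mul 2).const_add 2).sqrt ht.ne'
  have hg : ∀ t : ℝ, 0 < 2 + 2 * Real.cos t →
      HasDerivAt (fun t : ℝ => 1 - Real.cos t - 1 / √(2 + 2 * Real.cos t))
        (Real.sin t * (1 - 1 / √(2 + 2 * Real.cos t) ^ 3)) t := by
    intro t ht
    have hp := Real.sqrt_pos.2 ht
    refine (((Real.hasDerivAt_cos t).const_sub 1).fun_sub ((hasDerivAt_const t (1 : ℝ)).fun_div
      (hroot t ht) hp.ne')).congr_deriv ?_
    field_simp
    ring
  have hfd : ∀ᶠ t : ℝ in 𝓝 0, fderiv ℂ K (P + t • e) e =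
      ((Real.sin t * (1 - 1 / √(2 + 2 * Real.cos t) ^ 3) : ℝ) : ℂ) := by
    filter_upwards [hKt.eventually_nhds, hcos, hPt.eventually hK.eventually_analyticAt]
      with t h1 h2 h3
    have h4 : HasDerivAt (fun t : ℝ => P + t • e) e t := by
      simpa using ((hasDerivAt_id t).smul_const e).const_add P
    have h6 : HasFDerivAt K ((fderiv ℂ K (P + t • e)).restrictScalars ℝ) (P + t • e) :=
      h3.differentiableAt.hasFDerivAt.restrictScalars ℝ
    have h5 := h6.comp_hasDerivAt t h4
    exact h5.unique ((hg t h2).ofReal_comp.congr_of_eventuallyEq h1)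
  have h1 : HasDerivAt (fun t : ℝ => fderiv ℂ K (P + t • e) e) (fderiv ℂ (fderiv ℂ K) P e e) 0 := by
    have h2 := ((ContinuousLinearMap.apply ℂ ℂ e).hasFDerivAt.comp P
      hK.fderiv.differentiableAt.hasFDerivAt).restrictScalars ℝ
    exact h2.hasLineDerivAt e
  have hp0 : (0 : ℝ) < 2 + 2 * Real.cos 0 := by norm_num
  have hs0 : √(2 + 2 * Real.cos 0) = 2 := by
    rw [Real.cos_zero, show (2 + 2 * 1 : ℝ) = 2 ^ 2 by norm_num, Real.sqrt_sq (by norm_num)]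
  have h3 := ((Real.hasDerivAt_sin 0).fun_mul (((hasDerivAt_const (0 : ℝ) (1 : ℝ)).fun_div
    ((hroot 0 hp0).fun_pow 3) (by rw [hs0]; norm_num)).const_sub 1)).ofReal_comp
  rw [h1.unique (h3.congr_of_eventuallyEq hfd), hs0]
  norm_num

end

/-! ### Estimates near the circular orbit at μ = 0. -/

section

/-- The state and the mass ratio of the circular orbit from which the Lagrange point bifurcates. -/
def basePt : RealPt × ℝ := ((0, 1, 0), 0)

/-- Real coordinates and parameter as complex ones. -/
def embP : RealPt × ℝ →L[ℝ] CPt × ℂ := embL.prodMap Complex.ofRealCLM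

theorem embP_apply (q : RealPt × ℝ) : embP q = (emb q.1, (q.2 : ℂ)) := rfl

/-- The limit of the Hessian. -/
def limitHessian (δ : ℝ) : Matrix (Fin 4) (Fin 4) ℂ :=
  Matrix.of fun i j => let w : CPt := Pi.single i 1; let v : CPt := Pi.single j 1
    (v 2 * w 3 + w 2 * v 3) / (δ : ℂ) ^ 2 + 7 / 8 * (w 0 * v 0) - 3 * (w 1 * v 1)

theorem hamMatrix_limitHessian (δ : ℝ) : hamMatrix (limitHessian δ) = L3Matrix δ := by
  ext i j
  fin_cases i <;> fin_cases j <;> simp [hamMatrix, limitHessian, L3Matrix] <;> ring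

theorem scaleD_single (δ : ℝ) (i : Fin 4) :
    scaleD δ (Pi.single i 1) =
      ((![1, δ ^ 2, δ, δ] i : ℝ) : ℂ) • ((Pi.single i 1, 0) : CPt × ℂ) := by
  refine Prod.ext ?_ (by simp [scaleD])
  ext k
  fin_cases i <;> fin_cases k <;> simp [scaleD]

theorem norm_single_le (i : Fin 4) : ‖((Pi.single i 1, 0) : CPt × ℂ)‖ ≤ 1 := by
  rw [Prod.norm_mk, norm_zero]
  refine max_le ((pi_norm_le_iff_of_nonneg zero_le_one).2 fun k => ?_) zero_le_one
  by_cases h : k = i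
  · subst h; simp
  · simp [Pi.single_eq_of_ne h]

theorem norm_apply_single_le (N : CPt × ℂ →L[ℂ] CPt × ℂ →L[ℂ] ℂ) (i j : Fin 4) :
    ‖N (Pi.single i 1, 0) (Pi.single j 1, 0)‖ ≤ ‖N‖ := by
  refine (N.le_opNorm₂ _ _).trans ?_
  calc ‖N‖ * ‖((Pi.single i 1, 0) : CPt × ℂ)‖ * ‖((Pi.single j 1, 0) : CPt × ℂ)‖
      ≤ ‖N‖ * 1 * 1 := by gcongr <;> exact norm_single_le _
    _ = ‖N‖ := by ring

set_option maxSynthPendingDepth 10 in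
/-- The Hessian in the scaled coordinates, close to the circular orbit. -/
theorem norm_hessian_sub_le {K : CPt × ℂ → ℂ} {δ a b : ℝ} {c : CPt}
    {N₀ : CPt × ℂ →L[ℂ] CPt × ℂ →L[ℂ] ℂ} (hδ : 0 < δ) (hδ1 : δ ≤ 1)
    (hK : AnalyticAt ℂ K (scaleC (c, δ))) (hc : 1 + (δ : ℂ) ^ 2 * c 1 ≠ 0)
    (hN : ‖fderiv ℂ (fderiv ℂ K) (scaleC (c, δ)) - N₀‖ ≤ a)
    (hG : ‖3 / (1 + (δ : ℂ) ^ 2 * c 1) ^ 4 - 3‖ ≤ b)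
    (hN₀ : N₀ (Pi.single 0 1, 0) (Pi.single 0 1, 0) = 7 / 8) (i j : Fin 4) :
    ‖hessian (fun c => hamOf K (c, δ)) c i j - limitHessian δ i j‖ ≤ a + (‖N₀‖ + a) * δ + b := by
  have hδc : (δ : ℂ) ≠ 0 := Complex.ofReal_ne_zero.2 hδ.ne'
  set N := fderiv ℂ (fderiv ℂ K) (scaleC (c, δ)) with hNdef
  set w : CPt := Pi.single i 1 with hw
  set v : CPt := Pi.single j 1 with hv
  have ha : 0 ≤ a := le_trans (norm_nonneg (N - N₀)) hN
  have hb : 0 ≤ b := (norm_nonneg _).trans hG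
  have hNn : ‖N‖ ≤ ‖N₀‖ + a := by
    calc ‖N‖ = ‖N₀ + (N - N₀)‖ := by rw [add_sub_cancel]
      _ ≤ ‖N₀‖ + ‖N - N₀‖ := norm_add_le _ _
      _ ≤ _ := by gcongr
  have e1 : hessian (fun c => hamOf K (c, δ)) c i j - limitHessian δ i j =
      (N (scaleD δ w) (scaleD δ v) - 7 / 8 * (w 0 * v 0)) -
        (3 / (1 + (δ : ℂ) ^ 2 * c 1) ^ 4 - 3) * (w 1 * v 1) := by
    simp only [hessian, limitHessian, Matrix.of_apply, ← hw, ← hv]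
    rw [hessian_hamOf hK hδc hc]
    ring
  have hs : ∀ k l : Fin 4, ‖(Pi.single k 1 : CPt) l‖ ≤ 1 := by
    intro k l
    by_cases h : l = k
    · subst h; simp
    · simp [Pi.single_eq_of_ne h]
  have e2 : ‖(3 / (1 + (δ : ℂ) ^ 2 * c 1) ^ 4 - 3) * (w 1 * v 1)‖ ≤ b := by
    rw [norm_mul, norm_mul]
    calc _ ≤ b * (1 * 1) := by
          gcongr
          · exact hs _ _
          · exact hs _ _
      _ = b := by ring
  -- The scaling multiplies the directions by 1, δ², δ and δ. Every entry except the one in λ twice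
  -- thus carries a factor of at most δ; the exceptional entry is compared with its limit 7 / 8.
  have e3 : ‖N (scaleD δ w) (scaleD δ v) - 7 / 8 * (w 0 * v 0)‖ ≤ a + (‖N₀‖ + a) * δ := by
    rw [hw, hv, scaleD_single, scaleD_single]
    by_cases h : i = 0 ∧ j = 0
    · obtain ⟨rfl, rfl⟩ := h
      have h1 : ‖(N - N₀) (Pi.single 0 1, 0) (Pi.single 0 1, 0)‖ ≤ a :=
        (norm_apply_single_le _ _ _).trans hN
      rw [sub_apply, sub_apply, hN₀] at h1
      have h2 : (0 : ℝ) ≤ (‖N₀‖ + a) * δ := by positivity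
      simp only [Matrix.cons_val_zero, Complex.ofReal_one, one_smul, Pi.single_eq_same, mul_one]
      linarith
    · have h0 : (Pi.single i 1 : CPt) 0 * (Pi.single j 1 : CPt) 0 = 0 := by
        by_contra h3
        refine h ⟨?_, ?_⟩ <;> by_contra h4
        · simp [Pi.single_eq_of_ne (Ne.symm h4)] at h3
        · simp [Pi.single_eq_of_ne (Ne.symm h4)] at h3
      rw [h0, mul_zero, sub_zero, map_smul, map_smul, smul_apply, smul_eq_mul, smul_eq_mul,
        ← mul_assoc, norm_mul, ← Complex.ofReal_mul, Complex.norm_real]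
      have h5 : ‖(![1, δ ^ 2, δ, δ] j * ![1, δ ^ 2, δ, δ] i : ℝ)‖ ≤ δ := by
        have d2 : δ ^ 2 ≤ δ := by nlinarith
        rw [Real.norm_eq_abs, abs_of_nonneg]
        · fin_cases i <;> fin_cases j <;> simp at h ⊢ <;> nlinarith [sq_nonneg δ]
        · fin_cases i <;> fin_cases j <;> simp <;> positivity
      calc _ ≤ δ * (‖N₀‖ + a) := by
            gcongr
            exact (norm_apply_single_le _ _ _).trans hNn
        _ ≤ _ := by linarith
  rw [e1]
  exact (norm_sub_le _ _).trans (add_le_add e3 e2)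

set_option maxSynthPendingDepth 10 in
/-- Uniform control of the perturbation near the circular orbit. -/
theorem exists_uniform_bound {K : CPt × ℂ → ℂ} (hK : AnalyticAt ℂ K (embP basePt))
    (hKr : ∀ᶠ p : RealPt × ℝ in 𝓝 basePt, K (embP p) = realH1 p.2 (cartPoi p.1)) :
    ∃ ε > 0, ∃ a > 0, ∀ q : RealPt × ℝ, ‖q - basePt‖ < ε → AnalyticAt ℂ K (embP q) ∧
      (∀ᶠ p : RealPt × ℝ in 𝓝 q, K (embP p) = realH1 p.2 (cartPoi p.1)) ∧
      ‖fderiv ℂ (fderiv ℂ K) (embP q) - fderiv ℂ (fderiv ℂ K) (embP basePt)‖ ≤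
        a * ‖q - basePt‖ ∧
      ‖3 / ((embP q).1 1) ^ 4 - 3‖ ≤ a * ‖q - basePt‖ := by
  have ht : Tendsto embP (𝓝 basePt) (𝓝 (embP basePt)) := embP.continuous.tendsto _
  have hN : DifferentiableAt ℝ (fun q => fderiv ℂ (fderiv ℂ K) (embP q)) basePt :=
    DifferentiableAt.comp (g := fderiv ℂ (fderiv ℂ K)) (f := embP) basePt
      (hK.fderiv.fderiv.differentiableAt.restrictScalars ℝ) embP.differentiableAt
  have hb1 : ((embP basePt).1 1) = 1 := by simp [embP_apply, basePt, emb]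
  have hG : DifferentiableAt ℝ (fun q => 3 / ((embP q).1 1) ^ 4) basePt := by
    refine DifferentiableAt.comp (g := fun P : CPt × ℂ => 3 / (P.1 1) ^ 4) (f := embP) basePt ?_
      embP.differentiableAt
    exact ((analyticAt_const.div ((analyticAt_fst_apply _ 1).pow 4) (by
      change ((embP basePt).1 1) ^ 4 ≠ 0
      rw [hb1]; norm_num)).differentiableAt (𝕜 := ℂ)).restrictScalars ℝ
  -- Differentiability at the base point alone gives the linear bound in the distance to it.
  obtain ⟨a, ha, hNa⟩ := hN.isBigO_sub.exists_pos
  obtain ⟨b, hb, hGb⟩ := hG.isBigO_sub.exists_pos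
  obtain ⟨ε, hε, hball⟩ := Metric.eventually_nhds_iff.1 ((ht.eventually
    hK.eventually_analyticAt).and (hKr.eventually_nhds.and (hNa.bound.and hGb.bound)))
  refine ⟨ε, hε, max a b, lt_max_of_lt_left ha, fun q hq => ?_⟩
  obtain ⟨h1, h2, h3, h4⟩ := hball (by rwa [dist_eq_norm])
  refine ⟨h1, h2, h3.trans (by gcongr; exact le_max_left _ _), ?_⟩
  rw [hb1] at h4
  norm_num at h4
  exact h4.trans (by gcongr; exact le_max_right _ _)

/-- The Lagrange point in the new coordinates. -/
theorem exists_lagrange_point {δ : ℝ} (hδ : 0 < δ) (hδ1 : δ < 1 / 10) :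
    ∃ (l x : ℝ) (z : RealPt), |l| ≤ 16 ∧ |x| ≤ 16 ∧ z ∈ regularDomain δ ∧
      emb z = ![0, (δ : ℂ) ^ 2 * (l : ℂ), (δ : ℂ) ^ 3 * (x : ℂ), (δ : ℂ) ^ 3 * (x : ℂ)] ∧
      IsL3 (δ ^ 4) (coord δ z) ∧ (∀ w, IsL3 (δ ^ 4) w → w = coord δ z) ∧
      ‖(scale δ z, δ ^ 4) - basePt‖ ≤ 16 * δ := by
  have hμ : 0 < δ ^ 4 := by positivity
  have h3 : δ ^ 3 ≤ 1 / 1000 := by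
    calc δ ^ 3 ≤ (1 / 10) ^ 3 := by gcongr
      _ = 1 / 1000 := by norm_num
  have hμδ : δ ^ 4 ≤ δ := by nlinarith
  have hμ1 : δ ^ 4 ≤ 1 / 100 := by nlinarith
  obtain ⟨r, hr1, hr2, hr⟩ := exists_L3_radius hμ hμ1
  set μ := δ ^ 4 with hμdef
  have hr3 : r ^ 3 - 1 ≤ 7 * μ := by
    have h4 : r ≤ 1.02 := by linarith
    have h5 : r ^ 2 + r + 1 ≤ 3.5 := by nlinarith
    have h6 : r ^ 3 - 1 = (r - 1) * (r ^ 2 + r + 1) := by ring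
    rw [h6]; nlinarith
  have hr31 : 1 < r ^ 3 := one_lt_pow₀ hr1 (by norm_num)
  have hcube : r ^ 3 < 2 := by linarith
  obtain ⟨hz, hcart⟩ := cartPoi_perihelion hr1 hcube
  set L := √(r / (2 - r ^ 3)) with hL
  set η := L * (r ^ 3 - 1) / √(L + r ^ 2) with hη
  have hL2 : L ^ 2 = r / (2 - r ^ 3) := Real.sq_sqrt (div_nonneg (by linarith) (by linarith))
  have hL0 : 0 ≤ L := Real.sqrt_nonneg _
  have hq1 : 1 ≤ r / (2 - r ^ 3) := by rw [le_div_iff₀ (by linarith)]; linarith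
  have hq2 : r / (2 - r ^ 3) ≤ 1 + 12 * μ := by
    rw [div_le_iff₀ (by linarith)]; nlinarith
  have hLl : 1 ≤ L := by nlinarith
  have hLu : L - 1 ≤ 12 * μ := by nlinarith
  have hs : 1 ≤ √(L + r ^ 2) := Real.one_le_sqrt.2 (by nlinarith)
  have hη0 : 0 ≤ η := div_nonneg (mul_nonneg hL0 (by linarith)) (by linarith)
  have hηu : η ≤ 16 * μ := by
    have : η ≤ L * (r ^ 3 - 1) := div_le_self (mul_nonneg hL0 (by linarith)) hs
    nlinarith
  have hδc : (δ : ℂ) ≠ 0 := Complex.ofReal_ne_zero.2 hδ.ne'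
  have hδ0 := hδ.ne'
  have hsc : scale δ (0, (L - 1) / δ ^ 2, ((η / δ : ℝ) : ℂ)) = (0, L, (η : ℂ)) := by
    rw [scale_apply]
    refine Prod.ext rfl (Prod.ext ?_ ?_)
    · simp only; field_simp; ring
    · simp only; push_cast; field_simp
  have hco : coord δ (0, (L - 1) / δ ^ 2, ((η / δ : ℝ) : ℂ)) = ![r, 0, 0, r] := by
    rw [coord_eq, hsc, hcart]
  have hL3 : IsL3 μ (![r, 0, 0, r] : Cart) := by
    rw [isL3_iff]
    exact ⟨by simp; linarith, rfl, rfl, rfl, hr⟩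
  -- The scalings L = 1 + δ² Λ with Λ = δ² l and η = δ x₀ with x₀ = δ³ x give L - 1 = μ l and η = μ
  -- x. Both quotients are bounded because r - 1 < 2μ.
  refine ⟨(L - 1) / μ, η / μ, (0, (L - 1) / δ ^ 2, ((η / δ : ℝ) : ℂ)), ?_, ?_, ⟨?_, ?_⟩, ?_, ?_, ?_, ?_⟩
  · rw [abs_of_nonneg (div_nonneg (by linarith) hμ.le), div_le_iff₀ hμ]; linarith
  · rw [abs_of_nonneg (div_nonneg hη0 hμ.le), div_le_iff₀ hμ]; linarith
  · rw [mem_chartDomain_iff, hsc]; exact hz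
  · rw [hco]
    rintro (⟨a, -⟩ | ⟨a, -⟩) <;> simp at a <;> linarith
  · ext i
    fin_cases i <;> simp [emb, hμdef] <;> field_simp
  · rw [hco]; exact hL3
  · intro w hw
    obtain ⟨k0, k1, k2, k3, k4⟩ := isL3_iff.1 hw
    have hw0 := L3_unique hμ (by linarith) k0 (by linarith : μ < r) k4 hr
    rw [hco]
    ext i
    fin_cases i
    · exact hw0
    · exact k1
    · exact k2
    · exact k3.trans hw0
  · rw [hsc]
    have e : (((0, L, (η : ℂ)), μ) : RealPt × ℝ) - basePt = ((0, L - 1, (η : ℂ)), μ) := by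
      simp [basePt]
    rw [e, Prod.norm_mk, Prod.norm_mk, Prod.norm_mk, norm_zero, Complex.norm_real, Real.norm_eq_abs,
      Real.norm_eq_abs, Real.norm_eq_abs, abs_of_nonneg hη0, abs_of_pos hμ,
      abs_of_nonneg (by linarith : 0 ≤ L - 1)]
    refine max_le (max_le (by positivity) (max_le ?_ ?_)) ?_ <;> linarith

end

/-! ### The Lagrange point of the extended Hamiltonian. -/

section

theorem hessian_congr {F F' : CPt → ℂ} {P : CPt} (h : F =ᶠ[𝓝 P] F') :
    hessian F P = hessian F' P := by
  ext i j
  simp only [hessian, Matrix.of_apply]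
  rw [h.fderiv.fderiv_eq]

theorem norm_hamMatrix_sub_le {B B' : Matrix (Fin 4) (Fin 4) ℂ} {d : ℝ}
    (h : ∀ i j, ‖B i j - B' i j‖ ≤ d) (i j : Fin 4) :
    ‖hamMatrix B i j - hamMatrix B' i j‖ ≤ d := by
  fin_cases i
  · simpa [hamMatrix] using h j 1
  · simpa [hamMatrix, ← sub_eq_neg_add, norm_sub_rev] using h j 0
  · have := h j 3
    rw [← norm_neg, ← one_mul ‖_‖, ← Complex.norm_I, ← norm_mul] at this
    convert this using 2
    simp [hamMatrix]; ring
  · have := h j 2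
    rw [← one_mul ‖_‖, ← Complex.norm_I, ← norm_mul] at this
    convert this using 2
    simp [hamMatrix]; ring

theorem cj_single (j : Fin 4) : cj (Pi.single j 1) = Pi.single (Equiv.swap 2 3 j) 1 := by
  ext k
  fin_cases j <;> fin_cases k <;> simp [cj_apply, Equiv.swap_apply_def]

theorem linearPart_conj {X : CPt → CPt} {P : CPt}
    (h : ∀ v, fderiv ℂ X P (cj v) = cj (fderiv ℂ X P v)) (i j : Fin 4) :
    conj (linearPart X P i j) = linearPart X P (Equiv.swap 2 3 i) (Equiv.swap 2 3 j) := by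
  simp only [linearPart, Matrix.of_apply]
  rw [← cj_single, h]
  fin_cases i <;> simp [cj_apply, Equiv.swap_apply_def]

set_option maxSynthPendingDepth 10 in
/-- The Lagrange point `L₃` of the extended Hamiltonian, for small `δ`. -/
theorem exists_L3_estimate {U : Set (CPt × ℂ)} {Hc : CPt × ℂ → ℂ}
    (hU : IsOpen U) (hRU : realRegular ⊆ U) (hHa : AnalyticOnNhd ℂ Hc U)
    (hHc : ∀ P ∈ U, conj (Hc P) = Hc (conjL P)) (hHr : ∀ P ∈ realRegular, Hc P = hamReal P) :
    ∃ (δ₀ C : ℝ), 0 < δ₀ ∧ 0 < C ∧ ∀ δ : ℝ, 0 < δ → δ < δ₀ → ∃ l x : ℝ,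
      |l| ≤ C ∧ |x| ≤ C ∧ ∃ z : RealPt, z ∈ regularDomain δ ∧
        emb z = ![0, (δ : ℂ) ^ 2 * (l : ℂ), (δ : ℂ) ^ 3 * (x : ℂ), (δ : ℂ) ^ 3 * (x : ℂ)] ∧
        IsL3 (δ ^ 4) (coord δ z) ∧ (∀ w, IsL3 (δ ^ 4) w → w = coord δ z) ∧
        field Hc δ (emb z) = 0 ∧
        (∀ i j, ‖linearPart (field Hc δ) (emb z) i j - L3Matrix δ i j‖ ≤ C * δ) ∧
        ∃ ρ σ : ℝ, IsSaddleCenter (linearPart (field Hc δ) (emb z)) ρ σ ∧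
          (∃ W, IsStableCurve (field Hc δ) (emb z) ρ W) ∧
          (∃ W, IsUnstableCurve (field Hc δ) (emb z) ρ W) ∧
          (∃ W, IsCenterSurface (field Hc δ) (emb z) σ W) := by
  obtain ⟨K, hK, hKr⟩ := exists_local_H1 (circular_mem 0) (circular_regular (lam := 0) (by simp; norm_num))
  obtain ⟨ε, hε, a, ha, hbound⟩ := exists_uniform_bound (K := K) hK hKr
  obtain ⟨ε', hε', hdet⟩ := exists_det_neg
  set n₀ := ‖fderiv ℂ (fderiv ℂ K) (embP basePt)‖ with hn₀
  have hn₀0 : 0 ≤ n₀ := norm_nonneg (fderiv ℂ (fderiv ℂ K) (embP basePt))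
  -- The distance to the circular orbit is at most 16 δ, so the Hessian error is at most 16 a δ +
  -- (n₀ + 16 a δ) δ + 16 a δ; the summand 16 of C covers the bounds on l and x. In δ₀, 1 / 10
  -- serves the existence of L₃, ε / 16 the uniform bounds on K, and ε' / C the sign of the
  -- determinant.
  set C := 48 * a + n₀ + 16 with hC
  have hC0 : 0 < C := by positivity
  refine ⟨min (1 / 10) (min (ε / 16) (ε' / C)), C, by positivity, hC0, fun δ hδ hδ₀ => ?_⟩
  obtain ⟨hδ1, hδ2⟩ := lt_min_iff.1 hδ₀
  obtain ⟨hδ2, hδ3⟩ := lt_min_iff.1 hδ2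
  rw [lt_div_iff₀ (by norm_num)] at hδ2
  rw [lt_div_iff₀ hC0] at hδ3
  obtain ⟨l, x, z, hl, hx, hz, hemb, hL3, huniq, hdist⟩ := exists_lagrange_point hδ hδ1
  obtain ⟨hKq, hKrq, hNq, hGq⟩ := hbound (scale δ z, δ ^ 4) (by linarith)
  have hzU : (emb z, (δ : ℂ)) ∈ U := hRU ⟨δ, z, hδ, hz, rfl⟩
  have hsc : scaleC (emb z, (δ : ℂ)) = embP (scale δ z, δ ^ 4) := scaleC_emb δ z
  have hq1 : (embP (scale δ z, δ ^ 4)).1 1 = 1 + (δ : ℂ) ^ 2 * emb z 1 := by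
    rw [← hsc]; simp [scaleC]
  -- Near L₃ the extension is the one built from a single K, analytic at the circular orbit with μ =
  -- 0. As K does not depend on δ, the estimates are uniform.
  have hloc : Hc =ᶠ[𝓝 (emb z, (δ : ℂ))] hamOf K :=
    extension_eventuallyEq hδ hz (hHa _ hzU) hHr hKq hKrq
  have hslice : Tendsto (fun c : CPt => (c, (δ : ℂ))) (𝓝 (emb z)) (𝓝 (emb z, (δ : ℂ))) :=
    (Continuous.prodMk_left _).tendsto _
  set F : CPt → ℂ := fun c => Hc (c, (δ : ℂ)) with hF
  have hFa : AnalyticAt ℂ F (emb z) :=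
    AnalyticAt.comp (g := Hc) (f := fun c : CPt => (c, (δ : ℂ))) (hHa _ hzU)
      (analyticAt_id.prod analyticAt_const)
  have hFloc : F =ᶠ[𝓝 (emb z)] fun c => hamOf K (c, (δ : ℂ)) := hslice.eventually hloc
  have hsym : ∀ᶠ y in 𝓝 (emb z), F (cj y) = conj (F y) := by
    filter_upwards [hslice.eventually (hU.mem_nhds hzU)] with y hy
    rw [hF]
    simp only
    rw [hHc _ hy, conjL_apply]
    simp only [conjPt, Complex.conj_ofReal]
    congr 2
    ext i
    fin_cases i <;> simp [cj_apply]
  have hP : emb z ∈ Set.range emb := ⟨z, rfl⟩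
  have hcirc := hessian_circular hK hKr
  have hB : ∀ i j, ‖hessian F (emb z) i j - limitHessian δ i j‖ ≤ C * δ := by
    intro i j
    rw [hessian_congr hFloc]
    have hd : a * ‖((scale δ z, δ ^ 4) : RealPt × ℝ) - basePt‖ ≤ a * (16 * δ) := by gcongr
    have key := norm_hessian_sub_le (c := emb z) (N₀ := fderiv ℂ (fderiv ℂ K) (embP basePt))
      (a := a * (16 * δ)) (b := a * (16 * δ)) hδ (by linarith) (by rw [hsc]; exact hKq) (by
        rw [← hq1, embP_apply]
        have := hz.1.1
        simp only [emb, scale_apply, Matrix.cons_val]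
        exact_mod_cast this.ne')
      (by rw [hsc]; exact hNq.trans hd) (by rw [← hq1]; exact hGq.trans hd) hcirc i j
    rw [← hn₀] at key
    have : a * δ * (16 * δ) ≤ a * δ * 16 := by gcongr; linarith
    rw [hC]
    nlinarith [mul_pos ha hδ]
  have hlin : linearPart (hamVF F) (emb z) = hamMatrix (hessian F (emb z)) := linearPart_hamVF hFa
  have hM : ∀ i j, ‖linearPart (hamVF F) (emb z) i j - L3Matrix δ i j‖ ≤ C * δ := by
    intro i j
    rw [hlin, ← hamMatrix_limitHessian]
    exact norm_hamMatrix_sub_le hB i j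
  have hconj := linearPart_conj (fderiv_hamVF_cj hFa (cj_eq_self_iff.2 hP) hsym).2
  have h0 : field Hc δ (emb z) = 0 := by
    have := (emb_eq_field_iff hδ hz (hHa _ hzU) hHr 0).2 (by rw [smul_zero, map_zero, hL3.2.2])
    rw [← this]
    ext i; fin_cases i <;> simp [emb]
  obtain ⟨ρ, σ, hρσ⟩ := exists_isSaddleCenter (B := hessian F (emb z)) (hessian_symm hFa)
    (by rw [← hlin]; exact hconj)
    (by
      rw [← hlin]
      exact hdet δ hδ (by linarith) _ fun i j => (hM i j).trans_lt (by linarith))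
  rw [← hlin] at hρσ
  refine ⟨l, x, hl.trans (by linarith), hx.trans (by linarith), z, hz, hemb, hL3, huniq, h0, hM,
    ρ, σ, hρσ, ?_⟩
  exact exists_invariant_manifolds hFa hP hsym h0 hρσ

end

end RPC3BP

end

theorem theorem2p1 :
    -- the coordinates: an analytic chart, `2π`-periodic in `λ`, conformally symplectic
    (∀ δ : ℝ, 0 < δ → δ ^ 4 ≤ 1 / 2 →
      AnalyticOnNhd ℝ (RPC3BP.coord δ) (RPC3BP.chartDomain δ) ∧
      RPC3BP.coord δ '' RPC3BP.chartDomain δ = RPC3BP.directElliptic ∧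
      (∀ z ∈ RPC3BP.chartDomain δ, ∀ z' ∈ RPC3BP.chartDomain δ,
        RPC3BP.coord δ z = RPC3BP.coord δ z' ↔
          (∃ k : ℤ, z'.1 = z.1 + 2 * Real.pi * k) ∧ z.2 = z'.2) ∧
      (∀ z ∈ RPC3BP.chartDomain δ, ∀ v w : RPC3BP.RealPt,
        (RPC3BP.cartForm (fderiv ℝ (RPC3BP.coord δ) z v) (fderiv ℝ (RPC3BP.coord δ) z w) : ℂ) =
          (δ : ℂ) ^ 2 * RPC3BP.form (RPC3BP.emb v) (RPC3BP.emb w)) ∧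
      -- the new Hamiltonian is `h / δ⁴` up to a constant
      (∀ z ∈ RPC3BP.regularDomain δ,
        ((RPC3BP.h (δ ^ 4) (RPC3BP.coord δ z) : ℝ) : ℂ) / (δ : ℂ) ^ 4 =
          RPC3BP.H δ z - 3 / (2 * (δ : ℂ) ^ 4))) ∧
    -- the potential is the value of the perturbation at `μ = 0` on the circular orbit
    (∀ lam : ℝ, Real.cos lam ≠ -1 →
      Filter.Tendsto (fun μ : ℝ => ((RPC3BP.H1Poi μ lam 1 0 0 : ℝ) : ℂ))
        (nhdsWithin 0 {0}ᶜ) (nhds (RPC3BP.V lam))) ∧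
    ∃ (U : Set (RPC3BP.CPt × ℂ)) (Hc : RPC3BP.CPt × ℂ → ℂ),
      -- real-analyticity away from collision
      RPC3BP.IsRealAnalyticExtension U Hc ∧
      -- in the time `τ = δ² t`, the equations of `h` are the Hamiltonian system of `H`
      (∀ δ : ℝ, 0 < δ → δ ^ 4 ≤ 1 / 2 → ∀ (J : Set ℝ) (z : ℝ → RPC3BP.RealPt),
        IsOpen J → ContinuousOn z J → (∀ τ ∈ J, z τ ∈ RPC3BP.regularDomain δ) →
        ((∀ τ ∈ J, HasDerivAt (fun s => RPC3BP.emb (z s))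
            (RPC3BP.field Hc δ (RPC3BP.emb (z τ))) τ) ↔
          (∀ t : ℝ, δ ^ 2 * t ∈ J → HasDerivAt (fun s => RPC3BP.coord δ (z (δ ^ 2 * s)))
            (RPC3BP.cartVF (RPC3BP.h (δ ^ 4)) (RPC3BP.coord δ (z (δ ^ 2 * t)))) t))) ∧
      -- the Lagrange point `L₃`
      ∃ (δ₀ C : ℝ) (LLam : ℝ → ℝ) (Lx Ly : ℝ → ℂ), 0 < δ₀ ∧ 0 < C ∧
        ∀ δ : ℝ, 0 < δ → δ < δ₀ →
          |LLam δ| ≤ C ∧ ‖Lx δ‖ ≤ C ∧ ‖Ly δ‖ ≤ C ∧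
          ∃ z : RPC3BP.RealPt, z ∈ RPC3BP.regularDomain δ ∧
            RPC3BP.emb z =
              ![0, (δ : ℂ) ^ 2 * (LLam δ : ℂ), (δ : ℂ) ^ 3 * Lx δ, (δ : ℂ) ^ 3 * Ly δ] ∧
            RPC3BP.IsL3 (δ ^ 4) (RPC3BP.coord δ z) ∧
            (∀ w, RPC3BP.IsL3 (δ ^ 4) w → w = RPC3BP.coord δ z) ∧
            RPC3BP.field Hc δ (RPC3BP.emb z) = 0 ∧
            (∀ i j, ‖RPC3BP.linearPart (RPC3BP.field Hc δ) (RPC3BP.emb z) i j -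
              RPC3BP.L3Matrix δ i j‖ ≤ C * δ) ∧
            ∃ ρ σ : ℝ,
              RPC3BP.IsSaddleCenter (RPC3BP.linearPart (RPC3BP.field Hc δ) (RPC3BP.emb z)) ρ σ ∧
              (∃ W, RPC3BP.IsStableCurve (RPC3BP.field Hc δ) (RPC3BP.emb z) ρ W) ∧
              (∃ W, RPC3BP.IsUnstableCurve (RPC3BP.field Hc δ) (RPC3BP.emb z) ρ W) ∧
              (∃ W, RPC3BP.IsCenterSurface (RPC3BP.field Hc δ) (RPC3BP.emb z) σ W) := by
  refine ⟨fun δ hδ _ => RPC3BP.chart_properties hδ, fun lam h => RPC3BP.tendsto_H1Poi h, ?_⟩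
  obtain ⟨U, Hc, hU, hRU, hcU, hHa, hHc, hHr⟩ := RPC3BP.exists_extension
  obtain ⟨δ₀, C, hδ₀, hC, hL3⟩ := RPC3BP.exists_L3_estimate hU hRU hHa hHc hHr
  choose! l x hlx using hL3
  exact ⟨U, Hc, RPC3BP.isRealAnalyticExtension hU hRU hcU hHa hHc hHr,
    fun δ hδ _ J z hJ hzc hz => RPC3BP.equations_iff hδ (hHa.mono hRU) hHr hJ hzc hz,
    -- At L₃ the coordinate x is real, so y = conj x has the same value.
    δ₀, C, l, fun δ => x δ, fun δ => x δ, hδ₀, hC, fun δ hδ hδ₁ => by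
      simpa only [Complex.norm_real, Real.norm_eq_abs] using
        ⟨(hlx δ hδ hδ₁).1, (hlx δ hδ hδ₁).2.1, (hlx δ hδ hδ₁).2⟩⟩
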